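/- Let $k$ be a field of characteristic $0$ and let $H$ be a Hopf algebra over $k$ with comultiplication $\Delta(h)=h^1\otimes h^2$, counit $\epsilon$ and bijective antipode $S$. **Comodules.** Let $\mathcal M^H$ be the category of right $H$-comodules, with coactions $m\mapsto m_0\otimes m_1$, and $\mathcal M^H_{fd}$ the monoidal category of finite-dimensional ones, where $T\otimes L$ has the coaction $t\otimes l\mapsto t_0\otimes l_0\otimes t_1l_1$. For a comodule $T$, let $T^{S^2}$ be $T$ with the coaction $t\mapsto t_0\otimes S^2(t_1)$. Write $\mathcal M^{H\#}$ for $\mathcal M^H$ considered as an $\mathcal M^H_{fd}$-bimodule category by $T\cdot M\cdot L=T\otimes M\otimes L^{S^2}$. **Contramodules.** A (right) $H$-contramodule is a vector space $N$ with a linear contraaction $\alpha:\mathrm{Hom}(H,N)\to N$ such that $\alpha(h\mapsto\alpha(F(h)))=\alpha(h\mapsto F(h^1)(h^2))$ for linear $F:H\to\mathrm{Hom}(H,N)$ and $\alpha(h\mapsto\epsilon(h)n)=n$ for $n\in N$; morphisms are linear maps commuting with the contraactions. For $T\in\mathcal M^H_{fd}$ and a contramodule $N$, the spaces $T\otimes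 N$ and $N\otimes T$ are contramodules with contraactions $t\otimes f\mapsto t_0\otimes\alpha(f(t_1-))$ and $f\otimes t\mapsto\alpha(f(-t_1))\otimes t_0$, where $\mathrm{Hom}(H,T\otimes N)=T\otimes\mathrm{Hom}(H,N)$ and $\mathrm{Hom}(H,N\otimes T)=\mathrm{Hom}(H,N)\otimes T$. Write ${}^{\#}\widehat{\mathcal M^H}$ for the category of contramodules considered as an $\mathcal M^H_{fd}$-bimodule category by $T\cdot N\cdot L=T^{S^2}\otimes N\otimes L$. In both bimodule categories the associativity and unit isomorphisms are those of vector spaces. **The two functors.** For a comodule $M$ let $\widehat M=\mathrm{Hom}(H,M)^H$ be the space of comodule maps from $H$ (with coaction $\Delta$) to $M$, with the contraaction $(\alpha\theta)(h)=\theta_{h^1}(h^2)$. For a contramodule $N$ let $N'$ be the cokernel of the difference of the two maps $H\otimes\mathrm{Hom}(H,N)\rightrightarrows H\otimes N$ given by $h\otimes f\mapsto h\otimes\alpha(f)$ and $h\otimes f\mapsto h^2\otimes f(h^1)$, with the coaction $h\otimes n\mapsto(h^1\otimes n)\otimes h^2$. Both constructions are functorial by composition, respectively by $h\otimes n\mapsto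 h\otimes g(n)$. **Anti-Yetter–Drinfeld objects.** An aYD-module is a comodule $M$ with a left $H$-action such that $\rho(hm)=h^2m_0\otimes h^3m_1S(h^1)$; an aYD-contramodule is a contramodule $N$ with a left $H$-action such that $h\,\alpha(f)=\alpha\big(h^2f(S(h^3)-h^1)\big)$. Morphisms are the $H$-linear maps of comodules, respectively of contramodules. An aYD-module is stable if $m_1m_0=m$ for all $m\in M$; an aYD-contramodule is stable if $\alpha(r_n)=n$ for all $n\in N$, where $r_n(h)=hn$. Stable objects form full subcategories. **Centers.** The center $\mathcal Z(\mathcal D)$ of an $\mathcal M^H_{fd}$-bimodule category $\mathcal D$ has as objects the pairs of an object $D$ and a family of isomorphisms $T\cdot D\cong D\cdot T$, natural in $T\in\mathcal M^H_{fd}$ and compatible with the tensor product and the unit of $\mathcal M^H_{fd}$; morphisms are the morphisms of $\mathcal D$ that commute with these isomorphisms. A functor of bimodule categories $F$ induces a functor $\mathcal Z(F)$ on centers by $T\cdot FD\cong F(T\cdot D)\cong F(D\cdot T)\cong FD\cdot T$. **Theorem.** 1. The functor $N\mapsto N'$ is left adjoint to $M\mapsto\widehat M$, with counit $\widehat M{}'\to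 M$, $h\otimes f\mapsto f(h)$, and unit $N\to\widehat{N'}$, $n\mapsto(h\mapsto h\otimes n)$. 2. Both functors are functors of $\mathcal M^H_{fd}$-bimodule categories between $\mathcal M^{H\#}$ and ${}^{\#}\widehat{\mathcal M^H}$, by the isomorphisms $$\widehat{T\otimes M}\cong T^{S^2}\otimes\widehat M,\quad t\otimes f\mapsto t_0\otimes f(S^2(t_1)-),\qquad \widehat{M\otimes L^{S^2}}\cong\widehat M\otimes L,\quad f\otimes l\mapsto f(-l_1)\otimes l_0,$$ $$(T^{S^2}\otimes N)'\cong T\otimes N',\quad h\otimes t\otimes n\mapsto t_0\otimes S(t_1)h\otimes n,\qquad (N\otimes L)'\cong N'\otimes L^{S^2},\quad h\otimes n\otimes l\mapsto hS(l_1)\otimes n\otimes l_0,$$ where $t_0\otimes t_1$ and $l_0\otimes l_1$ are given by the original coactions of $T$ and $L$, and elements of $\mathrm{Hom}(H,T\otimes M)^H$ and $\mathrm{Hom}(H,M\otimes L^{S^2})^H$ are written as sums of elements of $T\otimes\mathrm{Hom}(H,M)$ and $\mathrm{Hom}(H,M)\otimes L$. 3. The adjunction of 1 lifts to the centers: $\mathcal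 Z((-)')$ is left adjoint to $\mathcal Z(\widehat{(-)})$, with the unit and counit of 1. 4. If $M$ is an aYD-module, then $\widehat M$ with the action $(h\cdot\phi)(-)=h^2\phi(S(h^3)-h^1)$ is an aYD-contramodule. If $N$ is an aYD-contramodule, then the action $x\cdot(h\otimes n)=x^3hS(x^1)\otimes x^2n$ is well defined on $N'$ and makes it an aYD-module. This gives functors $\widehat{(-)}_H$ and $(-)'_H$ between aYD-modules and aYD-contramodules, and $(-)'_H$ is left adjoint to $\widehat{(-)}_H$ with the unit and counit of 1. 5. The isomorphisms $T\otimes M\to M\otimes T^{S^2}$, $t\otimes m\mapsto t_1m\otimes t_0$, for aYD-modules $M$, and $T^{S^2}\otimes N\to N\otimes T$, $t\otimes n\mapsto t_1n\otimes t_0$, for aYD-contramodules $N$, define equivalences $$aYD\text{-mod}\simeq\mathcal Z(\mathcal M^{H\#}),\qquad aYD\text{-ctrmd}\simeq\mathcal Z({}^{\#}\widehat{\mathcal M^H})$$ that are the identity on underlying comodules and contramodules. 6. The diagram $$\begin{array}{ccc}\mathcal Z(\mathcal M^{H\#})&\rightleftarrows&\mathcal Z({}^{\#}\widehat{\mathcal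 M^H})\\ \uparrow\simeq&&\uparrow\simeq\\ aYD\text{-mod}&\rightleftarrows&aYD\text{-ctrmd}\end{array}$$ with the equivalences of 5 as vertical functors, $\mathcal Z(\widehat{(-)})$ and $\widehat{(-)}_H$ as the functors to the right, and $\mathcal Z((-)')$ and $(-)'_H$ as the functors to the left, commutes in both directions, by natural isomorphisms that are the identity on the underlying objects. 7. If $M$ is a stable aYD-module, then $\widehat M$ is stable, and if $N$ is a stable aYD-contramodule, then $N'$ is stable. The adjunction of 4 restricts, with the same unit and counit, to an adjunction between stable aYD-modules and stable aYD-contramodules. -/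

import Mathlib

open CategoryTheory MonoidalCategory TensorProduct
open scoped MonoidalLeftAction MonoidalRightAction

universe u

set_option linter.unusedVariables false
set_option linter.unusedSectionVars false
set_option linter.unusedSimpArgs false

namespace AYD

noncomputable section

/-! ### Matrix coefficients -/

section Matrix

variable {k : Type u} {H : Type u} [Field k] [Ring H] [HopfAlgebra k H]

/-- A finite square array of elements of a coalgebra with
`Δ c_ij = ∑ l, c_il ⊗ c_lj` and `ε c_ij = δ_ij`. -/
structure IsComatrix (k : Type u) {H : Type u} [Field k] [Ring H] [HopfAlgebra k H]
    {ι : Type} [Fintype ι] [DecidableEq ι] (C : ι → ι → H) : Prop where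
  comul : ∀ i j, Coalgebra.comul (R := k) (C i j) = ∑ l, C i l ⊗ₜ[k] C l j
  counit : ∀ i j, Coalgebra.counit (R := k) (C i j) = if i = j then 1 else 0

variable {ι κ : Type} [Fintype ι] [DecidableEq ι] [Fintype κ] [DecidableEq κ]

theorem IsComatrix.antipode_mul {C : ι → ι → H} (hC : IsComatrix k C) (i j : ι) :
    ∑ l, HopfAlgebra.antipode k (C i l) * C l j = if i = j then 1 else 0 := by
  have := HopfAlgebra.mul_antipode_rTensor_comul_apply (R := k) (C i j)
  rw [hC.comul, hC.counit] at this
  simpa [map_sum, apply_ite (algebraMap k H)] using this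

theorem IsComatrix.mul_antipode {C : ι → ι → H} (hC : IsComatrix k C) (i j : ι) :
    ∑ l, C i l * HopfAlgebra.antipode k (C l j) = if i = j then 1 else 0 := by
  have := HopfAlgebra.mul_antipode_lTensor_comul_apply (R := k) (C i j)
  rw [hC.comul, hC.counit] at this
  simpa [map_sum, apply_ite (algebraMap k H)] using this

theorem IsComatrix.mul {C : ι → ι → H} {D : κ → κ → H} (hC : IsComatrix k C)
    (hD : IsComatrix k D) :
    IsComatrix k (fun p q : ι × κ => C p.1 q.1 * D p.2 q.2) where
  comul p q := by
    rw [Bialgebra.comul_mul, hC.comul, hD.comul, Finset.sum_mul_sum, Fintype.sum_prod_type]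
    simp
  counit p q := by
    rw [Bialgebra.counit_mul, hC.counit, hD.counit]
    by_cases h1 : p.1 = q.1 <;> by_cases h2 : p.2 = q.2 <;> simp [h1, h2, Prod.ext_iff]

/-- Every element of a right comodule is a combination of a finite family `v` on which the
coaction is given by a comatrix. -/
theorem exists_comatrix {M : Type u} [AddCommGroup M] [Module k M] (ρ : M →ₗ[k] M ⊗[k] H)
    (hρ : (TensorProduct.assoc k M H H).toLinearMap ∘ₗ ρ.rTensor H ∘ₗ ρ =
      (Coalgebra.comul (R := k)).lTensor M ∘ₗ ρ)
    (hε : (TensorProduct.rid k M).toLinearMap ∘ₗ (Coalgebra.counit (R := k)).lTensor M ∘ₗ ρ =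
      LinearMap.id) (m : M) :
    ∃ (n : ℕ) (v : Fin n → M) (C : Fin n → Fin n → H), IsComatrix k C ∧
      (∀ j, ρ (v j) = ∑ i, v i ⊗ₜ[k] C i j) ∧ m ∈ Submodule.span k (Set.range v) := by
  classical
  let act : Module.Dual k H → M → M := fun χ x => TensorProduct.rid k M (χ.lTensor M (ρ x))
  have hact : ∀ ψ χ x, act ψ (act χ x) =
      act (LinearMap.mul' k k ∘ₗ TensorProduct.map ψ χ ∘ₗ Coalgebra.comul) x := by
    intro ψ χ x
    have h := LinearMap.congr_fun hρ x
    simp only [LinearMap.comp_apply, LinearEquiv.coe_coe] at h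
    have h2 := congrArg (fun z => TensorProduct.rid k M
      ((LinearMap.mul' k k ∘ₗ TensorProduct.map ψ χ).lTensor M z)) h
    change TensorProduct.rid k M (ψ.lTensor M (ρ (TensorProduct.rid k M (χ.lTensor M (ρ x))))) =
      TensorProduct.rid k M ((LinearMap.mul' k k ∘ₗ TensorProduct.map ψ χ ∘ₗ
        Coalgebra.comul).lTensor M (ρ x))
    rw [← LinearMap.comp_assoc, LinearMap.lTensor_comp, LinearMap.comp_apply, ← h2]
    generalize ρ x = z
    induction z with
    | zero => simp
    | add a b ha hb => simp only [map_add, ha, hb]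
    | tmul a h' =>
      simp only [LinearMap.lTensor_tmul, TensorProduct.rid_tmul, map_smul, LinearMap.rTensor_tmul]
      generalize ρ a = w
      induction w with
      | zero => simp
      | add a b ha hb => simp only [map_add, ha, hb, smul_add, TensorProduct.add_tmul]
      | tmul a h'' => simp [smul_smul, mul_comm]
  let L : Module.Dual k H →ₗ[k] M :=
    { toFun := fun χ => act χ m
      map_add' := fun a b => by simp [act, LinearMap.lTensor_add]
      map_smul' := fun a b => by simp [act, LinearMap.lTensor_smul] }
  let V : Submodule k M := LinearMap.range L
  have hmV : m ∈ V := ⟨Coalgebra.counit, LinearMap.congr_fun hε m⟩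
  have hVfg : V.FG := by
    obtain ⟨S, hS⟩ := TensorProduct.exists_finset (ρ m)
    have hle : V ≤ Submodule.span k (S.image Prod.fst : Set M) := by
      rintro _ ⟨χ, rfl⟩
      change TensorProduct.rid k M (χ.lTensor M (ρ m)) ∈ _
      rw [hS, map_sum, map_sum]
      refine Submodule.sum_mem _ fun p hp => ?_
      simp only [LinearMap.lTensor_tmul, TensorProduct.rid_tmul]
      exact Submodule.smul_mem _ _ (Submodule.subset_span (by
        simp only [Finset.coe_image]
        exact ⟨p, hp, rfl⟩))
    have : FiniteDimensional k (Submodule.span k (S.image Prod.fst : Set M)) :=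
      FiniteDimensional.span_finset k _
    have := Submodule.finiteDimensional_of_le hle
    exact (Submodule.fg_top V).1 this.fg_top
  have hfd : FiniteDimensional k V := Module.Finite.iff_fg.2 hVfg
  have hVact : ∀ ψ, ∀ v ∈ V, act ψ v ∈ V := by
    rintro ψ _ ⟨χ, rfl⟩
    exact ⟨_, (hact ψ χ m).symm⟩
  let b := Module.finBasis k V
  have hrho : ∀ v ∈ V, ∃ c : Fin (Module.finrank k V) → H,
      ρ v = ∑ i, (b i : M) ⊗ₜ[k] c i := by
    intro v hv
    let B := Module.Basis.ofVectorSpace k H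
    have e := (TensorProduct.equivFinsuppOfBasisRight (M := M) B).symm_apply_apply (ρ v)
    rw [TensorProduct.equivFinsuppOfBasisRight_symm_apply] at e
    have hy : ∀ a, ∃ r : Fin (Module.finrank k V) → k,
        TensorProduct.equivFinsuppOfBasisRight (M := M) B (ρ v) a = ∑ i, r i • (b i : M) := by
      intro a
      rw [TensorProduct.equivFinsuppOfBasisRight_apply]
      have := b.sum_repr ⟨_, hVact (B.coord a) v hv⟩
      refine ⟨fun i => b.repr ⟨_, hVact (B.coord a) v hv⟩ i, ?_⟩
      have h := congrArg Subtype.val this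
      rw [Submodule.coe_sum] at h
      exact h.symm
    choose r hr using hy
    refine ⟨fun i => ∑ a ∈ (TensorProduct.equivFinsuppOfBasisRight (M := M) B (ρ v)).support,
      r a i • B a, ?_⟩
    conv_lhs => rw [← e]
    rw [Finsupp.sum]
    simp only [hr, TensorProduct.sum_tmul, TensorProduct.tmul_sum]
    rw [Finset.sum_comm]
    simp [TensorProduct.smul_tmul]
  choose C hC using fun j => hrho (b j : M) (b j).2
  have hf : ∀ i, ∃ f : Module.Dual k M, ∀ j, f (b j : M) = if i = j then 1 else 0 := by
    intro i
    obtain ⟨g, hg⟩ := LinearMap.exists_extend (b.coord i)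
    refine ⟨g, fun j => ?_⟩
    have := LinearMap.congr_fun hg (b j)
    simpa [Finsupp.single_apply, eq_comm] using this
  choose f hf using hf
  refine ⟨_, fun i => (b i : M), fun i j => C j i, ⟨fun i j => ?_, fun i j => ?_⟩, hC, ?_⟩
  · have h := LinearMap.congr_fun hρ (b j : M)
    simp only [LinearMap.comp_apply, LinearEquiv.coe_coe] at h
    have h2 := congrArg (fun z => TensorProduct.lid k (H ⊗[k] H) ((f i).rTensor (H ⊗[k] H) z)) h
    simpa [hC, map_sum, TensorProduct.sum_tmul, hf, ite_smul] using h2.symm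
  · have h := LinearMap.congr_fun hε (b j : M)
    have h2 := congrArg (f i) h
    simpa [hC, map_sum, hf] using h2
  · have h := congrArg Subtype.val (b.sum_repr ⟨m, hmV⟩)
    rw [← show _ = m from h]
    simp only [Submodule.coe_sum, Submodule.coe_smul]
    exact Submodule.sum_mem _ fun i _ => Submodule.smul_mem _ _ (Submodule.subset_span ⟨i, rfl⟩)

/-- Linear maps out of a Hopf algebra agree when they agree on entries of comatrices. -/
theorem hopf_ext {X : Type*} [AddCommMonoid X] [Module k X] {f g : H →ₗ[k] X}
    (h : ∀ (n : ℕ) (C : Fin n → Fin n → H), IsComatrix k C → ∀ i j, f (C i j) = g (C i j)) :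
    f = g := by
  ext x
  obtain ⟨n, v, C, hC, hv, hx⟩ := exists_comatrix (k := k) (Coalgebra.comul (R := k) (A := H))
    Coalgebra.coassoc (by ext a; simp) x
  refine LinearMap.eqOn_span (s := Set.range v) ?_ hx
  rintro _ ⟨j, rfl⟩
  have e : v j = ∑ i, Coalgebra.counit (R := k) (v i) • C i j := by
    have := Coalgebra.rTensor_counit_comul (R := k) (v j)
    rw [hv j] at this
    have := congrArg (TensorProduct.lid k H) this
    simpa [map_sum] using this.symm
  rw [e]
  simp [map_sum, h n C hC]

theorem coassoc_of_comatrix {M : Type*} [AddCommGroup M] [Module k M] (ρ : M →ₗ[k] M ⊗[k] H)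
    {C : ι → ι → H} (hC : IsComatrix k C) {v : ι → M} (hv : ∀ j, ρ (v j) = ∑ i, v i ⊗ₜ[k] C i j)
    (j : ι) : TensorProduct.assoc k M H H (ρ.rTensor H (ρ (v j))) =
      (Coalgebra.comul (R := k)).lTensor M (ρ (v j)) := by
  simp only [hv, map_sum, LinearMap.rTensor_tmul, LinearMap.lTensor_tmul, hC.comul,
    TensorProduct.sum_tmul, TensorProduct.tmul_sum, TensorProduct.assoc_tmul]
  rw [Finset.sum_comm]

theorem counit_of_comatrix {M : Type*} [AddCommGroup M] [Module k M] (ρ : M →ₗ[k] M ⊗[k] H)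
    {C : ι → ι → H} (hC : IsComatrix k C) {v : ι → M} (hv : ∀ j, ρ (v j) = ∑ i, v i ⊗ₜ[k] C i j)
    (j : ι) : TensorProduct.rid k M ((Coalgebra.counit (R := k)).lTensor M (ρ (v j))) = v j := by
  simp [hv, map_sum, hC.counit]

theorem comul_antipode : Coalgebra.comul (R := k) ∘ₗ HopfAlgebra.antipode k (A := H) =
    (TensorProduct.comm k H H).toLinearMap ∘ₗ
      TensorProduct.map (HopfAlgebra.antipode k) (HopfAlgebra.antipode k) ∘ₗ
        Coalgebra.comul := by
  apply WithConv.toConv_injective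
  refine (left_inv_eq_right_inv (a := WithConv.toConv (Coalgebra.comul (R := k) (A := H)))
    ?_ LinearMap.comul_right_inv).symm
  apply WithConv.ofConv_injective
  refine hopf_ext fun n C hC i j => ?_
  simp only [LinearMap.convMul_def, LinearMap.convOne_def, WithConv.ofConv_toConv,
    LinearMap.comp_apply, hC.comul, hC.counit, map_sum, TensorProduct.map_tmul,
    LinearEquiv.coe_coe, TensorProduct.comm_tmul, TensorProduct.sum_tmul, TensorProduct.tmul_sum,
    LinearMap.mul'_apply, Algebra.TensorProduct.tmul_mul_tmul, Algebra.linearMap_apply]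
  rw [Finset.sum_comm]
  calc _ = ∑ q, ∑ p, (∑ l, HopfAlgebra.antipode k (C p l) * C l q) ⊗ₜ[k]
          (HopfAlgebra.antipode k (C i p) * C q j) := by
        refine Finset.sum_congr rfl fun q _ => ?_
        rw [Finset.sum_comm]
        simp only [TensorProduct.sum_tmul]
    _ = 1 ⊗ₜ[k] ∑ p, HopfAlgebra.antipode k (C i p) * C p j := by
        rw [TensorProduct.tmul_sum, Finset.sum_comm]
        simp only [hC.antipode_mul, TensorProduct.ite_tmul]
        simp
    _ = _ := by
        rw [hC.antipode_mul]
        split_ifs <;> simp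

theorem IsComatrix.antipode {C : ι → ι → H} (hC : IsComatrix k C) :
    IsComatrix k (fun i j => HopfAlgebra.antipode k (C j i)) where
  comul i j := by
    have := LinearMap.congr_fun (comul_antipode (k := k) (H := H)) (C j i)
    simpa [hC.comul, map_sum] using this
  counit i j := by
    rw [HopfAlgebra.counit_antipode, hC.counit]
    simp [eq_comm]

variable (k H) in
/-- The square of the antipode. -/
def antipodeSq : H →ₗ[k] H := HopfAlgebra.antipode k ∘ₗ HopfAlgebra.antipode k

theorem IsComatrix.antipodeSq {C : ι → ι → H} (hC : IsComatrix k C) :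
    IsComatrix k (fun i j => antipodeSq k H (C i j)) := hC.antipode.antipode

@[simp] theorem antipodeSq_one : antipodeSq k H 1 = 1 := by simp [antipodeSq]

theorem antipodeSq_mul (a b : H) :
    antipodeSq k H (a * b) = antipodeSq k H a * antipodeSq k H b := by
  simp [antipodeSq, HopfAlgebra.antipode_mul_antidistrib]

/-- The square of the antipode is a morphism of coalgebras. -/
theorem comul_antipodeSq : Coalgebra.comul (R := k) ∘ₗ antipodeSq k H =
    TensorProduct.map (antipodeSq k H) (antipodeSq k H) ∘ₗ Coalgebra.comul :=
  hopf_ext fun n C hC i j => by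
    simpa [hC.comul, map_sum] using hC.antipodeSq.comul i j

theorem counit_antipodeSq : Coalgebra.counit (R := k) ∘ₗ antipodeSq k H = Coalgebra.counit := by
  ext; simp [antipodeSq]

end Matrix
end

noncomputable section

variable (k H : Type u) [Field k] [Ring H] [HopfAlgebra k H]

/-! ### Comodules -/

/-- Right `H`-comodules. -/
structure Comod where
  carrier : Type u
  [addCommGroup : AddCommGroup carrier]
  [module : Module k carrier]
  coact : carrier →ₗ[k] carrier ⊗[k] H
  coassoc : (TensorProduct.assoc k carrier H H).toLinearMap ∘ₗ coact.rTensor H ∘ₗ coact =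
    (Coalgebra.comul (R := k)).lTensor carrier ∘ₗ coact
  counit : (TensorProduct.rid k carrier).toLinearMap ∘ₗ
    (Coalgebra.counit (R := k)).lTensor carrier ∘ₗ coact = LinearMap.id

attribute [instance] Comod.addCommGroup Comod.module

instance : CoeSort (Comod k H) (Type u) := ⟨Comod.carrier⟩

variable {k H}

/-- Morphisms of comodules. -/
@[ext]
structure Comod.Hom (M N : Comod k H) where
  lin : M →ₗ[k] N
  comm : N.coact ∘ₗ lin = lin.rTensor H ∘ₗ M.coact

instance : Category (Comod k H) where
  Hom := Comod.Hom
  id M := ⟨LinearMap.id, by simp⟩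
  comp f g := ⟨g.lin ∘ₗ f.lin, by
    rw [← LinearMap.comp_assoc, g.comm, LinearMap.comp_assoc, f.comm, ← LinearMap.comp_assoc,
      LinearMap.rTensor_comp]⟩

/-- The underlying linear map of a morphism of comodules. -/
abbrev Comod.lin {M N : Comod k H} (f : M ⟶ N) : M →ₗ[k] N := Comod.Hom.lin f

theorem Comod.lin_comm {M N : Comod k H} (f : M ⟶ N) :
    N.coact ∘ₗ Comod.lin f = (Comod.lin f).rTensor H ∘ₗ M.coact := Comod.Hom.comm f

theorem Comod.hom_ext {M N : Comod k H} {f g : M ⟶ N} (h : Comod.lin f = Comod.lin g) : f = g :=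
  Comod.Hom.ext h

@[simp] theorem Comod.lin_id (M : Comod k H) : Comod.lin (𝟙 M) = LinearMap.id := rfl

@[simp] theorem Comod.lin_comp {M N P : Comod k H} (f : M ⟶ N) (g : N ⟶ P) :
    Comod.lin (f ≫ g) = Comod.lin g ∘ₗ Comod.lin f := rfl

/-- An isomorphism of comodules from a linear equivalence that respects the coactions. -/
def Comod.mkIso {M N : Comod k H} (e : M ≃ₗ[k] N)
    (h : N.coact ∘ₗ e.toLinearMap = e.toLinearMap.rTensor H ∘ₗ M.coact) : M ≅ N where
  hom := ⟨e.toLinearMap, h⟩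
  inv := ⟨e.symm.toLinearMap, by
    refine LinearMap.ext fun x => ?_
    have h2 := congrArg (e.symm.toLinearMap.rTensor H) (LinearMap.congr_fun h (e.symm x))
    simp only [LinearMap.comp_apply, LinearEquiv.coe_coe, e.apply_symm_apply] at h2
    rw [← LinearMap.comp_apply (LinearMap.rTensor H _) (LinearMap.rTensor H _),
      ← LinearMap.rTensor_comp, LinearEquiv.symm_comp, LinearMap.rTensor_id] at h2
    exact h2.symm⟩
  hom_inv_id := Comod.hom_ext (by ext; simp [Comod.lin, CategoryStruct.comp])
  inv_hom_id := Comod.hom_ext (by ext; simp [Comod.lin, CategoryStruct.comp])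

/-- Linear maps out of a comodule agree when they agree on families on which the coaction is
given by a comatrix. -/
theorem Comod.lin_ext (M : Comod k H) {X : Type*} [AddCommGroup X] [Module k X] {f g : M →ₗ[k] X}
    (h : ∀ (n : ℕ) (v : Fin n → M) (C : Fin n → Fin n → H), IsComatrix k C →
      (∀ j, M.coact (v j) = ∑ i, v i ⊗ₜ[k] C i j) → ∀ j, f (v j) = g (v j)) : f = g := by
  ext x
  obtain ⟨n, v, C, hC, hv, hx⟩ := exists_comatrix M.coact M.coassoc M.counit x
  refine LinearMap.eqOn_span (s := Set.range v) ?_ hx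
  rintro _ ⟨j, rfl⟩
  exact h n v C hC hv j

/-- The coaction `m ⊗ n ↦ m₀ ⊗ n₀ ⊗ m₁ n₁` on a tensor product. -/
def tensorCoact (M N : Comod k H) : M ⊗[k] N →ₗ[k] (M ⊗[k] N) ⊗[k] H :=
  (LinearMap.mul' k H).lTensor (M ⊗[k] N) ∘ₗ
    (TensorProduct.tensorTensorTensorComm k M H N H).toLinearMap ∘ₗ
      TensorProduct.map M.coact N.coact

theorem tensorCoact_apply {M N : Comod k H} {n m : ℕ} {v : Fin n → M} {w : Fin m → N}
    {C : Fin n → Fin n → H} {D : Fin m → Fin m → H}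
    (hv : ∀ j, M.coact (v j) = ∑ i, v i ⊗ₜ[k] C i j)
    (hw : ∀ j, N.coact (w j) = ∑ i, w i ⊗ₜ[k] D i j) (p : Fin n × Fin m) :
    tensorCoact M N (v p.1 ⊗ₜ w p.2) =
      ∑ q : Fin n × Fin m, (v q.1 ⊗ₜ[k] w q.2) ⊗ₜ[k] (C q.1 p.1 * D q.2 p.2) := by
  simp only [tensorCoact, LinearMap.comp_apply, TensorProduct.map_tmul, hv, hw,
    TensorProduct.sum_tmul, TensorProduct.tmul_sum, map_sum, LinearEquiv.coe_coe,
    TensorProduct.tensorTensorTensorComm_tmul, LinearMap.lTensor_tmul, LinearMap.mul'_apply,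
    Fintype.sum_prod_type]
  rw [Finset.sum_comm]

theorem Comod.tensor_ext (M N : Comod k H) {X : Type*} [AddCommGroup X] [Module k X]
    {f g : M ⊗[k] N →ₗ[k] X}
    (h : ∀ (n m : ℕ) (v : Fin n → M) (w : Fin m → N) (C : Fin n → Fin n → H)
      (D : Fin m → Fin m → H), IsComatrix k C → IsComatrix k D →
      (∀ j, M.coact (v j) = ∑ i, v i ⊗ₜ[k] C i j) → (∀ j, N.coact (w j) = ∑ i, w i ⊗ₜ[k] D i j) →
      ∀ i j, f (v i ⊗ₜ w j) = g (v i ⊗ₜ w j)) : f = g := by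
  apply TensorProduct.ext
  refine M.lin_ext fun n v C hC hv i => N.lin_ext fun m w D hD hw j => ?_
  exact h n m v w C D hC hD hv hw i j

/-- The tensor product of comodules. -/
def Comod.tensor (M N : Comod k H) : Comod k H where
  carrier := M ⊗[k] N
  coact := tensorCoact M N
  coassoc := Comod.tensor_ext M N fun n m v w C D hC hD hv hw i j =>
    coassoc_of_comatrix _ (hC.mul hD) (v := fun p => v p.1 ⊗ₜ w p.2)
      (tensorCoact_apply hv hw) (i, j)
  counit := Comod.tensor_ext M N fun n m v w C D hC hD hv hw i j =>
    counit_of_comatrix _ (hC.mul hD) (v := fun p => v p.1 ⊗ₜ w p.2)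
      (tensorCoact_apply hv hw) (i, j)

theorem tensorCoact_tmul (M N : Comod k H) (m : M) (n : N) : tensorCoact M N (m ⊗ₜ n) =
    (LinearMap.mul' k H).lTensor (M ⊗[k] N)
      (TensorProduct.tensorTensorTensorComm k M H N H (M.coact m ⊗ₜ N.coact n)) := rfl

theorem tensorCoact_natural {M M' N N' : Comod k H} (f : M →ₗ[k] M') (g : N →ₗ[k] N')
    (hf : M'.coact ∘ₗ f = f.rTensor H ∘ₗ M.coact) (hg : N'.coact ∘ₗ g = g.rTensor H ∘ₗ N.coact) :
    tensorCoact M' N' ∘ₗ TensorProduct.map f g =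
      (TensorProduct.map f g).rTensor H ∘ₗ tensorCoact M N := by
  apply TensorProduct.ext'
  intro m n
  have h1 := LinearMap.congr_fun hf m
  have h2 := LinearMap.congr_fun hg n
  simp only [LinearMap.comp_apply] at h1 h2
  simp only [LinearMap.comp_apply, TensorProduct.map_tmul, tensorCoact_tmul, h1, h2]
  generalize M.coact m = x
  generalize N.coact n = y
  induction x with
  | zero => simp
  | add a b ha hb => simp only [map_add, TensorProduct.add_tmul, ha, hb]
  | tmul a h =>
    induction y with
    | zero => simp
    | add a b ha hb => simp only [map_add, TensorProduct.tmul_add, ha, hb]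
    | tmul a h => simp

/-- The tensor product of two morphisms of comodules. -/
def Comod.tensorMap {M M' N N' : Comod k H} (f : M ⟶ M') (g : N ⟶ N') :
    M.tensor N ⟶ M'.tensor N' :=
  ⟨TensorProduct.map (Comod.lin f) (Comod.lin g),
    tensorCoact_natural _ _ (Comod.lin_comm f) (Comod.lin_comm g)⟩

variable (k H) in
/-- The trivial comodule `k`. -/
def Comod.unit : Comod k H where
  carrier := k
  coact := (TensorProduct.mk k k H).flip 1
  coassoc := by ext; simp [Algebra.TensorProduct.one_def]
  counit := by ext; simp

/-- The comodule `M^φ` whose coaction is that of `M` followed by the coalgebra map `φ = S²`. -/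
def Comod.twist (M : Comod k H) : Comod k H where
  carrier := M
  coact := (antipodeSq k H).lTensor M ∘ₗ M.coact
  coassoc := M.lin_ext fun n v C hC hv j =>
    coassoc_of_comatrix _ hC.antipodeSq (v := v) (fun j => by simp [hv, map_sum]) j
  counit := M.lin_ext fun n v C hC hv j =>
    counit_of_comatrix _ hC.antipodeSq (v := v) (fun j => by simp [hv, map_sum]) j

/-- A morphism of comodules is also a morphism of the twisted comodules. -/
def Comod.twistMap {M N : Comod k H} (f : M ⟶ N) : M.twist ⟶ N.twist :=
  ⟨show M →ₗ[k] N from Comod.lin f, by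
    change (antipodeSq k H).lTensor N ∘ₗ N.coact ∘ₗ Comod.lin f =
      (Comod.lin f).rTensor H ∘ₗ (antipodeSq k H).lTensor M ∘ₗ M.coact
    rw [Comod.lin_comm, ← LinearMap.comp_assoc, ← LinearMap.comp_assoc,
      LinearMap.rTensor_comp_lTensor, LinearMap.lTensor_comp_rTensor]⟩

/-! ### Finite-dimensional comodules as a monoidal category -/

variable (k H) in
/-- Finite-dimensional right `H`-comodules, a full subcategory of all comodules. -/
structure FdComod where
  toComod : Comod k H
  [fd : FiniteDimensional k toComod]

attribute [instance] FdComod.fd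

instance : Category (FdComod k H) where
  Hom T L := T.toComod ⟶ L.toComod
  id T := 𝟙 T.toComod
  comp f g := CategoryStruct.comp (X := (_ : Comod k H)) f g

/-- The underlying linear map of a morphism of finite-dimensional comodules. -/
abbrev FdComod.lin {T L : FdComod k H} (f : T ⟶ L) : T.toComod →ₗ[k] L.toComod := Comod.Hom.lin f

theorem FdComod.hom_ext {M N : FdComod k H} {f g : M ⟶ N} (h : FdComod.lin f = FdComod.lin g) :
    f = g := Comod.Hom.ext h

/-- An isomorphism of the underlying comodules. -/
def FdComod.mkIso {T L : FdComod k H} (e : T.toComod ≅ L.toComod) : T ≅ L :=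
  ⟨e.hom, e.inv, e.hom_inv_id, e.inv_hom_id⟩

/-- The tensor product of finite-dimensional comodules. -/
def FdComod.tensor (T L : FdComod k H) : FdComod k H :=
  { toComod := T.toComod.tensor L.toComod
    fd := inferInstanceAs (FiniteDimensional k (T.toComod ⊗[k] L.toComod)) }

theorem tensorCoact_assoc (M N P : Comod k H) :
    tensorCoact M (N.tensor P) ∘ₗ (TensorProduct.assoc k M N P).toLinearMap =
      (TensorProduct.assoc k M N P).toLinearMap.rTensor H ∘ₗ tensorCoact (M.tensor N) P := by
  apply TensorProduct.ext_threefold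
  intro m n p
  change (LinearMap.mul' k H).lTensor _ (TensorProduct.tensorTensorTensorComm k M H _ H
      (M.coact m ⊗ₜ tensorCoact N P (n ⊗ₜ p))) =
    (TensorProduct.assoc k M N P).toLinearMap.rTensor H ((LinearMap.mul' k H).lTensor _
      (TensorProduct.tensorTensorTensorComm k _ H P H (tensorCoact M N (m ⊗ₜ n) ⊗ₜ P.coact p)))
  simp only [tensorCoact_tmul]
  generalize M.coact m = x
  generalize N.coact n = y
  generalize P.coact p = z
  induction x with
  | zero => simp
  | add a b ha hb => simp only [map_add, TensorProduct.add_tmul, ha, hb]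
  | tmul a h =>
    induction y with
    | zero => simp
    | add a b ha hb => simp only [map_add, TensorProduct.add_tmul, TensorProduct.tmul_add, ha, hb]
    | tmul b h' =>
      induction z with
      | zero => simp
      | add a b ha hb => simp only [map_add, TensorProduct.tmul_add, ha, hb]
      | tmul c h'' =>
        simp [mul_assoc]

/-- The associativity isomorphism `(M ⊗ N) ⊗ P ≅ M ⊗ (N ⊗ P)`. -/
def Comod.assocIso (M N P : Comod k H) :
    (M.tensor N).tensor P ≅ M.tensor (N.tensor P) :=
  Comod.mkIso (TensorProduct.assoc k M N P) (tensorCoact_assoc M N P)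

theorem tensorCoact_lid (M : Comod k H) :
    M.coact ∘ₗ (TensorProduct.lid k M).toLinearMap =
      (TensorProduct.lid k M).toLinearMap.rTensor H ∘ₗ tensorCoact (Comod.unit k H) M := by
  apply TensorProduct.ext'
  intro r m
  change M.coact (r • m) = (TensorProduct.lid k M).toLinearMap.rTensor H
    ((LinearMap.mul' k H).lTensor _ (TensorProduct.tensorTensorTensorComm k k H M H
      ((r ⊗ₜ 1) ⊗ₜ M.coact m)))
  rw [map_smul]
  generalize M.coact m = x
  induction x with
  | zero => simp
  | add a b ha hb => simp only [map_add, TensorProduct.tmul_add, ha, hb, smul_add]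
  | tmul a h => simp [TensorProduct.smul_tmul']

theorem tensorCoact_rid (M : Comod k H) :
    M.coact ∘ₗ (TensorProduct.rid k M).toLinearMap =
      (TensorProduct.rid k M).toLinearMap.rTensor H ∘ₗ tensorCoact M (Comod.unit k H) := by
  apply TensorProduct.ext'
  intro m r
  change M.coact (r • m) = (TensorProduct.rid k M).toLinearMap.rTensor H
    ((LinearMap.mul' k H).lTensor _ (TensorProduct.tensorTensorTensorComm k M H k H
      (M.coact m ⊗ₜ (r ⊗ₜ 1))))
  rw [map_smul]
  generalize M.coact m = x
  induction x with
  | zero => simp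
  | add a b ha hb => simp only [map_add, TensorProduct.add_tmul, ha, hb, smul_add]
  | tmul a h => simp [TensorProduct.smul_tmul']

/-- The isomorphism `k ⊗ M ≅ M`. -/
def Comod.lidIso (M : Comod k H) : (Comod.unit k H).tensor M ≅ M :=
  Comod.mkIso (TensorProduct.lid k M) (tensorCoact_lid M)

/-- The isomorphism `M ⊗ k ≅ M`. -/
def Comod.ridIso (M : Comod k H) : M.tensor (Comod.unit k H) ≅ M :=
  Comod.mkIso (TensorProduct.rid k M) (tensorCoact_rid M)

instance : MonoidalCategoryStruct (FdComod k H) where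
  tensorObj := FdComod.tensor
  tensorHom f g := Comod.tensorMap f g
  whiskerLeft T _ _ g := Comod.tensorMap (𝟙 T.toComod) g
  whiskerRight f T := Comod.tensorMap f (𝟙 T.toComod)
  tensorUnit := { toComod := Comod.unit k H, fd := inferInstanceAs (FiniteDimensional k k) }
  associator T L P := FdComod.mkIso (Comod.assocIso T.toComod L.toComod P.toComod)
  leftUnitor T := FdComod.mkIso (Comod.lidIso T.toComod)
  rightUnitor T := FdComod.mkIso (Comod.ridIso T.toComod)

variable (k H) in
/-- The forgetful functor to vector spaces. -/
def FdComod.forget : FdComod k H ⥤ ModuleCat.{u} k where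
  obj T := ModuleCat.of k T.toComod
  map f := ModuleCat.ofHom (FdComod.lin f)

instance : (FdComod.forget k H).Faithful where
  map_injective h := FdComod.hom_ext (congrArg ModuleCat.Hom.hom h)

instance : MonoidalCategory (FdComod k H) :=
  Monoidal.induced (FdComod.forget k H)
    { μIso := fun _ _ => Iso.refl _
      εIso := Iso.refl _
      whiskerLeft_eq := fun X _ _ f => by
        ext : 1; exact TensorProduct.ext' fun _ _ => rfl
      whiskerRight_eq := fun f X => by
        ext : 1; exact TensorProduct.ext' fun _ _ => rfl
      tensorHom_eq := fun f g => by
        ext : 1; exact TensorProduct.ext' fun _ _ => rfl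
      associator_eq := fun X Y Z => by
        ext : 1; exact TensorProduct.ext_threefold fun _ _ _ => rfl
      leftUnitor_eq := fun X => by
        ext : 1; exact TensorProduct.ext' fun _ _ => rfl
      rightUnitor_eq := fun X => by
        ext : 1; exact TensorProduct.ext' fun _ _ => rfl }

end

noncomputable section

/-! ### Bimodule categories, bimodule functors and centers -/

section Bimodule

universe v₁ u₁ v₂ u₂ v₃ u₃

open MonoidalLeftAction MonoidalRightAction

variable (C : Type u₁) [Category.{v₁} C] [MonoidalCategory C]

/-- A bimodule category over a monoidal category `C`: a category with a left and a right action
of `C` and middle associativity isomorphisms subject to the two pentagon axioms. -/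
class BimoduleCategory (D : Type u₂) [Category.{v₂} D] [MonoidalLeftAction C D]
    [MonoidalRightAction C D] where
  /-- The isomorphism `(X · M) · Y ≅ X · (M · Y)`. -/
  mid (X : C) (M : D) (Y : C) : (X ⊙ₗ M) ⊙ᵣ Y ≅ X ⊙ₗ (M ⊙ᵣ Y)
  mid_naturality {X X' : C} {M M' : D} {Y Y' : C} (f : X ⟶ X') (g : M ⟶ M') (h : Y ⟶ Y') :
    ((f ⊙ₗₘ g) ⊙ᵣₘ h) ≫ (mid X' M' Y').hom = (mid X M Y).hom ≫ (f ⊙ₗₘ (g ⊙ᵣₘ h))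
  pentagon_left (X X' : C) (M : D) (Y : C) :
    (αₗ X X' M).hom ⊵ᵣ Y ≫ (mid X (X' ⊙ₗ M) Y).hom ≫ X ⊴ₗ (mid X' M Y).hom =
      (mid (X ⊗ X') M Y).hom ≫ (αₗ X X' (M ⊙ᵣ Y)).hom
  pentagon_right (X : C) (M : D) (Y Y' : C) :
    (αᵣ (X ⊙ₗ M) Y Y').hom ≫ (mid X M Y).hom ⊵ᵣ Y' ≫ (mid X (M ⊙ᵣ Y) Y').hom =
      (mid X M (Y ⊗ Y')).hom ≫ X ⊴ₗ (αᵣ M Y Y').hom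

open BimoduleCategory

variable {D : Type u₂} [Category.{v₂} D] [MonoidalLeftAction C D] [MonoidalRightAction C D]
  [BimoduleCategory C D]
  {E : Type u₃} [Category.{v₃} E] [MonoidalLeftAction C E] [MonoidalRightAction C E]
  [BimoduleCategory C E]

/-- The structure of a functor of `C`-bimodule categories on a functor `F`. -/
structure BimoduleFunctor (F : D ⥤ E) where
  /-- The isomorphism `F (X · M) ≅ X · F M`. -/
  left (X : C) (M : D) : F.obj (X ⊙ₗ M) ≅ X ⊙ₗ F.obj M
  /-- The isomorphism `F (M · Y) ≅ F M · Y`. -/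
  right (M : D) (Y : C) : F.obj (M ⊙ᵣ Y) ≅ F.obj M ⊙ᵣ Y
  left_naturality {X X' : C} {M M' : D} (f : X ⟶ X') (g : M ⟶ M') :
    F.map (f ⊙ₗₘ g) ≫ (left X' M').hom = (left X M).hom ≫ (f ⊙ₗₘ F.map g)
  right_naturality {M M' : D} {Y Y' : C} (g : M ⟶ M') (f : Y ⟶ Y') :
    F.map (g ⊙ᵣₘ f) ≫ (right M' Y').hom = (right M Y).hom ≫ (F.map g ⊙ᵣₘ f)
  left_assoc (X X' : C) (M : D) :
    F.map (αₗ X X' M).hom ≫ (left X (X' ⊙ₗ M)).hom ≫ X ⊴ₗ (left X' M).hom =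
      (left (X ⊗ X') M).hom ≫ (αₗ X X' (F.obj M)).hom
  left_unit (M : D) : (left (𝟙_ C) M).hom ≫ (λₗ (F.obj M)).hom = F.map (λₗ M).hom
  right_assoc (M : D) (Y Y' : C) :
    F.map (αᵣ M Y Y').hom ≫ (right (M ⊙ᵣ Y) Y').hom ≫ (right M Y).hom ⊵ᵣ Y' =
      (right M (Y ⊗ Y')).hom ≫ (αᵣ (F.obj M) Y Y').hom
  right_unit (M : D) : (right M (𝟙_ C)).hom ≫ (ρᵣ (F.obj M)).hom = F.map (ρᵣ M).hom
  middle (X : C) (M : D) (Y : C) :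
    F.map (mid X M Y).hom ≫ (left X (M ⊙ᵣ Y)).hom ≫ X ⊴ₗ (right M Y).hom =
      (right (X ⊙ₗ M) Y).hom ≫ (left X M).hom ⊵ᵣ Y ≫ (mid X (F.obj M) Y).hom

variable (D) in
/-- Objects of the center of a `C`-bimodule category: an object with natural isomorphisms
`X · M ≅ M · X` compatible with the tensor product and the unit of `C`. -/
structure BimoduleCenter where
  obj : D
  β (X : C) : X ⊙ₗ obj ≅ obj ⊙ᵣ X
  naturality {X Y : C} (f : X ⟶ Y) : f ⊵ₗ obj ≫ (β Y).hom = (β X).hom ≫ obj ⊴ᵣ f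
  hexagon (X Y : C) : (β (X ⊗ Y)).hom = (αₗ X Y obj).hom ≫ X ⊴ₗ (β Y).hom ≫
    (mid X obj Y).inv ≫ (β X).hom ⊵ᵣ Y ≫ (αᵣ obj X Y).inv
  unit : (β (𝟙_ C)).hom = (λₗ obj).hom ≫ (ρᵣ obj).inv

variable {C}

/-- Morphisms of the center: morphisms that commute with the central structures. -/
@[ext]
structure BimoduleCenter.Hom (M N : BimoduleCenter C D) where
  hom : M.obj ⟶ N.obj
  comm (X : C) : X ⊴ₗ hom ≫ (N.β X).hom = (M.β X).hom ≫ hom ⊵ᵣ X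

instance : Category (BimoduleCenter C D) where
  Hom := BimoduleCenter.Hom
  id M := ⟨𝟙 _, by simp⟩
  comp f g := ⟨f.hom ≫ g.hom, fun X => by simp [g.comm X, reassoc_of% (f.comm X)]⟩

/-- The underlying morphism of a morphism of the center. -/
abbrev BimoduleCenter.hom {M N : BimoduleCenter C D} (f : M ⟶ N) : M.obj ⟶ N.obj := BimoduleCenter.Hom.hom f

theorem BimoduleCenter.hom_ext {M N : BimoduleCenter C D} {f g : M ⟶ N} (h : BimoduleCenter.hom f = BimoduleCenter.hom g) :
    f = g := BimoduleCenter.Hom.ext h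

namespace BimoduleFunctor

variable {F : D ⥤ E} (B : BimoduleFunctor C F)

theorem map_whisker_left (X : C) {M M' : D} (g : M ⟶ M') :
    F.map (X ⊴ₗ g) = (B.left X M).hom ≫ X ⊴ₗ F.map g ≫ (B.left X M').inv := by
  have := B.left_naturality (𝟙 X) g
  simp only [MonoidalLeftAction.id_actionHom] at this
  rw [← reassoc_of% this]
  simp

theorem map_act_right (M : D) {X Y : C} (f : X ⟶ Y) :
    F.map (M ⊴ᵣ f) ≫ (B.right M Y).hom = (B.right M X).hom ≫ F.obj M ⊴ᵣ f := by
  have := B.right_naturality (𝟙 M) f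
  simpa using this

theorem map_act_left (M : D) {X Y : C} (f : X ⟶ Y) :
    F.map (f ⊵ₗ M) ≫ (B.left Y M).hom = (B.left X M).hom ≫ f ⊵ₗ F.obj M := by
  have := B.left_naturality f (𝟙 M)
  simpa using this

theorem map_whisker_right {M M' : D} (g : M ⟶ M') (Y : C) :
    F.map (g ⊵ᵣ Y) = (B.right M Y).hom ≫ F.map g ⊵ᵣ Y ≫ (B.right M' Y).inv := by
  have := B.right_naturality g (𝟙 Y)
  simp only [MonoidalRightAction.actionHom_id] at this
  rw [← reassoc_of% this]
  simp

/-- The functor between centers induced by a bimodule functor `F`, which sends `(M, β)` to `F M`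
with the central structure `X · F M ≅ F (X · M) ≅ F (M · X) ≅ F M · X`. -/
def center : BimoduleCenter C D ⥤ BimoduleCenter C E where
  obj M :=
    { obj := F.obj M.obj
      β X := (B.left X M.obj).symm ≪≫ F.mapIso (M.β X) ≪≫ B.right M.obj X
      naturality {X Y} f := by
        have h1 := B.map_act_left M.obj f
        have h2 := B.map_act_right M.obj f
        have h3 := congrArg F.map (M.naturality f)
        simp only [Functor.map_comp] at h3
        simp only [Iso.trans_hom, Iso.symm_hom, Functor.mapIso_hom, Category.assoc]
        rw [← h2, ← reassoc_of% h3, Iso.eq_inv_comp, ← reassoc_of% h1, Iso.hom_inv_id_assoc]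
      hexagon X Y := by
        have h1 := B.left_assoc X Y M.obj
        have h2 := B.right_assoc M.obj X Y
        have h3 := B.middle X M.obj Y
        have h4 := congrArg F.map (M.hexagon X Y)
        simp only [Functor.map_comp, B.map_whisker_left, B.map_whisker_right] at h4
        simp only [Iso.trans_hom, Iso.symm_hom, Functor.mapIso_hom, Category.assoc]
        have h1' : F.map (αₗ X Y M.obj).hom ≫ (B.left X (Y ⊙ₗ M.obj)).hom =
            (B.left (X ⊗ Y) M.obj).hom ≫ (αₗ X Y (F.obj M.obj)).hom ≫
              X ⊴ₗ (B.left Y M.obj).inv := by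
          rw [← reassoc_of% h1]; simp
        have h2' : (B.right (M.obj ⊙ᵣ X) Y).inv ≫ F.map (αᵣ M.obj X Y).inv ≫
            (B.right M.obj (X ⊗ Y)).hom =
              (B.right M.obj X).hom ⊵ᵣ Y ≫ (αᵣ (F.obj M.obj) X Y).inv := by
          rw [← cancel_mono (αᵣ (F.obj M.obj) X Y).hom, Category.assoc, Category.assoc, ← h2]
          simp [← Functor.map_comp_assoc]
        have h3' : (B.left X (M.obj ⊙ᵣ Y)).inv ≫ F.map (mid X M.obj Y).inv ≫
            (B.right (X ⊙ₗ M.obj) Y).hom = X ⊴ₗ (B.right M.obj Y).hom ≫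
              (mid X (F.obj M.obj) Y).inv ≫ (B.left X M.obj).inv ⊵ᵣ Y := by
          rw [Iso.inv_comp_eq, ← cancel_epi (F.map (mid X M.obj Y).hom), reassoc_of% h3]
          simp [← Functor.map_comp_assoc]
        rw [h4]
        simp only [Category.assoc, h2', reassoc_of% h3', reassoc_of% h1', Iso.inv_hom_id_assoc,
          MonoidalLeftAction.actionHomRight_comp, MonoidalRightAction.comp_actionHomLeft]
      unit := by
        have h1 := B.left_unit M.obj
        have h2 := B.right_unit M.obj
        have h4 := congrArg F.map M.unit
        simp only [Functor.map_comp] at h4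
        simp only [Iso.trans_hom, Iso.symm_hom, Functor.mapIso_hom, h4, ← h1, Category.assoc]
        rw [Iso.inv_hom_id_assoc, Iso.cancel_iso_hom_left,
          ← cancel_mono (ρᵣ (F.obj M.obj)).hom, Category.assoc, h2,
          ← F.map_comp, Iso.inv_hom_id, F.map_id, Iso.inv_hom_id] }
  map {M N} f := ⟨F.map (BimoduleCenter.hom f), fun X => by
    have h1 := B.map_whisker_left X (BimoduleCenter.hom f)
    have h2 := B.map_whisker_right (BimoduleCenter.hom f) X
    have h3 := congrArg F.map (BimoduleCenter.Hom.comm f X)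
    simp only [Functor.map_comp] at h3
    change X ⊴ₗ F.map (BimoduleCenter.hom f) ≫ (B.left X N.obj).inv ≫ F.map (N.β X).hom ≫
      (B.right N.obj X).hom = ((B.left X M.obj).inv ≫ F.map (M.β X).hom ≫
      (B.right M.obj X).hom) ≫ F.map (BimoduleCenter.hom f) ⊵ᵣ X
    have h1' := (Iso.inv_comp_eq _).2 h1
    have h2' := congrArg (· ≫ (B.right N.obj X).hom) h2
    simp only [Category.assoc, Iso.inv_hom_id, Category.comp_id] at h1' h2'
    rw [← reassoc_of% h1', Category.assoc, Category.assoc, ← h2', ← reassoc_of% h3]⟩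
  map_id M := BimoduleCenter.hom_ext (F.map_id _)
  map_comp f g := BimoduleCenter.hom_ext (F.map_comp _ _)

end BimoduleFunctor

end Bimodule

end

noncomputable section

variable {k H : Type u} [Field k] [Ring H] [HopfAlgebra k H]

/-! ### The bimodule category of comodules, with right action twisted by `S²` -/

/-- The twisted finite-dimensional comodule. -/
def FdComod.twist (T : FdComod k H) : FdComod k H :=
  { toComod := T.toComod.twist
    fd := inferInstanceAs (FiniteDimensional k T.toComod) }

theorem tensorCoact_twist (M N : Comod k H) :
    tensorCoact M.twist N.twist = (antipodeSq k H).lTensor (M ⊗[k] N) ∘ₗ tensorCoact M N := by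
  apply TensorProduct.ext'
  intro m n
  change (LinearMap.mul' k H).lTensor _ (TensorProduct.tensorTensorTensorComm k M H N H
      ((antipodeSq k H).lTensor M (M.coact m) ⊗ₜ (antipodeSq k H).lTensor N (N.coact n))) =
    (antipodeSq k H).lTensor (M ⊗[k] N) ((LinearMap.mul' k H).lTensor _
      (TensorProduct.tensorTensorTensorComm k M H N H (M.coact m ⊗ₜ N.coact n)))
  generalize M.coact m = x
  generalize N.coact n = y
  induction x with
  | zero => simp
  | add a b ha hb => simp only [map_add, TensorProduct.add_tmul, ha, hb]
  | tmul a h =>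
    induction y with
    | zero => simp
    | add a b ha hb => simp only [map_add, TensorProduct.tmul_add, ha, hb]
    | tmul b h' => simp [antipodeSq_mul]

/-- `(M ⊗ N)^{S²} ≅ M^{S²} ⊗ N^{S²}`, the identity on the underlying space. -/
def Comod.twistTensorIso (M N : Comod k H) :
    (M.tensor N).twist ≅ M.twist.tensor N.twist :=
  Comod.mkIso (LinearEquiv.refl k (M ⊗[k] N)) (by
    refine LinearMap.ext fun x => (LinearMap.congr_fun (tensorCoact_twist M N) x).trans ?_
    exact (LinearMap.congr_fun (LinearMap.rTensor_id H (M ⊗[k] N)) _).symm)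

variable (k H) in
/-- `k^{S²} ≅ k`, the identity on the underlying space. -/
def Comod.twistUnitIso : (Comod.unit k H).twist ≅ Comod.unit k H :=
  Comod.mkIso (LinearEquiv.refl k k) (by
    change (TensorProduct.mk k k H).flip 1 ∘ₗ LinearMap.id =
      LinearMap.id.rTensor H ∘ₗ (antipodeSq k H).lTensor k ∘ₗ (TensorProduct.mk k k H).flip 1
    ext; simp)

/-- Isomorphic factors give an isomorphism of tensor products of comodules. -/
def Comod.tensorIso {M M' N N' : Comod k H} (e : M ≅ M') (f : N ≅ N') :
    M.tensor N ≅ M'.tensor N' where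
  hom := Comod.tensorMap e.hom f.hom
  inv := Comod.tensorMap e.inv f.inv
  hom_inv_id := Comod.hom_ext (by
    have h1 := congrArg Comod.lin e.hom_inv_id
    have h2 := congrArg Comod.lin f.hom_inv_id
    simp only [Comod.lin_comp, Comod.lin_id] at h1 h2
    change TensorProduct.map (Comod.lin e.inv) (Comod.lin f.inv) ∘ₗ
      TensorProduct.map (Comod.lin e.hom) (Comod.lin f.hom) = LinearMap.id
    rw [← TensorProduct.map_comp, h1, h2, TensorProduct.map_id])
  inv_hom_id := Comod.hom_ext (by
    have h1 := congrArg Comod.lin e.inv_hom_id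
    have h2 := congrArg Comod.lin f.inv_hom_id
    simp only [Comod.lin_comp, Comod.lin_id] at h1 h2
    change TensorProduct.map (Comod.lin e.hom) (Comod.lin f.hom) ∘ₗ
      TensorProduct.map (Comod.lin e.inv) (Comod.lin f.inv) = LinearMap.id
    rw [← TensorProduct.map_comp, h1, h2, TensorProduct.map_id])

/-- The left action `T · M = T ⊗ M`. -/
instance : MonoidalLeftAction (FdComod k H) (Comod k H) where
  actionObj T M := T.toComod.tensor M
  actionHomLeft f M := Comod.tensorMap f (𝟙 M)
  actionHomRight T _ _ g := Comod.tensorMap (𝟙 T.toComod) g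
  actionHom f g := Comod.tensorMap f g
  actionAssocIso T L M := Comod.assocIso T.toComod L.toComod M
  actionUnitIso M := Comod.lidIso M
  actionHom_def _ _ := Comod.hom_ext (TensorProduct.ext' fun _ _ => rfl)
  actionHomRight_id _ _ := Comod.hom_ext (TensorProduct.ext' fun _ _ => rfl)
  id_actionHomLeft _ _ := Comod.hom_ext (TensorProduct.ext' fun _ _ => rfl)
  actionHom_comp _ _ _ _ := Comod.hom_ext (TensorProduct.ext' fun _ _ => rfl)
  actionAssocIso_hom_naturality _ _ _ :=
    Comod.hom_ext (TensorProduct.ext_threefold fun _ _ _ => rfl)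
  actionUnitIso_hom_naturality f :=
    Comod.hom_ext (TensorProduct.ext' fun (r : k) m => map_smul (Comod.lin f) r m)
  whiskerLeft_actionHomLeft _ _ _ _ _ :=
    Comod.hom_ext (TensorProduct.ext_threefold fun _ _ _ => rfl)
  whiskerRight_actionHomLeft _ _ _ :=
    Comod.hom_ext (TensorProduct.ext_threefold fun _ _ _ => rfl)
  associator_actionHom _ _ _ _ :=
    Comod.hom_ext (TensorProduct.ext_fourfold fun _ _ _ _ => rfl)
  leftUnitor_actionHom _ _ :=
    Comod.hom_ext (TensorProduct.ext_threefold fun _ _ _ => rfl)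
  rightUnitor_actionHom _ _ :=
    Comod.hom_ext (TensorProduct.ext_threefold fun t (r : k) m =>
      TensorProduct.smul_tmul (R := k) (R' := k) r t m)

/-- The right action `M · L = M ⊗ L^{S²}`. -/
instance : MonoidalRightAction (FdComod k H) (Comod k H) where
  actionObj M L := M.tensor L.toComod.twist
  actionHomLeft g L := Comod.tensorMap g (𝟙 L.toComod.twist)
  actionHomRight M _ _ f := Comod.tensorMap (𝟙 M) (Comod.twistMap f)
  actionHom g f := Comod.tensorMap g (Comod.twistMap f)
  actionAssocIso M T L :=
    Comod.tensorIso (Iso.refl M) (Comod.twistTensorIso T.toComod L.toComod) ≪≫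
      (Comod.assocIso M T.toComod.twist L.toComod.twist).symm
  actionUnitIso M := Comod.tensorIso (Iso.refl M) (Comod.twistUnitIso k H) ≪≫ Comod.ridIso M
  actionHom_def _ _ := Comod.hom_ext (TensorProduct.ext' fun _ _ => rfl)
  actionHomRight_id _ _ := Comod.hom_ext (TensorProduct.ext' fun _ _ => rfl)
  id_actionHomLeft _ _ := Comod.hom_ext (TensorProduct.ext' fun _ _ => rfl)
  actionHom_comp _ _ _ _ := Comod.hom_ext (TensorProduct.ext' fun _ _ => rfl)
  actionAssocIso_hom_naturality _ _ _ :=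
    Comod.hom_ext (TensorProduct.ext_threefold' fun _ _ _ => rfl)
  actionUnitIso_hom_naturality f :=
    Comod.hom_ext (TensorProduct.ext' fun m (r : k) => map_smul (Comod.lin f) r m)
  actionHomRight_whiskerRight _ _ _ :=
    Comod.hom_ext (TensorProduct.ext_threefold' fun _ _ _ => rfl)
  whiskerRight_actionHomLeft _ _ _ _ _ :=
    Comod.hom_ext (TensorProduct.ext_threefold' fun _ _ _ => rfl)
  actionHom_associator _ _ _ _ := Comod.hom_ext
    (TensorProduct.ext (LinearMap.ext fun _ => TensorProduct.ext_threefold fun _ _ _ => rfl))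
  actionHom_leftUnitor T M := Comod.hom_ext (TensorProduct.ext_threefold' fun m (r : k) t =>
    (TensorProduct.smul_tmul (R := k) (R' := k) (M := M) (N := T.toComod) r m t).symm)
  actionHom_rightUnitor T M := Comod.hom_ext (TensorProduct.ext_threefold' fun m t (r : k) =>
    TensorProduct.tmul_smul (R := k) (M := M) (N := T.toComod) r m t)

/-- The bimodule category of all comodules over finite-dimensional ones, with
`T · M · L = T ⊗ M ⊗ L^{S²}`. -/
instance : BimoduleCategory (FdComod k H) (Comod k H) where
  mid T M L := Comod.assocIso T.toComod M L.toComod.twist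
  mid_naturality _ _ _ := Comod.hom_ext (TensorProduct.ext_threefold fun _ _ _ => rfl)
  pentagon_left _ _ _ _ := Comod.hom_ext (TensorProduct.ext_fourfold fun _ _ _ _ => rfl)
  pentagon_right _ _ _ _ := Comod.hom_ext (TensorProduct.ext_fourfold' fun _ _ _ _ => rfl)

end

noncomputable section

/-! ### Contramodules -/

variable (k H : Type u) [Field k] [Ring H] [HopfAlgebra k H]

/-- Right `H`-contramodules. -/
structure Contra where
  carrier : Type u
  [addCommGroup : AddCommGroup carrier]
  [module : Module k carrier]
  act : (H →ₗ[k] carrier) →ₗ[k] carrier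
  assoc (F : H →ₗ[k] H →ₗ[k] carrier) :
    act (act ∘ₗ F) = act (TensorProduct.lift F ∘ₗ Coalgebra.comul)
  unit (n : carrier) : act ((Coalgebra.counit (R := k) (A := H)).smulRight n) = n

attribute [instance] Contra.addCommGroup Contra.module

instance : CoeSort (Contra k H) (Type u) := ⟨Contra.carrier⟩

variable {k H}

/-- Morphisms of contramodules. -/
@[ext]
structure Contra.Hom (M N : Contra k H) where
  lin : M →ₗ[k] N
  comm (f : H →ₗ[k] M) : lin (M.act f) = N.act (lin ∘ₗ f)

instance : Category (Contra k H) where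
  Hom := Contra.Hom
  id M := ⟨LinearMap.id, fun f => rfl⟩
  comp f g := ⟨g.lin ∘ₗ f.lin, fun φ => by
    rw [LinearMap.comp_apply, f.comm, g.comm, LinearMap.comp_assoc]⟩

/-- The underlying linear map of a morphism of contramodules. -/
abbrev Contra.lin {M N : Contra k H} (f : M ⟶ N) : M →ₗ[k] N := Contra.Hom.lin f

theorem Contra.lin_comm {M N : Contra k H} (f : M ⟶ N) (φ : H →ₗ[k] M) :
    Contra.lin f (M.act φ) = N.act (Contra.lin f ∘ₗ φ) := Contra.Hom.comm f φ

theorem Contra.hom_ext {M N : Contra k H} {f g : M ⟶ N} (h : Contra.lin f = Contra.lin g) :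
    f = g := Contra.Hom.ext h

@[simp] theorem Contra.lin_id (M : Contra k H) : Contra.lin (𝟙 M) = LinearMap.id := rfl

@[simp] theorem Contra.lin_comp {M N P : Contra k H} (f : M ⟶ N) (g : N ⟶ P) :
    Contra.lin (f ≫ g) = Contra.lin g ∘ₗ Contra.lin f := rfl

/-- An isomorphism of contramodules from a linear equivalence that respects the contraactions. -/
def Contra.mkIso {M N : Contra k H} (e : M ≃ₗ[k] N)
    (h : ∀ φ, e (M.act φ) = N.act (e.toLinearMap ∘ₗ φ)) : M ≅ N where
  hom := ⟨e.toLinearMap, h⟩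
  inv := ⟨e.symm.toLinearMap, fun φ => by
    have h1 := h (e.symm.toLinearMap ∘ₗ φ)
    rw [← LinearMap.comp_assoc, LinearEquiv.comp_symm, LinearMap.id_comp] at h1
    exact e.symm_apply_eq.2 h1.symm⟩
  hom_inv_id := Contra.hom_ext (LinearMap.ext fun x => e.symm_apply_apply x)
  inv_hom_id := Contra.hom_ext (LinearMap.ext fun x => e.apply_symm_apply x)

section HomTensor

variable (H) (V W : Type u) [AddCommGroup V] [Module k V] [AddCommGroup W] [Module k W]

/-- The canonical map `V ⊗ Hom(H, W) → Hom(H, V ⊗ W)`. -/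
def canonL : V ⊗[k] (H →ₗ[k] W) →ₗ[k] H →ₗ[k] V ⊗[k] W :=
  TensorProduct.lift (LinearMap.mk₂ k (fun v f => TensorProduct.mk k V W v ∘ₗ f)
    (fun _ _ _ => by ext; simp [TensorProduct.add_tmul])
    (fun _ _ _ => by ext; simp [TensorProduct.smul_tmul'])
    (fun _ _ _ => by ext; simp [TensorProduct.tmul_add])
    (fun _ _ _ => by ext; simp))

/-- The canonical map `Hom(H, V) ⊗ W → Hom(H, V ⊗ W)`. -/
def canonR : (H →ₗ[k] V) ⊗[k] W →ₗ[k] H →ₗ[k] V ⊗[k] W :=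
  TensorProduct.lift (LinearMap.mk₂ k (fun f w => (TensorProduct.mk k V W).flip w ∘ₗ f)
    (fun _ _ _ => by ext; simp [TensorProduct.add_tmul])
    (fun _ _ _ => by ext; simp [TensorProduct.smul_tmul'])
    (fun _ _ _ => by ext; simp [TensorProduct.tmul_add])
    (fun _ _ _ => by ext; simp))

variable {H V W}

@[simp] theorem canonL_tmul (v : V) (f : H →ₗ[k] W) (h : H) :
    canonL H V W (v ⊗ₜ f) h = v ⊗ₜ f h := rfl

@[simp] theorem canonR_tmul (f : H →ₗ[k] V) (w : W) (h : H) :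
    canonR H V W (f ⊗ₜ w) h = f h ⊗ₜ w := rfl

variable (H V W)

/-- `V ⊗ Hom(H, W) ≃ Hom(H, V ⊗ W)` for finite-dimensional `V`. -/
def canonLEquiv [FiniteDimensional k V] : V ⊗[k] (H →ₗ[k] W) ≃ₗ[k] (H →ₗ[k] V ⊗[k] W) :=
  LinearEquiv.ofLinearMap (canonL H V W)
    (∑ i, TensorProduct.mk k V (H →ₗ[k] W) (Module.finBasis k V i) ∘ₗ
      LinearMap.llcomp k H (V ⊗[k] W) W ((TensorProduct.lid k W).toLinearMap ∘ₗ
        ((Module.finBasis k V).coord i).rTensor W))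
    (by
      ext F h
      simp only [LinearMap.comp_apply, LinearMap.sum_apply, map_sum, TensorProduct.mk_apply,
        canonL_tmul, LinearMap.llcomp_apply, LinearMap.id_apply, LinearEquiv.coe_coe]
      generalize F h = z
      induction z with
      | zero => simp
      | add a b ha hb =>
        simp only [map_add, TensorProduct.tmul_add, Finset.sum_add_distrib, ha, hb]
      | tmul v w =>
        simp only [LinearMap.rTensor_tmul, TensorProduct.lid_tmul, TensorProduct.tmul_smul,
          TensorProduct.smul_tmul', ← TensorProduct.sum_tmul, Module.Basis.coord_apply,
          Module.Basis.sum_repr])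
    (by
      apply TensorProduct.ext'
      intro v f
      simp only [LinearMap.comp_apply, LinearMap.sum_apply, TensorProduct.mk_apply,
        LinearMap.id_apply]
      have : ∀ i, LinearMap.llcomp k H (V ⊗[k] W) W ((TensorProduct.lid k W).toLinearMap ∘ₗ
          ((Module.finBasis k V).coord i).rTensor W) (canonL H V W (v ⊗ₜ f)) =
          (Module.finBasis k V).repr v i • f := by
        intro i; ext h; simp
      simp only [this, TensorProduct.tmul_smul, TensorProduct.smul_tmul', ← TensorProduct.sum_tmul,
        Module.Basis.sum_repr])

/-- `Hom(H, V) ⊗ W ≃ Hom(H, V ⊗ W)` for finite-dimensional `W`. -/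
def canonREquiv [FiniteDimensional k W] : (H →ₗ[k] V) ⊗[k] W ≃ₗ[k] (H →ₗ[k] V ⊗[k] W) :=
  LinearEquiv.ofLinearMap (canonR H V W)
    (∑ i, (TensorProduct.mk k (H →ₗ[k] V) W).flip (Module.finBasis k W i) ∘ₗ
      LinearMap.llcomp k H (V ⊗[k] W) V ((TensorProduct.rid k V).toLinearMap ∘ₗ
        ((Module.finBasis k W).coord i).lTensor V))
    (by
      ext F h
      simp only [LinearMap.comp_apply, LinearMap.sum_apply, map_sum, TensorProduct.mk_apply,
        canonR_tmul, LinearMap.llcomp_apply, LinearMap.id_apply, LinearEquiv.coe_coe,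
        LinearMap.flip_apply]
      generalize F h = z
      induction z with
      | zero => simp
      | add a b ha hb =>
        simp only [map_add, TensorProduct.add_tmul, Finset.sum_add_distrib, ha, hb]
      | tmul v w =>
        simp only [LinearMap.lTensor_tmul, TensorProduct.rid_tmul, TensorProduct.smul_tmul,
          ← TensorProduct.tmul_sum, Module.Basis.coord_apply,
          Module.Basis.sum_repr])
    (by
      apply TensorProduct.ext'
      intro f w
      simp only [LinearMap.comp_apply, LinearMap.sum_apply, TensorProduct.mk_apply,
        LinearMap.id_apply, LinearMap.flip_apply]
      have : ∀ i, LinearMap.llcomp k H (V ⊗[k] W) V ((TensorProduct.rid k V).toLinearMap ∘ₗ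
          ((Module.finBasis k W).coord i).lTensor V) (canonR H V W (f ⊗ₜ w)) =
          (Module.finBasis k W).repr w i • f := by
        intro i; ext h; simp
      simp only [this, TensorProduct.smul_tmul, ← TensorProduct.tmul_sum,
        Module.Basis.sum_repr])

variable {H V W}

theorem canonL_surjective [FiniteDimensional k V] : Function.Surjective (canonL (k := k) H V W) :=
  (canonLEquiv H V W).surjective

theorem canonR_surjective [FiniteDimensional k W] : Function.Surjective (canonR (k := k) H V W) :=
  (canonREquiv H V W).surjective

@[simp] theorem canonLEquiv_symm_canonL [FiniteDimensional k V] (z : V ⊗[k] (H →ₗ[k] W)) :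
    (canonLEquiv H V W).symm (canonL H V W z) = z := (canonLEquiv H V W).symm_apply_apply z

@[simp] theorem canonREquiv_symm_canonR [FiniteDimensional k W] (z : (H →ₗ[k] V) ⊗[k] W) :
    (canonREquiv H V W).symm (canonR H V W z) = z := (canonREquiv H V W).symm_apply_apply z

end HomTensor

section Shift

variable {V : Type u} [AddCommGroup V] [Module k V] (ρ : V →ₗ[k] V ⊗[k] H)
  (W : Type u) [AddCommGroup W] [Module k W]

/-- The map `t ⊗ f ↦ t₀ ⊗ f(t₁ -)` on `V ⊗ Hom(H, W)`, where `ρ t = t₀ ⊗ t₁`. -/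
def shiftL : V ⊗[k] (H →ₗ[k] W) →ₗ[k] V ⊗[k] (H →ₗ[k] W) :=
  TensorProduct.lift (LinearMap.mk₂ k
    (fun t f => (LinearMap.llcomp k H H W f ∘ₗ LinearMap.mul k H).lTensor V (ρ t))
    (fun _ _ _ => by simp)
    (fun _ _ _ => by simp)
    (fun _ _ _ => by simp [LinearMap.add_comp, LinearMap.lTensor_add])
    (fun _ _ _ => by simp [LinearMap.smul_comp, LinearMap.lTensor_smul]))

/-- The map `f ⊗ t ↦ f(- t₁) ⊗ t₀` on `Hom(H, W) ⊗ V`, where `ρ t = t₀ ⊗ t₁`. -/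
def shiftR : (H →ₗ[k] W) ⊗[k] V →ₗ[k] (H →ₗ[k] W) ⊗[k] V :=
  TensorProduct.lift (LinearMap.mk₂ k
    (fun f t => TensorProduct.comm k V (H →ₗ[k] W)
      ((LinearMap.llcomp k H H W f ∘ₗ (LinearMap.mul k H).flip).lTensor V (ρ t)))
    (fun _ _ _ => by simp [LinearMap.add_comp, LinearMap.lTensor_add])
    (fun _ _ _ => by simp [LinearMap.smul_comp, LinearMap.lTensor_smul])
    (fun _ _ _ => by simp)
    (fun _ _ _ => by simp))

variable {W} (α : (H →ₗ[k] W) →ₗ[k] W) [FiniteDimensional k V]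

/-- The map `t ⊗ f ↦ t₀ ⊗ α(f(t₁ -))` with `Hom(H, V ⊗ W)` identified with `V ⊗ Hom(H, W)`. -/
def contraActL : (H →ₗ[k] V ⊗[k] W) →ₗ[k] V ⊗[k] W :=
  α.lTensor V ∘ₗ shiftL ρ W ∘ₗ (canonLEquiv H V W).symm.toLinearMap

/-- The map `f ⊗ t ↦ α(f(- t₁)) ⊗ t₀` with `Hom(H, W ⊗ V)` identified with `Hom(H, W) ⊗ V`. -/
def contraActR : (H →ₗ[k] W ⊗[k] V) →ₗ[k] W ⊗[k] V :=
  α.rTensor V ∘ₗ shiftR ρ W ∘ₗ (canonREquiv H W V).symm.toLinearMap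

theorem contraActL_pure (v : V) (f : H →ₗ[k] W) : contraActL ρ α (canonL H V W (v ⊗ₜ f)) =
    (α ∘ₗ LinearMap.llcomp k H H W f ∘ₗ LinearMap.mul k H).lTensor V (ρ v) := by
  simp only [contraActL, shiftL, LinearMap.comp_apply, LinearEquiv.coe_coe,
    canonLEquiv_symm_canonL, TensorProduct.lift.tmul, LinearMap.mk₂_apply]
  rw [← LinearMap.comp_apply (LinearMap.lTensor _ _) (LinearMap.lTensor _ _),
    ← LinearMap.lTensor_comp]

theorem contraActR_pure (v : V) (f : H →ₗ[k] W) : contraActR ρ α (canonR H W V (f ⊗ₜ v)) =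
    TensorProduct.comm k V W
      ((α ∘ₗ LinearMap.llcomp k H H W f ∘ₗ (LinearMap.mul k H).flip).lTensor V (ρ v)) := by
  simp only [contraActR, shiftR, LinearMap.comp_apply, LinearEquiv.coe_coe,
    canonREquiv_symm_canonR, TensorProduct.lift.tmul, LinearMap.mk₂_apply]
  generalize ρ v = z
  induction z with
  | zero => simp
  | add x y hx hy => simp only [map_add, hx, hy]
  | tmul a b => simp

variable {ρ} {α}

theorem contraActL_tmul {ι : Type} [Fintype ι] {v : ι → V} {C : ι → ι → H}
    (hv : ∀ j, ρ (v j) = ∑ i, v i ⊗ₜ[k] C i j) (j : ι) (f : H →ₗ[k] W) :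
    contraActL ρ α (canonL H V W (v j ⊗ₜ f)) =
      ∑ i, v i ⊗ₜ[k] α (f ∘ₗ LinearMap.mulLeft k (C i j)) := by
  rw [contraActL_pure, hv, map_sum]
  rfl

theorem contraActR_tmul {ι : Type} [Fintype ι] {v : ι → V} {C : ι → ι → H}
    (hv : ∀ j, ρ (v j) = ∑ i, v i ⊗ₜ[k] C i j) (j : ι) (f : H →ₗ[k] W) :
    contraActR ρ α (canonR H W V (f ⊗ₜ v j)) =
      ∑ i, α (f ∘ₗ LinearMap.mulRight k (C i j)) ⊗ₜ[k] v i := by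
  rw [contraActR_pure, hv, map_sum, map_sum]
  rfl

end Shift

section

variable {T : Comod k H} {W : Type u} [AddCommGroup W] [Module k W]

theorem Comod.induction_left (P : T ⊗[k] W → Prop) (zero : P 0)
    (add : ∀ x y, P x → P y → P (x + y))
    (hv : ∀ (n : ℕ) (v : Fin n → T) (C : Fin n → Fin n → H), IsComatrix k C →
      (∀ j, T.coact (v j) = ∑ i, v i ⊗ₜ[k] C i j) → ∀ j w, P (v j ⊗ₜ w)) (z : T ⊗[k] W) :
    P z := by
  induction z with
  | zero => exact zero
  | add x y hx hy => exact add x y hx hy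
  | tmul t w =>
    obtain ⟨n, v, C, hC, hv', ht⟩ := exists_comatrix T.coact T.coassoc T.counit t
    induction ht using Submodule.span_induction generalizing w with
    | mem x hx => obtain ⟨j, rfl⟩ := hx; exact hv n v C hC hv' j w
    | zero => simpa using zero
    | add x y _ _ hx hy => rw [TensorProduct.add_tmul]; exact add _ _ (hx w) (hy w)
    | smul a x _ hx => rw [TensorProduct.smul_tmul]; exact hx _

theorem Comod.induction_right (P : W ⊗[k] T → Prop) (zero : P 0)
    (add : ∀ x y, P x → P y → P (x + y))
    (hv : ∀ (n : ℕ) (v : Fin n → T) (C : Fin n → Fin n → H), IsComatrix k C →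
      (∀ j, T.coact (v j) = ∑ i, v i ⊗ₜ[k] C i j) → ∀ j w, P (w ⊗ₜ v j)) (z : W ⊗[k] T) :
    P z := by
  have := Comod.induction_left (T := T) (W := W) (fun z => P (TensorProduct.comm k T W z))
    (by simpa using zero) (fun x y hx hy => by rw [map_add]; exact add _ _ hx hy)
    (fun n v C hC h j w => by simpa using hv n v C hC h j w) (TensorProduct.comm k W T z)
  simpa [← LinearEquiv.trans_apply] using this

end

variable (T L : FdComod k H) (N : Contra k H)

theorem lift_add_aux {A B X : Type u} [AddCommGroup A] [Module k A] [AddCommGroup B] [Module k B]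
    [AddCommGroup X] [Module k X] (f g : A →ₗ[k] B →ₗ[k] X) :
    TensorProduct.lift (f + g) = TensorProduct.lift f + TensorProduct.lift g := by
  ext; simp

theorem lift_zero_aux {A B X : Type u} [AddCommGroup A] [Module k A] [AddCommGroup B] [Module k B]
    [AddCommGroup X] [Module k X] :
    TensorProduct.lift (0 : A →ₗ[k] B →ₗ[k] X) = 0 := by
  ext; simp

/-- The contramodule `T ⊗ N`. -/
def Contra.tensorL : Contra k H where
  carrier := T.toComod ⊗[k] N
  act := contraActL T.toComod.coact N.act
  assoc F := by
    obtain ⟨z, rfl⟩ : ∃ z, F = (canonL H T.toComod N) ∘ₗ canonL H T.toComod (H →ₗ[k] N) z := by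
      obtain ⟨z, hz⟩ := canonL_surjective ((canonLEquiv H T.toComod N).symm.toLinearMap ∘ₗ F)
      refine ⟨z, ?_⟩
      rw [hz]
      ext1 x
      exact ((canonLEquiv H T.toComod N).apply_symm_apply _).symm
    induction z using Comod.induction_left with
    | zero => simp [lift_zero_aux]
    | add x y hx hy =>
      simp only [map_add, LinearMap.comp_add, lift_add_aux, LinearMap.add_comp, hx, hy]
    | hv n v C hC hv j g =>
      have e1 : contraActL T.toComod.coact N.act ∘ₗ canonL H T.toComod N ∘ₗ
          canonL H T.toComod (H →ₗ[k] N) (v j ⊗ₜ g) = ∑ i, canonL H T.toComod N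
            (v i ⊗ₜ (N.act ∘ₗ LinearMap.lcomp k N (LinearMap.mulLeft k (C i j)) ∘ₗ g)) := by
        ext1 x
        simp only [LinearMap.comp_apply, canonL_tmul, LinearMap.sum_apply]
        rw [contraActL_tmul hv]
        rfl
      have e2 : TensorProduct.lift (canonL H T.toComod N ∘ₗ
          canonL H T.toComod (H →ₗ[k] N) (v j ⊗ₜ g)) ∘ₗ Coalgebra.comul =
            canonL H T.toComod N (v j ⊗ₜ (TensorProduct.lift g ∘ₗ Coalgebra.comul)) := by
        ext1 x
        simp only [LinearMap.comp_apply, canonL_tmul]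
        generalize Coalgebra.comul (R := k) x = y
        induction y with
        | zero => simp
        | add a b ha hb => simp only [map_add, ha, hb, TensorProduct.tmul_add]
        | tmul a b => simp
      rw [e1, e2, contraActL_tmul hv, map_sum]
      simp only [contraActL_tmul hv]
      rw [Finset.sum_comm]
      refine Finset.sum_congr rfl fun l _ => ?_
      rw [← TensorProduct.tmul_sum, ← map_sum]
      congr 1
      have e3 : TensorProduct.lift g ∘ₗ Coalgebra.comul ∘ₗ LinearMap.mulLeft k (C l j) =
          ∑ i, TensorProduct.lift (LinearMap.lcomp k N (LinearMap.mulLeft k (C i j)) ∘ₗ g ∘ₗ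
            LinearMap.mulLeft k (C l i)) ∘ₗ Coalgebra.comul := by
        ext1 x
        simp only [LinearMap.comp_apply, LinearMap.mulLeft_apply, Bialgebra.comul_mul, hC.comul,
          LinearMap.sum_apply]
        generalize Coalgebra.comul (R := k) x = y
        induction y with
        | zero => simp
        | add a b ha hb => simp only [map_add, ha, hb, mul_add, Finset.sum_add_distrib]
        | tmul a b => simp [Finset.sum_mul]
      rw [LinearMap.comp_assoc, e3, map_sum, map_sum]
      refine Finset.sum_congr rfl fun i _ => ?_
      rw [← N.assoc]
      rfl
  unit z := by
    induction z using Comod.induction_left with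
    | zero =>
      rw [show LinearMap.smulRight (Coalgebra.counit (R := k) (A := H))
        (0 : T.toComod ⊗[k] N) = 0 by ext; simp, map_zero]
    | add x y hx hy =>
      rw [show LinearMap.smulRight (Coalgebra.counit (R := k) (A := H)) (x + y) =
        LinearMap.smulRight (Coalgebra.counit (R := k) (A := H)) x +
        LinearMap.smulRight (Coalgebra.counit (R := k) (A := H)) y by ext; simp, map_add, hx, hy]
    | hv n v C hC hv j m =>
      have e1 : LinearMap.smulRight (Coalgebra.counit (R := k) (A := H)) (v j ⊗ₜ[k] m) =
          canonL H T.toComod N (v j ⊗ₜ LinearMap.smulRight (Coalgebra.counit (R := k) (A := H)) m) := by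
        ext; simp
      have e2 : ∀ i, LinearMap.smulRight (Coalgebra.counit (R := k) (A := H)) m ∘ₗ
          LinearMap.mulLeft k (C i j) = (if i = j then (1 : k) else 0) •
            LinearMap.smulRight (Coalgebra.counit (R := k) (A := H)) m := by
        intro i; ext x
        by_cases h : i = j <;> simp [hC.counit, mul_smul, h]
      rw [e1, contraActL_tmul hv]
      simp only [e2, map_smul, N.unit]
      simp [ite_smul, TensorProduct.tmul_ite]

/-- The contramodule `N ⊗ T`. -/
def Contra.tensorR : Contra k H where
  carrier := N ⊗[k] T.toComod
  act := contraActR T.toComod.coact N.act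
  assoc F := by
    obtain ⟨z, rfl⟩ : ∃ z, F = (canonR H N T.toComod) ∘ₗ canonR H (H →ₗ[k] N) T.toComod z := by
      obtain ⟨z, hz⟩ := canonR_surjective ((canonREquiv H N T.toComod).symm.toLinearMap ∘ₗ F)
      refine ⟨z, ?_⟩
      rw [hz]
      ext1 x
      exact ((canonREquiv H N T.toComod).apply_symm_apply _).symm
    induction z using Comod.induction_right with
    | zero => simp [lift_zero_aux]
    | add x y hx hy =>
      simp only [map_add, LinearMap.comp_add, lift_add_aux, LinearMap.add_comp, hx, hy]
    | hv n v C hC hv j g =>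
      have e1 : contraActR T.toComod.coact N.act ∘ₗ canonR H N T.toComod ∘ₗ
          canonR H (H →ₗ[k] N) T.toComod (g ⊗ₜ v j) = ∑ i, canonR H N T.toComod
            ((N.act ∘ₗ LinearMap.lcomp k N (LinearMap.mulRight k (C i j)) ∘ₗ g) ⊗ₜ v i) := by
        ext1 x
        simp only [LinearMap.comp_apply, canonR_tmul, LinearMap.sum_apply]
        rw [contraActR_tmul hv]
        rfl
      have e2 : TensorProduct.lift (canonR H N T.toComod ∘ₗ
          canonR H (H →ₗ[k] N) T.toComod (g ⊗ₜ v j)) ∘ₗ Coalgebra.comul =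
            canonR H N T.toComod ((TensorProduct.lift g ∘ₗ Coalgebra.comul) ⊗ₜ v j) := by
        ext1 x
        simp only [LinearMap.comp_apply, canonR_tmul]
        generalize Coalgebra.comul (R := k) x = y
        induction y with
        | zero => simp
        | add a b ha hb => simp only [map_add, ha, hb, TensorProduct.add_tmul]
        | tmul a b => simp
      rw [e1, e2, contraActR_tmul hv, map_sum]
      simp only [contraActR_tmul hv]
      rw [Finset.sum_comm]
      refine Finset.sum_congr rfl fun l _ => ?_
      rw [← TensorProduct.sum_tmul, ← map_sum]
      congr 1
      have e3 : TensorProduct.lift g ∘ₗ Coalgebra.comul ∘ₗ LinearMap.mulRight k (C l j) =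
          ∑ i, TensorProduct.lift (LinearMap.lcomp k N (LinearMap.mulRight k (C i j)) ∘ₗ g ∘ₗ
            LinearMap.mulRight k (C l i)) ∘ₗ Coalgebra.comul := by
        ext1 x
        simp only [LinearMap.comp_apply, LinearMap.mulRight_apply, Bialgebra.comul_mul, hC.comul,
          LinearMap.sum_apply]
        generalize Coalgebra.comul (R := k) x = y
        induction y with
        | zero => simp
        | add a b ha hb => simp only [map_add, ha, hb, add_mul, Finset.sum_add_distrib]
        | tmul a b => simp [Finset.mul_sum]
      rw [LinearMap.comp_assoc, e3, map_sum, map_sum]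
      refine Finset.sum_congr rfl fun i _ => ?_
      rw [← N.assoc]
      rfl
  unit z := by
    induction z using Comod.induction_right with
    | zero =>
      rw [show LinearMap.smulRight (Coalgebra.counit (R := k) (A := H))
        (0 : N ⊗[k] T.toComod) = 0 by ext; simp, map_zero]
    | add x y hx hy =>
      rw [show LinearMap.smulRight (Coalgebra.counit (R := k) (A := H)) (x + y) =
        LinearMap.smulRight (Coalgebra.counit (R := k) (A := H)) x +
        LinearMap.smulRight (Coalgebra.counit (R := k) (A := H)) y by ext; simp, map_add, hx, hy]
    | hv n v C hC hv j m =>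
      have e1 : LinearMap.smulRight (Coalgebra.counit (R := k) (A := H)) (m ⊗ₜ[k] v j) =
          canonR H N T.toComod (LinearMap.smulRight (Coalgebra.counit (R := k) (A := H)) m ⊗ₜ v j) := by
        ext; simp [TensorProduct.smul_tmul']
      have e2 : ∀ i, LinearMap.smulRight (Coalgebra.counit (R := k) (A := H)) m ∘ₗ
          LinearMap.mulRight k (C i j) = (if i = j then (1 : k) else 0) •
            LinearMap.smulRight (Coalgebra.counit (R := k) (A := H)) m := by
        intro i; ext x
        by_cases h : i = j <;> simp [hC.counit, mul_smul, h]
      rw [e1, contraActR_tmul hv]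
      simp only [e2, map_smul, N.unit]
      simp [ite_smul, TensorProduct.ite_tmul]

end

noncomputable section

variable {k H : Type u} [Field k] [Ring H] [HopfAlgebra k H]

/-! ### The bimodule category of contramodules, with left action twisted by `S²` -/

section Raw

variable {V V' U U' W W' : Type u} [AddCommGroup V] [Module k V] [AddCommGroup V'] [Module k V']
  [AddCommGroup U] [Module k U] [AddCommGroup W] [Module k W] [AddCommGroup W'] [Module k W']
  [FiniteDimensional k V] [FiniteDimensional k V'] [FiniteDimensional k U]
  {ρ : V →ₗ[k] V ⊗[k] H} {ρ' : V' →ₗ[k] V' ⊗[k] H} {τ : U →ₗ[k] U ⊗[k] H}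
  {α : (H →ₗ[k] W) →ₗ[k] W} {α' : (H →ₗ[k] W') →ₗ[k] W'}

theorem canonL_ext {X : Type*} [AddCommGroup X] [Module k X] {f g : (H →ₗ[k] V ⊗[k] W) →ₗ[k] X}
    (h : ∀ v φ, f (canonL H V W (v ⊗ₜ φ)) = g (canonL H V W (v ⊗ₜ φ))) (F) : f F = g F := by
  obtain ⟨z, rfl⟩ := canonL_surjective F
  induction z with
  | zero => simp
  | add x y hx hy => simp only [map_add, hx, hy]
  | tmul v φ => exact h v φ

theorem canonR_ext {X : Type*} [AddCommGroup X] [Module k X] {f g : (H →ₗ[k] W ⊗[k] V) →ₗ[k] X}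
    (h : ∀ φ v, f (canonR H W V (φ ⊗ₜ v)) = g (canonR H W V (φ ⊗ₜ v))) (F) : f F = g F := by
  obtain ⟨z, rfl⟩ := canonR_surjective F
  induction z with
  | zero => simp
  | add x y hx hy => simp only [map_add, hx, hy]
  | tmul v φ => exact h v φ

theorem contraActL_map (f : V →ₗ[k] V') (g : W →ₗ[k] W') (hf : ρ' ∘ₗ f = f.rTensor H ∘ₗ ρ)
    (hg : ∀ φ, g (α φ) = α' (g ∘ₗ φ)) (F : H →ₗ[k] V ⊗[k] W) :
    TensorProduct.map f g (contraActL ρ α F) = contraActL ρ' α' (TensorProduct.map f g ∘ₗ F) := by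
  refine canonL_ext (f := TensorProduct.map f g ∘ₗ contraActL ρ α)
    (g := contraActL ρ' α' ∘ₗ LinearMap.llcomp k H _ _ (TensorProduct.map f g)) (fun v φ => ?_) F
  have e : TensorProduct.map f g ∘ₗ canonL H V W (v ⊗ₜ φ) = canonL H V' W' (f v ⊗ₜ (g ∘ₗ φ)) := by
    ext x; simp
  have h1 := LinearMap.congr_fun hf v
  simp only [LinearMap.comp_apply] at h1
  rw [LinearMap.comp_apply, LinearMap.comp_apply, LinearMap.llcomp_apply', e, contraActL_pure,
    contraActL_pure, h1]
  generalize ρ v = z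
  induction z with
  | zero => simp
  | add x y hx hy => simp only [map_add, hx, hy]
  | tmul a b =>
    simp only [LinearMap.lTensor_tmul, LinearMap.rTensor_tmul, TensorProduct.map_tmul,
      LinearMap.comp_apply, hg]
    rfl

theorem canonL_comp (v : V) (φ : H →ₗ[k] W) (g : H →ₗ[k] H) :
    canonL H V W (v ⊗ₜ φ) ∘ₗ g = canonL H V W (v ⊗ₜ (φ ∘ₗ g)) := rfl

theorem canonR_comp (v : V) (φ : H →ₗ[k] W) (g : H →ₗ[k] H) :
    canonR H W V (φ ⊗ₜ v) ∘ₗ g = canonR H W V ((φ ∘ₗ g) ⊗ₜ v) := rfl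

theorem contraActR_map (f : V →ₗ[k] V') (g : W →ₗ[k] W') (hf : ρ' ∘ₗ f = f.rTensor H ∘ₗ ρ)
    (hg : ∀ φ, g (α φ) = α' (g ∘ₗ φ)) (F : H →ₗ[k] W ⊗[k] V) :
    TensorProduct.map g f (contraActR ρ α F) = contraActR ρ' α' (TensorProduct.map g f ∘ₗ F) := by
  refine canonR_ext (f := TensorProduct.map g f ∘ₗ contraActR ρ α)
    (g := contraActR ρ' α' ∘ₗ LinearMap.llcomp k H _ _ (TensorProduct.map g f)) (fun φ v => ?_) F
  have e : TensorProduct.map g f ∘ₗ canonR H W V (φ ⊗ₜ v) = canonR H W' V' ((g ∘ₗ φ) ⊗ₜ f v) := by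
    ext x; simp
  have h1 := LinearMap.congr_fun hf v
  simp only [LinearMap.comp_apply] at h1
  rw [LinearMap.comp_apply, LinearMap.comp_apply, LinearMap.llcomp_apply', e, contraActR_pure,
    contraActR_pure, h1]
  generalize ρ v = z
  induction z with
  | zero => simp
  | add x y hx hy => simp only [map_add, hx, hy]
  | tmul a b =>
    simp only [LinearMap.lTensor_tmul, LinearMap.rTensor_tmul, TensorProduct.map_tmul,
      LinearMap.comp_apply, hg, TensorProduct.comm_tmul]
    rfl

theorem contraActL_assoc (σ : V ⊗[k] V' →ₗ[k] (V ⊗[k] V') ⊗[k] H)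
    (hσ : ∀ v w, σ (v ⊗ₜ w) = (LinearMap.mul' k H).lTensor (V ⊗[k] V')
      (TensorProduct.tensorTensorTensorComm k V H V' H (ρ v ⊗ₜ ρ' w)))
    (F : H →ₗ[k] (V ⊗[k] V') ⊗[k] W) :
    TensorProduct.assoc k V V' W (contraActL σ α F) =
      contraActL ρ (contraActL ρ' α) ((TensorProduct.assoc k V V' W).toLinearMap ∘ₗ F) := by
  refine canonL_ext (f := (TensorProduct.assoc k V V' W).toLinearMap ∘ₗ contraActL σ α)
    (g := contraActL ρ (contraActL ρ' α) ∘ₗ LinearMap.llcomp k H _ _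
      (TensorProduct.assoc k V V' W).toLinearMap) (fun y φ => ?_) F
  rw [LinearMap.comp_apply, LinearMap.comp_apply, LinearMap.llcomp_apply']
  induction y with
  | zero => simp
  | add x y hx hy =>
    simp only [TensorProduct.add_tmul, map_add, LinearMap.comp_add, hx, hy]
  | tmul v w =>
    have e : (TensorProduct.assoc k V V' W).toLinearMap ∘ₗ canonL H _ W ((v ⊗ₜ w) ⊗ₜ φ) =
        canonL H V (V' ⊗[k] W) (v ⊗ₜ canonL H V' W (w ⊗ₜ φ)) := by
      ext x; rfl
    rw [e, contraActL_pure, contraActL_pure, hσ]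
    generalize ρ v = z
    induction z with
    | zero => simp
    | add x y hx hy => simp only [map_add, TensorProduct.add_tmul, hx, hy]
    | tmul a b =>
      have e2 : contraActL ρ' α (canonL H V' W (w ⊗ₜ φ) ∘ₗ LinearMap.mulLeft k b) =
          (α ∘ₗ LinearMap.llcomp k H H W (φ ∘ₗ LinearMap.mulLeft k b) ∘ₗ
            LinearMap.mul k H).lTensor V' (ρ' w) := by
        rw [canonL_comp, contraActL_pure]
      change _ = a ⊗ₜ[k] contraActL ρ' α (canonL H V' W (w ⊗ₜ φ) ∘ₗ LinearMap.mulLeft k b)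
      rw [e2]
      generalize ρ' w = z
      induction z with
      | zero => simp
      | add x y hx hy => simp only [map_add, TensorProduct.tmul_add, hx, hy]
      | tmul c d =>
        change a ⊗ₜ[k] (c ⊗ₜ[k] α (φ ∘ₗ LinearMap.mulLeft k (b * d))) =
          a ⊗ₜ[k] (c ⊗ₜ[k] α ((φ ∘ₗ LinearMap.mulLeft k b) ∘ₗ LinearMap.mulLeft k d))
        rw [LinearMap.mulLeft_mul, LinearMap.comp_assoc]

theorem contraActR_assoc (σ : V ⊗[k] V' →ₗ[k] (V ⊗[k] V') ⊗[k] H)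
    (hσ : ∀ v w, σ (v ⊗ₜ w) = (LinearMap.mul' k H).lTensor (V ⊗[k] V')
      (TensorProduct.tensorTensorTensorComm k V H V' H (ρ v ⊗ₜ ρ' w)))
    (F : H →ₗ[k] W ⊗[k] (V ⊗[k] V')) :
    (TensorProduct.assoc k W V V').symm (contraActR σ α F) =
      contraActR ρ' (contraActR ρ α) ((TensorProduct.assoc k W V V').symm.toLinearMap ∘ₗ F) := by
  refine canonR_ext (f := (TensorProduct.assoc k W V V').symm.toLinearMap ∘ₗ contraActR σ α)
    (g := contraActR ρ' (contraActR ρ α) ∘ₗ LinearMap.llcomp k H _ _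
      (TensorProduct.assoc k W V V').symm.toLinearMap) (fun φ y => ?_) F
  rw [LinearMap.comp_apply, LinearMap.comp_apply, LinearMap.llcomp_apply']
  induction y with
  | zero => simp
  | add x y hx hy =>
    simp only [TensorProduct.tmul_add, map_add, LinearMap.comp_add, hx, hy]
  | tmul v w =>
    have e : (TensorProduct.assoc k W V V').symm.toLinearMap ∘ₗ canonR H W _ (φ ⊗ₜ (v ⊗ₜ w)) =
        canonR H (W ⊗[k] V) V' (canonR H W V (φ ⊗ₜ v) ⊗ₜ w) := by
      ext x; rfl
    rw [e, contraActR_pure, contraActR_pure, hσ]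
    generalize ρ' w = z
    induction z with
    | zero => simp
    | add x y hx hy => simp only [map_add, TensorProduct.tmul_add, hx, hy]
    | tmul c d =>
      have e2 : contraActR ρ α (canonR H W V (φ ⊗ₜ v) ∘ₗ LinearMap.mulRight k d) =
          TensorProduct.comm k V W ((α ∘ₗ LinearMap.llcomp k H H W (φ ∘ₗ LinearMap.mulRight k d) ∘ₗ
            (LinearMap.mul k H).flip).lTensor V (ρ v)) := by
        rw [canonR_comp, contraActR_pure]
      change _ = contraActR ρ α (canonR H W V (φ ⊗ₜ v) ∘ₗ LinearMap.mulRight k d) ⊗ₜ[k] c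
      rw [e2]
      generalize ρ v = z
      induction z with
      | zero => simp
      | add x y hx hy => simp only [map_add, TensorProduct.add_tmul, hx, hy]
      | tmul a b =>
        change (α (φ ∘ₗ LinearMap.mulRight k (b * d)) ⊗ₜ[k] a) ⊗ₜ[k] c =
          (α ((φ ∘ₗ LinearMap.mulRight k d) ∘ₗ LinearMap.mulRight k b) ⊗ₜ[k] a) ⊗ₜ[k] c
        rw [LinearMap.mulRight_mul, LinearMap.comp_assoc]

theorem contraAct_mid (F : H →ₗ[k] (V ⊗[k] W) ⊗[k] U) :
    TensorProduct.assoc k V W U (contraActR τ (contraActL ρ α) F) =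
      contraActL ρ (contraActR τ α) ((TensorProduct.assoc k V W U).toLinearMap ∘ₗ F) := by
  refine canonR_ext (f := (TensorProduct.assoc k V W U).toLinearMap ∘ₗ
    contraActR τ (contraActL ρ α)) (g := contraActL ρ (contraActR τ α) ∘ₗ
      LinearMap.llcomp k H _ _ (TensorProduct.assoc k V W U).toLinearMap) (fun G u => ?_) F
  refine canonL_ext (f := (TensorProduct.assoc k V W U).toLinearMap ∘ₗ
    contraActR τ (contraActL ρ α) ∘ₗ canonR H (V ⊗[k] W) U ∘ₗ
      (TensorProduct.mk k (H →ₗ[k] V ⊗[k] W) U).flip u)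
    (g := contraActL ρ (contraActR τ α) ∘ₗ
      LinearMap.llcomp k H _ _ (TensorProduct.assoc k V W U).toLinearMap ∘ₗ
      canonR H (V ⊗[k] W) U ∘ₗ (TensorProduct.mk k (H →ₗ[k] V ⊗[k] W) U).flip u)
      (fun v φ => ?_) G
  have e : (TensorProduct.assoc k V W U).toLinearMap ∘ₗ
      canonR H (V ⊗[k] W) U (canonL H V W (v ⊗ₜ φ) ⊗ₜ u) =
        canonL H V (W ⊗[k] U) (v ⊗ₜ canonR H W U (φ ⊗ₜ u)) := by
    ext x; rfl
  simp only [LinearMap.comp_apply, LinearMap.llcomp_apply', LinearMap.flip_apply,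
    TensorProduct.mk_apply, LinearEquiv.coe_coe]
  rw [e, contraActL_pure, contraActR_pure]
  obtain ⟨S, hS⟩ := TensorProduct.exists_finset (ρ v)
  obtain ⟨R, hR⟩ := TensorProduct.exists_finset (τ u)
  have e1 : ∀ d, contraActL ρ α (canonL H V W (v ⊗ₜ φ) ∘ₗ LinearMap.mulRight k d) =
      ∑ p ∈ S, p.1 ⊗ₜ[k] α ((φ ∘ₗ LinearMap.mulRight k d) ∘ₗ LinearMap.mulLeft k p.2) := by
    intro d
    rw [canonL_comp, contraActL_pure, hS, map_sum]
    rfl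
  have e2 : ∀ d, contraActR τ α (canonR H W U (φ ⊗ₜ u) ∘ₗ LinearMap.mulLeft k d) =
      ∑ p ∈ R, α ((φ ∘ₗ LinearMap.mulLeft k d) ∘ₗ LinearMap.mulRight k p.2) ⊗ₜ[k] p.1 := by
    intro d
    rw [canonR_comp, contraActR_pure, hR, map_sum, map_sum]
    rfl
  have e3 : ∀ p q : H, (φ ∘ₗ LinearMap.mulRight k p) ∘ₗ LinearMap.mulLeft k q =
      (φ ∘ₗ LinearMap.mulLeft k q) ∘ₗ LinearMap.mulRight k p := fun p q => by
    ext x; simp [mul_assoc]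
  rw [hS, hR, map_sum, map_sum, map_sum, map_sum]
  trans ∑ p ∈ R, ∑ q ∈ S, q.1 ⊗ₜ[k]
    (α ((φ ∘ₗ LinearMap.mulRight k p.2) ∘ₗ LinearMap.mulLeft k q.2) ⊗ₜ[k] p.1)
  · refine Finset.sum_congr rfl fun p _ => ?_
    change TensorProduct.assoc k V W U (contraActL ρ α (canonL H V W (v ⊗ₜ φ) ∘ₗ
      LinearMap.mulRight k p.2) ⊗ₜ[k] p.1) = _
    rw [e1, TensorProduct.sum_tmul, map_sum]
    rfl
  · rw [Finset.sum_comm]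
    refine Finset.sum_congr rfl fun q _ => ?_
    change _ = q.1 ⊗ₜ[k] contraActR τ α (canonR H W U (φ ⊗ₜ u) ∘ₗ LinearMap.mulLeft k q.2)
    rw [e2, TensorProduct.tmul_sum]
    simp only [e3]

theorem contraActL_lid (σ : k →ₗ[k] k ⊗[k] H) (hσ : σ 1 = 1 ⊗ₜ 1) (F : H →ₗ[k] k ⊗[k] W) :
    TensorProduct.lid k W (contraActL σ α F) = α ((TensorProduct.lid k W).toLinearMap ∘ₗ F) := by
  obtain ⟨z, rfl⟩ := canonL_surjective F
  obtain ⟨φ, rfl⟩ : ∃ φ, z = (1 : k) ⊗ₜ[k] φ := ⟨TensorProduct.lid k _ z,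
    ((TensorProduct.lid k (H →ₗ[k] W)).symm_apply_apply z).symm⟩
  rw [contraActL_pure, hσ]
  have e2 : (TensorProduct.lid k W).toLinearMap ∘ₗ canonL H k W ((1 : k) ⊗ₜ[k] φ) = φ := by
    ext x; simp
  rw [e2]
  simp only [LinearMap.lTensor_tmul, TensorProduct.lid_tmul, one_smul, LinearMap.comp_apply,
    LinearMap.llcomp_apply']
  congr 1
  ext x; simp

theorem contraActR_rid (σ : k →ₗ[k] k ⊗[k] H) (hσ : σ 1 = 1 ⊗ₜ 1) (F : H →ₗ[k] W ⊗[k] k) :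
    TensorProduct.rid k W (contraActR σ α F) = α ((TensorProduct.rid k W).toLinearMap ∘ₗ F) := by
  obtain ⟨z, rfl⟩ := canonR_surjective F
  obtain ⟨φ, rfl⟩ : ∃ φ, z = φ ⊗ₜ[k] (1 : k) := ⟨TensorProduct.rid k _ z,
    ((TensorProduct.rid k (H →ₗ[k] W)).symm_apply_apply z).symm⟩
  rw [contraActR_pure, hσ]
  have e2 : (TensorProduct.rid k W).toLinearMap ∘ₗ canonR H W k (φ ⊗ₜ[k] (1 : k)) = φ := by
    ext x; simp
  rw [e2]
  simp only [LinearMap.lTensor_tmul, TensorProduct.comm_tmul, TensorProduct.rid_tmul, one_smul,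
    LinearMap.comp_apply, LinearMap.llcomp_apply']
  congr 1
  ext x; simp

end Raw

section

variable {T T' L : FdComod k H} {N N' : Contra k H}

/-- The tensor product of a comodule morphism and a contramodule morphism. -/
def Contra.tensorLMap (f : T ⟶ T') (g : N ⟶ N') : Contra.tensorL T N ⟶ Contra.tensorL T' N' :=
  ⟨TensorProduct.map (FdComod.lin f) (Contra.lin g),
    contraActL_map _ _ (Comod.lin_comm (M := T.toComod) (N := T'.toComod) f) (Contra.lin_comm g)⟩

/-- The tensor product of a contramodule morphism and a comodule morphism. -/
def Contra.tensorRMap (g : N ⟶ N') (f : T ⟶ T') : Contra.tensorR T N ⟶ Contra.tensorR T' N' :=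
  ⟨TensorProduct.map (Contra.lin g) (FdComod.lin f),
    contraActR_map _ _ (Comod.lin_comm (M := T.toComod) (N := T'.toComod) f) (Contra.lin_comm g)⟩

/-- Isomorphic factors give isomorphic contramodules. -/
def Contra.tensorLIso (e : T ≅ T') (f : N ≅ N') : Contra.tensorL T N ≅ Contra.tensorL T' N' where
  hom := Contra.tensorLMap e.hom f.hom
  inv := Contra.tensorLMap e.inv f.inv
  hom_inv_id := Contra.hom_ext (by
    have h1 := congrArg FdComod.lin e.hom_inv_id
    have h2 := congrArg Contra.lin f.hom_inv_id
    change FdComod.lin e.inv ∘ₗ FdComod.lin e.hom = LinearMap.id at h1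
    change Contra.lin f.inv ∘ₗ Contra.lin f.hom = LinearMap.id at h2
    change TensorProduct.map (FdComod.lin e.inv) (Contra.lin f.inv) ∘ₗ
      TensorProduct.map (FdComod.lin e.hom) (Contra.lin f.hom) = LinearMap.id
    rw [← TensorProduct.map_comp, h1, h2, TensorProduct.map_id])
  inv_hom_id := Contra.hom_ext (by
    have h1 := congrArg FdComod.lin e.inv_hom_id
    have h2 := congrArg Contra.lin f.inv_hom_id
    change FdComod.lin e.hom ∘ₗ FdComod.lin e.inv = LinearMap.id at h1
    change Contra.lin f.hom ∘ₗ Contra.lin f.inv = LinearMap.id at h2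
    change TensorProduct.map (FdComod.lin e.hom) (Contra.lin f.hom) ∘ₗ
      TensorProduct.map (FdComod.lin e.inv) (Contra.lin f.inv) = LinearMap.id
    rw [← TensorProduct.map_comp, h1, h2, TensorProduct.map_id])

end

variable (T L : FdComod k H) (N : Contra k H)

/-- `(T ⊗ L) ⊗ N ≅ T ⊗ (L ⊗ N)`. -/
def Contra.assocLIso : Contra.tensorL (T.tensor L) N ≅ Contra.tensorL T (Contra.tensorL L N) :=
  Contra.mkIso (TensorProduct.assoc k T.toComod L.toComod N)
    (contraActL_assoc (tensorCoact T.toComod L.toComod) fun _ _ => rfl)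

/-- `N ⊗ (T ⊗ L) ≅ (N ⊗ T) ⊗ L`. -/
def Contra.assocRIso : Contra.tensorR (T.tensor L) N ≅ Contra.tensorR L (Contra.tensorR T N) :=
  Contra.mkIso (TensorProduct.assoc k N T.toComod L.toComod).symm
    (contraActR_assoc (tensorCoact T.toComod L.toComod) fun _ _ => rfl)

/-- `(T ⊗ N) ⊗ L ≅ T ⊗ (N ⊗ L)`. -/
def Contra.midIso : Contra.tensorR L (Contra.tensorL T N) ≅ Contra.tensorL T (Contra.tensorR L N) :=
  Contra.mkIso (TensorProduct.assoc k T.toComod N L.toComod) contraAct_mid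

/-- `k ⊗ N ≅ N`. -/
def Contra.lidIso : Contra.tensorL (𝟙_ (FdComod k H)) N ≅ N :=
  Contra.mkIso (TensorProduct.lid k N) (contraActL_lid (Comod.unit k H).coact rfl)

/-- `N ⊗ k ≅ N`. -/
def Contra.ridIso : Contra.tensorR (𝟙_ (FdComod k H)) N ≅ N :=
  Contra.mkIso (TensorProduct.rid k N) (contraActR_rid (Comod.unit k H).coact rfl)

/-- A morphism of comodules is also a morphism of the twisted comodules. -/
def FdComod.twistMap {T L : FdComod k H} (f : T ⟶ L) : T.twist ⟶ L.twist := Comod.twistMap f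

/-- The left action `T · N = T^{S²} ⊗ N`. -/
instance : MonoidalLeftAction (FdComod k H) (Contra k H) where
  actionObj T N := Contra.tensorL T.twist N
  actionHomLeft f N := Contra.tensorLMap (FdComod.twistMap f) (𝟙 N)
  actionHomRight T _ _ g := Contra.tensorLMap (𝟙 T.twist) g
  actionHom f g := Contra.tensorLMap (FdComod.twistMap f) g
  actionAssocIso T L N :=
    Contra.tensorLIso (T' := T.twist.tensor L.twist)
      (FdComod.mkIso (Comod.twistTensorIso T.toComod L.toComod)) (Iso.refl N) ≪≫
      Contra.assocLIso T.twist L.twist N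
  actionUnitIso N :=
    Contra.tensorLIso (T' := 𝟙_ (FdComod k H)) (FdComod.mkIso (Comod.twistUnitIso k H))
      (Iso.refl N) ≪≫ Contra.lidIso N
  actionHom_def _ _ := Contra.hom_ext (TensorProduct.ext' fun _ _ => rfl)
  actionHomRight_id _ _ := Contra.hom_ext (TensorProduct.ext' fun _ _ => rfl)
  id_actionHomLeft _ _ := Contra.hom_ext (TensorProduct.ext' fun _ _ => rfl)
  actionHom_comp _ _ _ _ := Contra.hom_ext (TensorProduct.ext' fun _ _ => rfl)
  actionAssocIso_hom_naturality _ _ _ :=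
    Contra.hom_ext (TensorProduct.ext_threefold fun _ _ _ => rfl)
  actionUnitIso_hom_naturality f :=
    Contra.hom_ext (TensorProduct.ext' fun (r : k) m => map_smul (Contra.lin f) r m)
  whiskerLeft_actionHomLeft _ _ _ _ _ :=
    Contra.hom_ext (TensorProduct.ext_threefold fun _ _ _ => rfl)
  whiskerRight_actionHomLeft _ _ _ :=
    Contra.hom_ext (TensorProduct.ext_threefold fun _ _ _ => rfl)
  associator_actionHom _ _ _ _ :=
    Contra.hom_ext (TensorProduct.ext_fourfold fun _ _ _ _ => rfl)
  leftUnitor_actionHom _ _ :=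
    Contra.hom_ext (TensorProduct.ext_threefold fun _ _ _ => rfl)
  rightUnitor_actionHom _ _ :=
    Contra.hom_ext (TensorProduct.ext_threefold fun t (r : k) m =>
      TensorProduct.smul_tmul (R := k) (R' := k) r t m)

/-- The right action `N · L = N ⊗ L`. -/
instance : MonoidalRightAction (FdComod k H) (Contra k H) where
  actionObj N L := Contra.tensorR L N
  actionHomLeft g L := Contra.tensorRMap g (𝟙 L)
  actionHomRight N _ _ f := Contra.tensorRMap (𝟙 N) f
  actionHom g f := Contra.tensorRMap g f
  actionAssocIso N T L := Contra.assocRIso T L N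
  actionUnitIso N := Contra.ridIso N
  actionHom_def _ _ := Contra.hom_ext (TensorProduct.ext' fun _ _ => rfl)
  actionHomRight_id _ _ := Contra.hom_ext (TensorProduct.ext' fun _ _ => rfl)
  id_actionHomLeft _ _ := Contra.hom_ext (TensorProduct.ext' fun _ _ => rfl)
  actionHom_comp _ _ _ _ := Contra.hom_ext (TensorProduct.ext' fun _ _ => rfl)
  actionAssocIso_hom_naturality _ _ _ :=
    Contra.hom_ext (TensorProduct.ext_threefold' fun _ _ _ => rfl)
  actionUnitIso_hom_naturality f :=
    Contra.hom_ext (TensorProduct.ext' fun m (r : k) => map_smul (Contra.lin f) r m)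
  actionHomRight_whiskerRight _ _ _ :=
    Contra.hom_ext (TensorProduct.ext_threefold' fun _ _ _ => rfl)
  whiskerRight_actionHomLeft _ _ _ _ _ :=
    Contra.hom_ext (TensorProduct.ext_threefold' fun _ _ _ => rfl)
  actionHom_associator _ _ _ _ := Contra.hom_ext
    (TensorProduct.ext (LinearMap.ext fun _ => TensorProduct.ext_threefold fun _ _ _ => rfl))
  actionHom_leftUnitor T M := Contra.hom_ext (TensorProduct.ext_threefold' fun m (r : k) t =>
    (TensorProduct.smul_tmul (R := k) (R' := k) (M := M) (N := T.toComod) r m t).symm)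
  actionHom_rightUnitor T M := Contra.hom_ext (TensorProduct.ext_threefold' fun m t (r : k) =>
    TensorProduct.tmul_smul (R := k) (M := M) (N := T.toComod) r m t)

/-- The bimodule category of contramodules over finite-dimensional comodules, with
`T · N · L = T^{S²} ⊗ N ⊗ L`. -/
instance : BimoduleCategory (FdComod k H) (Contra k H) where
  mid T N L := Contra.midIso T.twist L N
  mid_naturality _ _ _ := Contra.hom_ext (TensorProduct.ext_threefold fun _ _ _ => rfl)
  pentagon_left _ _ _ _ := Contra.hom_ext (TensorProduct.ext_fourfold fun _ _ _ _ => rfl)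
  pentagon_right _ _ _ _ := Contra.hom_ext (TensorProduct.ext_fourfold' fun _ _ _ _ => rfl)

end

noncomputable section

variable {k H : Type u} [Field k] [Ring H] [HopfAlgebra k H]

/-! ### The functors between comodules and contramodules -/

section Hat

/-- The space `Hom(H, M)^H` of comodule maps `H → M`, where `H` is a comodule through its
comultiplication. -/
def hatSubmodule (M : Comod k H) : Submodule k (H →ₗ[k] M) where
  carrier := {φ | M.coact ∘ₗ φ = φ.rTensor H ∘ₗ Coalgebra.comul}
  zero_mem' := by simp
  add_mem' {a b} ha hb := by
    simp only [Set.mem_ofPred_eq] at *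
    rw [LinearMap.comp_add, ha, hb, LinearMap.rTensor_add, LinearMap.add_comp]
  smul_mem' r a ha := by
    simp only [Set.mem_ofPred_eq] at *
    rw [LinearMap.comp_smul, ha, LinearMap.rTensor_smul, LinearMap.smul_comp]

theorem hatSubmodule_apply {M : Comod k H} (φ : hatSubmodule M) {ι : Type} [Fintype ι]
    [DecidableEq ι] {C : ι → ι → H} (hC : IsComatrix k C) (i j : ι) :
    M.coact (φ.1 (C i j)) = ∑ l, φ.1 (C i l) ⊗ₜ[k] C l j := by
  have := LinearMap.congr_fun φ.2 (C i j)
  simpa [hC.comul, map_sum] using this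

/-- The contraaction `θ ↦ (h ↦ θ_{h¹}(h²))` on `Hom(H, M)^H`. -/
def hatAct (M : Comod k H) : (H →ₗ[k] hatSubmodule M) →ₗ[k] hatSubmodule M where
  toFun θ := ⟨TensorProduct.lift ((hatSubmodule M).subtype ∘ₗ θ) ∘ₗ Coalgebra.comul, by
    refine hopf_ext fun n C hC i j => ?_
    simp only [LinearMap.comp_apply, hC.comul, map_sum, TensorProduct.lift.tmul,
      Submodule.subtype_apply, LinearMap.rTensor_tmul, TensorProduct.sum_tmul]
    rw [Finset.sum_comm]
    exact Finset.sum_congr rfl fun l _ => hatSubmodule_apply _ hC l j⟩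
  map_add' θ θ' := by
    refine Subtype.ext (hopf_ext fun n C hC i j => ?_)
    simp [hC.comul, Finset.sum_add_distrib]
  map_smul' r θ := by
    refine Subtype.ext (hopf_ext fun n C hC i j => ?_)
    simp [hC.comul, Finset.smul_sum]

theorem hatAct_apply {M : Comod k H} (θ : H →ₗ[k] hatSubmodule M) {ι : Type} [Fintype ι]
    [DecidableEq ι] {C : ι → ι → H} (hC : IsComatrix k C) (i j : ι) :
    (hatAct M θ).1 (C i j) = ∑ l, (θ (C i l)).1 (C l j) := by
  simp [hatAct, hC.comul]

/-- The contramodule `Hom(H, M)^H`. -/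
def hatObj (M : Comod k H) : Contra k H where
  carrier := hatSubmodule M
  act := hatAct M
  assoc F := by
    refine Subtype.ext (hopf_ext fun n C hC i j => ?_)
    rw [hatAct_apply _ hC, hatAct_apply _ hC]
    simp only [LinearMap.comp_apply, hatAct_apply _ hC, hC.comul, map_sum,
      TensorProduct.lift.tmul, AddSubmonoidClass.coe_finsetSum, LinearMap.sum_apply]
    rw [Finset.sum_comm]
  unit φ := by
    refine Subtype.ext (hopf_ext fun n C hC i j => ?_)
    rw [hatAct_apply _ hC]
    refine (Finset.sum_eq_single i (fun l _ hl => ?_) fun h => absurd (Finset.mem_univ i) h).trans ?_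
    · simp [hC.counit, hl.symm]
    · simp [hC.counit]

variable (k H) in
/-- The functor `M ↦ Hom(H, M)^H` from comodules to contramodules. -/
def hat : Comod k H ⥤ Contra k H where
  obj := hatObj
  map {M N} f :=
    { lin := ((LinearMap.llcomp k H M N (Comod.lin f)).restrict (p := hatSubmodule M)
        (q := hatSubmodule N) fun φ hφ => by
          change N.coact ∘ₗ Comod.lin f ∘ₗ φ = (Comod.lin f ∘ₗ φ).rTensor H ∘ₗ Coalgebra.comul
          rw [← LinearMap.comp_assoc, Comod.lin_comm, LinearMap.comp_assoc,
            show M.coact ∘ₗ φ = _ from hφ, ← LinearMap.comp_assoc, LinearMap.rTensor_comp] :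
          hatSubmodule M →ₗ[k] hatSubmodule N)
      comm := fun θ => by
        refine Subtype.ext (hopf_ext fun n C hC i j => ?_)
        refine Eq.trans ?_ (hatAct_apply _ hC i j).symm
        refine (congrArg (Comod.lin f) (hatAct_apply θ hC i j)).trans ?_
        rw [map_sum]
        rfl }
  map_id M := Contra.hom_ext (LinearMap.ext fun _ => rfl)
  map_comp f g := Contra.hom_ext (LinearMap.ext fun _ => rfl)

end Hat

section Prime

variable (N : Contra k H)

/-- The map `h ⊗ f ↦ h² ⊗ f(h¹)`. -/
def primeRel : H ⊗[k] (H →ₗ[k] N) →ₗ[k] H ⊗[k] N :=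
  TensorProduct.lift (LinearMap.mk₂ k
    (fun h f => TensorProduct.comm k N H (f.rTensor H (Coalgebra.comul h)))
    (fun _ _ _ => by simp)
    (fun _ _ _ => by simp)
    (fun _ _ _ => by simp [LinearMap.rTensor_add])
    (fun _ _ _ => by simp [LinearMap.rTensor_smul]))

theorem primeRel_apply {N : Contra k H} {ι : Type} [Fintype ι] [DecidableEq ι] {C : ι → ι → H}
    (hC : IsComatrix k C) (i j : ι) (f : H →ₗ[k] N) :
    primeRel N (C i j ⊗ₜ f) = ∑ l, C l j ⊗ₜ[k] f (C i l) := by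
  simp [primeRel, hC.comul]

/-- The image of the difference of `Id ⊗ α` and `h ⊗ f ↦ h² ⊗ f(h¹)`. -/
def primeSubmodule : Submodule k (H ⊗[k] N) := LinearMap.range (N.act.lTensor H - primeRel N)

/-- The cokernel of the difference of `Id ⊗ α` and `h ⊗ f ↦ h² ⊗ f(h¹)`. -/
abbrev primeSpace : Type u := (H ⊗[k] N) ⧸ primeSubmodule N

/-- The class of an element of `H ⊗ N` in the cokernel. -/
def primeMk : H ⊗[k] N →ₗ[k] primeSpace N := (primeSubmodule N).mkQ

theorem primeMk_rel {N : Contra k H} {ι : Type} [Fintype ι] [DecidableEq ι] {C : ι → ι → H}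
    (hC : IsComatrix k C) (i j : ι) (f : H →ₗ[k] N) :
    primeMk N (C i j ⊗ₜ N.act f) = ∑ l, primeMk N (C l j ⊗ₜ[k] f (C i l)) := by
  rw [← map_sum, ← primeRel_apply hC]
  refine (Submodule.Quotient.eq _).2 ⟨C i j ⊗ₜ f, ?_⟩
  simp

theorem tensorHopf_ext {W X : Type*} [AddCommGroup W] [Module k W] [AddCommGroup X] [Module k X]
    {f g : H ⊗[k] W →ₗ[k] X}
    (h : ∀ (n : ℕ) (C : Fin n → Fin n → H), IsComatrix k C → ∀ i j w,
      f (C i j ⊗ₜ w) = g (C i j ⊗ₜ w)) : f = g :=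
  TensorProduct.ext (hopf_ext fun n C hC i j => LinearMap.ext fun w => h n C hC i j w)

theorem prime_ext {N : Contra k H} {X : Type*} [AddCommGroup X] [Module k X]
    {f g : primeSpace N →ₗ[k] X}
    (h : ∀ (n : ℕ) (C : Fin n → Fin n → H), IsComatrix k C → ∀ i j w,
      f (primeMk N (C i j ⊗ₜ w)) = g (primeMk N (C i j ⊗ₜ w))) : f = g :=
  Submodule.linearMap_qext _ (tensorHopf_ext h)

/-- Maps out of the cokernel. -/
def primeLift {N : Contra k H} {X : Type*} [AddCommGroup X] [Module k X] (f : H ⊗[k] N →ₗ[k] X)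
    (hf : ∀ (n : ℕ) (C : Fin n → Fin n → H), IsComatrix k C → ∀ i j (φ : H →ₗ[k] N),
      f (C i j ⊗ₜ N.act φ) = ∑ l, f (C l j ⊗ₜ φ (C i l))) : primeSpace N →ₗ[k] X :=
  (primeSubmodule N).liftQ f (by
    rintro _ ⟨z, rfl⟩
    rw [LinearMap.mem_ker]
    refine LinearMap.congr_fun (f := f ∘ₗ (N.act.lTensor H - primeRel N)) (g := 0)
      (tensorHopf_ext fun n C hC i j φ => ?_) z
    simp [primeRel_apply hC, hf n C hC])

@[simp] theorem primeLift_mk {N : Contra k H} {X : Type*} [AddCommGroup X] [Module k X]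
    (f : H ⊗[k] N →ₗ[k] X) (hf) (z : H ⊗[k] N) : primeLift f hf (primeMk N z) = f z := rfl

/-- The map `h ⊗ n ↦ [h¹ ⊗ n] ⊗ h²`. -/
def primeCoactAux : H ⊗[k] N →ₗ[k] primeSpace N ⊗[k] H :=
  (primeMk N).rTensor H ∘ₗ (TensorProduct.assoc k H N H).symm.toLinearMap ∘ₗ
    (TensorProduct.comm k H N).toLinearMap.lTensor H ∘ₗ
      (TensorProduct.assoc k H H N).toLinearMap ∘ₗ (Coalgebra.comul (R := k)).rTensor N

theorem primeCoactAux_apply {N : Contra k H} {ι : Type} [Fintype ι] [DecidableEq ι]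
    {C : ι → ι → H} (hC : IsComatrix k C) (i j : ι) (w : N) :
    primeCoactAux N (C i j ⊗ₜ w) = ∑ l, primeMk N (C i l ⊗ₜ w) ⊗ₜ[k] C l j := by
  simp [primeCoactAux, hC.comul, TensorProduct.sum_tmul, map_sum]

/-- The coaction `h ⊗ n ↦ (h¹ ⊗ n) ⊗ h²` on the cokernel. -/
def primeCoact : primeSpace N →ₗ[k] primeSpace N ⊗[k] H :=
  primeLift (primeCoactAux N) fun n C hC i j φ => by
    simp only [primeCoactAux_apply hC, primeMk_rel hC, TensorProduct.sum_tmul]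
    rw [Finset.sum_comm]

theorem primeCoact_apply {N : Contra k H} {ι : Type} [Fintype ι] [DecidableEq ι]
    {C : ι → ι → H} (hC : IsComatrix k C) (i j : ι) (w : N) :
    primeCoact N (primeMk N (C i j ⊗ₜ w)) = ∑ l, primeMk N (C i l ⊗ₜ w) ⊗ₜ[k] C l j :=
  primeCoactAux_apply hC i j w

/-- The comodule `N'`, a cokernel of `H ⊗ Hom(H, N) → H ⊗ N`. -/
def primeObj : Comod k H where
  carrier := primeSpace N
  coact := primeCoact N
  coassoc := prime_ext fun n C hC i j w =>
    coassoc_of_comatrix (primeCoact N) hC (v := fun l => primeMk N (C i l ⊗ₜ w))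
      (fun l => primeCoact_apply hC i l w) j
  counit := prime_ext fun n C hC i j w =>
    counit_of_comatrix (primeCoact N) hC (v := fun l => primeMk N (C i l ⊗ₜ w))
      (fun l => primeCoact_apply hC i l w) j

variable (k H) in
/-- The functor `N ↦ N'` from contramodules to comodules. -/
def prime : Contra k H ⥤ Comod k H where
  obj := primeObj
  map {N P} f :=
    { lin := (primeLift (primeMk P ∘ₗ (Contra.lin f).lTensor H) fun n C hC i j φ => by
        simp only [LinearMap.comp_apply, LinearMap.lTensor_tmul, Contra.lin_comm, primeMk_rel hC] :
          primeSpace N →ₗ[k] primeSpace P)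
      comm := prime_ext fun n C hC i j w => by
        change primeCoact P (primeMk P (C i j ⊗ₜ Contra.lin f w)) = LinearMap.rTensor H
          (primeLift (primeMk P ∘ₗ (Contra.lin f).lTensor H) _) (primeCoact N (primeMk N (C i j ⊗ₜ w)))
        simp only [primeCoact_apply hC, map_sum]
        rfl }
  map_id N := Comod.hom_ext (prime_ext fun n C hC i j w => rfl)
  map_comp f g := Comod.hom_ext (prime_ext fun n C hC i j w => rfl)

end Prime

end

noncomputable section

variable {k H : Type u} [Field k] [Ring H] [HopfAlgebra k H]

/-! ### Anti-Yetter-Drinfeld modules and contramodules -/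

theorem sum_rot {P Q Y X : Type*} [Fintype P] [Fintype Q] [Fintype Y] [AddCommMonoid X]
    (F : P → Q → Y → X) : ∑ p, ∑ q, ∑ y, F p q y = ∑ y, ∑ q, ∑ p, F p q y := by
  rw [Finset.sum_comm]
  calc _ = ∑ q, ∑ y, ∑ p, F p q y := Finset.sum_congr rfl fun q _ => Finset.sum_comm
    _ = _ := Finset.sum_comm

section Sweedler

variable {X : Type*} [AddCommMonoid X] [Module k X]

/-- The map `h ↦ f(h¹, h², h³)`. -/
def sweedler3 (f : H →ₗ[k] H →ₗ[k] H →ₗ[k] X) : H →ₗ[k] X :=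
  TensorProduct.lift (TensorProduct.lift f) ∘ₗ (Coalgebra.comul (R := k)).rTensor H ∘ₗ
    Coalgebra.comul

theorem sweedler3_apply (f : H →ₗ[k] H →ₗ[k] H →ₗ[k] X) {ι : Type} [Fintype ι] [DecidableEq ι]
    {C : ι → ι → H} (hC : IsComatrix k C) (i j : ι) :
    sweedler3 f (C i j) = ∑ p, ∑ q, f (C i p) (C p q) (C q j) := by
  simp only [sweedler3, LinearMap.comp_apply, hC.comul, map_sum, LinearMap.rTensor_tmul,
    TensorProduct.lift.tmul, TensorProduct.sum_tmul]
  rw [Finset.sum_comm]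

variable {W : Type u} [AddCommGroup W] [Module k W] (a : H →ₗ[k] Module.End k W)

/-- The map `(x, y, z) ↦ (f ↦ y f(S(z) - x))`. -/
def conjTri : H →ₗ[k] H →ₗ[k] H →ₗ[k] Module.End k (H →ₗ[k] W) where
  toFun x := LinearMap.mk₂ k (fun y z =>
      LinearMap.llcomp k H W W (a y) ∘ₗ LinearMap.lcomp k W
        (LinearMap.mulLeft k (HopfAlgebra.antipode k z) ∘ₗ LinearMap.mulRight k x))
    (fun _ _ _ => by ext; simp) (fun _ _ _ => by ext; simp)
    (fun _ _ _ => by ext; simp [add_mul]) (fun _ _ _ => by ext; simp)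
  map_add' _ _ := by ext; simp [mul_add]
  map_smul' _ _ := by ext; simp

/-- The action `(h · f)(-) = h² f(S(h³) - h¹)` of `H` on `Hom(H, W)`. -/
def conjAct : H →ₗ[k] Module.End k (H →ₗ[k] W) := sweedler3 (conjTri a)

theorem conjAct_apply {ι : Type} [Fintype ι] [DecidableEq ι] {C : ι → ι → H}
    (hC : IsComatrix k C) (i j : ι) (f : H →ₗ[k] W) (x : H) : conjAct a (C i j) f x =
      ∑ p, ∑ q, a (C p q) (f (HopfAlgebra.antipode k (C q j) * (x * C i p))) := by
  simp [conjAct, sweedler3_apply _ hC, conjTri]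

/-- The map `(x, y, z) ↦ (w ⊗ h ↦ y w ⊗ z h S(x))`. -/
def aydTri : H →ₗ[k] H →ₗ[k] H →ₗ[k] Module.End k (W ⊗[k] H) where
  toFun x := LinearMap.mk₂ k (fun y z => TensorProduct.map (a y)
      (LinearMap.mulLeft k z ∘ₗ LinearMap.mulRight k (HopfAlgebra.antipode k x)))
    (fun _ _ _ => by ext; simp [TensorProduct.add_tmul])
    (fun _ _ _ => by ext; simp [TensorProduct.smul_tmul'])
    (fun _ _ _ => by ext; simp [TensorProduct.tmul_add, add_mul])
    (fun _ _ _ => by ext; simp)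
  map_add' _ _ := by ext; simp [TensorProduct.tmul_add, mul_add]
  map_smul' _ _ := by ext; simp

/-- The action `h · (w ⊗ x) = h² w ⊗ h³ x S(h¹)` of `H` on `W ⊗ H`. -/
def aydAct : H →ₗ[k] Module.End k (W ⊗[k] H) := sweedler3 (aydTri a)

theorem aydAct_apply {ι : Type} [Fintype ι] [DecidableEq ι] {C : ι → ι → H}
    (hC : IsComatrix k C) (i j : ι) (w : W) (x : H) : aydAct a (C i j) (w ⊗ₜ x) =
      ∑ p, ∑ q, a (C p q) w ⊗ₜ[k] (C q j * (x * HopfAlgebra.antipode k (C i p))) := by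
  simp [aydAct, sweedler3_apply _ hC, aydTri]

theorem isComatrix_one : IsComatrix k (fun _ _ : Unit => (1 : H)) where
  comul _ _ := by simp [Algebra.TensorProduct.one_def]
  counit _ _ := by simp

theorem hopf_mul_ext {A : Type*} [Semiring A] [Algebra k A] (L : H →ₗ[k] A)
    (h : ∀ (n m : ℕ) (C : Fin n → Fin n → H) (D : Fin m → Fin m → H), IsComatrix k C →
      IsComatrix k D → ∀ i j a b, L (C i j * D a b) = L (C i j) * L (D a b)) (x y : H) :
    L (x * y) = L x * L y := by
  let P : H →ₗ[k] H →ₗ[k] A := (LinearMap.mul k H).compr₂ L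
  let Q : H →ₗ[k] H →ₗ[k] A := (LinearMap.mul k A).compl₁₂ L L
  have : P = Q := hopf_ext fun n C hC i j => hopf_ext fun m D hD a b => h n m C D hC hD i j a b
  exact LinearMap.congr_fun (LinearMap.congr_fun this x) y

theorem conjAct_one (b : H →ₐ[k] Module.End k W) : conjAct b.toLinearMap 1 = 1 := by
  ext f x
  refine (conjAct_apply _ isComatrix_one () () f x).trans ?_
  simp

theorem conjAct_mul (b : H →ₐ[k] Module.End k W) (x y : H) :
    conjAct b.toLinearMap (x * y) = conjAct b.toLinearMap x * conjAct b.toLinearMap y := by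
  refine hopf_mul_ext _ (fun n m C D hC hD i j r s => ?_) x y
  ext f z
  refine (conjAct_apply _ (hC.mul hD) (i, r) (j, s) f z).trans ?_
  simp only [Module.End.mul_apply, conjAct_apply _ hC, conjAct_apply _ hD, map_sum,
    Fintype.sum_prod_type]
  refine Finset.sum_congr rfl fun p _ => ?_
  rw [Finset.sum_comm]
  refine Finset.sum_congr rfl fun q _ => ?_
  simp [mul_assoc, HopfAlgebra.antipode_mul_antidistrib]

/-- The map `(x, y, z) ↦ (h ⊗ w ↦ z h S(x) ⊗ y w)`. -/
def primeTri : H →ₗ[k] H →ₗ[k] H →ₗ[k] Module.End k (H ⊗[k] W) where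
  toFun x := LinearMap.mk₂ k (fun y z => TensorProduct.map
      (LinearMap.mulLeft k z ∘ₗ LinearMap.mulRight k (HopfAlgebra.antipode k x)) (a y))
    (fun _ _ _ => by ext; simp [TensorProduct.tmul_add])
    (fun _ _ _ => by ext; simp [TensorProduct.smul_tmul'])
    (fun _ _ _ => by ext; simp [TensorProduct.add_tmul, add_mul])
    (fun _ _ _ => by ext; simp [TensorProduct.smul_tmul'])
  map_add' _ _ := by ext; simp [TensorProduct.add_tmul, mul_add]
  map_smul' _ _ := by ext; simp [TensorProduct.smul_tmul']

/-- The action `x · (h ⊗ w) = x³ h S(x¹) ⊗ x² w` of `H` on `H ⊗ W`. -/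
def primeAct : H →ₗ[k] Module.End k (H ⊗[k] W) := sweedler3 (primeTri a)

theorem primeAct_apply {ι : Type} [Fintype ι] [DecidableEq ι] {C : ι → ι → H}
    (hC : IsComatrix k C) (i j : ι) (x : H) (w : W) : primeAct a (C i j) (x ⊗ₜ w) =
      ∑ p, ∑ q, (C q j * (x * HopfAlgebra.antipode k (C i p))) ⊗ₜ[k] a (C p q) w := by
  simp [primeAct, sweedler3_apply _ hC, primeTri]

theorem primeAct_one (b : H →ₐ[k] Module.End k W) : primeAct b.toLinearMap 1 = 1 := by
  refine TensorProduct.ext' fun x w => ?_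
  refine (primeAct_apply _ isComatrix_one () () x w).trans ?_
  simp

theorem primeAct_mul (b : H →ₐ[k] Module.End k W) (x y : H) :
    primeAct b.toLinearMap (x * y) = primeAct b.toLinearMap x * primeAct b.toLinearMap y := by
  refine hopf_mul_ext _ (fun n m C D hC hD i j r s => ?_) x y
  refine TensorProduct.ext' fun z w => ?_
  refine (primeAct_apply _ (hC.mul hD) (i, r) (j, s) z w).trans ?_
  simp only [Module.End.mul_apply, primeAct_apply _ hC, primeAct_apply _ hD, map_sum,
    Fintype.sum_prod_type]
  rw [Finset.sum_comm]
  refine Finset.sum_congr rfl fun u _ => ?_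
  rw [sum_rot]
  refine Finset.sum_congr rfl fun v _ => ?_
  rw [Finset.sum_comm]
  simp [mul_assoc, HopfAlgebra.antipode_mul_antidistrib]

end Sweedler

variable (k H)

/-- Left-right anti-Yetter-Drinfeld modules: a right comodule with a left action of `H` such that
`ρ(h m) = h² m₀ ⊗ h³ m₁ S(h¹)`. -/
structure AYDMod where
  toComod : Comod k H
  act : H →ₐ[k] Module.End k toComod
  compat (h : H) (m : toComod) :
    toComod.coact (act h m) = aydAct act.toLinearMap h (toComod.coact m)

/-- Left-right anti-Yetter-Drinfeld contramodules: a right contramodule with a left action of `H`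
such that `h α(f) = α(h² f(S(h³) - h¹))`. -/
structure AYDContra where
  toContra : Contra k H
  act : H →ₐ[k] Module.End k toContra
  compat (h : H) (f : H →ₗ[k] toContra) :
    act h (toContra.act f) = toContra.act (conjAct act.toLinearMap h f)

variable {k H}

/-- Morphisms of anti-Yetter-Drinfeld modules: morphisms of comodules that are `H`-linear. -/
@[ext]
structure AYDMod.Hom (M N : AYDMod k H) where
  hom : M.toComod ⟶ N.toComod
  comm (h : H) (m : M.toComod) : Comod.lin hom (M.act h m) = N.act h (Comod.lin hom m)

instance : Category (AYDMod k H) where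
  Hom := AYDMod.Hom
  id M := ⟨𝟙 _, fun _ _ => rfl⟩
  comp f g := ⟨f.hom ≫ g.hom, fun h m => by simp [f.comm, g.comm]⟩

/-- The underlying morphism of comodules. -/
abbrev AYDMod.hom {M N : AYDMod k H} (f : M ⟶ N) : M.toComod ⟶ N.toComod := AYDMod.Hom.hom f

theorem AYDMod.hom_ext {M N : AYDMod k H} {f g : M ⟶ N} (h : AYDMod.hom f = AYDMod.hom g) :
    f = g := AYDMod.Hom.ext h

/-- Morphisms of anti-Yetter-Drinfeld contramodules: morphisms of contramodules that are
`H`-linear. -/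
@[ext]
structure AYDContra.Hom (M N : AYDContra k H) where
  hom : M.toContra ⟶ N.toContra
  comm (h : H) (m : M.toContra) : Contra.lin hom (M.act h m) = N.act h (Contra.lin hom m)

instance : Category (AYDContra k H) where
  Hom := AYDContra.Hom
  id M := ⟨𝟙 _, fun _ _ => rfl⟩
  comp f g := ⟨f.hom ≫ g.hom, fun h m => by simp [f.comm, g.comm]⟩

/-- The underlying morphism of contramodules. -/
abbrev AYDContra.hom {M N : AYDContra k H} (f : M ⟶ N) : M.toContra ⟶ N.toContra :=
  AYDContra.Hom.hom f

theorem AYDContra.hom_ext {M N : AYDContra k H} {f g : M ⟶ N}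
    (h : AYDContra.hom f = AYDContra.hom g) : f = g := AYDContra.Hom.ext h

variable (k H) in
/-- An anti-Yetter-Drinfeld module is stable when `m₁ m₀ = m` for all `m`. -/
def stableMod : ObjectProperty (AYDMod k H) := fun M =>
  ∀ m : M.toComod, TensorProduct.lift M.act.toLinearMap.flip (M.toComod.coact m) = m

variable (k H) in
/-- An anti-Yetter-Drinfeld contramodule is stable when `α(r_n) = n` for all `n`, where
`r_n(h) = h n`. -/
def stableContra : ObjectProperty (AYDContra k H) := fun N =>
  ∀ n : N.toContra, N.toContra.act (N.act.toLinearMap.flip n) = n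

/-! ### The upgraded functors -/

section HatH

theorem IsComatrix.collapse {ι : Type} [Fintype ι] [DecidableEq ι] {C : ι → ι → H}
    (hC : IsComatrix k C) (s t e r : ι) (d : H) :
    ∑ q, ∑ p, C s q * (HopfAlgebra.antipode k (C q t) * d * C e p *
      HopfAlgebra.antipode k (C p r)) =
        (if s = t then 1 else 0) * d * (if e = r then 1 else 0) := by
  rw [← hC.mul_antipode, ← hC.mul_antipode]
  simp only [Finset.sum_mul, Finset.mul_sum, mul_assoc]
  rw [Finset.sum_comm]

variable (M : AYDMod k H)

theorem conjAct_mem (h : H) (φ : hatSubmodule M.toComod) :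
    conjAct M.act.toLinearMap h φ.1 ∈ hatSubmodule M.toComod := by
  let L : H →ₗ[k] H →ₗ[k] M.toComod ⊗[k] H := LinearMap.llcomp k H M.toComod
    (M.toComod ⊗[k] H) M.toComod.coact ∘ₗ (conjAct M.act.toLinearMap).flip φ.1
  let R : H →ₗ[k] H →ₗ[k] M.toComod ⊗[k] H := LinearMap.lcomp k (M.toComod ⊗[k] H)
    (Coalgebra.comul (R := k) (A := H)) ∘ₗ LinearMap.rTensorHom H ∘ₗ
      (conjAct M.act.toLinearMap).flip φ.1
  refine LinearMap.congr_fun (f := L) (g := R) (hopf_ext fun n C hC i j => ?_) h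
  refine hopf_ext fun m D hD a b => ?_
  change M.toComod.coact (conjAct M.act.toLinearMap (C i j) φ.1 (D a b)) =
    (conjAct M.act.toLinearMap (C i j) φ.1).rTensor H (Coalgebra.comul (D a b))
  have key : ∀ p q, M.toComod.coact (M.act (C p q)
      (φ.1 (HopfAlgebra.antipode k (C q j) * (D a b * C i p)))) =
        ∑ y : ((Fin n × Fin m) × Fin n) × (Fin n × Fin n), M.act (C y.2.1 y.2.2)
          (φ.1 (HopfAlgebra.antipode k (C y.1.1.1 j) * (D a y.1.1.2 * C i y.1.2))) ⊗ₜ[k]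
          (C y.2.2 q * (HopfAlgebra.antipode k (C q y.1.1.1) * D y.1.1.2 b * C y.1.2 p *
            HopfAlgebra.antipode k (C p y.2.1))) := by
    intro p q
    have h1 := hatSubmodule_apply φ ((hC.antipode.mul hD).mul hC) ((j, a), i) ((q, b), p)
    dsimp only at h1
    rw [M.compat, ← mul_assoc, h1, map_sum]
    refine Eq.trans ?_ (Fintype.sum_prod_type _).symm
    refine Finset.sum_congr rfl fun y _ => ?_
    rw [aydAct_apply _ hC, Fintype.sum_prod_type]
    simp only [mul_assoc]
    rfl
  rw [conjAct_apply _ hC, map_sum]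
  simp only [map_sum]
  refine (Finset.sum_congr rfl fun p _ => Finset.sum_congr rfl fun q _ => key p q).trans ?_
  rw [sum_rot]
  simp only [← TensorProduct.tmul_sum, hC.collapse]
  simp only [hD.comul, map_sum, LinearMap.rTensor_tmul, conjAct_apply _ hC,
    TensorProduct.sum_tmul, Fintype.sum_prod_type]
  simp [TensorProduct.tmul_ite]
  rw [Finset.sum_comm]
  refine Finset.sum_congr rfl fun d _ => ?_
  rw [Finset.sum_comm]

theorem hatHAct_aux : conjAct M.act.toLinearMap 1 = 1 ∧
    ∀ x y, conjAct M.act.toLinearMap (x * y) =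
      conjAct M.act.toLinearMap x * conjAct M.act.toLinearMap y :=
  ⟨conjAct_one M.act, conjAct_mul M.act⟩

/-- The action of `H` on `Hom(H, M)^H` given by `(h · φ)(-) = h² φ(S(h³) - h¹)`. -/
def hatHAct : H →ₐ[k] Module.End k (hatSubmodule M.toComod) :=
  AlgHom.ofLinearMap
    { toFun := fun h => (conjAct M.act.toLinearMap h).restrict fun φ hφ => conjAct_mem M h ⟨φ, hφ⟩
      map_add' := fun x y => LinearMap.ext fun φ => Subtype.ext (by simp)
      map_smul' := fun r x => LinearMap.ext fun φ => Subtype.ext (by simp) }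
    (LinearMap.ext fun φ => Subtype.ext (by simp [conjAct_one]))
    (fun x y => LinearMap.ext fun φ => Subtype.ext (by simp [conjAct_mul]))

theorem hatHAct_coe (h : H) (φ : hatSubmodule M.toComod) :
    (hatHAct M h φ).1 = conjAct M.act.toLinearMap h φ.1 := rfl

theorem hatH_compat (h : H) (θ : H →ₗ[k] hatSubmodule M.toComod) :
    hatHAct M h (hatAct M.toComod θ) =
      hatAct M.toComod (conjAct (hatHAct M).toLinearMap h θ) := by
  let L : H →ₗ[k] hatSubmodule M.toComod := (hatHAct M).toLinearMap.flip (hatAct M.toComod θ)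
  let R : H →ₗ[k] hatSubmodule M.toComod :=
    hatAct M.toComod ∘ₗ (conjAct (hatHAct M).toLinearMap).flip θ
  suffices hLR : L = R from LinearMap.congr_fun hLR h
  refine hopf_ext fun n C hC i j => Subtype.ext (hopf_ext fun m D hD a b => ?_)
  change conjAct M.act.toLinearMap (C i j) (hatAct M.toComod θ).1 (D a b) =
    (hatAct M.toComod (conjAct (hatHAct M).toLinearMap (C i j) θ)).1 (D a b)
  rw [conjAct_apply _ hC, hatAct_apply _ hD]
  have h1 : ∀ p q, (hatAct M.toComod θ).1 (HopfAlgebra.antipode k (C q j) * (D a b * C i p)) =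
      ∑ y : (Fin n × Fin m) × Fin n,
        (θ (HopfAlgebra.antipode k (C y.1.1 j) * (D a y.1.2 * C i y.2))).1
          (HopfAlgebra.antipode k (C q y.1.1) * (D y.1.2 b * C y.2 p)) := by
    intro p q
    have := hatAct_apply θ ((hC.antipode.mul hD).mul hC) ((j, a), i) ((q, b), p)
    simpa only [mul_assoc] using this
  have h2 : ∀ d, (conjAct (hatHAct M).toLinearMap (C i j) θ (D a d)).1 (D d b) =
      ∑ e, ∑ t, ∑ p, ∑ q, M.act (C p q)
        ((θ (HopfAlgebra.antipode k (C t j) * (D a d * C i e))).1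
          (HopfAlgebra.antipode k (C q t) * (D d b * C e p))) := by
    intro d
    rw [conjAct_apply _ hC]
    simp only [AddSubmonoidClass.coe_finsetSum, LinearMap.sum_apply]
    refine Finset.sum_congr rfl fun e _ => Finset.sum_congr rfl fun t _ => ?_
    exact conjAct_apply _ hC e t _ _
  simp only [h1, h2, map_sum]
  rw [sum_rot]
  simp only [Fintype.sum_prod_type]
  rw [Finset.sum_comm]
  refine Finset.sum_congr rfl fun d _ => ?_
  rw [Finset.sum_comm]
  refine Finset.sum_congr rfl fun e _ => Finset.sum_congr rfl fun t _ => ?_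
  rw [Finset.sum_comm]
  rfl

/-- The anti-Yetter-Drinfeld contramodule `Hom(H, M)^H`. -/
def hatHObj : AYDContra k H where
  toContra := (hat k H).obj M.toComod
  act := hatHAct M
  compat := hatH_compat M

variable (k H) in
/-- The functor from anti-Yetter-Drinfeld modules to anti-Yetter-Drinfeld contramodules that
upgrades `M ↦ Hom(H, M)^H`. -/
def hatH : AYDMod k H ⥤ AYDContra k H where
  obj := hatHObj
  map {M N} f :=
    { hom := (hat k H).map (AYDMod.hom f)
      comm := fun h φ => by
        refine Subtype.ext ?_
        change Comod.lin (AYDMod.hom f) ∘ₗ conjAct M.act.toLinearMap h φ.1 =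
          conjAct N.act.toLinearMap h (Comod.lin (AYDMod.hom f) ∘ₗ φ.1)
        let L : H →ₗ[k] H →ₗ[k] N.toComod := LinearMap.llcomp k H M.toComod N.toComod
          (Comod.lin (AYDMod.hom f)) ∘ₗ (conjAct M.act.toLinearMap).flip φ.1
        let R : H →ₗ[k] H →ₗ[k] N.toComod :=
          (conjAct N.act.toLinearMap).flip (Comod.lin (AYDMod.hom f) ∘ₗ φ.1)
        suffices hLR : L = R from LinearMap.congr_fun hLR h
        refine hopf_ext fun n C hC i j => LinearMap.ext fun x => ?_
        change Comod.lin (AYDMod.hom f) (conjAct M.act.toLinearMap (C i j) φ.1 x) =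
          conjAct N.act.toLinearMap (C i j) (Comod.lin (AYDMod.hom f) ∘ₗ φ.1) x
        rw [conjAct_apply _ hC, conjAct_apply _ hC]
        simp only [map_sum]
        refine Finset.sum_congr rfl fun p _ => Finset.sum_congr rfl fun q _ => ?_
        exact AYDMod.Hom.comm f _ _ }
  map_id M := AYDContra.hom_ext ((hat k H).map_id _)
  map_comp f g := AYDContra.hom_ext ((hat k H).map_comp _ _)

end HatH

section PrimeH

variable (N : AYDContra k H)

theorem primeHAct_rel (h : H) {n : ℕ} {C : Fin n → Fin n → H} (hC : IsComatrix k C)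
    (i j : Fin n) (φ : H →ₗ[k] N.toContra) :
    primeMk N.toContra (primeAct N.act.toLinearMap h (C i j ⊗ₜ N.toContra.act φ)) =
      ∑ l, primeMk N.toContra (primeAct N.act.toLinearMap h (C l j ⊗ₜ φ (C i l))) := by
  let A : H ⊗[k] N.toContra → H →ₗ[k] primeSpace N.toContra := fun z =>
    primeMk N.toContra ∘ₗ (primeAct N.act.toLinearMap).flip z
  suffices hA : A (C i j ⊗ₜ N.toContra.act φ) = ∑ l, A (C l j ⊗ₜ φ (C i l)) by
    simpa [A] using LinearMap.congr_fun hA h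
  refine hopf_ext fun m D hD a b => ?_
  simp only [A, LinearMap.comp_apply, LinearMap.flip_apply, LinearMap.sum_apply,
    primeAct_apply _ hD, map_sum]
  have h1 : ∀ p q, primeMk N.toContra ((D q b * (C i j * HopfAlgebra.antipode k (D a p))) ⊗ₜ[k]
      N.act (D p q) (N.toContra.act φ)) =
      ∑ y : ((Fin m × Fin n) × Fin m) × (Fin m × Fin m), primeMk N.toContra
        ((D y.1.1.1 b * (C y.1.1.2 j * HopfAlgebra.antipode k (D a y.1.2))) ⊗ₜ[k]
          N.act (D y.2.1 y.2.2) (φ (HopfAlgebra.antipode k (D y.2.2 q) * (D q y.1.1.1 *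
            C i y.1.1.2 * HopfAlgebra.antipode k (D y.1.2 p) * D p y.2.1)))) := by
    intro p q
    have := primeMk_rel ((hD.mul hC).mul hD.antipode) ((q, i), p) ((b, j), a)
      (conjAct N.act.toLinearMap (D p q) φ)
    dsimp only at this
    rw [N.compat, ← mul_assoc, this]
    refine Eq.trans ?_ (Fintype.sum_prod_type _).symm
    refine Finset.sum_congr rfl fun y _ => ?_
    rw [conjAct_apply _ hD, TensorProduct.tmul_sum, map_sum, Fintype.sum_prod_type]
    simp only [TensorProduct.tmul_sum, map_sum, mul_assoc]
    rfl
  have h2 : ∀ (t : Fin m) (l : Fin n) (s r u : Fin m), ∑ q, ∑ p,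
      HopfAlgebra.antipode k (D u q) * (D q t * C i l * HopfAlgebra.antipode k (D s p) * D p r) =
        (if u = t then 1 else 0) * C i l * (if s = r then 1 else 0) := by
    intro t l s r u
    rw [← hD.antipode_mul, ← hD.antipode_mul]
    simp only [Finset.sum_mul, Finset.mul_sum, mul_assoc]
    rw [Finset.sum_comm]
  refine (Finset.sum_congr rfl fun p _ => Finset.sum_congr rfl fun q _ => h1 p q).trans ?_
  rw [sum_rot]
  simp only [← map_sum, ← TensorProduct.tmul_sum, h2]
  simp only [map_sum, Fintype.sum_prod_type]
  have hite : ∀ (P : Prop) [Decidable P] (x y : Fin m) (w : N.toContra),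
      N.act (D x y) (if P then w else 0) = if P then N.act (D x y) w else 0 := by
    intros
    split_ifs <;> simp
  simp only [ite_mul, mul_ite, one_mul, mul_one, zero_mul, mul_zero, apply_ite φ, map_zero, hite,
    TensorProduct.tmul_ite, apply_ite (primeMk N.toContra), Finset.sum_ite_eq, Finset.sum_ite_eq',
    Finset.mem_univ, if_true, Finset.sum_ite_irrel, Finset.sum_const_zero]
  rw [Finset.sum_comm]
  refine Finset.sum_congr rfl fun l _ => ?_
  rw [Finset.sum_comm]
  rfl

/-- The map induced on the cokernel by the action of an element of `H` on `H ⊗ N`. -/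
def primeHMap (h : H) : primeSpace N.toContra →ₗ[k] primeSpace N.toContra :=
  primeLift (primeMk N.toContra ∘ₗ primeAct N.act.toLinearMap h)
    fun n C hC i j φ => primeHAct_rel N h hC i j φ

/-- The action of `H` on `N'` given by `x · (h ⊗ n) = x³ h S(x¹) ⊗ x² n`. -/
def primeHAct : H →ₐ[k] Module.End k (primeSpace N.toContra) :=
  AlgHom.ofLinearMap
    { toFun := primeHMap N
      map_add' := fun x y => Submodule.linearMap_qext _ (TensorProduct.ext' fun a b => by
        change primeMk N.toContra (primeAct N.act.toLinearMap (x + y) (a ⊗ₜ b)) =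
          primeMk N.toContra (primeAct N.act.toLinearMap x (a ⊗ₜ b)) +
            primeMk N.toContra (primeAct N.act.toLinearMap y (a ⊗ₜ b))
        simp)
      map_smul' := fun r x => Submodule.linearMap_qext _ (TensorProduct.ext' fun a b => by
        change primeMk N.toContra (primeAct N.act.toLinearMap (r • x) (a ⊗ₜ b)) =
          r • primeMk N.toContra (primeAct N.act.toLinearMap x (a ⊗ₜ b))
        simp) }
    (Submodule.linearMap_qext _ (TensorProduct.ext' fun a b => by
      change primeMk N.toContra (primeAct N.act.toLinearMap 1 (a ⊗ₜ b)) =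
        primeMk N.toContra (a ⊗ₜ b)
      rw [primeAct_one]
      rfl))
    (fun x y => Submodule.linearMap_qext _ (TensorProduct.ext' fun a b => by
      change primeMk N.toContra (primeAct N.act.toLinearMap (x * y) (a ⊗ₜ b)) =
        primeMk N.toContra (primeAct N.act.toLinearMap x (primeAct N.act.toLinearMap y (a ⊗ₜ b)))
      rw [primeAct_mul]
      rfl))

theorem primeHAct_mk (h : H) (z : H ⊗[k] N.toContra) :
    primeHAct N h (primeMk N.toContra z) =
      primeMk N.toContra (primeAct N.act.toLinearMap h z) := rfl

theorem primeHAct_apply {ι : Type} [Fintype ι] [DecidableEq ι] {C : ι → ι → H}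
    (hC : IsComatrix k C) (i j : ι) (x : H) (w : N.toContra) :
    primeHAct N (C i j) (primeMk N.toContra (x ⊗ₜ w)) = ∑ p, ∑ q, primeMk N.toContra
      ((C q j * (x * HopfAlgebra.antipode k (C i p))) ⊗ₜ[k] N.act (C p q) w) := by
  rw [primeHAct_mk, primeAct_apply _ hC]
  simp only [map_sum]
  rfl

theorem primeH_compat (h : H) (m : primeSpace N.toContra) :
    primeCoact N.toContra (primeHAct N h m) =
      aydAct (primeHAct N).toLinearMap h (primeCoact N.toContra m) := by
  let L : H →ₗ[k] primeSpace N.toContra →ₗ[k] primeSpace N.toContra ⊗[k] H :=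
    LinearMap.llcomp k _ _ _ (primeCoact N.toContra) ∘ₗ (primeHAct N).toLinearMap
  let R : H →ₗ[k] primeSpace N.toContra →ₗ[k] primeSpace N.toContra ⊗[k] H :=
    LinearMap.lcomp k _ (primeCoact N.toContra) ∘ₗ aydAct (primeHAct N).toLinearMap
  suffices hLR : L = R from LinearMap.congr_fun (LinearMap.congr_fun hLR h) m
  refine hopf_ext fun m D hD a b => prime_ext fun n C hC i j w => ?_
  change primeCoact N.toContra (primeHAct N (D a b) (primeMk N.toContra (C i j ⊗ₜ w))) =
    aydAct (primeHAct N).toLinearMap (D a b)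
      (primeCoact N.toContra (primeMk N.toContra (C i j ⊗ₜ w)))
  have h1 : ∀ p q, primeCoact N.toContra (primeMk N.toContra
      ((D q b * (C i j * HopfAlgebra.antipode k (D a p))) ⊗ₜ[k] N.act (D p q) w)) =
      ∑ y : (Fin m × Fin n) × Fin m, primeMk N.toContra ((D q y.1.1 * (C i y.1.2 *
        HopfAlgebra.antipode k (D y.2 p))) ⊗ₜ[k] N.act (D p q) w) ⊗ₜ[k]
          (D y.1.1 b * (C y.1.2 j * HopfAlgebra.antipode k (D a y.2))) := by
    intro p q
    have := primeCoact_apply ((hD.mul hC).mul hD.antipode) ((q, i), p) ((b, j), a)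
      (N.act (D p q) w)
    simpa only [mul_assoc] using this
  have h2 : ∀ l, aydAct (primeHAct N).toLinearMap (D a b)
      (primeMk N.toContra (C i l ⊗ₜ w) ⊗ₜ[k] C l j) = ∑ s, ∑ t, ∑ p, ∑ q,
        primeMk N.toContra ((D q t * (C i l * HopfAlgebra.antipode k (D s p))) ⊗ₜ[k]
          N.act (D p q) w) ⊗ₜ[k] (D t b * (C l j * HopfAlgebra.antipode k (D a s))) := by
    intro l
    rw [aydAct_apply _ hD]
    refine Finset.sum_congr rfl fun s _ => Finset.sum_congr rfl fun t _ => ?_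
    refine (congrArg (· ⊗ₜ[k] _) (primeHAct_apply N hD s t (C i l) w)).trans ?_
    simp only [TensorProduct.sum_tmul]
  rw [primeHAct_apply N hD, primeCoact_apply hC]
  simp only [map_sum, h1, h2]
  rw [sum_rot]
  simp only [Fintype.sum_prod_type]
  rw [Finset.sum_comm]
  refine Finset.sum_congr rfl fun l _ => ?_
  rw [Finset.sum_comm]
  refine Finset.sum_congr rfl fun s _ => Finset.sum_congr rfl fun t _ => ?_
  rw [Finset.sum_comm]

/-- The anti-Yetter-Drinfeld module `N'`. -/
def primeHObj : AYDMod k H where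
  toComod := (prime k H).obj N.toContra
  act := primeHAct N
  compat := primeH_compat N

variable (k H) in
/-- The functor from anti-Yetter-Drinfeld contramodules to anti-Yetter-Drinfeld modules that
upgrades `N ↦ N'`. -/
def primeH : AYDContra k H ⥤ AYDMod k H where
  obj := primeHObj
  map {N P} f :=
    { hom := (prime k H).map (AYDContra.hom f)
      comm := fun h z => by
        let g : primeSpace N.toContra →ₗ[k] primeSpace P.toContra :=
          Comod.lin ((prime k H).map (AYDContra.hom f))
        let L : H →ₗ[k] primeSpace N.toContra →ₗ[k] primeSpace P.toContra :=
          LinearMap.llcomp k _ _ _ g ∘ₗ (primeHAct N).toLinearMap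
        let R : H →ₗ[k] primeSpace N.toContra →ₗ[k] primeSpace P.toContra :=
          LinearMap.lcomp k _ g ∘ₗ (primeHAct P).toLinearMap
        suffices hLR : L = R from LinearMap.congr_fun (LinearMap.congr_fun hLR h) z
        refine hopf_ext fun m D hD a b => prime_ext fun n C hC i j w => ?_
        change g (primeHAct N (D a b) (primeMk N.toContra (C i j ⊗ₜ w))) =
          primeHAct P (D a b) (primeMk P.toContra (C i j ⊗ₜ Contra.lin (AYDContra.hom f) w))
        rw [primeHAct_apply N hD, primeHAct_apply P hD]
        simp only [map_sum]
        refine Finset.sum_congr rfl fun p _ => Finset.sum_congr rfl fun q _ => ?_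
        change primeMk P.toContra (_ ⊗ₜ Contra.lin (AYDContra.hom f) (N.act (D p q) w)) = _
        rw [AYDContra.Hom.comm f]
        rfl }
  map_id M := AYDMod.hom_ext ((prime k H).map_id _)
  map_comp f g := AYDMod.hom_ext ((prime k H).map_comp _ _)

end PrimeH

end

noncomputable section

variable {k H : Type u} [Field k] [Ring H] [HopfAlgebra k H]

/-! ### The central structure defined by an action -/

section Braid

variable {V W : Type u} [AddCommGroup V] [Module k V] [AddCommGroup W] [Module k W]
  (ρ : V →ₗ[k] V ⊗[k] H) (a : H →ₗ[k] Module.End k W)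

/-- The map `t ⊗ w ↦ t₁ w ⊗ t₀`, where `ρ t = t₀ ⊗ t₁`. -/
def braid : V ⊗[k] W →ₗ[k] W ⊗[k] V :=
  TensorProduct.lift (LinearMap.mk₂ k
    (fun t w => TensorProduct.comm k V W ((a.flip w).lTensor V (ρ t)))
    (fun _ _ _ => by simp)
    (fun _ _ _ => by simp)
    (fun _ _ _ => by simp [LinearMap.lTensor_add])
    (fun _ _ _ => by simp [LinearMap.lTensor_smul]))

/-- The map `w ⊗ t ↦ t₀ ⊗ S(t₁) w`, where `ρ t = t₀ ⊗ t₁`. -/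
def braidInv : W ⊗[k] V →ₗ[k] V ⊗[k] W :=
  TensorProduct.lift (LinearMap.mk₂ k
    (fun w t => (a.flip w ∘ₗ HopfAlgebra.antipode k).lTensor V (ρ t))
    (fun _ _ _ => by simp [LinearMap.add_comp, LinearMap.lTensor_add])
    (fun _ _ _ => by simp [LinearMap.smul_comp, LinearMap.lTensor_smul])
    (fun _ _ _ => by simp)
    (fun _ _ _ => by simp))

variable {ρ}

theorem braid_apply {ι : Type} [Fintype ι] {v : ι → V} {C : ι → ι → H}
    (hv : ∀ j, ρ (v j) = ∑ i, v i ⊗ₜ[k] C i j) (j : ι) (w : W) :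
    braid ρ a (v j ⊗ₜ w) = ∑ i, a (C i j) w ⊗ₜ[k] v i := by
  simp [braid, hv, map_sum]

theorem braidInv_apply {ι : Type} [Fintype ι] {v : ι → V} {C : ι → ι → H}
    (hv : ∀ j, ρ (v j) = ∑ i, v i ⊗ₜ[k] C i j) (j : ι) (w : W) :
    braidInv ρ a (w ⊗ₜ v j) = ∑ i, v i ⊗ₜ[k] a (HopfAlgebra.antipode k (C i j)) w := by
  simp [braidInv, hv, map_sum]

/-- The isomorphism `t ⊗ w ↦ t₁ w ⊗ t₀` with inverse `w ⊗ t ↦ t₀ ⊗ S(t₁) w`. -/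
def braidEquiv (T : Comod k H) (b : H →ₐ[k] Module.End k W) : T ⊗[k] W ≃ₗ[k] W ⊗[k] T :=
  LinearEquiv.ofLinearMap (braid T.coact b.toLinearMap) (braidInv T.coact b.toLinearMap)
    (TensorProduct.ext (LinearMap.ext fun w => T.lin_ext fun n v C hC hv j => by
      change braid T.coact b.toLinearMap (braidInv T.coact b.toLinearMap (w ⊗ₜ v j)) = w ⊗ₜ v j
      simp only [braidInv_apply _ hv, map_sum, braid_apply _ hv]
      rw [Finset.sum_comm]
      simp only [← TensorProduct.sum_tmul, AlgHom.toLinearMap_apply, ← Module.End.mul_apply,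
        ← map_mul, ← LinearMap.sum_apply, ← map_sum, hC.mul_antipode]
      simp [apply_ite b, ite_apply, apply_ite (fun z : Module.End k W => z w),
        TensorProduct.ite_tmul]))
    (TensorProduct.ext (T.lin_ext fun n v C hC hv j => LinearMap.ext fun w => by
      change braidInv T.coact b.toLinearMap (braid T.coact b.toLinearMap (v j ⊗ₜ w)) = v j ⊗ₜ w
      simp only [braidInv_apply _ hv, map_sum, braid_apply _ hv]
      rw [Finset.sum_comm]
      simp only [← TensorProduct.tmul_sum, AlgHom.toLinearMap_apply, ← Module.End.mul_apply,
        ← map_mul, ← LinearMap.sum_apply, ← map_sum, hC.antipode_mul]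
      simp [apply_ite b, ite_apply, apply_ite (fun z : Module.End k W => z w),
        TensorProduct.tmul_ite]))

theorem braid_pure (t : V) (w : W) :
    braid ρ a (t ⊗ₜ w) = TensorProduct.comm k V W ((a.flip w).lTensor V (ρ t)) := rfl

theorem braid_natural {V' W' : Type u} [AddCommGroup V'] [Module k V'] [AddCommGroup W']
    [Module k W'] {ρ' : V' →ₗ[k] V' ⊗[k] H} {a' : H →ₗ[k] Module.End k W'} (f : V →ₗ[k] V')
    (g : W →ₗ[k] W') (hf : ρ' ∘ₗ f = f.rTensor H ∘ₗ ρ) (hg : ∀ h w, g (a h w) = a' h (g w))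
    (t : V) (w : W) :
    braid ρ' a' (f t ⊗ₜ g w) = TensorProduct.map g f (braid ρ a (t ⊗ₜ w)) := by
  have h1 := LinearMap.congr_fun hf t
  simp only [LinearMap.comp_apply] at h1
  rw [braid_pure, braid_pure, h1]
  generalize ρ t = z
  induction z with
  | zero => simp
  | add x y hx hy => simp only [map_add, hx, hy]
  | tmul x y => simp [hg]

theorem braid_hexagon {V' : Type u} [AddCommGroup V'] [Module k V'] {ρ' : V' →ₗ[k] V' ⊗[k] H}
    (b : H →ₐ[k] Module.End k W) (σ : V ⊗[k] V' →ₗ[k] (V ⊗[k] V') ⊗[k] H)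
    (hσ : ∀ v w, σ (v ⊗ₜ w) = (LinearMap.mul' k H).lTensor (V ⊗[k] V')
      (TensorProduct.tensorTensorTensorComm k V H V' H (ρ v ⊗ₜ ρ' w)))
    (t : V) (s : V') (w : W) :
    braid σ b.toLinearMap ((t ⊗ₜ s) ⊗ₜ w) = TensorProduct.assoc k W V V'
      ((braid ρ b.toLinearMap).rTensor V' ((TensorProduct.assoc k V W V').symm
        (t ⊗ₜ braid ρ' b.toLinearMap (s ⊗ₜ w)))) := by
  rw [braid_pure, braid_pure, hσ]
  generalize ρ' s = y
  induction y with
  | zero => simp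
  | add x y hx hy => simp only [map_add, TensorProduct.tmul_add, hx, hy]
  | tmul c d =>
    simp only [LinearMap.lTensor_tmul, TensorProduct.comm_tmul, TensorProduct.assoc_symm_tmul,
      LinearMap.rTensor_tmul, braid_pure]
    generalize ρ t = z
    induction z with
    | zero => simp
    | add x y hx hy => simp only [map_add, TensorProduct.add_tmul, hx, hy]
    | tmul x y => simp

theorem braid_unit (b : H →ₐ[k] Module.End k W) (σ : k →ₗ[k] k ⊗[k] H)
    (hσ : ∀ r, σ r = r ⊗ₜ 1) (r : k) (w : W) :
    braid σ b.toLinearMap (r ⊗ₜ w) = (r • w) ⊗ₜ[k] (1 : k) := by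
  rw [braid_pure, hσ]
  simp [TensorProduct.smul_tmul]

end Braid

theorem IsComatrix.antipode_antipodeSq {ι : Type} [Fintype ι] [DecidableEq ι] {C : ι → ι → H}
    (hC : IsComatrix k C) (p l : ι) :
    ∑ i, HopfAlgebra.antipode k (C i p) * AYD.antipodeSq k H (C l i) = if l = p then 1 else 0 := by
  have := congrArg (HopfAlgebra.antipode k) (hC.antipode_mul l p)
  simpa [map_sum, HopfAlgebra.antipode_mul_antidistrib, AYD.antipodeSq,
    apply_ite (HopfAlgebra.antipode k)] using this

theorem IsComatrix.antipodeSq_antipode {ι : Type} [Fintype ι] [DecidableEq ι] {C : ι → ι → H}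
    (hC : IsComatrix k C) (q j : ι) :
    ∑ i, AYD.antipodeSq k H (C i j) * HopfAlgebra.antipode k (C q i) = if q = j then 1 else 0 := by
  have := congrArg (HopfAlgebra.antipode k) (hC.mul_antipode q j)
  simpa [map_sum, HopfAlgebra.antipode_mul_antidistrib, AYD.antipodeSq,
    apply_ite (HopfAlgebra.antipode k)] using this

theorem braid_comod_aux (T : Comod k H) (M : AYDMod k H) (σ : T →ₗ[k] T ⊗[k] H)
    (hσ : σ = (antipodeSq k H).lTensor T ∘ₗ T.coact) (z : T ⊗[k] M.toComod) :
    (LinearMap.mul' k H).lTensor (M.toComod ⊗[k] T)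
      (TensorProduct.tensorTensorTensorComm k M.toComod H T H
        (TensorProduct.map M.toComod.coact σ (braid T.coact M.act.toLinearMap z))) =
      (braid T.coact M.act.toLinearMap).rTensor H (tensorCoact T M.toComod z) := by
  let Q : M.toComod ⊗[k] T →ₗ[k] (M.toComod ⊗[k] T) ⊗[k] H :=
    (LinearMap.mul' k H).lTensor (M.toComod ⊗[k] T) ∘ₗ
      (TensorProduct.tensorTensorTensorComm k M.toComod H T H).toLinearMap ∘ₗ
        TensorProduct.map M.toComod.coact σ
  suffices h : Q ∘ₗ braid T.coact M.act.toLinearMap =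
      (braid T.coact M.act.toLinearMap).rTensor H ∘ₗ tensorCoact T M.toComod from
    LinearMap.congr_fun h z
  refine TensorProduct.ext (T.lin_ext fun n v C hC hv j => M.toComod.lin_ext
    fun m w D hD hw b => ?_)
  have hM : ∀ i, M.toComod.coact (M.act (C i j) (w b)) =
      ∑ c, ∑ p, ∑ q, M.act (C p q) (w c) ⊗ₜ[k]
        (C q j * (D c b * HopfAlgebra.antipode k (C i p))) := by
    intro i
    rw [M.compat, hw, map_sum]
    refine Finset.sum_congr rfl fun c _ => ?_
    rw [aydAct_apply _ hC]
    rfl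
  have hT : ∀ i, σ (v i) = ∑ l, v l ⊗ₜ[k] antipodeSq k H (C l i) := by
    intro i
    simp [hσ, hv, map_sum]
  change Q (braid T.coact M.act.toLinearMap (v j ⊗ₜ w b)) =
    (braid T.coact M.act.toLinearMap).rTensor H (tensorCoact T M.toComod (v j ⊗ₜ w b))
  have h1 : ∀ i, Q (M.act (C i j) (w b) ⊗ₜ[k] v i) =
      ∑ c, ∑ p, ∑ q, ∑ l, (M.act (C p q) (w c) ⊗ₜ[k] v l) ⊗ₜ[k]
        (C q j * (D c b * (HopfAlgebra.antipode k (C i p) * antipodeSq k H (C l i)))) := by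
    intro i
    simp only [Q, LinearMap.comp_apply, TensorProduct.map_tmul, hM, hT, LinearEquiv.coe_coe,
      TensorProduct.sum_tmul, map_sum]
    refine Finset.sum_congr rfl fun c _ => Finset.sum_congr rfl fun p _ =>
      Finset.sum_congr rfl fun q _ => ?_
    simp only [TensorProduct.tmul_sum, map_sum,
      TensorProduct.tensorTensorTensorComm_tmul, LinearMap.lTensor_tmul, LinearMap.mul'_apply,
      mul_assoc]
  have h2 := tensorCoact_apply hv hw (j, b)
  dsimp only at h2
  rw [braid_apply _ hv, map_sum, h2]
  refine (Finset.sum_congr rfl fun i _ => h1 i).trans ?_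
  simp only [map_sum, LinearMap.rTensor_tmul, braid_apply _ hv, TensorProduct.sum_tmul,
    Fintype.sum_prod_type]
  rw [Finset.sum_comm]
  refine (Finset.sum_congr rfl fun c _ => Finset.sum_comm).trans ?_
  rw [Finset.sum_comm (s := (Finset.univ : Finset (Fin n))) (t := (Finset.univ : Finset (Fin m)))]
  refine Finset.sum_congr rfl fun c _ => ?_
  calc _ = ∑ p, ∑ q, ∑ l, ∑ i, (M.act (C p q) (w c) ⊗ₜ[k] v l) ⊗ₜ[k]
        (C q j * (D c b * (HopfAlgebra.antipode k (C i p) * antipodeSq k H (C l i)))) := by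
        refine Finset.sum_congr rfl fun p _ => ?_
        rw [Finset.sum_comm]
        exact Finset.sum_congr rfl fun q _ => Finset.sum_comm
    _ = _ := by
        simp only [← TensorProduct.tmul_sum, ← Finset.mul_sum, hC.antipode_antipodeSq]
        simp only [mul_ite, mul_one, mul_zero, TensorProduct.tmul_ite, Finset.sum_ite_eq',
          Finset.mem_univ, if_true]
        rw [Finset.sum_comm]
        rfl

theorem braid_comod (T : Comod k H) (M : AYDMod k H) :
    tensorCoact M.toComod T.twist ∘ₗ braid T.coact M.act.toLinearMap =
      (braid T.coact M.act.toLinearMap).rTensor H ∘ₗ tensorCoact T M.toComod :=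
  LinearMap.ext (braid_comod_aux T M _ rfl)

theorem braid_contra (T : FdComod k H) (N : AYDContra k H)
    (σ : T.toComod →ₗ[k] T.toComod ⊗[k] H)
    (hσ : σ = (antipodeSq k H).lTensor T.toComod ∘ₗ T.toComod.coact)
    (F : H →ₗ[k] T.toComod ⊗[k] N.toContra) :
    braid T.toComod.coact N.act.toLinearMap (contraActL σ N.toContra.act F) =
      contraActR T.toComod.coact N.toContra.act
        (braid T.toComod.coact N.act.toLinearMap ∘ₗ F) := by
  obtain ⟨z, rfl⟩ := canonL_surjective F
  induction z using Comod.induction_left with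
  | zero => simp
  | add x y hx hy => simp only [map_add, LinearMap.comp_add, hx, hy]
  | hv n v C hC hv j φ =>
    have hT : ∀ j, σ (v j) = ∑ l, v l ⊗ₜ[k] antipodeSq k H (C l j) := by
      intro i
      simp [hσ, hv, map_sum]
    have e : braid T.toComod.coact N.act.toLinearMap ∘ₗ canonL H T.toComod N.toContra (v j ⊗ₜ φ) =
        ∑ i, canonR H N.toContra T.toComod ((N.act (C i j) ∘ₗ φ) ⊗ₜ v i) := by
      ext x
      simp [braid_apply _ hv]
    have h1 : ∀ l i, N.act (C l i) (N.toContra.act (φ ∘ₗ LinearMap.mulLeft k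
        (antipodeSq k H (C i j)))) = ∑ p, ∑ q, N.toContra.act (N.act (C p q) ∘ₗ φ ∘ₗ
          LinearMap.mulLeft k (antipodeSq k H (C i j) * HopfAlgebra.antipode k (C q i)) ∘ₗ
            LinearMap.mulRight k (C l p)) := by
      intro l i
      rw [N.compat]
      simp only [← map_sum]
      congr 1
      ext x
      simp [conjAct_apply _ hC, mul_assoc]
    rw [contraActL_tmul hT, e, map_sum, map_sum]
    simp only [braid_apply _ hv, contraActR_tmul hv]
    have h2 : ∀ p q l, ∑ i, N.act (C p q) ∘ₗ φ ∘ₗ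
          LinearMap.mulLeft k (antipodeSq k H (C i j) * HopfAlgebra.antipode k (C q i)) ∘ₗ
            LinearMap.mulRight k (C l p) =
        if q = j then N.act (C p q) ∘ₗ φ ∘ₗ LinearMap.mulRight k (C l p) else 0 := by
      intro p q l
      ext x
      have := congrArg (fun y => N.act (C p q) (φ (y * (x * C l p)))) (hC.antipodeSq_antipode q j)
      simp only [Finset.sum_mul, map_sum] at this
      simp only [LinearMap.sum_apply, LinearMap.comp_apply, LinearMap.mulLeft_apply,
        LinearMap.mulRight_apply]
      refine this.trans ?_
      split_ifs <;> simp
    have h3 : ∀ l, ∑ i, N.act (C l i) (N.toContra.act (φ ∘ₗ LinearMap.mulLeft k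
        (antipodeSq k H (C i j)))) = ∑ p, N.toContra.act (N.act (C p j) ∘ₗ φ ∘ₗ
            LinearMap.mulRight k (C l p)) := by
      intro l
      simp only [h1]
      rw [Finset.sum_comm]
      refine Finset.sum_congr rfl fun p _ => ?_
      rw [Finset.sum_comm]
      simp only [← map_sum, h2]
      simp
    rw [Finset.sum_comm]
    refine (Finset.sum_congr rfl fun l _ => (TensorProduct.sum_tmul _ _ _).symm.trans
      (congrArg (· ⊗ₜ[k] v l) (h3 l))).trans ?_
    simp only [TensorProduct.sum_tmul]
    rw [Finset.sum_comm]
    rfl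

variable (k H) in
/-- The functor that equips an anti-Yetter-Drinfeld module `M` with the central structure
`T ⊗ M → M ⊗ T^{S²}`, `t ⊗ m ↦ t₁ m ⊗ t₀`. -/
def modToCenter : AYDMod k H ⥤ BimoduleCenter (FdComod k H) (Comod k H) where
  obj M :=
    { obj := M.toComod
      β T := Comod.mkIso (M := T.toComod.tensor M.toComod) (N := M.toComod.tensor T.toComod.twist)
        (braidEquiv T.toComod M.act) (braid_comod T.toComod M)
      naturality := fun {X Y} f => Comod.hom_ext (TensorProduct.ext' fun t m =>
        braid_natural (ρ := X.toComod.coact) (ρ' := Y.toComod.coact) M.act.toLinearMap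
          (FdComod.lin f) LinearMap.id
          (Comod.lin_comm (M := X.toComod) (N := Y.toComod) f) (fun _ _ => rfl) t m)
      hexagon := fun X Y => Comod.hom_ext (TensorProduct.ext_threefold fun t s m =>
        (braid_hexagon (ρ := X.toComod.coact) (ρ' := Y.toComod.coact) M.act
          (tensorCoact X.toComod Y.toComod) (fun _ _ => rfl) t s m).trans
            (LinearMap.congr_fun TensorProduct.map_id _).symm)
      unit := Comod.hom_ext (TensorProduct.ext' fun r m =>
        braid_unit M.act (Comod.unit k H).coact (fun _ => rfl) r m) }
  map {M N} f := ⟨AYDMod.hom f, fun T => Comod.hom_ext (TensorProduct.ext' fun t m =>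
    braid_natural (ρ := T.toComod.coact) (ρ' := T.toComod.coact) M.act.toLinearMap (a' := N.act.toLinearMap)
      LinearMap.id (Comod.lin (AYDMod.hom f)) (by simp) (AYDMod.Hom.comm f) t m)⟩

variable (k H) in
/-- The functor that equips an anti-Yetter-Drinfeld contramodule `N` with the central structure
`T^{S²} ⊗ N → N ⊗ T`, `t ⊗ n ↦ t₁ n ⊗ t₀`. -/
def contraToCenter : AYDContra k H ⥤ BimoduleCenter (FdComod k H) (Contra k H) where
  obj N :=
    { obj := N.toContra
      β T := Contra.mkIso (M := Contra.tensorL T.twist N.toContra)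
        (N := Contra.tensorR T N.toContra) (braidEquiv T.toComod N.act)
        (braid_contra T N _ rfl)
      naturality := fun {X Y} f => Contra.hom_ext (TensorProduct.ext' fun t m =>
        braid_natural (ρ := X.toComod.coact) (ρ' := Y.toComod.coact) N.act.toLinearMap
          (FdComod.lin f) LinearMap.id
          (Comod.lin_comm (M := X.toComod) (N := Y.toComod) f) (fun _ _ => rfl) t m)
      hexagon := fun X Y => Contra.hom_ext (TensorProduct.ext_threefold fun t s m =>
        braid_hexagon (ρ := X.toComod.coact) (ρ' := Y.toComod.coact) N.act
          (tensorCoact X.toComod Y.toComod) (fun _ _ => rfl) t s m)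
      unit := Contra.hom_ext (TensorProduct.ext' fun r m =>
        braid_unit N.act (Comod.unit k H).coact (fun _ => rfl) r m) }
  map {M N} f := ⟨AYDContra.hom f, fun T => Contra.hom_ext (TensorProduct.ext' fun t m =>
    braid_natural (ρ := T.toComod.coact) (ρ' := T.toComod.coact) M.act.toLinearMap (a' := N.act.toLinearMap)
      LinearMap.id (Contra.lin (AYDContra.hom f)) (by simp) (AYDContra.Hom.comm f) t m)⟩

end

end AYD

open AYD

/-! Everything rests on one reduction. Each element of a comodule lies in the span of a finite
family v_j with ρ(v_j) = Σ_i v_i ⊗ c_ij for a comatrix (c_ij), so linear identities need only be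
checked on such families and on entries of comatrices. There Sweedler sums become matrix products,
S(c) is the inverse matrix of c, and the transpose of S(c) is again a comatrix. Applying S to S(c)c
= 1 = cS(c) gives the reversed relations Σ_i S(c_ip) S²(c_li) = δ_lp and Σ_i S²(c_ij) S(c_qi) =
δ_qj; they are the reason for the twists by S².

Adjunction. The relation imposed on N' is exactly contralinearity of n ↦ (h ↦ h ⊗ n), and the
contraaction of Hom(H, M)^H is exactly what makes evaluation respect that relation. The triangle
identities then hold by definition (`primeHatAdj`).

Tensor products. For Hom(H, -)^H the comparison maps are built in the direction t ⊗ f ↦ t₀ ⊗ f(S(t₁)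
-) and f ⊗ t ↦ f(- S(t₁)) ⊗ t₀, where every pure tensor is allowed as input. They are inverted by
the shifts by S²(t₁) and t₁; the point needing proof is that these shifts produce components that
are again comodule maps (`hatLeft_component`, `hatRight_component`). For N' both directions are
given by formulas, and the work is to see that they respect the cokernel relation
(`primeLeftAux_rel`, `primeLeftInvAux_rel` and their right versions). The coherence axioms reduce to
anti-multiplicativity of S and associativity of H.

Centers. If the unit of an adjunction between bimodule functors is compatible with the bimodule
structures, the counit is too, as its mate, and both are then morphisms of centers
(`BimoduleFunctor.centerAdj`). Here the compatibility of the unit is the coincidence of two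
formulas. For anti-Yetter–Drinfeld objects one checks instead that unit and counit are H-linear
(`unitLin_act`, `counitLin_act`). Stability is preserved by a short comatrix computation, and stable
objects form full subcategories, so the adjunction restricts.

Equivalences. A central structure on W is turned into an action of H as follows: x in a
finite-dimensional subcomodule D of H acts by applying the counit to the D-component of β_D(x ⊗ w).
Naturality makes this independent of D and, applied to matrix coefficients T → H, shows that β is t
⊗ w ↦ t₁ w ⊗ t₀ (`HalfBraiding.β_eq_braid`). The unit and hexagon axioms make the action unital and
associative. That β_T is a morphism of comodules or contramodules, read off on matrix comodules, is
the anti-Yetter–Drinfeld condition (`aydAct_of_braid`, `conjAct_of_braid`). The squares commute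
because the comparison maps intertwine the two braidings (`hatRight_braid`, `primeRight_braid`). -/

namespace AYD

noncomputable section

variable {k H : Type u} [Field k] [Ring H] [HopfAlgebra k H]

/-! ### The adjunction between comodules and contramodules -/

/-- The map `n ↦ (h ↦ [h ⊗ n])`. -/
def unitLin (N : Contra k H) : N →ₗ[k] hatSubmodule (primeObj N) :=
  LinearMap.codRestrict (hatSubmodule (primeObj N))
    (LinearMap.llcomp k H (H ⊗[k] N) (primeSpace N) (primeMk N) ∘ₗ (TensorProduct.mk k H N).flip)
    -- The coaction of N' involves only the factor h, so h ↦ [h ⊗ n] is a comodule map.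
    fun n => hopf_ext fun m C hC i j => by
      refine (primeCoact_apply hC i j n).trans ?_
      simp only [LinearMap.comp_apply, hC.comul, map_sum]
      rfl

/-- The unit `N → Hom(H, N')^H` of the adjunction. -/
def primeHatUnit (N : Contra k H) : N ⟶ hatObj (primeObj N) where
  lin := unitLin N
  comm φ := Subtype.ext (hopf_ext fun n C hC i j => by
    refine Eq.trans ?_ (hatAct_apply (unitLin N ∘ₗ φ) hC i j).symm
    -- Contralinearity of the unit, evaluated at an entry of a comatrix, is the defining relation of
    -- the cokernel.
    exact primeMk_rel hC i j φ)

/-- The map `[h ⊗ f] ↦ f(h)`. -/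
def counitLin (M : Comod k H) : primeSpace (hatObj M) →ₗ[k] M :=
  primeLift (N := hatObj M) (X := M) (TensorProduct.lift (hatSubmodule M).subtype.flip)
    fun n C hC i j φ => by
      -- Evaluation respects the cokernel relation by the very definition of the contraaction θ ↦ (h
      -- ↦ θ_{h¹}(h²)).
      refine (hatAct_apply (M := M) φ hC i j).trans ?_
      rfl

/-- The counit `(Hom(H, M)^H)' → M` of the adjunction. -/
def primeHatCounit (M : Comod k H) : primeObj (hatObj M) ⟶ M where
  lin := counitLin M
  comm := prime_ext fun n C hC i j f => by
    -- Colinearity of evaluation is colinearity of the functions f being evaluated.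
    refine (hatSubmodule_apply (M := M) f hC i j).trans ?_
    refine Eq.trans ?_ (congrArg ((counitLin M).rTensor H) (primeCoact_apply hC i j f)).symm
    rw [map_sum]
    rfl

variable (k H) in
/-- The functor `N ↦ N'` is left adjoint to `M ↦ Hom(H, M)^H`. -/
def primeHatAdj : prime k H ⊣ hat k H where
  unit :=
    { app := primeHatUnit
      naturality := fun N P f => Contra.hom_ext (LinearMap.ext fun n => rfl) }
  counit :=
    { app := primeHatCounit
      naturality := fun M P f => Comod.hom_ext (prime_ext fun n C hC i j w => rfl) }
  -- Both triangles are definitional: evaluating h' ↦ [h' ⊗ n] at h returns [h ⊗ n], and h ↦ [h ⊗ φ]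
  -- evaluates back to φ.
  left_triangle_components N := Comod.hom_ext (prime_ext fun n C hC i j w => rfl)
  right_triangle_components M := Contra.hom_ext (LinearMap.ext fun φ => rfl)

end
end AYD

/-! ### Bimodule functors presented by the inverse structure maps; coordinates in a finite basis. -/

namespace AYD

noncomputable section

section InverseForm

universe v₁ u₁ v₂ u₂ v₃ u₃

open MonoidalLeftAction MonoidalRightAction BimoduleCategory

variable {C : Type u₁} [Category.{v₁} C] [MonoidalCategory C]
  {D : Type u₂} [Category.{v₂} D] [MonoidalLeftAction C D] [MonoidalRightAction C D]
  [BimoduleCategory C D]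
  {E : Type u₃} [Category.{v₃} E] [MonoidalLeftAction C E] [MonoidalRightAction C E]
  [BimoduleCategory C E]

/-- A bimodule functor structure given by isomorphisms `X · F M ≅ F (X · M)` and
`F M · Y ≅ F (M · Y)`. -/
def BimoduleFunctor.ofInverse (F : D ⥤ E)
    (l : ∀ (X : C) (M : D), X ⊙ₗ F.obj M ≅ F.obj (X ⊙ₗ M))
    (r : ∀ (M : D) (Y : C), F.obj M ⊙ᵣ Y ≅ F.obj (M ⊙ᵣ Y))
    (l_natural : ∀ {X X' : C} {M M' : D} (f : X ⟶ X') (g : M ⟶ M'),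
      (f ⊙ₗₘ F.map g) ≫ (l X' M').hom = (l X M).hom ≫ F.map (f ⊙ₗₘ g))
    (r_natural : ∀ {M M' : D} {Y Y' : C} (g : M ⟶ M') (f : Y ⟶ Y'),
      (F.map g ⊙ᵣₘ f) ≫ (r M' Y').hom = (r M Y).hom ≫ F.map (g ⊙ᵣₘ f))
    (l_assoc : ∀ (X X' : C) (M : D),
      (αₗ X X' (F.obj M)).hom ≫ X ⊴ₗ (l X' M).hom ≫ (l X (X' ⊙ₗ M)).hom =
        (l (X ⊗ X') M).hom ≫ F.map (αₗ X X' M).hom)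
    (l_unit : ∀ M : D, (λₗ (F.obj M)).hom = (l (𝟙_ C) M).hom ≫ F.map (λₗ M).hom)
    (r_assoc : ∀ (M : D) (Y Y' : C),
      (αᵣ (F.obj M) Y Y').hom ≫ (r M Y).hom ⊵ᵣ Y' ≫ (r (M ⊙ᵣ Y) Y').hom =
        (r M (Y ⊗ Y')).hom ≫ F.map (αᵣ M Y Y').hom)
    (r_unit : ∀ M : D, (ρᵣ (F.obj M)).hom = (r M (𝟙_ C)).hom ≫ F.map (ρᵣ M).hom)
    (mid_comp : ∀ (X : C) (M : D) (Y : C),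
      (l X M).hom ⊵ᵣ Y ≫ (r (X ⊙ₗ M) Y).hom ≫ F.map (mid X M Y).hom =
        (mid X (F.obj M) Y).hom ≫ X ⊴ₗ (r M Y).hom ≫ (l X (M ⊙ᵣ Y)).hom) :
    BimoduleFunctor C F where
  left X M := (l X M).symm
  right M Y := (r M Y).symm
  -- Each axiom is the matching hypothesis with the isomorphisms moved to the other side of the
  -- equation.
  left_naturality f g := by
    rw [Iso.symm_hom, Iso.symm_hom, Iso.eq_inv_comp, ← reassoc_of% l_natural f g]
    simp
  right_naturality g f := by
    rw [Iso.symm_hom, Iso.symm_hom, Iso.eq_inv_comp, ← reassoc_of% r_natural g f]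
    simp
  left_assoc X X' M := by
    simp only [Iso.symm_hom]
    rw [Iso.eq_inv_comp, ← reassoc_of% l_assoc X X' M]
    simp [← MonoidalLeftAction.actionHomRight_comp]
  left_unit M := by
    rw [Iso.symm_hom, Iso.inv_comp_eq, l_unit]
  right_assoc M Y Y' := by
    simp only [Iso.symm_hom]
    rw [Iso.eq_inv_comp, ← reassoc_of% r_assoc M Y Y']
    simp [← MonoidalRightAction.comp_actionHomLeft]
  right_unit M := by
    rw [Iso.symm_hom, Iso.inv_comp_eq, r_unit]
  middle X M Y := by
    simp only [Iso.symm_hom]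
    -- Precomposing with the isomorphism `(l X M).hom ⊵ᵣ Y` produces the left-hand side of
    -- `mid_comp`; afterwards all inverses cancel.
    rw [Iso.eq_inv_comp, ← cancel_epi ((l X M).hom ⊵ᵣ Y), reassoc_of% mid_comp X M Y,
      ← MonoidalRightAction.comp_actionHomLeft_assoc, Iso.hom_inv_id]
    simp [← MonoidalLeftAction.actionHomRight_comp]

end InverseForm

variable {k H : Type u} [Field k] [Ring H] [HopfAlgebra k H]

/-! ### Coefficients with respect to a basis -/

section Basis

variable {V W : Type u} [AddCommGroup V] [Module k V] [AddCommGroup W] [Module k W]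
  {ι : Type} [Fintype ι] (b : Module.Basis ι k V)

/-- The coefficient at `b i` of an element of `V ⊗ W`. -/
def leftCoeff (i : ι) : V ⊗[k] W →ₗ[k] W :=
  (TensorProduct.lid k W).toLinearMap ∘ₗ (b.coord i).rTensor W

/-- The coefficient at `b i` of an element of `W ⊗ V`. -/
def rightCoeff (i : ι) : W ⊗[k] V →ₗ[k] W :=
  (TensorProduct.rid k W).toLinearMap ∘ₗ (b.coord i).lTensor W

variable [DecidableEq ι]

@[simp] theorem leftCoeff_tmul (i j : ι) (w : W) :
    leftCoeff b i (b j ⊗ₜ[k] w) = if j = i then w else 0 := by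
  simp [leftCoeff, Finsupp.single_apply]

@[simp] theorem rightCoeff_tmul (i j : ι) (w : W) :
    rightCoeff b i (w ⊗ₜ[k] b j) = if j = i then w else 0 := by
  simp [rightCoeff, Finsupp.single_apply]

theorem sum_leftCoeff (z : V ⊗[k] W) : ∑ i, b i ⊗ₜ[k] leftCoeff b i z = z := by
  induction z with
  | zero => simp
  | add x y hx hy => simp only [map_add, TensorProduct.tmul_add, Finset.sum_add_distrib, hx, hy]
  | tmul v w =>
    simp only [leftCoeff, LinearMap.comp_apply, LinearMap.rTensor_tmul, LinearEquiv.coe_coe,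
      TensorProduct.lid_tmul, TensorProduct.tmul_smul, TensorProduct.smul_tmul',
      ← TensorProduct.sum_tmul, Module.Basis.coord_apply, Module.Basis.sum_repr]

theorem sum_rightCoeff (z : W ⊗[k] V) : ∑ i, rightCoeff b i z ⊗ₜ[k] b i = z := by
  induction z with
  | zero => simp
  | add x y hx hy => simp only [map_add, TensorProduct.add_tmul, Finset.sum_add_distrib, hx, hy]
  | tmul w v =>
    simp only [rightCoeff, LinearMap.comp_apply, LinearMap.lTensor_tmul, LinearEquiv.coe_coe,
      TensorProduct.rid_tmul, TensorProduct.smul_tmul,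
      ← TensorProduct.tmul_sum, Module.Basis.coord_apply, Module.Basis.sum_repr]

/-- This and its right-hand version are how matrix entries are read off: one identity in a tensor
product yields one identity for each basis vector. -/
theorem tmul_left_injective {x y : ι → W} (h : ∑ i, b i ⊗ₜ[k] x i = ∑ i, b i ⊗ₜ[k] y i) :
    x = y := by
  ext i
  simpa [map_sum] using congrArg (leftCoeff b i) h

theorem tmul_right_injective {x y : ι → W} (h : ∑ i, x i ⊗ₜ[k] b i = ∑ i, y i ⊗ₜ[k] b i) :
    x = y := by
  ext i
  simpa [map_sum] using congrArg (rightCoeff b i) h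

/-- The coaction of a comodule is given on a finite basis by a comatrix. -/
theorem Comod.exists_basis_comatrix (M : Comod k H) (b : Module.Basis ι k M) :
    ∃ C : ι → ι → H, IsComatrix k C ∧ ∀ j, M.coact (b j) = ∑ i, b i ⊗ₜ[k] C i j := by
  have hC : ∀ j, M.coact (b j) = ∑ i, b i ⊗ₜ[k] leftCoeff b i (M.coact (b j)) :=
    fun j => (sum_leftCoeff b _).symm
  -- The coefficients are defined through the very coaction that `hC` rewrites, so they are made
  -- opaque to keep the rewriting from looping.
  generalize hc : (fun i j => leftCoeff b i (M.coact (b j))) = C at *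
  have hC : ∀ j, M.coact (b j) = ∑ i, b i ⊗ₜ[k] C i j := fun j => by rw [← hc]; exact hC j
  refine ⟨C, ⟨fun i j => ?_, fun i j => ?_⟩, hC⟩
  -- Comparing coefficients of b_i in coassociativity at b_j gives Δ c_ij; the counit axiom gives ε
  -- c_ij in the same way.
  · have h := LinearMap.congr_fun M.coassoc (b j)
    simp only [LinearMap.comp_apply, LinearEquiv.coe_coe, hC, map_sum, LinearMap.rTensor_tmul,
      TensorProduct.sum_tmul, TensorProduct.assoc_tmul, LinearMap.lTensor_tmul] at h
    rw [Finset.sum_comm] at h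
    simp only [← TensorProduct.tmul_sum] at h
    exact (congrFun (tmul_left_injective b h) i).symm
  · have h := congrArg (fun m => b.repr m i) (LinearMap.congr_fun M.counit (b j))
    simpa [hC, map_sum, Finsupp.single_apply, eq_comm] using h

end Basis
end
end AYD

namespace AYD

noncomputable section

variable {k H : Type u} [Field k] [Ring H] [HopfAlgebra k H]

/-! ### The functor `M ↦ Hom(H, M)^H` and tensor products -/

section Shift

variable {V W : Type u} [AddCommGroup V] [Module k V] [AddCommGroup W] [Module k W]
  {ρ : V →ₗ[k] V ⊗[k] H}

/-- The map g makes one formula serve for the shifts by S(t₁) and by S²(t₁). -/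
theorem shiftL_tmul {ι : Type} [Fintype ι] {v : ι → V} {C : ι → ι → H}
    (hv : ∀ j, ρ (v j) = ∑ i, v i ⊗ₜ[k] C i j) (g : H →ₗ[k] H) (j : ι) (f : H →ₗ[k] W) :
    shiftL (g.lTensor V ∘ₗ ρ) W (v j ⊗ₜ f) =
      ∑ i, v i ⊗ₜ[k] (f ∘ₗ LinearMap.mulLeft k (g (C i j))) := by
  simp only [shiftL, TensorProduct.lift.tmul, LinearMap.mk₂_apply, LinearMap.comp_apply, hv,
    map_sum, LinearMap.lTensor_tmul]
  rfl

theorem shiftR_tmul {ι : Type} [Fintype ι] {v : ι → V} {C : ι → ι → H}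
    (hv : ∀ j, ρ (v j) = ∑ i, v i ⊗ₜ[k] C i j) (j : ι) (f : H →ₗ[k] W) :
    shiftR ρ W (f ⊗ₜ v j) = ∑ i, (f ∘ₗ LinearMap.mulRight k (C i j)) ⊗ₜ[k] v i := by
  simp only [shiftR, TensorProduct.lift.tmul, LinearMap.mk₂_apply, LinearMap.comp_apply, hv,
    map_sum, LinearMap.lTensor_tmul]
  rfl

/-- Supplies the matrix hypothesis of `shiftR_tmul` and `contraActL_tmul` for a coaction followed by
S or S². -/
theorem lTensor_coeff {ι : Type} [Fintype ι] {v : ι → V} {C : ι → ι → H}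
    (hv : ∀ j, ρ (v j) = ∑ i, v i ⊗ₜ[k] C i j) (g : H →ₗ[k] H) (j : ι) :
    (g.lTensor V ∘ₗ ρ) (v j) = ∑ i, v i ⊗ₜ[k] g (C i j) := by
  simp [hv, map_sum]

end Shift

section ShiftInverse

variable (T : Comod k H) {W : Type u} [AddCommGroup W] [Module k W]

/-- Left shifts compose by multiplying coefficients inside the argument of f, here to Σ_i S(c_ij)
S²(c_li). This is S applied to Σ_i S(c_li) c_ij = δ_lj. The next lemma uses the other order, S
applied to c S(c) = 1. -/
theorem shiftL_antipodeSq_antipode (z : T ⊗[k] (H →ₗ[k] W)) :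
    shiftL ((antipodeSq k H).lTensor T ∘ₗ T.coact) W
      (shiftL ((HopfAlgebra.antipode k).lTensor T ∘ₗ T.coact) W z) = z := by
  induction z using Comod.induction_left with
  | zero => simp
  | add x y hx hy => simp only [map_add, hx, hy]
  | hv n v C hC hv j f =>
    simp only [shiftL_tmul hv, map_sum]
    rw [Finset.sum_comm]
    have : ∀ l, ∑ i, (f ∘ₗ LinearMap.mulLeft k (HopfAlgebra.antipode k (C i j))) ∘ₗ
        LinearMap.mulLeft k (antipodeSq k H (C l i)) = if l = j then f else 0 := by
      intro l
      ext x
      have := congrArg (fun y => f (y * x)) (hC.antipode_antipodeSq j l)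
      simp only [Finset.sum_mul, map_sum] at this
      simp only [LinearMap.sum_apply, LinearMap.comp_apply, LinearMap.mulLeft_apply, ← mul_assoc]
      refine this.trans ?_
      split_ifs <;> simp
    simp only [← TensorProduct.tmul_sum, this]
    simp [TensorProduct.tmul_ite]

theorem shiftL_antipode_antipodeSq (z : T ⊗[k] (H →ₗ[k] W)) :
    shiftL ((HopfAlgebra.antipode k).lTensor T ∘ₗ T.coact) W
      (shiftL ((antipodeSq k H).lTensor T ∘ₗ T.coact) W z) = z := by
  induction z using Comod.induction_left with
  | zero => simp
  | add x y hx hy => simp only [map_add, hx, hy]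
  | hv n v C hC hv j f =>
    simp only [shiftL_tmul hv, map_sum]
    rw [Finset.sum_comm]
    have : ∀ l, ∑ i, (f ∘ₗ LinearMap.mulLeft k (antipodeSq k H (C i j))) ∘ₗ
        LinearMap.mulLeft k (HopfAlgebra.antipode k (C l i)) = if l = j then f else 0 := by
      intro l
      ext x
      have := congrArg (fun y => f (y * x)) (hC.antipodeSq_antipode l j)
      simp only [Finset.sum_mul, map_sum] at this
      simp only [LinearMap.sum_apply, LinearMap.comp_apply, LinearMap.mulLeft_apply, ← mul_assoc]
      refine this.trans ?_
      split_ifs <;> simp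
    simp only [← TensorProduct.tmul_sum, this]
    simp [TensorProduct.tmul_ite]

/-- On the right the coefficients multiply in the opposite order, so the shift by S(t₁) is undone by
the shift by t₁ itself, through c S(c) = 1 here and S(c) c = 1 in the next lemma. -/
theorem shiftR_coact_antipode (z : (H →ₗ[k] W) ⊗[k] T) :
    shiftR T.coact W (shiftR ((HopfAlgebra.antipode k).lTensor T ∘ₗ T.coact) W z) = z := by
  induction z using Comod.induction_right with
  | zero => simp
  | add x y hx hy => simp only [map_add, hx, hy]
  | hv n v C hC hv j f =>
    simp only [shiftR_tmul (lTensor_coeff hv (HopfAlgebra.antipode k)), shiftR_tmul hv, map_sum]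
    rw [Finset.sum_comm]
    have : ∀ l, ∑ i, (f ∘ₗ LinearMap.mulRight k (HopfAlgebra.antipode k (C i j))) ∘ₗ
        LinearMap.mulRight k (C l i) = if l = j then f else 0 := by
      intro l
      ext x
      have := congrArg (fun y => f (x * y)) (hC.mul_antipode l j)
      simp only [Finset.mul_sum, map_sum] at this
      simp only [LinearMap.sum_apply, LinearMap.comp_apply, LinearMap.mulRight_apply, mul_assoc]
      refine this.trans ?_
      split_ifs <;> simp
    simp only [← TensorProduct.sum_tmul, this]
    simp [TensorProduct.ite_tmul]

theorem shiftR_antipode_coact (z : (H →ₗ[k] W) ⊗[k] T) :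
    shiftR ((HopfAlgebra.antipode k).lTensor T ∘ₗ T.coact) W (shiftR T.coact W z) = z := by
  induction z using Comod.induction_right with
  | zero => simp
  | add x y hx hy => simp only [map_add, hx, hy]
  | hv n v C hC hv j f =>
    simp only [shiftR_tmul (lTensor_coeff hv (HopfAlgebra.antipode k)), shiftR_tmul hv, map_sum]
    rw [Finset.sum_comm]
    have : ∀ l, ∑ i, (f ∘ₗ LinearMap.mulRight k (C i j)) ∘ₗ
        LinearMap.mulRight k (HopfAlgebra.antipode k (C l i)) = if l = j then f else 0 := by
      intro l
      ext x
      have := congrArg (fun y => f (x * y)) (hC.antipode_mul l j)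
      simp only [Finset.mul_sum, map_sum] at this
      simp only [LinearMap.sum_apply, LinearMap.comp_apply, LinearMap.mulRight_apply, mul_assoc]
      refine this.trans ?_
      split_ifs <;> simp
    simp only [← TensorProduct.sum_tmul, this]
    simp [TensorProduct.ite_tmul]

end ShiftInverse

/-- Only T is put into comatrix form. The coaction of m stays unexpanded, so that the coaction of a
value of a comodule map H → M can be substituted later. -/
theorem tensorCoact_left {T M : Comod k H} {ι : Type} [Fintype ι] {v : ι → T} {C : ι → ι → H}
    (hv : ∀ j, T.coact (v j) = ∑ i, v i ⊗ₜ[k] C i j) (j : ι) (m : M) :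
    tensorCoact T M (v j ⊗ₜ m) = ∑ i, TensorProduct.map (TensorProduct.mk k T M (v i))
      (LinearMap.mulLeft k (C i j)) (M.coact m) := by
  rw [tensorCoact_tmul, hv]
  generalize M.coact m = z
  induction z with
  | zero => simp
  | add x y hx hy => simp only [map_add, TensorProduct.tmul_add, Finset.sum_add_distrib, hx, hy]
  | tmul a b => simp [TensorProduct.sum_tmul, map_sum]

theorem tensorCoact_right {M T : Comod k H} {ι : Type} [Fintype ι] {v : ι → T} {C : ι → ι → H}
    (hv : ∀ j, T.coact (v j) = ∑ i, v i ⊗ₜ[k] C i j) (m : M) (j : ι) :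
    tensorCoact M T (m ⊗ₜ v j) = ∑ i, TensorProduct.map ((TensorProduct.mk k M T).flip (v i))
      (LinearMap.mulRight k (C i j)) (M.coact m) := by
  rw [tensorCoact_tmul, hv]
  generalize M.coact m = z
  induction z with
  | zero => simp
  | add x y hx hy => simp only [map_add, TensorProduct.add_tmul, Finset.sum_add_distrib, hx, hy]
  | tmul a b => simp [TensorProduct.tmul_sum, map_sum]

theorem Comod.twist_coact {T : Comod k H} {ι : Type} [Fintype ι] {v : ι → T} {C : ι → ι → H}
    (hv : ∀ j, T.coact (v j) = ∑ i, v i ⊗ₜ[k] C i j) (j : ι) :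
    T.twist.coact (v j) = ∑ i, v i ⊗ₜ[k] antipodeSq k H (C i j) :=
  lTensor_coeff hv (antipodeSq k H) j

/-- The coaction on `M ⊗ T^{S²}`, as a map defined on `M ⊗ T`. -/
def tensorTwistCoact (M T : Comod k H) : M ⊗[k] T →ₗ[k] (M ⊗[k] T) ⊗[k] H :=
  tensorCoact M T.twist

theorem tensorTwistCoact_right {M T : Comod k H} {ι : Type} [Fintype ι] {v : ι → T}
    {C : ι → ι → H} (hv : ∀ j, T.coact (v j) = ∑ i, v i ⊗ₜ[k] C i j) (m : M) (j : ι) :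
    tensorTwistCoact M T (m ⊗ₜ v j) = ∑ i, TensorProduct.map
      ((TensorProduct.mk k M T).flip (v i)) (LinearMap.mulRight k (antipodeSq k H (C i j)))
        (M.coact m) :=
  tensorCoact_right (T := T.twist) (v := v) (Comod.twist_coact hv) m j

section HatTensor

variable (T : Comod k H) (M : Comod k H)

/-- The map `t ⊗ f ↦ t₀ ⊗ f(S(t₁) -)` from `T ⊗ Hom(H, M)^H` to `Hom(H, T ⊗ M)`. -/
def hatLeftAux : T ⊗[k] hatSubmodule M →ₗ[k] H →ₗ[k] T ⊗[k] M :=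
  canonL H T M ∘ₗ shiftL ((HopfAlgebra.antipode k).lTensor T ∘ₗ T.coact) M ∘ₗ
    (hatSubmodule M).subtype.lTensor T

variable {T M} in
theorem hatLeftAux_tmul {ι : Type} [Fintype ι] {v : ι → T} {C : ι → ι → H}
    (hv : ∀ j, T.coact (v j) = ∑ i, v i ⊗ₜ[k] C i j) (j : ι) (φ : hatSubmodule M) (x : H) :
    hatLeftAux T M (v j ⊗ₜ φ) x =
      ∑ i, v i ⊗ₜ[k] φ.1 (HopfAlgebra.antipode k (C i j) * x) := by
  simp [hatLeftAux, shiftL_tmul hv, map_sum]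

/-- The coaction of T contributes c_pi, and that of φ at S(c_ij) h contributes S(c_il) h². Their
product summed over i leaves h² alone. -/
theorem hatLeftAux_mem (z : T ⊗[k] hatSubmodule M) :
    hatLeftAux T M z ∈ hatSubmodule (T.tensor M) := by
  induction z using Comod.induction_left with
  | zero => rw [map_zero]; exact zero_mem _
  | add x y hx hy => rw [map_add]; exact add_mem hx hy
  | hv n v C hC hv j φ =>
    refine hopf_ext fun m D hD a b => ?_
    change tensorCoact T M (hatLeftAux T M (v j ⊗ₜ φ) (D a b)) =
      (hatLeftAux T M (v j ⊗ₜ φ)).rTensor H (Coalgebra.comul (D a b))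
    -- S(c_ij) d_ab is the entry ((j, a), (i, b)) of the product of the comatrices S(c)ᵗ and d, so
    -- colinearity of φ applies to it directly.
    have h1 : ∀ i, M.coact (φ.1 (HopfAlgebra.antipode k (C i j) * D a b)) =
        ∑ l, ∑ d, φ.1 (HopfAlgebra.antipode k (C l j) * D a d) ⊗ₜ[k]
          (HopfAlgebra.antipode k (C i l) * D d b) := fun i =>
      (hatSubmodule_apply φ (hC.antipode.mul hD) (j, a) (i, b)).trans (Fintype.sum_prod_type _)
    rw [hatLeftAux_tmul hv, map_sum]
    simp only [tensorCoact_left hv, h1, map_sum, TensorProduct.map_tmul, hD.comul,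
      LinearMap.rTensor_tmul, hatLeftAux_tmul hv, TensorProduct.sum_tmul]
    have h2 : ∀ p l d, ∑ i, (v p ⊗ₜ[k] φ.1 (HopfAlgebra.antipode k (C l j) * D a d)) ⊗ₜ[k]
        (C p i * (HopfAlgebra.antipode k (C i l) * D d b)) = if p = l then
          (v p ⊗ₜ[k] φ.1 (HopfAlgebra.antipode k (C l j) * D a d)) ⊗ₜ[k] D d b else 0 := by
      intro p l d
      simp only [← mul_assoc, ← TensorProduct.tmul_sum, ← Finset.sum_mul, hC.mul_antipode]
      split_ifs <;> simp
    rw [Finset.sum_comm]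
    calc _ = ∑ p, ∑ l, ∑ d, ∑ i, (v p ⊗ₜ[k] φ.1 (HopfAlgebra.antipode k (C l j) * D a d)) ⊗ₜ[k]
        (C p i * (HopfAlgebra.antipode k (C i l) * D d b)) := by
          refine Finset.sum_congr rfl fun p _ => ?_
          rw [Finset.sum_comm]
          exact Finset.sum_congr rfl fun l _ => Finset.sum_comm
      _ = _ := by
          simp only [h2, Finset.sum_ite_irrel, Finset.sum_const_zero, Finset.sum_ite_eq,
            Finset.mem_univ, if_true]
          rw [Finset.sum_comm]

/-- The map `t ⊗ f ↦ t₀ ⊗ f(S(t₁) -)` from `T ⊗ Hom(H, M)^H` to `Hom(H, T ⊗ M)^H`. -/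
def hatLeft : T ⊗[k] hatSubmodule M →ₗ[k] hatSubmodule (T.tensor M) :=
  LinearMap.codRestrict (hatSubmodule (T.tensor M)) (hatLeftAux T M) (hatLeftAux_mem T M)

variable {T M} in
theorem hatLeft_tmul {ι : Type} [Fintype ι] {v : ι → T} {C : ι → ι → H}
    (hv : ∀ j, T.coact (v j) = ∑ i, v i ⊗ₜ[k] C i j) (j : ι) (φ : hatSubmodule M) (x : H) :
    (hatLeft T M (v j ⊗ₜ φ)).1 x =
      ∑ i, v i ⊗ₜ[k] φ.1 (HopfAlgebra.antipode k (C i j) * x) := hatLeftAux_tmul hv j φ x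

/-- The map `f ⊗ t ↦ f(- S(t₁)) ⊗ t₀` from `Hom(H, M)^H ⊗ T` to `Hom(H, M ⊗ T)`. -/
def hatRightAux : hatSubmodule M ⊗[k] T →ₗ[k] H →ₗ[k] M ⊗[k] T :=
  canonR H M T ∘ₗ shiftR ((HopfAlgebra.antipode k).lTensor T ∘ₗ T.coact) M ∘ₗ
    (hatSubmodule M).subtype.rTensor T

variable {T M} in
theorem hatRightAux_tmul {ι : Type} [Fintype ι] {v : ι → T} {C : ι → ι → H}
    (hv : ∀ j, T.coact (v j) = ∑ i, v i ⊗ₜ[k] C i j) (φ : hatSubmodule M) (j : ι) (x : H) :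
    hatRightAux T M (φ ⊗ₜ v j) x =
      ∑ i, φ.1 (x * HopfAlgebra.antipode k (C i j)) ⊗ₜ[k] v i := by
  simp [hatRightAux, shiftR_tmul (lTensor_coeff hv (HopfAlgebra.antipode k)), map_sum]

/-- Here the coefficient of T stands to the right of S(c_il). It must be S²(c_pi) for the sum over i
to collapse, which is why the right factor carries the twist. -/
theorem hatRightAux_mem (z : hatSubmodule M ⊗[k] T) :
    hatRightAux T M z ∈ hatSubmodule (M.tensor T.twist) := by
  induction z using Comod.induction_right with
  | zero => rw [map_zero]; exact zero_mem _
  | add x y hx hy => rw [map_add]; exact add_mem hx hy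
  | hv n v C hC hv j φ =>
    refine hopf_ext fun m D hD a b => ?_
    change tensorTwistCoact M T (hatRightAux T M (φ ⊗ₜ v j) (D a b)) =
      (hatRightAux T M (φ ⊗ₜ v j)).rTensor H (Coalgebra.comul (D a b))
    have h1 : ∀ i, M.coact (φ.1 (D a b * HopfAlgebra.antipode k (C i j))) =
        ∑ d, ∑ l, φ.1 (D a d * HopfAlgebra.antipode k (C l j)) ⊗ₜ[k]
          (D d b * HopfAlgebra.antipode k (C i l)) := fun i =>
      (hatSubmodule_apply φ (hD.mul hC.antipode) (a, j) (b, i)).trans (Fintype.sum_prod_type _)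
    have h2 : ∀ p d l, ∑ i, (φ.1 (D a d * HopfAlgebra.antipode k (C l j)) ⊗ₜ[k] v p) ⊗ₜ[k]
        (D d b * HopfAlgebra.antipode k (C i l) * antipodeSq k H (C p i)) = if p = l then
          (φ.1 (D a d * HopfAlgebra.antipode k (C l j)) ⊗ₜ[k] v p) ⊗ₜ[k] D d b else 0 := by
      intro p d l
      simp only [mul_assoc, ← TensorProduct.tmul_sum, ← Finset.mul_sum, hC.antipode_antipodeSq]
      split_ifs <;> simp
    rw [hatRightAux_tmul hv, map_sum]
    simp only [tensorTwistCoact_right hv, h1, map_sum, TensorProduct.map_tmul, hD.comul,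
      LinearMap.rTensor_tmul, hatRightAux_tmul hv, TensorProduct.sum_tmul]
    rw [Finset.sum_comm]
    calc _ = ∑ p, ∑ d, ∑ l, ∑ i, (φ.1 (D a d * HopfAlgebra.antipode k (C l j)) ⊗ₜ[k] v p) ⊗ₜ[k]
        (D d b * HopfAlgebra.antipode k (C i l) * antipodeSq k H (C p i)) := by
          refine Finset.sum_congr rfl fun p _ => ?_
          rw [Finset.sum_comm]
          exact Finset.sum_congr rfl fun l _ => Finset.sum_comm
      _ = _ := by
          simp only [h2, Finset.sum_ite_eq, Finset.mem_univ, if_true]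
          rw [Finset.sum_comm]

/-- The map `f ⊗ t ↦ f(- S(t₁)) ⊗ t₀` from `Hom(H, M)^H ⊗ T` to `Hom(H, M ⊗ T^{S²})^H`. -/
def hatRight : hatSubmodule M ⊗[k] T →ₗ[k] hatSubmodule (M.tensor T.twist) :=
  LinearMap.codRestrict (hatSubmodule (M.tensor T.twist)) (hatRightAux T M) (hatRightAux_mem T M)

variable {T M} in
theorem hatRight_tmul {ι : Type} [Fintype ι] {v : ι → T} {C : ι → ι → H}
    (hv : ∀ j, T.coact (v j) = ∑ i, v i ⊗ₜ[k] C i j) (φ : hatSubmodule M) (j : ι) (x : H) :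
    (hatRight T M (φ ⊗ₜ v j)).1 x =
      ∑ i, φ.1 (x * HopfAlgebra.antipode k (C i j)) ⊗ₜ[k] v i := hatRightAux_tmul hv φ j x

end HatTensor

end
end AYD

/-! ### Bijectivity and contralinearity of the comparison maps for Hom(H, -)^H. -/

namespace AYD

noncomputable section

variable {k H : Type u} [Field k] [Ring H] [HopfAlgebra k H]

section HatTensorEquiv

variable {M : Comod k H}

/-- If `∑ v_j ⊗ f_j` is a comodule map `H → T ⊗ M`, then `∑ f_j(S²(C_ij) -)` is one for all `i`. -/
theorem hatLeft_component {T : Comod k H} {ι : Type} [Fintype ι] [DecidableEq ι]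
    (v : Module.Basis ι k T) {C : ι → ι → H} (hC : IsComatrix k C)
    (hv : ∀ j, T.coact (v j) = ∑ i, v i ⊗ₜ[k] C i j) (f : ι → H →ₗ[k] M)
    (hf : ∑ j, canonL H T M (v j ⊗ₜ f j) ∈ hatSubmodule (T.tensor M)) (i : ι) :
    ∑ j, f j ∘ₗ LinearMap.mulLeft k (antipodeSq k H (C i j)) ∈ hatSubmodule M := by
  -- The coefficient of v_i in colinearity of Σ v_j ⊗ f_j is a linear system for the ρ(f_j x), with
  -- matrix c acting by left multiplication on the factor H.
  have h1 : ∀ x i, ∑ j, (LinearMap.mulLeft k (C i j)).lTensor M (M.coact (f j x)) =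
      (f i).rTensor H (Coalgebra.comul x) := by
    intro x i
    have e : tensorCoact T M ((∑ j, canonL H T M (v j ⊗ₜ f j)) x) =
        (∑ j, canonL H T M (v j ⊗ₜ f j)).rTensor H (Coalgebra.comul x) :=
      LinearMap.congr_fun hf x
    have e2 := congrArg ((leftCoeff (W := M) v i).rTensor H) e
    rw [← LinearMap.rTensor_comp_apply H (leftCoeff (W := M) v i)
      (∑ j, canonL H T M (v j ⊗ₜ f j))] at e2
    have e3 : leftCoeff v i ∘ₗ ∑ j, canonL H T M (v j ⊗ₜ f j) = f i := by
      ext y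
      simp [LinearMap.sum_apply, map_sum]
    have e4 : ∀ j (z : M ⊗[k] H), (leftCoeff (W := M) v i).rTensor H
        (∑ l, TensorProduct.map (TensorProduct.mk k T M (v l)) (LinearMap.mulLeft k (C l j)) z) =
          (LinearMap.mulLeft k (C i j)).lTensor M z := by
      intro j z
      induction z with
      | zero => simp
      | add x y hx hy => simp only [map_add, Finset.sum_add_distrib, hx, hy]
      | tmul a b => simp [map_sum, TensorProduct.ite_tmul]
    rw [e3] at e2
    rw [← e2]
    simp only [LinearMap.sum_apply, canonL_tmul, map_sum, tensorCoact_left hv]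
    exact Finset.sum_congr rfl fun j _ => by rw [← map_sum, e4]
  -- The system is solved by the inverse matrix S(c).
  have h2 : ∀ x j, M.coact (f j x) = ∑ p, (LinearMap.mulLeft k (HopfAlgebra.antipode k
      (C j p))).lTensor M ((f p).rTensor H (Coalgebra.comul x)) := by
    intro x j
    simp only [← h1, map_sum]
    rw [Finset.sum_comm]
    have e5 : ∀ l (z : M ⊗[k] H), ∑ p, (LinearMap.mulLeft k (HopfAlgebra.antipode k
        (C j p))).lTensor M ((LinearMap.mulLeft k (C p l)).lTensor M z) =
          if j = l then z else 0 := by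
      intro l z
      induction z with
      | zero => simp
      | add x y hx hy =>
        simp only [map_add, Finset.sum_add_distrib, hx, hy]
        split_ifs <;> simp
      | tmul a b =>
        simp only [LinearMap.lTensor_tmul, LinearMap.mulLeft_apply, ← mul_assoc,
          ← TensorProduct.tmul_sum, ← Finset.sum_mul, hC.antipode_mul]
        split_ifs <;> simp
    simp [e5]
  refine hopf_ext fun m D hD a b => ?_
  simp only [LinearMap.comp_apply, LinearMap.sum_apply, LinearMap.mulLeft_apply, hD.comul,
    map_sum, LinearMap.rTensor_tmul, h2]
  have e6 : ∀ j, Coalgebra.comul (R := k) (antipodeSq k H (C i j) * D a b) =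
      ∑ l, ∑ d, (antipodeSq k H (C i l) * D a d) ⊗ₜ[k] (antipodeSq k H (C l j) * D d b) :=
    fun j => ((hC.antipodeSq.mul hD).comul (i, a) (j, b)).trans (Fintype.sum_prod_type _)
  simp only [e6, map_sum, LinearMap.rTensor_tmul, LinearMap.lTensor_tmul, LinearMap.mulLeft_apply,
    TensorProduct.sum_tmul]
  -- The coproduct of S²(c_ij) h places S²(c_lj) to the right of S(c_jp); the sum over j is δ_lp.
  -- This selects S² as the correct shift.
  have e7 : ∀ p l d, ∑ j, f p (antipodeSq k H (C i l) * D a d) ⊗ₜ[k]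
      (HopfAlgebra.antipode k (C j p) * (antipodeSq k H (C l j) * D d b)) =
        if l = p then f p (antipodeSq k H (C i l) * D a d) ⊗ₜ[k] D d b else 0 := by
    intro p l d
    simp only [← mul_assoc, ← TensorProduct.tmul_sum, ← Finset.sum_mul, hC.antipode_antipodeSq]
    split_ifs <;> simp
  rw [Finset.sum_comm]
  calc _ = ∑ p, ∑ l, ∑ d, ∑ j, f p (antipodeSq k H (C i l) * D a d) ⊗ₜ[k]
      (HopfAlgebra.antipode k (C j p) * (antipodeSq k H (C l j) * D d b)) := by
        refine Finset.sum_congr rfl fun p _ => ?_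
        rw [Finset.sum_comm]
        exact Finset.sum_congr rfl fun l _ => Finset.sum_comm
    _ = _ := by
        simp only [e7, Finset.sum_ite_irrel, Finset.sum_const_zero, Finset.sum_ite_eq',
          Finset.mem_univ, if_true]
        rw [Finset.sum_comm]

/-- If `∑ f_j ⊗ v_j` is a comodule map `H → M ⊗ T^{S²}`, then `∑ f_j(- C_ij)` is one for
all `i`. -/
theorem hatRight_component {T : Comod k H} {ι : Type} [Fintype ι] [DecidableEq ι]
    (v : Module.Basis ι k T) {C : ι → ι → H} (hC : IsComatrix k C)
    (hv : ∀ j, T.coact (v j) = ∑ i, v i ⊗ₜ[k] C i j) (f : ι → H →ₗ[k] M)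
    (hf : ∑ j, canonR H M T (f j ⊗ₜ v j) ∈ hatSubmodule (M.tensor T.twist)) (i : ι) :
    ∑ j, f j ∘ₗ LinearMap.mulRight k (C i j) ∈ hatSubmodule M := by
  -- As on the left, but the coaction of T^{S²} multiplies from the right by the entries of S²(c).
  have h1 : ∀ x i, ∑ j, (LinearMap.mulRight k (antipodeSq k H (C i j))).lTensor M
      (M.coact (f j x)) = (f i).rTensor H (Coalgebra.comul x) := by
    intro x i
    have e : tensorTwistCoact M T ((∑ j, canonR H M T (f j ⊗ₜ v j)) x) =
        (∑ j, canonR H M T (f j ⊗ₜ v j)).rTensor H (Coalgebra.comul x) :=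
      LinearMap.congr_fun hf x
    have e2 := congrArg ((rightCoeff (W := M) v i).rTensor H) e
    rw [← LinearMap.rTensor_comp_apply H (rightCoeff (W := M) v i)
      (∑ j, canonR H M T (f j ⊗ₜ v j))] at e2
    have e3 : rightCoeff v i ∘ₗ ∑ j, canonR H M T (f j ⊗ₜ v j) = f i := by
      ext y
      simp [LinearMap.sum_apply, map_sum]
    have e4 : ∀ j (z : M ⊗[k] H), (rightCoeff (W := M) v i).rTensor H
        (∑ l, TensorProduct.map ((TensorProduct.mk k M T).flip (v l))
          (LinearMap.mulRight k (antipodeSq k H (C l j))) z) =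
          (LinearMap.mulRight k (antipodeSq k H (C i j))).lTensor M z := by
      intro j z
      induction z with
      | zero => simp
      | add x y hx hy => simp only [map_add, Finset.sum_add_distrib, hx, hy]
      | tmul a b => simp [map_sum, TensorProduct.ite_tmul]
    rw [e3] at e2
    rw [← e2]
    simp only [LinearMap.sum_apply, canonR_tmul, map_sum, tensorTwistCoact_right hv]
    exact Finset.sum_congr rfl fun j _ => by rw [← map_sum, e4]
  -- For multiplication from the right, S(c) inverts S²(c) by Σ_p S²(c_pl) S(c_jp) = δ_jl. So
  -- S(c_jp) remains as a right factor, to be cancelled by the entries of c in the shifted argument.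
  have h2 : ∀ x j, M.coact (f j x) = ∑ p, (LinearMap.mulRight k (HopfAlgebra.antipode k
      (C j p))).lTensor M ((f p).rTensor H (Coalgebra.comul x)) := by
    intro x j
    simp only [← h1, map_sum]
    rw [Finset.sum_comm]
    have e5 : ∀ l (z : M ⊗[k] H), ∑ p, (LinearMap.mulRight k (HopfAlgebra.antipode k
        (C j p))).lTensor M ((LinearMap.mulRight k (antipodeSq k H (C p l))).lTensor M z) =
          if j = l then z else 0 := by
      intro l z
      induction z with
      | zero => simp
      | add x y hx hy =>
        simp only [map_add, Finset.sum_add_distrib, hx, hy]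
        split_ifs <;> simp
      | tmul a b =>
        simp only [LinearMap.lTensor_tmul, LinearMap.mulRight_apply, mul_assoc,
          ← TensorProduct.tmul_sum, ← Finset.mul_sum, hC.antipodeSq_antipode]
        split_ifs <;> simp
    simp [e5]
  refine hopf_ext fun m D hD a b => ?_
  simp only [LinearMap.comp_apply, LinearMap.sum_apply, LinearMap.mulRight_apply, hD.comul,
    map_sum, LinearMap.rTensor_tmul, h2]
  have e6 : ∀ j, Coalgebra.comul (R := k) (D a b * C i j) =
      ∑ d, ∑ l, (D a d * C i l) ⊗ₜ[k] (D d b * C l j) :=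
    fun j => ((hD.mul hC).comul (a, i) (b, j)).trans (Fintype.sum_prod_type _)
  simp only [e6, map_sum, LinearMap.rTensor_tmul, LinearMap.lTensor_tmul, LinearMap.mulRight_apply,
    TensorProduct.sum_tmul]
  have e7 : ∀ p d l, ∑ j, f p (D a d * C i l) ⊗ₜ[k]
      (D d b * C l j * HopfAlgebra.antipode k (C j p)) =
        if l = p then f p (D a d * C i l) ⊗ₜ[k] D d b else 0 := by
    intro p d l
    simp only [mul_assoc, ← TensorProduct.tmul_sum, ← Finset.mul_sum, hC.mul_antipode]
    split_ifs <;> simp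
  rw [Finset.sum_comm]
  calc _ = ∑ p, ∑ d, ∑ l, ∑ j, f p (D a d * C i l) ⊗ₜ[k]
      (D d b * C l j * HopfAlgebra.antipode k (C j p)) := by
        refine Finset.sum_congr rfl fun p _ => ?_
        rw [Finset.sum_comm]
        exact Finset.sum_congr rfl fun l _ => Finset.sum_comm
    _ = _ := by
        simp only [e7, Finset.sum_ite_eq', Finset.mem_univ, if_true]
        rw [Finset.sum_comm]

variable (T : FdComod k H) (M)

/-- The S²-shift undoes `hatLeft` up to the inclusion of Hom(H, M)^H in Hom(H, M), and this
inclusion stays injective after tensoring with T, by flatness. -/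
theorem hatLeft_injective : Function.Injective (hatLeft T.toComod M) := by
  intro x y h
  have h1 : hatLeftAux T.toComod M x = hatLeftAux T.toComod M y := congrArg Subtype.val h
  have h2 : shiftL _ M _ = shiftL _ M _ := (canonLEquiv H T.toComod M).injective h1
  replace h2 := congrArg (shiftL ((antipodeSq k H).lTensor T.toComod ∘ₗ T.toComod.coact) M) h2
  rw [shiftL_antipodeSq_antipode, shiftL_antipodeSq_antipode] at h2
  exact Module.Flat.lTensor_preserves_injective_linearMap _ (Submodule.subtype_injective _) h2

theorem hatRight_injective : Function.Injective (hatRight T.toComod M) := by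
  intro x y h
  have h1 : hatRightAux T.toComod M x = hatRightAux T.toComod M y := congrArg Subtype.val h
  have h2 : shiftR _ M _ = shiftR _ M _ := (canonREquiv H M T.toComod).injective h1
  replace h2 := congrArg (shiftR T.toComod.coact M) h2
  rw [shiftR_coact_antipode, shiftR_coact_antipode] at h2
  exact Module.Flat.rTensor_preserves_injective_linearMap _ (Submodule.subtype_injective _) h2

/-- As T is finite-dimensional, F is Σ v_j ⊗ f_j. The preimage is its S²-shift, whose components lie
in Hom(H, M)^H by `hatLeft_component`; the S-shift then leads back to F. -/
theorem hatLeft_surjective : Function.Surjective (hatLeft T.toComod M) := by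
  intro F
  obtain ⟨z, hz⟩ := canonL_surjective (V := T.toComod) F.1
  let v := Module.finBasis k T.toComod
  obtain ⟨C, hC, hv⟩ := T.toComod.exists_basis_comatrix v
  have hz' : z = ∑ j, v j ⊗ₜ[k] leftCoeff v j z := (sum_leftCoeff v z).symm
  have hF : ∑ j, canonL H T.toComod M (v j ⊗ₜ leftCoeff v j z) ∈
      hatSubmodule (T.toComod.tensor M) := by
    rw [← map_sum, ← hz', hz]
    exact F.2
  refine ⟨∑ i, v i ⊗ₜ[k] ⟨_, hatLeft_component v hC hv _ hF i⟩, Subtype.ext ?_⟩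
  rw [← hz]
  change canonL H T.toComod M (shiftL _ M _) = _
  congr 1
  refine Eq.trans (congrArg _ ?_) (shiftL_antipode_antipodeSq T.toComod z)
  refine Eq.trans ?_ (congrArg _ hz'.symm)
  simp only [map_sum, LinearMap.lTensor_tmul, Submodule.subtype_apply, shiftL_tmul hv,
    TensorProduct.tmul_sum]
  rw [Finset.sum_comm]

theorem hatRight_surjective : Function.Surjective (hatRight T.toComod M) := by
  intro F
  let G : H →ₗ[k] M ⊗[k] T.toComod := F.1
  obtain ⟨z, hz⟩ : ∃ z, canonR H M T.toComod z = G := canonR_surjective G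
  let v := Module.finBasis k T.toComod
  obtain ⟨C, hC, hv⟩ := T.toComod.exists_basis_comatrix v
  have hz' : z = ∑ j, rightCoeff v j z ⊗ₜ[k] v j := (sum_rightCoeff v z).symm
  have hF : ∑ j, canonR H M T.toComod (rightCoeff v j z ⊗ₜ v j) ∈
      hatSubmodule (M.tensor T.toComod.twist) := by
    have e : ∑ j, canonR H M T.toComod (rightCoeff v j z ⊗ₜ v j) = G := by
      rw [← map_sum, ← hz', hz]
    -- T^{S²} and T share one underlying space only up to unfolding, so the transport names the type
    -- M ⊗ T explicitly.
    exact Eq.subst (motive := fun G : H →ₗ[k] M ⊗[k] T.toComod =>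
      G ∈ hatSubmodule (M.tensor T.toComod.twist)) e.symm F.2
  refine ⟨∑ i, ⟨_, hatRight_component v hC hv _ hF i⟩ ⊗ₜ[k] v i, Subtype.ext ?_⟩
  refine Eq.trans ?_ hz
  change canonR H M T.toComod (shiftR _ M _) = _
  congr 1
  refine Eq.trans (congrArg _ ?_) (shiftR_antipode_coact T.toComod z)
  refine Eq.trans ?_ (congrArg _ hz'.symm)
  simp only [map_sum, LinearMap.rTensor_tmul, Submodule.subtype_apply, shiftR_tmul hv,
    TensorProduct.sum_tmul]
  rw [Finset.sum_comm]

/-- The contraaction of T^{S²} ⊗ Hom(H, M)^H puts S²(c_lj) into the argument of θ, and splitting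
S(c_il) h puts S(c_pl) beside it. The sum over l is δ_pj, so the twist on the left factor is what
makes the map contralinear. -/
theorem hatLeft_act (F : H →ₗ[k] T.toComod ⊗[k] hatSubmodule M)
    (σ : T.toComod →ₗ[k] T.toComod ⊗[k] H)
    (hσ : σ = (antipodeSq k H).lTensor T.toComod ∘ₗ T.toComod.coact) :
    hatLeft T.toComod M (contraActL σ (hatAct M) F) =
      hatAct (T.toComod.tensor M) (hatLeft T.toComod M ∘ₗ F) := by
  obtain ⟨z, rfl⟩ := canonL_surjective F
  induction z using Comod.induction_left (T := T.toComod) (W := H →ₗ[k] hatSubmodule M) with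
  | zero => simp
  | add x y hx hy => simp only [map_add, LinearMap.comp_add, hx, hy]
  | hv n v C hC hv j θ =>
    have hT : ∀ j, σ (v j) = ∑ l, v l ⊗ₜ[k] antipodeSq k H (C l j) := by
      intro i
      rw [hσ]
      exact lTensor_coeff hv _ i
    refine Subtype.ext (hopf_ext fun m D hD a b => ?_)
    refine Eq.trans ?_ (hatAct_apply (M := T.toComod.tensor M) _ hD a b).symm
    rw [contraActL_tmul hT, map_sum]
    have h1 : ∀ l i, (hatAct M (θ ∘ₗ LinearMap.mulLeft k (antipodeSq k H (C l j)))).1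
        (HopfAlgebra.antipode k (C i l) * D a b) = ∑ p, ∑ d,
          (θ (antipodeSq k H (C l j) * HopfAlgebra.antipode k (C p l) * D a d)).1
            (HopfAlgebra.antipode k (C i p) * D d b) := by
      intro l i
      refine (hatAct_apply _ (hC.antipode.mul hD) (l, a) (i, b)).trans ?_
      rw [Fintype.sum_prod_type]
      simp [mul_assoc]
    have h2 : ∀ p d (x : H), ∑ l,
        (θ (antipodeSq k H (C l j) * HopfAlgebra.antipode k (C p l) * D a d)).1 x =
          if p = j then (θ (D a d)).1 x else 0 := by
      intro p d x
      have := congrArg (fun y => (θ (y * D a d)).1 x) (hC.antipodeSq_antipode p j)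
      simp only [Finset.sum_mul, map_sum, AddSubmonoidClass.coe_finsetSum,
        LinearMap.sum_apply] at this
      refine this.trans ?_
      split_ifs <;> simp
    have h3 : (∑ l, hatLeft T.toComod M (v l ⊗ₜ[k] hatAct M (θ ∘ₗ LinearMap.mulLeft k
        (antipodeSq k H (C l j))))).1 (D a b) = ∑ l, ∑ i, v i ⊗ₜ[k] ∑ p, ∑ d,
          (θ (antipodeSq k H (C l j) * HopfAlgebra.antipode k (C p l) * D a d)).1
            (HopfAlgebra.antipode k (C i p) * D d b) := by
      rw [AddSubmonoidClass.coe_finsetSum]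
      refine (LinearMap.sum_apply _ _ _).trans (Finset.sum_congr rfl fun l _ => ?_)
      rw [hatLeft_tmul hv]
      simp only [h1]
      rfl
    refine h3.trans ?_
    rw [Finset.sum_comm]
    simp only [← TensorProduct.tmul_sum]
    calc _ = ∑ i, v i ⊗ₜ[k] ∑ p, ∑ d, ∑ l,
          (θ (antipodeSq k H (C l j) * HopfAlgebra.antipode k (C p l) * D a d)).1
            (HopfAlgebra.antipode k (C i p) * D d b) := by
          refine Finset.sum_congr rfl fun i _ => congrArg _ ?_
          rw [Finset.sum_comm]
          exact Finset.sum_congr rfl fun p _ => Finset.sum_comm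
      _ = ∑ i, v i ⊗ₜ[k] ∑ d, (θ (D a d)).1 (HopfAlgebra.antipode k (C i j) * D d b) := by
          refine Finset.sum_congr rfl fun i _ => congrArg _ ?_
          simp only [h2, Finset.sum_ite_irrel, Finset.sum_const_zero, Finset.sum_ite_eq',
            Finset.mem_univ, if_true]
      _ = _ := by
          simp only [TensorProduct.tmul_sum]
          rw [Finset.sum_comm]
          exact Finset.sum_congr rfl fun d _ => (hatLeft_tmul hv j (θ (D a d)) (D d b)).symm

/-- On the right the argument of θ contains Σ_l S(c_pl) c_lj = δ_pj, so the contramodule side needs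
no twist there. -/
theorem hatRight_act (F : H →ₗ[k] hatSubmodule M ⊗[k] T.toComod) :
    hatRight T.toComod M (contraActR T.toComod.coact (hatAct M) F) =
      hatAct (M.tensor T.toComod.twist) (hatRight T.toComod M ∘ₗ F) := by
  obtain ⟨z, rfl⟩ := canonR_surjective F
  induction z using Comod.induction_right (T := T.toComod) (W := H →ₗ[k] hatSubmodule M) with
  | zero => simp
  | add x y hx hy => simp only [map_add, LinearMap.comp_add, hx, hy]
  | hv n v C hC hv j θ =>
    refine Subtype.ext (hopf_ext fun m D hD a b => ?_)
    refine Eq.trans ?_ (hatAct_apply (M := M.tensor T.toComod.twist) _ hD a b).symm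
    rw [contraActR_tmul hv, map_sum]
    have h1 : ∀ l i, (hatAct M (θ ∘ₗ LinearMap.mulRight k (C l j))).1
        (D a b * HopfAlgebra.antipode k (C i l)) = ∑ d, ∑ p,
          (θ (D a d * (HopfAlgebra.antipode k (C p l) * C l j))).1
            (D d b * HopfAlgebra.antipode k (C i p)) := by
      intro l i
      refine (hatAct_apply _ (hD.mul hC.antipode) (a, l) (b, i)).trans ?_
      rw [Fintype.sum_prod_type]
      simp [mul_assoc]
    have h2 : ∀ p d (x : H), ∑ l,
        (θ (D a d * (HopfAlgebra.antipode k (C p l) * C l j))).1 x =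
          if p = j then (θ (D a d)).1 x else 0 := by
      intro p d x
      have := congrArg (fun y => (θ (D a d * y)).1 x) (hC.antipode_mul p j)
      simp only [Finset.mul_sum, map_sum, AddSubmonoidClass.coe_finsetSum,
        LinearMap.sum_apply] at this
      refine this.trans ?_
      split_ifs <;> simp
    have h3 : (∑ l, hatRight T.toComod M (hatAct M (θ ∘ₗ LinearMap.mulRight k (C l j)) ⊗ₜ[k]
        v l)).1 (D a b) = ∑ l, ∑ i, (∑ d, ∑ p,
          (θ (D a d * (HopfAlgebra.antipode k (C p l) * C l j))).1
            (D d b * HopfAlgebra.antipode k (C i p))) ⊗ₜ[k] v i := by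
      rw [AddSubmonoidClass.coe_finsetSum]
      refine (LinearMap.sum_apply _ _ _).trans (Finset.sum_congr rfl fun l _ => ?_)
      rw [hatRight_tmul hv]
      simp only [h1]
      rfl
    refine h3.trans ?_
    rw [Finset.sum_comm]
    simp only [← TensorProduct.sum_tmul]
    calc _ = ∑ i, (∑ d, ∑ p, ∑ l, (θ (D a d * (HopfAlgebra.antipode k (C p l) * C l j))).1
            (D d b * HopfAlgebra.antipode k (C i p))) ⊗ₜ[k] v i := by
          refine Finset.sum_congr rfl fun i _ => congrArg (· ⊗ₜ[k] v i) ?_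
          rw [Finset.sum_comm]
          exact Finset.sum_congr rfl fun d _ => Finset.sum_comm
      _ = ∑ i, (∑ d, (θ (D a d)).1 (D d b * HopfAlgebra.antipode k (C i j))) ⊗ₜ[k] v i := by
          refine Finset.sum_congr rfl fun i _ => congrArg (· ⊗ₜ[k] v i) ?_
          simp only [h2, Finset.sum_ite_eq', Finset.mem_univ, if_true]
      _ = _ := by
          simp only [TensorProduct.sum_tmul]
          rw [Finset.sum_comm]
          exact Finset.sum_congr rfl fun d _ => (hatRight_tmul hv (θ (D a d)) j (D d b)).symm

/-- The isomorphism `T^{S²} ⊗ Hom(H, M)^H ≅ Hom(H, T ⊗ M)^H`. -/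
def hatLeftIso : Contra.tensorL T.twist (hatObj M) ≅ hatObj (T.toComod.tensor M) :=
  Contra.mkIso (M := Contra.tensorL T.twist (hatObj M)) (N := hatObj (T.toComod.tensor M))
    (LinearEquiv.ofBijective (hatLeft T.toComod M) ⟨hatLeft_injective M T, hatLeft_surjective M T⟩)
    (fun F => hatLeft_act M T F _ rfl)

/-- The isomorphism `Hom(H, M)^H ⊗ T ≅ Hom(H, M ⊗ T^{S²})^H`. -/
def hatRightIso : Contra.tensorR T (hatObj M) ≅ hatObj (M.tensor T.toComod.twist) :=
  Contra.mkIso (M := Contra.tensorR T (hatObj M)) (N := hatObj (M.tensor T.toComod.twist))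
    (LinearEquiv.ofBijective (hatRight T.toComod M)
      ⟨hatRight_injective M T, hatRight_surjective M T⟩)
    (hatRight_act M T)

end HatTensorEquiv

end
end AYD

/-! ### Coherence of the comparison maps for Hom(H, -)^H. -/

namespace AYD

noncomputable section

variable {k H : Type u} [Field k] [Ring H] [HopfAlgebra k H]

section HatBimodule

/-- The form free of bases, t₀ ⊗ φ(S(t₁) x). It gives naturality and the unit axiom, and is compared
with the formula for N' in `centerAdj`. -/
theorem hatLeft_pure {T M : Comod k H} (t : T) (φ : hatSubmodule M) (x : H) :
    (hatLeft T M (t ⊗ₜ φ)).1 x =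
      (φ.1 ∘ₗ LinearMap.mulRight k x ∘ₗ HopfAlgebra.antipode k).lTensor T (T.coact t) := by
  change canonL H T M (shiftL _ M (t ⊗ₜ φ.1)) x = _
  simp only [shiftL, TensorProduct.lift.tmul, LinearMap.mk₂_apply, LinearMap.comp_apply]
  generalize T.coact t = z
  induction z with
  | zero => simp
  | add x y hx hy => simp only [map_add, LinearMap.add_apply, hx, hy]
  | tmul a b => simp

theorem hatRight_pure {T M : Comod k H} (φ : hatSubmodule M) (t : T) (x : H) :
    (hatRight T M (φ ⊗ₜ t)).1 x = TensorProduct.comm k T M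
      ((φ.1 ∘ₗ LinearMap.mulLeft k x ∘ₗ HopfAlgebra.antipode k).lTensor T (T.coact t)) := by
  change canonR H M T (shiftR _ M (φ.1 ⊗ₜ t)) x = _
  simp only [shiftR, TensorProduct.lift.tmul, LinearMap.mk₂_apply, LinearMap.comp_apply]
  generalize T.coact t = z
  induction z with
  | zero => simp
  | add x y hx hy => simp only [map_add, LinearMap.add_apply, hx, hy]
  | tmul a b => simp

/-- Holds because f commutes with the coactions. The image of φ enters as φ' with an equation, which
the application of `hat` to a morphism satisfies by definition. -/
theorem hatLeft_natural {T T' M M' : Comod k H} (f : T ⟶ T') (g : M ⟶ M') (t : T)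
    (φ : hatSubmodule M) (φ' : hatSubmodule M') (hφ : φ'.1 = Comod.lin g ∘ₗ φ.1) (x : H) :
    (hatLeft T' M' (Comod.lin f t ⊗ₜ φ')).1 x =
      TensorProduct.map (Comod.lin f) (Comod.lin g) ((hatLeft T M (t ⊗ₜ φ)).1 x) := by
  have h := LinearMap.congr_fun (Comod.lin_comm f) t
  simp only [LinearMap.comp_apply] at h
  rw [hatLeft_pure, hatLeft_pure, h, hφ]
  generalize T.coact t = z
  induction z with
  | zero => simp; rfl
  | add x y hx hy => simp only [map_add, hx, hy]; rfl
  | tmul a b => simp; rfl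

theorem hatRight_natural {T T' M M' : Comod k H} (g : M ⟶ M') (f : T ⟶ T') (t : T)
    (φ : hatSubmodule M) (φ' : hatSubmodule M') (hφ : φ'.1 = Comod.lin g ∘ₗ φ.1) (x : H) :
    (hatRight T' M' (φ' ⊗ₜ Comod.lin f t)).1 x =
      TensorProduct.map (Comod.lin g) (Comod.lin f) ((hatRight T M (φ ⊗ₜ t)).1 x) := by
  have h := LinearMap.congr_fun (Comod.lin_comm f) t
  simp only [LinearMap.comp_apply] at h
  rw [hatRight_pure, hatRight_pure, h, hφ]
  generalize T.coact t = z
  induction z with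
  | zero => simp; rfl
  | add x y hx hy => simp only [map_add, hx, hy]; rfl
  | tmul a b => simp; rfl

/-- Two successive shifts give φ(S(t'₁) S(t₁) x), which is φ(S(t₁ t'₁) x) since S reverses products.
-/
theorem hatLeft_assoc {T T' M : Comod k H} (t : T) (t' : T') (φ : hatSubmodule M) (x : H) :
    (hatLeft T (T'.tensor M) (t ⊗ₜ hatLeft T' M (t' ⊗ₜ φ))).1 x =
      TensorProduct.assoc k T T' M ((hatLeft (T.tensor T') M ((t ⊗ₜ[k] t') ⊗ₜ φ)).1 x) := by
  -- Both sides are packaged as linear maps of t ⊗ t', so that they can be compared on comatrix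
  -- families.
  let L : T ⊗[k] T' →ₗ[k] T ⊗[k] (T' ⊗[k] M) :=
    LinearMap.applyₗ x ∘ₗ (hatSubmodule (T.tensor (T'.tensor M))).subtype ∘ₗ
      hatLeft T (T'.tensor M) ∘ₗ
        (hatLeft T' M ∘ₗ (TensorProduct.mk k T' (hatSubmodule M)).flip φ).lTensor T
  let R : T ⊗[k] T' →ₗ[k] T ⊗[k] (T' ⊗[k] M) :=
    (TensorProduct.assoc k T T' M).toLinearMap ∘ₗ LinearMap.applyₗ x ∘ₗ
      (hatSubmodule ((T.tensor T').tensor M)).subtype ∘ₗ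
        hatLeft (T.tensor T') M ∘ₗ (TensorProduct.mk k (T ⊗[k] T') (hatSubmodule M)).flip φ
  suffices h : L = R from LinearMap.congr_fun h (t ⊗ₜ t')
  refine Comod.tensor_ext T T' fun n m v w C D hC hD hv hw i j => ?_
  change (hatLeft T (T'.tensor M) (v i ⊗ₜ hatLeft T' M (w j ⊗ₜ φ))).1 x =
      TensorProduct.assoc k T T' M ((hatLeft (T.tensor T') M ((v i ⊗ₜ[k] w j) ⊗ₜ φ)).1 x)
  refine (hatLeft_tmul hv i _ x).trans ?_
  refine Eq.trans ?_ (congrArg _ (hatLeft_tmul (T := T.tensor T')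
    (v := fun p : Fin n × Fin m => v p.1 ⊗ₜ[k] w p.2)
    (C := fun p q => C p.1 q.1 * D p.2 q.2) (tensorCoact_apply hv hw) (i, j) φ x)).symm
  refine Eq.trans ?_ (map_sum (TensorProduct.assoc k T T' M) _ _).symm
  rw [Fintype.sum_prod_type]
  refine Finset.sum_congr rfl fun p _ => ?_
  refine (congrArg (TensorProduct.mk k T (T' ⊗[k] M) (v p)) (hatLeft_tmul hw j φ _)).trans ?_
  rw [map_sum]
  refine Finset.sum_congr rfl fun q _ => ?_
  simp only [HopfAlgebra.antipode_mul_antidistrib, mul_assoc]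
  rfl

/-- Again anti-multiplicativity of S: the argument becomes x S(t'₁) S(t₁) = x S(t₁ t'₁). -/
theorem hatRight_assoc {T T' M : Comod k H} (φ : hatSubmodule M) (t : T) (t' : T') (x : H) :
    (hatRight T' (M.tensor T.twist) (hatRight T M (φ ⊗ₜ t) ⊗ₜ t')).1 x =
      (TensorProduct.assoc k M T T').symm
        ((hatRight (T.tensor T') M (φ ⊗ₜ (t ⊗ₜ[k] t'))).1 x) := by
  let L : T ⊗[k] T' →ₗ[k] (M ⊗[k] T) ⊗[k] T' :=
    LinearMap.applyₗ x ∘ₗ (hatSubmodule ((M.tensor T.twist).tensor T'.twist)).subtype ∘ₗ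
      hatRight T' (M.tensor T.twist) ∘ₗ
        (hatRight T M ∘ₗ TensorProduct.mk k (hatSubmodule M) T φ).rTensor T'
  let R : T ⊗[k] T' →ₗ[k] (M ⊗[k] T) ⊗[k] T' :=
    (TensorProduct.assoc k M T T').symm.toLinearMap ∘ₗ LinearMap.applyₗ x ∘ₗ
      (hatSubmodule (M.tensor (T.tensor T').twist)).subtype ∘ₗ
        hatRight (T.tensor T') M ∘ₗ TensorProduct.mk k (hatSubmodule M) (T ⊗[k] T') φ
  suffices h : L = R from LinearMap.congr_fun h (t ⊗ₜ t')
  refine Comod.tensor_ext T T' fun n m v w C D hC hD hv hw i j => ?_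
  change (hatRight T' (M.tensor T.twist) (hatRight T M (φ ⊗ₜ v i) ⊗ₜ w j)).1 x =
      (TensorProduct.assoc k M T T').symm
        ((hatRight (T.tensor T') M (φ ⊗ₜ (v i ⊗ₜ[k] w j))).1 x)
  refine (hatRight_tmul hw _ j x).trans ?_
  refine Eq.trans ?_ (congrArg _ (hatRight_tmul (T := T.tensor T')
    (v := fun p : Fin n × Fin m => v p.1 ⊗ₜ[k] w p.2)
    (C := fun p q => C p.1 q.1 * D p.2 q.2) (tensorCoact_apply hv hw) φ (i, j) x)).symm
  refine Eq.trans ?_ (map_sum (TensorProduct.assoc k M T T').symm _ _).symm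
  rw [Fintype.sum_prod_type, Finset.sum_comm]
  refine Finset.sum_congr rfl fun p _ => ?_
  refine (congrArg ((TensorProduct.mk k (M ⊗[k] T) T').flip (w p))
    (hatRight_tmul hv φ i _)).trans ?_
  rw [map_sum]
  refine Finset.sum_congr rfl fun q _ => ?_
  simp only [HopfAlgebra.antipode_mul_antidistrib, mul_assoc]
  rfl

/-- Left and right multiplications in H commute: both orders evaluate φ at S(t₁) x S(l₁). -/
theorem hatLeft_hatRight {T L M : Comod k H} (t : T) (φ : hatSubmodule M) (l : L) (x : H) :
    TensorProduct.assoc k T M L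
      ((hatRight L (T.tensor M) (hatLeft T M (t ⊗ₜ φ) ⊗ₜ l)).1 x) =
      (hatLeft T (M.tensor L.twist) (t ⊗ₜ hatRight L M (φ ⊗ₜ l))).1 x := by
  refine LinearMap.congr_fun (f := (TensorProduct.assoc k T M L).toLinearMap ∘ₗ
    LinearMap.applyₗ x ∘ₗ (hatSubmodule ((T.tensor M).tensor L.twist)).subtype ∘ₗ
      hatRight L (T.tensor M) ∘ₗ (TensorProduct.mk k (hatSubmodule (T.tensor M)) L).flip l ∘ₗ
        hatLeft T M ∘ₗ (TensorProduct.mk k T (hatSubmodule M)).flip φ)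
    (g := LinearMap.applyₗ x ∘ₗ (hatSubmodule (T.tensor (M.tensor L.twist))).subtype ∘ₗ
      hatLeft T (M.tensor L.twist) ∘ₗ (TensorProduct.mk k T
        (hatSubmodule (M.tensor L.twist))).flip (hatRight L M (φ ⊗ₜ l)))
    (T.lin_ext fun n v C hC hv i => ?_) t
  refine LinearMap.congr_fun (f := (TensorProduct.assoc k T M L).toLinearMap ∘ₗ
    LinearMap.applyₗ x ∘ₗ (hatSubmodule ((T.tensor M).tensor L.twist)).subtype ∘ₗ
      hatRight L (T.tensor M) ∘ₗ TensorProduct.mk k (hatSubmodule (T.tensor M)) L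
        (hatLeft T M (v i ⊗ₜ φ)))
    (g := LinearMap.applyₗ x ∘ₗ (hatSubmodule (T.tensor (M.tensor L.twist))).subtype ∘ₗ
      hatLeft T (M.tensor L.twist) ∘ₗ TensorProduct.mk k T (hatSubmodule (M.tensor L.twist)) (v i)
        ∘ₗ hatRight L M ∘ₗ TensorProduct.mk k (hatSubmodule M) L φ)
    (L.lin_ext fun m w D hD hw j => ?_) l
  change TensorProduct.assoc k T M L
      ((hatRight L (T.tensor M) (hatLeft T M (v i ⊗ₜ φ) ⊗ₜ w j)).1 x) =
      (hatLeft T (M.tensor L.twist) (v i ⊗ₜ hatRight L M (φ ⊗ₜ w j))).1 x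
  refine (congrArg _ (hatRight_tmul hw _ j x)).trans ?_
  refine (map_sum (TensorProduct.assoc k T M L) _ _).trans ?_
  refine Eq.trans ?_ (hatLeft_tmul (M := M.tensor L.twist) hv i _ x).symm
  have h1 : ∀ p, TensorProduct.assoc k T M L ((hatLeft T M (v i ⊗ₜ φ)).1
      (x * HopfAlgebra.antipode k (D p j)) ⊗ₜ[k] w p) = ∑ q, v q ⊗ₜ[k]
        (φ.1 (HopfAlgebra.antipode k (C q i) * (x * HopfAlgebra.antipode k (D p j))) ⊗ₜ[k] w p) := by
    intro p
    refine (congrArg (fun y => TensorProduct.assoc k T M L (y ⊗ₜ[k] w p))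
      (hatLeft_tmul hv i φ _)).trans ?_
    simp only [TensorProduct.sum_tmul, map_sum, TensorProduct.assoc_tmul]
  have h2 : ∀ q, v q ⊗ₜ[k] (show M ⊗[k] L from (hatRight L M (φ ⊗ₜ w j)).1
      (HopfAlgebra.antipode k (C q i) * x)) = ∑ p, v q ⊗ₜ[k]
        (φ.1 (HopfAlgebra.antipode k (C q i) * (x * HopfAlgebra.antipode k (D p j))) ⊗ₜ[k] w p) := by
    intro q
    refine (congrArg (TensorProduct.mk k T (M ⊗[k] L) (v q)) (hatRight_tmul hw φ j _)).trans ?_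
    simp only [map_sum, mul_assoc]
    rfl
  refine (Finset.sum_congr rfl fun p _ => h1 p).trans ?_
  refine Eq.trans ?_ (Finset.sum_congr rfl fun q _ => h2 q).symm
  rw [Finset.sum_comm]

/-- The coaction of k is r ↦ r ⊗ 1 and S(1) = 1, so nothing is shifted. -/
theorem hatLeft_unit {M : Comod k H} (r : k) (φ : hatSubmodule M) (x : H) :
    TensorProduct.lid k M ((hatLeft (Comod.unit k H) M ((show Comod.unit k H from r) ⊗ₜ φ)).1 x) =
      r • φ.1 x := by
  refine (congrArg _ (hatLeft_pure (T := Comod.unit k H) r φ x)).trans ?_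
  change TensorProduct.lid k M ((φ.1 ∘ₗ LinearMap.mulRight k x ∘ₗ HopfAlgebra.antipode k).lTensor k
    (r ⊗ₜ[k] (1 : H))) = _
  simp

theorem hatRight_unit {M : Comod k H} (φ : hatSubmodule M) (r : k) (x : H) :
    TensorProduct.rid k M ((hatRight (Comod.unit k H) M
      (φ ⊗ₜ (show Comod.unit k H from r))).1 x) = r • φ.1 x := by
  refine (congrArg _ (hatRight_pure (T := Comod.unit k H) φ r x)).trans ?_
  change TensorProduct.rid k M (TensorProduct.comm k k M
    ((φ.1 ∘ₗ LinearMap.mulLeft k x ∘ₗ HopfAlgebra.antipode k).lTensor k (r ⊗ₜ[k] (1 : H)))) = _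
  simp

variable (k H) in
/-- The functor `M ↦ Hom(H, M)^H` is a functor of bimodule categories. -/
def hatBimodule : BimoduleFunctor (FdComod k H) (hat k H) :=
  BimoduleFunctor.ofInverse (hat k H)
    (fun T M => hatLeftIso M T)
    (fun M T => hatRightIso M T)
    (fun {T T' M M'} f g => Contra.hom_ext (TensorProduct.ext' fun t φ => Subtype.ext
      (LinearMap.ext fun x => hatLeft_natural (T := T.toComod) (T' := T'.toComod) f g t φ _ rfl x)))
    (fun {M M' T T'} g f => Contra.hom_ext (TensorProduct.ext' fun φ t => Subtype.ext
      (LinearMap.ext fun x => hatRight_natural (T := T.toComod) (T' := T'.toComod) g f t φ _ rfl x)))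
    (fun T T' M => Contra.hom_ext (TensorProduct.ext_threefold fun t t' φ => Subtype.ext
      (LinearMap.ext fun x => hatLeft_assoc t t' φ x)))
    (fun M => Contra.hom_ext (TensorProduct.ext' fun r φ => Subtype.ext
      (LinearMap.ext fun x => (hatLeft_unit (k := k) (H := H) (M := M) r φ x).symm)))
    -- The right associator of comodules contains (T ⊗ T')^{S²} ≅ T^{S²} ⊗ T'^{S²}, which is the
    -- identity on spaces; `TensorProduct.map_id` accounts for it.
    (fun M T T' => Contra.hom_ext (TensorProduct.ext_threefold' fun φ t t' => Subtype.ext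
      (LinearMap.ext fun x => (hatRight_assoc φ t t' x).trans
        (congrArg _ (LinearMap.congr_fun TensorProduct.map_id _).symm))))
    (fun M => Contra.hom_ext (TensorProduct.ext' fun φ r => Subtype.ext
      (LinearMap.ext fun x => (hatRight_unit (k := k) (H := H) (M := M) φ r x).symm.trans
        (congrArg _ (LinearMap.congr_fun TensorProduct.map_id _).symm))))
    (fun T M L => Contra.hom_ext (TensorProduct.ext_threefold fun t φ l => Subtype.ext
      (LinearMap.ext fun x => hatLeft_hatRight (T := T.toComod) (L := L.toComod) (M := M) t φ l x)))

end HatBimodule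

end
end AYD

namespace AYD

noncomputable section

variable {k H : Type u} [Field k] [Ring H] [HopfAlgebra k H]

/-! ### The functor `N ↦ N'` and tensor products -/

section PrimeShift

variable {V W : Type u} [AddCommGroup V] [Module k V] [AddCommGroup W] [Module k W]
  (ρ : V →ₗ[k] V ⊗[k] H) (g : H →ₗ[k] H)

/-- The map `v ⊗ (h ⊗ w) ↦ v₀ ⊗ (g(v₁) h ⊗ w)`. -/
def mulShiftL : V ⊗[k] (H ⊗[k] W) →ₗ[k] V ⊗[k] (H ⊗[k] W) :=
  (TensorProduct.lift (LinearMap.rTensorHom W ∘ₗ LinearMap.mul k H ∘ₗ g)).lTensor V ∘ₗ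
    (TensorProduct.assoc k V H (H ⊗[k] W)).toLinearMap ∘ₗ ρ.rTensor (H ⊗[k] W)

/-- The map `v ⊗ (h ⊗ w) ↦ v₀ ⊗ (h g(v₁) ⊗ w)`. -/
def mulShiftR : V ⊗[k] (H ⊗[k] W) →ₗ[k] V ⊗[k] (H ⊗[k] W) :=
  (TensorProduct.lift (LinearMap.rTensorHom W ∘ₗ (LinearMap.mul k H).flip ∘ₗ g)).lTensor V ∘ₗ
    (TensorProduct.assoc k V H (H ⊗[k] W)).toLinearMap ∘ₗ ρ.rTensor (H ⊗[k] W)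

variable {ρ}

theorem mulShiftL_tmul {ι : Type} [Fintype ι] {v : ι → V} {C : ι → ι → H}
    (hv : ∀ j, ρ (v j) = ∑ i, v i ⊗ₜ[k] C i j) (j : ι) (h : H) (w : W) :
    mulShiftL ρ g (v j ⊗ₜ (h ⊗ₜ[k] w)) = ∑ i, v i ⊗ₜ[k] ((g (C i j) * h) ⊗ₜ[k] w) := by
  simp [mulShiftL, hv, TensorProduct.sum_tmul, map_sum]

theorem mulShiftR_tmul {ι : Type} [Fintype ι] {v : ι → V} {C : ι → ι → H}
    (hv : ∀ j, ρ (v j) = ∑ i, v i ⊗ₜ[k] C i j) (j : ι) (h : H) (w : W) :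
    mulShiftR ρ g (v j ⊗ₜ (h ⊗ₜ[k] w)) = ∑ i, v i ⊗ₜ[k] ((h * g (C i j)) ⊗ₜ[k] w) := by
  simp [mulShiftR, hv, TensorProduct.sum_tmul, map_sum]

end PrimeShift

section PrimeTensor

variable (T : FdComod k H) (N : Contra k H)

/-- The class of `h ⊗ (t ⊗ n)` in `(T^{S²} ⊗ N)'`. -/
def primeMkL : H ⊗[k] (T.toComod ⊗[k] N) →ₗ[k] primeSpace (Contra.tensorL T.twist N) :=
  primeMk (Contra.tensorL T.twist N)

/-- The class of `h ⊗ (n ⊗ t)` in `(N ⊗ T)'`. -/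
def primeMkR : H ⊗[k] (N ⊗[k] T.toComod) →ₗ[k] primeSpace (Contra.tensorR T N) :=
  primeMk (Contra.tensorR T N)

variable {N T}

/-- Maps out of the cokernel may be tested with H and T in comatrix form at the same time, the
setting in which all formulas below are stated. -/
theorem primeTensorL_ext {X : Type*} [AddCommGroup X]
    [Module k X] {f g : primeSpace (Contra.tensorL T.twist N) →ₗ[k] X}
    (h : ∀ (m : ℕ) (D : Fin m → Fin m → H) (n : ℕ) (v : Fin n → T.toComod)
      (C : Fin n → Fin n → H), IsComatrix k D → IsComatrix k C →
      (∀ j, T.toComod.coact (v j) = ∑ i, v i ⊗ₜ[k] C i j) → ∀ a b j (w : N),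
        f (primeMkL T N (D a b ⊗ₜ[k] (v j ⊗ₜ[k] w))) =
          g (primeMkL T N (D a b ⊗ₜ[k] (v j ⊗ₜ[k] w)))) : f = g := by
  refine prime_ext fun m D hD a b => ?_
  -- The carrier of the contramodule is exposed as T ⊗ N to permit induction on tensors.
  change ∀ w : T.toComod ⊗[k] N, f (primeMkL T N (D a b ⊗ₜ w)) = g (primeMkL T N (D a b ⊗ₜ w))
  intro w
  induction w using Comod.induction_left (T := T.toComod) (W := N) with
  | zero => rw [TensorProduct.tmul_zero, map_zero, map_zero, map_zero]
  | add x y hx hy => simp only [TensorProduct.tmul_add, map_add, hx, hy]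
  | hv n v C hC hv j w => exact h m D n v C hD hC hv a b j w

theorem primeTensorR_ext {X : Type*} [AddCommGroup X]
    [Module k X] {f g : primeSpace (Contra.tensorR T N) →ₗ[k] X}
    (h : ∀ (m : ℕ) (D : Fin m → Fin m → H) (n : ℕ) (v : Fin n → T.toComod)
      (C : Fin n → Fin n → H), IsComatrix k D → IsComatrix k C →
      (∀ j, T.toComod.coact (v j) = ∑ i, v i ⊗ₜ[k] C i j) → ∀ a b j (w : N),
        f (primeMkR T N (D a b ⊗ₜ[k] (w ⊗ₜ[k] v j))) =
          g (primeMkR T N (D a b ⊗ₜ[k] (w ⊗ₜ[k] v j)))) : f = g := by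
  refine prime_ext fun m D hD a b => ?_
  change ∀ w : N ⊗[k] T.toComod, f (primeMkR T N (D a b ⊗ₜ w)) = g (primeMkR T N (D a b ⊗ₜ w))
  intro w
  induction w using Comod.induction_right (T := T.toComod) (W := N) with
  | zero => rw [TensorProduct.tmul_zero, map_zero, map_zero, map_zero]
  | add x y hx hy => simp only [TensorProduct.tmul_add, map_add, hx, hy]
  | hv n v C hC hv j w => exact h m D n v C hD hC hv a b j w

/-- The general relation, restated over T ⊗ N and with the twisted coaction written out, so that it
can be used for rewriting. -/
theorem primeMkL_rel {ι : Type} [Fintype ι] [DecidableEq ι] {C : ι → ι → H}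
    (hC : IsComatrix k C) (i j : ι) (f : H →ₗ[k] T.toComod ⊗[k] N) :
    primeMkL T N (C i j ⊗ₜ contraActL ((antipodeSq k H).lTensor T.toComod ∘ₗ T.toComod.coact)
      N.act f) = ∑ l, primeMkL T N (C l j ⊗ₜ[k] f (C i l)) :=
  primeMk_rel (N := Contra.tensorL T.twist N) hC i j f

theorem primeMkR_rel {ι : Type} [Fintype ι] [DecidableEq ι] {C : ι → ι → H}
    (hC : IsComatrix k C) (i j : ι) (f : H →ₗ[k] N ⊗[k] T.toComod) :
    primeMkR T N (C i j ⊗ₜ contraActR T.toComod.coact N.act f) =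
      ∑ l, primeMkR T N (C l j ⊗ₜ[k] f (C i l)) :=
  primeMk_rel (N := Contra.tensorR T N) hC i j f

theorem primeMkL_coact {ι : Type} [Fintype ι] [DecidableEq ι] {C : ι → ι → H}
    (hC : IsComatrix k C) (i j : ι) (w : T.toComod ⊗[k] N) :
    primeCoact (Contra.tensorL T.twist N) (primeMkL T N (C i j ⊗ₜ w)) =
      ∑ l, primeMkL T N (C i l ⊗ₜ w) ⊗ₜ[k] C l j :=
  primeCoact_apply (N := Contra.tensorL T.twist N) hC i j w

theorem primeMkR_coact {ι : Type} [Fintype ι] [DecidableEq ι] {C : ι → ι → H}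
    (hC : IsComatrix k C) (i j : ι) (w : N ⊗[k] T.toComod) :
    primeCoact (Contra.tensorR T N) (primeMkR T N (C i j ⊗ₜ w)) =
      ∑ l, primeMkR T N (C i l ⊗ₜ w) ⊗ₜ[k] C l j :=
  primeCoact_apply (N := Contra.tensorR T N) hC i j w

variable (T N)

/-- The map `h ⊗ (t ⊗ n) ↦ t₀ ⊗ [S(t₁) h ⊗ n]`. -/
def primeLeftAux : H ⊗[k] (T.toComod ⊗[k] N) →ₗ[k] T.toComod ⊗[k] primeSpace N :=
  (primeMk N).lTensor T.toComod ∘ₗ mulShiftL T.toComod.coact (HopfAlgebra.antipode k) ∘ₗ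
    (TensorProduct.leftComm k H T.toComod N).toLinearMap

theorem primeLeftAux_tmul {N : Contra k H} {T : FdComod k H} {ι : Type} [Fintype ι]
    {v : ι → T.toComod} {C : ι → ι → H}
    (hv : ∀ j, T.toComod.coact (v j) = ∑ i, v i ⊗ₜ[k] C i j) (h : H) (j : ι) (w : N) :
    primeLeftAux T N (h ⊗ₜ (v j ⊗ₜ w)) =
      ∑ i, v i ⊗ₜ[k] primeMk N ((HopfAlgebra.antipode k (C i j) * h) ⊗ₜ[k] w) := by
  simp [primeLeftAux, mulShiftL_tmul _ hv, map_sum]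

/-- The contraaction of T^{S²} ⊗ N inserts S²(c_lj) into f, and the relation of N' at S(c_il) h
inserts S(c_pl). Their sum over l is δ_pj, and the relation for h remains. -/
theorem primeLeftAux_rel {σ : T.toComod →ₗ[k] T.toComod ⊗[k] H}
    (hσ : σ = (antipodeSq k H).lTensor T.toComod ∘ₗ T.toComod.coact) {m : ℕ}
    {D : Fin m → Fin m → H} (hD : IsComatrix k D) (a b : Fin m)
    (φ : H →ₗ[k] T.toComod ⊗[k] N) :
    primeLeftAux T N (D a b ⊗ₜ contraActL σ N.act φ) =
      ∑ d, primeLeftAux T N (D d b ⊗ₜ φ (D a d)) := by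
  obtain ⟨z, rfl⟩ := canonL_surjective φ
  induction z using Comod.induction_left with
  | zero => simp
  | add x y hx hy =>
    simp only [map_add, LinearMap.add_apply, TensorProduct.tmul_add, Finset.sum_add_distrib,
      hx, hy]
  | hv n v C hC hv j f =>
    have hT : ∀ j, σ (v j) = ∑ l, v l ⊗ₜ[k] antipodeSq k H (C l j) := by
      intro i
      rw [hσ]
      exact lTensor_coeff hv _ i
    have h1 : ∀ l i, primeMk N ((HopfAlgebra.antipode k (C i l) * D a b) ⊗ₜ[k]
        N.act (f ∘ₗ LinearMap.mulLeft k (antipodeSq k H (C l j)))) = ∑ p, ∑ d,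
          primeMk N ((HopfAlgebra.antipode k (C i p) * D d b) ⊗ₜ[k]
            f (antipodeSq k H (C l j) * HopfAlgebra.antipode k (C p l) * D a d)) := by
      intro l i
      refine (primeMk_rel (hC.antipode.mul hD) (l, a) (i, b) _).trans ?_
      rw [Fintype.sum_prod_type]
      simp [mul_assoc]
    have h2 : ∀ p d, ∑ l, f (antipodeSq k H (C l j) * HopfAlgebra.antipode k (C p l) * D a d) =
        if p = j then f (D a d) else 0 := by
      intro p d
      rw [← map_sum, ← Finset.sum_mul, hC.antipodeSq_antipode]
      split_ifs <;> simp
    rw [contraActL_tmul hT, TensorProduct.tmul_sum, map_sum]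
    simp only [canonL_tmul, primeLeftAux_tmul hv, h1]
    rw [Finset.sum_comm, Finset.sum_comm (s := (Finset.univ : Finset (Fin m)))]
    refine Finset.sum_congr rfl fun i _ => ?_
    rw [← TensorProduct.tmul_sum, ← TensorProduct.tmul_sum]
    congr 1
    calc _ = ∑ p, ∑ d, ∑ l, primeMk N ((HopfAlgebra.antipode k (C i p) * D d b) ⊗ₜ[k]
            f (antipodeSq k H (C l j) * HopfAlgebra.antipode k (C p l) * D a d)) := by
          rw [Finset.sum_comm]
          exact Finset.sum_congr rfl fun p _ => Finset.sum_comm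
      _ = _ := by
          simp only [← map_sum, ← TensorProduct.tmul_sum, h2]
          simp [TensorProduct.tmul_ite, apply_ite (primeMk N), Finset.sum_ite_irrel]

/-- The map `[h ⊗ (t ⊗ n)] ↦ t₀ ⊗ [S(t₁) h ⊗ n]`. -/
def primeLeft : primeSpace (Contra.tensorL T.twist N) →ₗ[k] T.toComod ⊗[k] primeSpace N :=
  primeLift (N := Contra.tensorL T.twist N) (X := T.toComod ⊗[k] primeSpace N)
    (primeLeftAux T N) fun m D hD a b φ => primeLeftAux_rel T N rfl hD a b φ

theorem primeLeft_tmul {N : Contra k H} {T : FdComod k H} {ι : Type} [Fintype ι]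
    {v : ι → T.toComod} {C : ι → ι → H}
    (hv : ∀ j, T.toComod.coact (v j) = ∑ i, v i ⊗ₜ[k] C i j) (h : H) (j : ι) (w : N) :
    primeLeft T N (primeMkL T N (h ⊗ₜ[k] (v j ⊗ₜ[k] w))) =
      ∑ i, v i ⊗ₜ[k] primeMk N ((HopfAlgebra.antipode k (C i j) * h) ⊗ₜ[k] w) :=
  primeLeftAux_tmul hv h j w

theorem primeLeft_pure {N : Contra k H} {T : FdComod k H} (h : H) (t : T.toComod) (w : N) :
    primeLeft T N (primeMkL T N (h ⊗ₜ[k] (t ⊗ₜ[k] w))) =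
      (primeMk N ∘ₗ (TensorProduct.mk k H N).flip w ∘ₗ LinearMap.mulRight k h ∘ₗ
        HopfAlgebra.antipode k).lTensor T.toComod (T.toComod.coact t) := by
  change primeLeftAux T N (h ⊗ₜ (t ⊗ₜ w)) = _
  simp only [primeLeftAux, mulShiftL, LinearMap.comp_apply, LinearEquiv.coe_coe,
    TensorProduct.leftComm_tmul, LinearMap.rTensor_tmul]
  generalize T.toComod.coact t = z
  induction z with
  | zero => simp
  | add x y hx hy => simp only [map_add, TensorProduct.add_tmul, hx, hy]
  | tmul a b => simp

/-- The map `h ⊗ n ↦ (t ↦ [t₁ h ⊗ (t₀ ⊗ n)])`. -/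
def primeLeftInvAux :
    H ⊗[k] N →ₗ[k] T.toComod →ₗ[k] primeSpace (Contra.tensorL T.twist N) :=
  (TensorProduct.curry (show T.toComod ⊗[k] (H ⊗[k] N) →ₗ[k]
      primeSpace (Contra.tensorL T.twist N) from
    primeMkL T N ∘ₗ
      (TensorProduct.leftComm k T.toComod H N).toLinearMap ∘ₗ
        mulShiftL T.toComod.coact LinearMap.id)).flip

theorem primeLeftInvAux_tmul {N : Contra k H} {T : FdComod k H} {ι : Type} [Fintype ι]
    {v : ι → T.toComod} {C : ι → ι → H}
    (hv : ∀ j, T.toComod.coact (v j) = ∑ i, v i ⊗ₜ[k] C i j) (h : H) (j : ι) (w : N) :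
    primeLeftInvAux T N (h ⊗ₜ w) (v j) =
      ∑ i, primeMkL T N ((C i j * h) ⊗ₜ[k] (v i ⊗ₜ[k] w)) := by
  refine (congrArg (fun z => primeMkL T N
    (TensorProduct.leftComm k T.toComod H N z)) (mulShiftL_tmul _ hv j h w)).trans ?_
  simp only [map_sum]
  rfl

/-- The relation of (T^{S²} ⊗ N)' speaks only of values of its own contraaction, so v_i ⊗ α(f) must
first be exhibited as such a value; the relation for the product comatrix c d then applies. -/
theorem primeLeftInvAux_rel {m : ℕ} {D : Fin m → Fin m → H} (hD : IsComatrix k D) (a b : Fin m)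
    (f : H →ₗ[k] N) :
    primeLeftInvAux T N (D a b ⊗ₜ N.act f) = ∑ d, primeLeftInvAux T N (D d b ⊗ₜ f (D a d)) := by
  refine T.toComod.lin_ext fun n v C hC hv j => ?_
  have hT : ∀ j, ((antipodeSq k H).lTensor T.toComod ∘ₗ T.toComod.coact) (v j) =
      ∑ l, v l ⊗ₜ[k] antipodeSq k H (C l j) := fun j => lTensor_coeff hv _ j
  -- The preimage Σ_l v_l ⊗ f(S(c_li) -) compensates the S²-shift in the contraaction.
  have h1 : ∀ i, v i ⊗ₜ[k] N.act f = contraActL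
      ((antipodeSq k H).lTensor T.toComod ∘ₗ T.toComod.coact) N.act
        (canonL H T.toComod N (∑ l, v l ⊗ₜ[k] (f ∘ₗ LinearMap.mulLeft k
          (HopfAlgebra.antipode k (C l i))))) := by
    intro i
    have h2 : ∀ p, ∑ l, (f ∘ₗ LinearMap.mulLeft k (HopfAlgebra.antipode k (C l i))) ∘ₗ
        LinearMap.mulLeft k (antipodeSq k H (C p l)) = if p = i then f else 0 := by
      intro p
      ext x
      have := congrArg (fun y => f (y * x)) (hC.antipode_antipodeSq i p)
      simp only [Finset.sum_mul, map_sum] at this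
      simp only [LinearMap.sum_apply, LinearMap.comp_apply, LinearMap.mulLeft_apply, ← mul_assoc]
      refine this.trans ?_
      split_ifs <;> simp
    simp only [map_sum, contraActL_tmul hT]
    rw [Finset.sum_comm]
    simp only [← TensorProduct.tmul_sum, ← map_sum, h2]
    simp [apply_ite N.act, TensorProduct.tmul_ite]
  -- The correction S(c_li) now meets the entry c_ip split off by the relation; summing over i
  -- removes both.
  have h3 : ∀ i, primeMkL T N ((C i j * D a b) ⊗ₜ[k] (v i ⊗ₜ[k] N.act f)) =
      ∑ p, ∑ d, ∑ l, primeMkL T N ((C p j * D d b) ⊗ₜ[k]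
        (v l ⊗ₜ[k] f (HopfAlgebra.antipode k (C l i) * C i p * D a d))) := by
    intro i
    rw [h1]
    refine (primeMkL_rel (hC.mul hD) (i, a) (j, b) _).trans ?_
    rw [Fintype.sum_prod_type]
    refine Finset.sum_congr rfl fun p _ => Finset.sum_congr rfl fun d _ => ?_
    rw [← map_sum, ← TensorProduct.tmul_sum]
    congr 2
    simp only [map_sum, LinearMap.sum_apply, canonL_tmul, LinearMap.comp_apply,
      LinearMap.mulLeft_apply, mul_assoc]
  have h4 : ∀ p d l, ∑ i, primeMkL T N ((C p j * D d b) ⊗ₜ[k]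
      (v l ⊗ₜ[k] f (HopfAlgebra.antipode k (C l i) * C i p * D a d))) =
        if l = p then primeMkL T N ((C p j * D d b) ⊗ₜ[k]
          (v l ⊗ₜ[k] f (D a d))) else 0 := by
    intro p d l
    have := congrArg (fun y => primeMkL T N ((C p j * D d b) ⊗ₜ[k]
      (v l ⊗ₜ[k] f (y * D a d)))) (hC.antipode_mul l p)
    simp only [Finset.sum_mul, map_sum, TensorProduct.tmul_sum] at this
    refine (Eq.trans ?_ this).trans ?_
    · rw [← map_sum, ← TensorProduct.tmul_sum]
    · split_ifs <;> simp
  rw [primeLeftInvAux_tmul hv, LinearMap.sum_apply]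
  simp only [primeLeftInvAux_tmul hv, h3]
  calc _ = ∑ p, ∑ d, ∑ l, ∑ i, primeMkL T N ((C p j * D d b) ⊗ₜ[k]
        (v l ⊗ₜ[k] f (HopfAlgebra.antipode k (C l i) * C i p * D a d))) := by
        rw [Finset.sum_comm]
        refine Finset.sum_congr rfl fun p _ => ?_
        rw [Finset.sum_comm]
        exact Finset.sum_congr rfl fun d _ => Finset.sum_comm
    _ = _ := by
        simp only [h4, Finset.sum_ite_eq', Finset.mem_univ, if_true]
        rw [Finset.sum_comm]

/-- The map `t ⊗ [h ⊗ n] ↦ [t₁ h ⊗ (t₀ ⊗ n)]`. -/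
def primeLeftInv :
    T.toComod ⊗[k] primeSpace N →ₗ[k] primeSpace (Contra.tensorL T.twist N) :=
  TensorProduct.lift (primeLift (primeLeftInvAux T N) fun m D hD a b f => by
    exact primeLeftInvAux_rel T N hD a b f).flip

theorem primeLeftInv_tmul {N : Contra k H} {T : FdComod k H} {ι : Type} [Fintype ι]
    {v : ι → T.toComod} {C : ι → ι → H}
    (hv : ∀ j, T.toComod.coact (v j) = ∑ i, v i ⊗ₜ[k] C i j) (h : H) (j : ι) (w : N) :
    primeLeftInv T N (v j ⊗ₜ primeMk N (h ⊗ₜ w)) =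
      ∑ i, primeMkL T N ((C i j * h) ⊗ₜ[k] (v i ⊗ₜ[k] w)) :=
  primeLeftInvAux_tmul hv h j w

/-- The isomorphism `(T^{S²} ⊗ N)' ≅ T ⊗ N'` of vector spaces. -/
def primeLeftEquiv :
    primeSpace (Contra.tensorL T.twist N) ≃ₗ[k] T.toComod ⊗[k] primeSpace N :=
  LinearEquiv.ofLinearMap (primeLeft T N) (primeLeftInv T N)
    (TensorProduct.ext (T.toComod.lin_ext fun n v C hC hv j => prime_ext fun m D hD a b w => by
      change primeLeft T N (primeLeftInv T N (v j ⊗ₜ primeMk N (D a b ⊗ₜ w))) =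
        v j ⊗ₜ primeMk N (D a b ⊗ₜ w)
      rw [primeLeftInv_tmul hv, map_sum]
      refine (Finset.sum_congr rfl fun i _ => primeLeft_tmul hv _ i w).trans ?_
      rw [Finset.sum_comm]
      simp only [← mul_assoc, ← TensorProduct.tmul_sum, ← map_sum, ← TensorProduct.sum_tmul,
        ← Finset.sum_mul, hC.antipode_mul]
      simp [TensorProduct.tmul_ite, TensorProduct.ite_tmul, apply_ite (primeMk N)]))
    (primeTensorL_ext fun m D n v C hD hC hv a b j w => by
      change primeLeftInv T N (primeLeft T N (primeMkL T N
        (D a b ⊗ₜ[k] (v j ⊗ₜ[k] w)))) =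
          primeMkL T N (D a b ⊗ₜ[k] (v j ⊗ₜ[k] w))
      rw [primeLeft_tmul hv, map_sum]
      refine (Finset.sum_congr rfl fun i _ => primeLeftInv_tmul hv _ i w).trans ?_
      rw [Finset.sum_comm]
      have : ∀ l, ∑ i, primeMkL T N
          ((C l i * (HopfAlgebra.antipode k (C i j) * D a b)) ⊗ₜ[k] (v l ⊗ₜ[k] w)) =
            if l = j then primeMkL T N
              (D a b ⊗ₜ[k] (v l ⊗ₜ[k] w)) else 0 := by
        intro l
        have h := congrArg (fun y => primeMkL T N
          ((y * D a b) ⊗ₜ[k] (v l ⊗ₜ[k] w))) (hC.mul_antipode l j)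
        simp only [Finset.sum_mul, map_sum, TensorProduct.sum_tmul, mul_assoc] at h
        refine h.trans ?_
        split_ifs <;> simp
      simp only [this, Finset.sum_ite_eq', Finset.mem_univ, if_true])

/-- The coaction of `T ⊗ N'`. -/
def tensorPrimeCoact :
    T.toComod ⊗[k] primeSpace N →ₗ[k] (T.toComod ⊗[k] primeSpace N) ⊗[k] H :=
  tensorCoact T.toComod (primeObj N)

theorem tensorPrimeCoact_left {N : Contra k H} {T : FdComod k H} {ι : Type} [Fintype ι]
    {v : ι → T.toComod} {C : ι → ι → H}
    (hv : ∀ j, T.toComod.coact (v j) = ∑ i, v i ⊗ₜ[k] C i j) (j : ι) (m : primeSpace N) :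
    tensorPrimeCoact T N (v j ⊗ₜ m) = ∑ i, TensorProduct.map (TensorProduct.mk k T.toComod
      (primeSpace N) (v i)) (LinearMap.mulLeft k (C i j)) (primeCoact N m) :=
  tensorCoact_left (M := primeObj N) hv j m

/-- The coaction of T gives c_pi, that of [S(c_ij) h ⊗ n] gives S(c_il) h², and the sum over i
cancels the two coefficients. -/
theorem primeLeft_coact :
    tensorPrimeCoact T N ∘ₗ primeLeft T N =
      (primeLeft T N).rTensor H ∘ₗ primeCoact (Contra.tensorL T.twist N) :=
  primeTensorL_ext fun m D n v C hD hC hv a b j w => by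
    change tensorPrimeCoact T N (primeLeft T N (primeMkL T N
        (D a b ⊗ₜ[k] (v j ⊗ₜ[k] w)))) = (primeLeft T N).rTensor H
          (primeCoact (Contra.tensorL T.twist N) (primeMkL T N
            (D a b ⊗ₜ[k] (v j ⊗ₜ[k] w))))
    have h1 : ∀ i, primeCoact N (primeMk N ((HopfAlgebra.antipode k (C i j) * D a b) ⊗ₜ w)) =
        ∑ l, ∑ d, primeMk N ((HopfAlgebra.antipode k (C l j) * D a d) ⊗ₜ w) ⊗ₜ[k]
          (HopfAlgebra.antipode k (C i l) * D d b) := fun i =>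
      (primeCoact_apply (hC.antipode.mul hD) (j, a) (i, b) w).trans (Fintype.sum_prod_type _)
    have h2 : ∀ i, tensorPrimeCoact T N (v i ⊗ₜ[k]
        primeMk N ((HopfAlgebra.antipode k (C i j) * D a b) ⊗ₜ w)) = ∑ p, ∑ l, ∑ d,
          (v p ⊗ₜ[k] primeMk N ((HopfAlgebra.antipode k (C l j) * D a d) ⊗ₜ w)) ⊗ₜ[k]
            (C p i * (HopfAlgebra.antipode k (C i l) * D d b)) := by
      intro i
      rw [tensorPrimeCoact_left hv, h1]
      simp only [map_sum]
      rfl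
    have h3 : ∀ p l d, ∑ i, (v p ⊗ₜ[k] primeMk N ((HopfAlgebra.antipode k (C l j) * D a d) ⊗ₜ w))
        ⊗ₜ[k] (C p i * (HopfAlgebra.antipode k (C i l) * D d b)) = if p = l then
          (v p ⊗ₜ[k] primeMk N ((HopfAlgebra.antipode k (C l j) * D a d) ⊗ₜ w)) ⊗ₜ[k] D d b
            else 0 := by
      intro p l d
      simp only [← mul_assoc, ← TensorProduct.tmul_sum, ← Finset.sum_mul, hC.mul_antipode]
      split_ifs <;> simp
    rw [primeMkL_coact hD, primeLeft_tmul hv, map_sum, map_sum]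
    simp only [h2]
    simp only [LinearMap.rTensor_tmul, primeLeft_tmul hv, TensorProduct.sum_tmul]
    rw [Finset.sum_comm]
    calc _ = ∑ p, ∑ l, ∑ d, ∑ i, (v p ⊗ₜ[k] primeMk N ((HopfAlgebra.antipode k (C l j) * D a d)
          ⊗ₜ w)) ⊗ₜ[k] (C p i * (HopfAlgebra.antipode k (C i l) * D d b)) := by
          refine Finset.sum_congr rfl fun p _ => ?_
          rw [Finset.sum_comm]
          exact Finset.sum_congr rfl fun l _ => Finset.sum_comm
      _ = _ := by
          simp only [h3, Finset.sum_ite_irrel, Finset.sum_const_zero, Finset.sum_ite_eq,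
            Finset.mem_univ, if_true]
          rw [Finset.sum_comm]

/-- The isomorphism `(T^{S²} ⊗ N)' ≅ T ⊗ N'`. -/
def primeLeftIso : primeObj (Contra.tensorL T.twist N) ≅ T.toComod.tensor (primeObj N) :=
  Comod.mkIso (M := primeObj (Contra.tensorL T.twist N)) (N := T.toComod.tensor (primeObj N))
    (primeLeftEquiv T N) (primeLeft_coact T N)

end PrimeTensor

end
end AYD

/-! ### The comparison between (N ⊗ T)' and N' ⊗ T^{S²}. -/

namespace AYD

noncomputable section

variable {k H : Type u} [Field k] [Ring H] [HopfAlgebra k H]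

section PrimeTensorRight

variable (T : FdComod k H) (N : Contra k H)

/-- The map `h ⊗ (n ⊗ t) ↦ [h S(t₁) ⊗ n] ⊗ t₀`. -/
def primeRightAux : H ⊗[k] (N ⊗[k] T.toComod) →ₗ[k] primeSpace N ⊗[k] T.toComod :=
  (TensorProduct.comm k T.toComod (primeSpace N)).toLinearMap ∘ₗ
    (primeMk N).lTensor T.toComod ∘ₗ mulShiftR T.toComod.coact (HopfAlgebra.antipode k) ∘ₗ
      (TensorProduct.comm k (H ⊗[k] N) T.toComod).toLinearMap ∘ₗ
        (TensorProduct.assoc k H N T.toComod).symm.toLinearMap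

variable {T N}

theorem primeRightAux_tmul {ι : Type} [Fintype ι]
    {v : ι → T.toComod} {C : ι → ι → H}
    (hv : ∀ j, T.toComod.coact (v j) = ∑ i, v i ⊗ₜ[k] C i j) (h : H) (w : N) (j : ι) :
    primeRightAux T N (h ⊗ₜ (w ⊗ₜ v j)) =
      ∑ i, primeMk N ((h * HopfAlgebra.antipode k (C i j)) ⊗ₜ[k] w) ⊗ₜ[k] v i := by
  simp [primeRightAux, mulShiftR_tmul _ hv, map_sum]

/-- The shift by c_lj in the contraaction of N ⊗ T is cancelled by S(c_pl), which the relation of N'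
splits off from S(c_il). -/
theorem primeRightAux_rel {m : ℕ} {D : Fin m → Fin m → H} (hD : IsComatrix k D) (a b : Fin m)
    (φ : H →ₗ[k] N ⊗[k] T.toComod) :
    primeRightAux T N (D a b ⊗ₜ contraActR T.toComod.coact N.act φ) =
      ∑ d, primeRightAux T N (D d b ⊗ₜ φ (D a d)) := by
  obtain ⟨z, rfl⟩ := canonR_surjective φ
  induction z using Comod.induction_right with
  | zero => simp
  | add x y hx hy =>
    simp only [map_add, LinearMap.add_apply, TensorProduct.tmul_add, Finset.sum_add_distrib,
      hx, hy]
  | hv n v C hC hv j f =>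
    have h1 : ∀ l i, primeMk N ((D a b * HopfAlgebra.antipode k (C i l)) ⊗ₜ[k]
        N.act (f ∘ₗ LinearMap.mulRight k (C l j))) = ∑ d, ∑ p,
          primeMk N ((D d b * HopfAlgebra.antipode k (C i p)) ⊗ₜ[k]
            f (D a d * (HopfAlgebra.antipode k (C p l) * C l j))) := by
      intro l i
      refine (primeMk_rel (hD.mul hC.antipode) (a, l) (b, i) _).trans ?_
      rw [Fintype.sum_prod_type]
      simp [mul_assoc]
    have h2 : ∀ p d, ∑ l, f (D a d * (HopfAlgebra.antipode k (C p l) * C l j)) =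
        if p = j then f (D a d) else 0 := by
      intro p d
      rw [← map_sum, ← Finset.mul_sum, hC.antipode_mul]
      split_ifs <;> simp
    rw [contraActR_tmul hv, TensorProduct.tmul_sum, map_sum]
    simp only [canonR_tmul, primeRightAux_tmul hv, h1]
    rw [Finset.sum_comm, Finset.sum_comm (s := (Finset.univ : Finset (Fin m)))]
    refine Finset.sum_congr rfl fun i _ => ?_
    rw [← TensorProduct.sum_tmul, ← TensorProduct.sum_tmul]
    congr 1
    calc _ = ∑ d, ∑ p, ∑ l, primeMk N ((D d b * HopfAlgebra.antipode k (C i p)) ⊗ₜ[k]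
            f (D a d * (HopfAlgebra.antipode k (C p l) * C l j))) := by
          rw [Finset.sum_comm]
          exact Finset.sum_congr rfl fun p _ => Finset.sum_comm
      _ = _ := by
          simp only [← map_sum, ← TensorProduct.tmul_sum, h2]
          simp [TensorProduct.tmul_ite, apply_ite (primeMk N)]

variable (T N)

/-- The map `[h ⊗ (n ⊗ t)] ↦ [h S(t₁) ⊗ n] ⊗ t₀`. -/
def primeRight : primeSpace (Contra.tensorR T N) →ₗ[k] primeSpace N ⊗[k] T.toComod :=
  primeLift (N := Contra.tensorR T N) (X := primeSpace N ⊗[k] T.toComod)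
    (primeRightAux T N) fun m D hD a b φ => primeRightAux_rel hD a b φ

variable {T N}

theorem primeRight_tmul {ι : Type} [Fintype ι]
    {v : ι → T.toComod} {C : ι → ι → H}
    (hv : ∀ j, T.toComod.coact (v j) = ∑ i, v i ⊗ₜ[k] C i j) (h : H) (w : N) (j : ι) :
    primeRight T N (primeMkR T N (h ⊗ₜ[k] (w ⊗ₜ[k] v j))) =
      ∑ i, primeMk N ((h * HopfAlgebra.antipode k (C i j)) ⊗ₜ[k] w) ⊗ₜ[k] v i :=
  primeRightAux_tmul hv h w j

theorem primeRight_pure (h : H) (w : N) (t : T.toComod) :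
    primeRight T N (primeMkR T N (h ⊗ₜ[k] (w ⊗ₜ[k] t))) =
      TensorProduct.comm k T.toComod (primeSpace N)
        ((primeMk N ∘ₗ (TensorProduct.mk k H N).flip w ∘ₗ LinearMap.mulLeft k h ∘ₗ
          HopfAlgebra.antipode k).lTensor T.toComod (T.toComod.coact t)) := by
  change primeRightAux T N (h ⊗ₜ (w ⊗ₜ t)) = _
  simp only [primeRightAux, mulShiftR, LinearMap.comp_apply, LinearEquiv.coe_coe,
    TensorProduct.assoc_symm_tmul, TensorProduct.comm_tmul, LinearMap.rTensor_tmul]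
  generalize T.toComod.coact t = z
  induction z with
  | zero => simp
  | add x y hx hy => simp only [map_add, TensorProduct.add_tmul, hx, hy]
  | tmul a b => simp

variable (T N)

/-- The map `h ⊗ n ↦ (t ↦ [h S²(t₁) ⊗ (n ⊗ t₀)])`. -/
def primeRightInvAux :
    H ⊗[k] N →ₗ[k] T.toComod →ₗ[k] primeSpace (Contra.tensorR T N) :=
  (TensorProduct.curry (show T.toComod ⊗[k] (H ⊗[k] N) →ₗ[k]
      primeSpace (Contra.tensorR T N) from
    primeMkR T N ∘ₗ (TensorProduct.assoc k H N T.toComod).toLinearMap ∘ₗ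
      (TensorProduct.comm k T.toComod (H ⊗[k] N)).toLinearMap ∘ₗ
        mulShiftR T.toComod.coact (antipodeSq k H))).flip

variable {T N}

theorem primeRightInvAux_tmul {ι : Type} [Fintype ι]
    {v : ι → T.toComod} {C : ι → ι → H}
    (hv : ∀ j, T.toComod.coact (v j) = ∑ i, v i ⊗ₜ[k] C i j) (h : H) (w : N) (j : ι) :
    primeRightInvAux T N (h ⊗ₜ w) (v j) =
      ∑ i, primeMkR T N ((h * antipodeSq k H (C i j)) ⊗ₜ[k] (w ⊗ₜ[k] v i)) := by
  refine (congrArg (fun z => primeMkR T N (TensorProduct.assoc k H N T.toComod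
    (TensorProduct.comm k T.toComod (H ⊗[k] N) z))) (mulShiftR_tmul _ hv j h w)).trans ?_
  simp only [map_sum]
  rfl

/-- The inverse multiplies by S²(t₁) because, on the right of h, this is what S(t₁) inverts. The
relation used is that of the product comatrix d S²(c), and Σ_i S²(c_ip) S(c_li) = δ_lp finishes. -/
theorem primeRightInvAux_rel {m : ℕ} {D : Fin m → Fin m → H} (hD : IsComatrix k D) (a b : Fin m)
    (f : H →ₗ[k] N) :
    primeRightInvAux T N (D a b ⊗ₜ N.act f) =
      ∑ d, primeRightInvAux T N (D d b ⊗ₜ f (D a d)) := by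
  refine T.toComod.lin_ext fun n v C hC hv j => ?_
  -- As on the left, α(f) ⊗ v_i is exhibited as a value of the contraaction, with preimage Σ_l f(-
  -- S(c_li)) ⊗ v_l.
  have h1 : ∀ i, N.act f ⊗ₜ[k] v i = contraActR T.toComod.coact N.act
        (canonR H N T.toComod (∑ l, (f ∘ₗ LinearMap.mulRight k
          (HopfAlgebra.antipode k (C l i))) ⊗ₜ[k] v l)) := by
    intro i
    have h2 : ∀ p, ∑ l, (f ∘ₗ LinearMap.mulRight k (HopfAlgebra.antipode k (C l i))) ∘ₗ
        LinearMap.mulRight k (C p l) = if p = i then f else 0 := by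
      intro p
      ext x
      have := congrArg (fun y => f (x * y)) (hC.mul_antipode p i)
      simp only [Finset.mul_sum, map_sum] at this
      simp only [LinearMap.sum_apply, LinearMap.comp_apply, LinearMap.mulRight_apply, mul_assoc]
      refine this.trans ?_
      split_ifs <;> simp
    simp only [map_sum, contraActR_tmul hv]
    rw [Finset.sum_comm]
    simp only [← TensorProduct.sum_tmul, ← map_sum, h2]
    simp [apply_ite N.act, TensorProduct.ite_tmul]
  have h3 : ∀ i, primeMkR T N ((D a b * antipodeSq k H (C i j)) ⊗ₜ[k] (N.act f ⊗ₜ[k] v i)) =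
      ∑ d, ∑ p, ∑ l, primeMkR T N ((D d b * antipodeSq k H (C p j)) ⊗ₜ[k]
        (f (D a d * (antipodeSq k H (C i p) * HopfAlgebra.antipode k (C l i))) ⊗ₜ[k] v l)) := by
    intro i
    rw [h1]
    refine (primeMkR_rel (hD.mul hC.antipodeSq) (a, i) (b, j) _).trans ?_
    rw [Fintype.sum_prod_type]
    refine Finset.sum_congr rfl fun d _ => Finset.sum_congr rfl fun p _ => ?_
    rw [← map_sum, ← TensorProduct.tmul_sum]
    congr 2
    simp only [map_sum, LinearMap.sum_apply, canonR_tmul, LinearMap.comp_apply,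
      LinearMap.mulRight_apply, mul_assoc]
  have h4 : ∀ d p l, ∑ i, primeMkR T N ((D d b * antipodeSq k H (C p j)) ⊗ₜ[k]
      (f (D a d * (antipodeSq k H (C i p) * HopfAlgebra.antipode k (C l i))) ⊗ₜ[k] v l)) =
        if l = p then primeMkR T N ((D d b * antipodeSq k H (C p j)) ⊗ₜ[k]
          (f (D a d) ⊗ₜ[k] v l)) else 0 := by
    intro d p l
    have := congrArg (fun y => primeMkR T N ((D d b * antipodeSq k H (C p j)) ⊗ₜ[k]
      (f (D a d * y) ⊗ₜ[k] v l))) (hC.antipodeSq_antipode l p)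
    simp only [Finset.mul_sum, map_sum, TensorProduct.tmul_sum, TensorProduct.sum_tmul] at this
    refine this.trans ?_
    split_ifs <;> simp
  rw [primeRightInvAux_tmul hv, LinearMap.sum_apply]
  simp only [primeRightInvAux_tmul hv, h3]
  calc _ = ∑ d, ∑ p, ∑ l, ∑ i, primeMkR T N ((D d b * antipodeSq k H (C p j)) ⊗ₜ[k]
        (f (D a d * (antipodeSq k H (C i p) * HopfAlgebra.antipode k (C l i))) ⊗ₜ[k] v l)) := by
        rw [Finset.sum_comm]
        refine Finset.sum_congr rfl fun p _ => ?_
        rw [Finset.sum_comm]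
        exact Finset.sum_congr rfl fun d _ => Finset.sum_comm
    _ = _ := by
        simp only [h4, Finset.sum_ite_eq', Finset.mem_univ, if_true]

variable (T N)

/-- The map `[h ⊗ n] ⊗ t ↦ [h S²(t₁) ⊗ (n ⊗ t₀)]`. -/
def primeRightInv :
    primeSpace N ⊗[k] T.toComod →ₗ[k] primeSpace (Contra.tensorR T N) :=
  TensorProduct.lift (primeLift (primeRightInvAux T N) fun m D hD a b f => by
    exact primeRightInvAux_rel hD a b f)

variable {T N}

theorem primeRightInv_tmul {ι : Type} [Fintype ι]
    {v : ι → T.toComod} {C : ι → ι → H}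
    (hv : ∀ j, T.toComod.coact (v j) = ∑ i, v i ⊗ₜ[k] C i j) (h : H) (w : N) (j : ι) :
    primeRightInv T N (primeMk N (h ⊗ₜ w) ⊗ₜ v j) =
      ∑ i, primeMkR T N ((h * antipodeSq k H (C i j)) ⊗ₜ[k] (w ⊗ₜ[k] v i)) :=
  primeRightInvAux_tmul hv h w j

variable (T N)

/-- The isomorphism `(N ⊗ T)' ≅ N' ⊗ T` of vector spaces. -/
def primeRightEquiv :
    primeSpace (Contra.tensorR T N) ≃ₗ[k] primeSpace N ⊗[k] T.toComod :=
  LinearEquiv.ofLinearMap (primeRight T N) (primeRightInv T N)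
    (TensorProduct.ext (prime_ext fun m D hD a b w => T.toComod.lin_ext fun n v C hC hv j => by
      change primeRight T N (primeRightInv T N (primeMk N (D a b ⊗ₜ w) ⊗ₜ v j)) =
        primeMk N (D a b ⊗ₜ w) ⊗ₜ v j
      rw [primeRightInv_tmul hv, map_sum]
      simp only [primeRight_tmul hv]
      rw [Finset.sum_comm]
      simp only [mul_assoc, ← TensorProduct.sum_tmul, ← map_sum,
        ← Finset.mul_sum, hC.antipodeSq_antipode]
      simp [TensorProduct.tmul_ite, TensorProduct.ite_tmul, apply_ite (primeMk N)]))
    (primeTensorR_ext fun m D n v C hD hC hv a b j w => by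
      change primeRightInv T N (primeRight T N (primeMkR T N
        (D a b ⊗ₜ[k] (w ⊗ₜ[k] v j)))) = primeMkR T N (D a b ⊗ₜ[k] (w ⊗ₜ[k] v j))
      rw [primeRight_tmul hv, map_sum]
      simp only [primeRightInv_tmul hv]
      rw [Finset.sum_comm]
      simp only [mul_assoc, ← TensorProduct.sum_tmul, ← map_sum,
        ← Finset.mul_sum, hC.antipode_antipodeSq]
      simp [TensorProduct.ite_tmul, apply_ite (primeMkR T N)])

/-- The coaction of `N' ⊗ T^{S²}`. -/
def primeTensorCoact :
    primeSpace N ⊗[k] T.toComod →ₗ[k] (primeSpace N ⊗[k] T.toComod) ⊗[k] H :=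
  tensorTwistCoact (primeObj N) T.toComod

theorem primeTensorCoact_right {N : Contra k H} {T : FdComod k H} {ι : Type} [Fintype ι]
    {v : ι → T.toComod} {C : ι → ι → H}
    (hv : ∀ j, T.toComod.coact (v j) = ∑ i, v i ⊗ₜ[k] C i j) (m : primeSpace N) (j : ι) :
    primeTensorCoact T N (m ⊗ₜ v j) = ∑ i, TensorProduct.map ((TensorProduct.mk k
      (primeSpace N) T.toComod).flip (v i)) (LinearMap.mulRight k (antipodeSq k H (C i j)))
        (primeCoact N m) :=
  tensorTwistCoact_right (M := primeObj N) hv m j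

/-- The coefficient of T^{S²} stands to the right of S(c_il), and S(c_il) S²(c_pi) sums over i to
δ_pl; this fixes the twist on the target. -/
theorem primeRight_coact :
    primeTensorCoact T N ∘ₗ primeRight T N =
      (primeRight T N).rTensor H ∘ₗ primeCoact (Contra.tensorR T N) :=
  primeTensorR_ext (T := T) (N := N) (X := (primeSpace N ⊗[k] T.toComod) ⊗[k] H)
    (f := primeTensorCoact T N ∘ₗ primeRight T N)
    (g := (primeRight T N).rTensor H ∘ₗ primeCoact (Contra.tensorR T N)) fun m D n v C hD hC hv a b j w => by
    change primeTensorCoact T N (primeRight T N (primeMkR T N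
        (D a b ⊗ₜ[k] (w ⊗ₜ[k] v j)))) = (primeRight T N).rTensor H
          (primeCoact (Contra.tensorR T N) (primeMkR T N
            (D a b ⊗ₜ[k] (w ⊗ₜ[k] v j))))
    have h1 : ∀ i, primeCoact N (primeMk N ((D a b * HopfAlgebra.antipode k (C i j)) ⊗ₜ w)) =
        ∑ d, ∑ l, primeMk N ((D a d * HopfAlgebra.antipode k (C l j)) ⊗ₜ w) ⊗ₜ[k]
          (D d b * HopfAlgebra.antipode k (C i l)) := fun i =>
      (primeCoact_apply (hD.mul hC.antipode) (a, j) (b, i) w).trans (Fintype.sum_prod_type _)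
    have h2 : ∀ i, primeTensorCoact T N (
        primeMk N ((D a b * HopfAlgebra.antipode k (C i j)) ⊗ₜ w) ⊗ₜ[k] v i) = ∑ p, ∑ d, ∑ l,
          (primeMk N ((D a d * HopfAlgebra.antipode k (C l j)) ⊗ₜ w) ⊗ₜ[k] v p) ⊗ₜ[k]
            (D d b * (HopfAlgebra.antipode k (C i l) * antipodeSq k H (C p i))) := by
      intro i
      rw [primeTensorCoact_right hv, h1]
      simp only [map_sum, ← mul_assoc]
      rfl
    have h3 : ∀ p d l, ∑ i, (primeMk N ((D a d * HopfAlgebra.antipode k (C l j)) ⊗ₜ w) ⊗ₜ[k] v p)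
        ⊗ₜ[k] (D d b * (HopfAlgebra.antipode k (C i l) * antipodeSq k H (C p i))) = if p = l then
          (primeMk N ((D a d * HopfAlgebra.antipode k (C l j)) ⊗ₜ w) ⊗ₜ[k] v p) ⊗ₜ[k] D d b
            else 0 := by
      intro p d l
      simp only [← TensorProduct.tmul_sum, ← Finset.mul_sum, hC.antipode_antipodeSq]
      split_ifs <;> simp
    rw [primeMkR_coact hD, primeRight_tmul hv, map_sum, map_sum]
    simp only [h2]
    simp only [LinearMap.rTensor_tmul, primeRight_tmul hv, TensorProduct.sum_tmul]
    rw [Finset.sum_comm]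
    calc _ = ∑ p, ∑ d, ∑ l, ∑ i, (primeMk N ((D a d * HopfAlgebra.antipode k (C l j)) ⊗ₜ w)
          ⊗ₜ[k] v p) ⊗ₜ[k]
            (D d b * (HopfAlgebra.antipode k (C i l) * antipodeSq k H (C p i))) := by
          refine Finset.sum_congr rfl fun p _ => ?_
          rw [Finset.sum_comm]
          exact Finset.sum_congr rfl fun l _ => Finset.sum_comm
      _ = _ := by
          simp only [h3, Finset.sum_ite_eq, Finset.mem_univ, if_true]
          rw [Finset.sum_comm]

/-- The isomorphism `(N ⊗ T)' ≅ N' ⊗ T^{S²}`. -/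
def primeRightIso : primeObj (Contra.tensorR T N) ≅ (primeObj N).tensor T.toComod.twist :=
  Comod.mkIso (M := primeObj (Contra.tensorR T N)) (N := (primeObj N).tensor T.toComod.twist)
    (primeRightEquiv T N) (primeRight_coact T N)

end PrimeTensorRight

end
end AYD

/-! ### Coherence of the comparison maps for N ↦ N'. -/

namespace AYD

noncomputable section

variable {k H : Type u} [Field k] [Ring H] [HopfAlgebra k H]

section PrimeBimodule

/-- The linear map `[h ⊗ n] ↦ [h ⊗ g(n)]`. -/
def primeMapLin {N N' : Contra k H} (g : N ⟶ N') : primeSpace N →ₗ[k] primeSpace N' :=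
  Comod.lin ((prime k H).map g)

theorem primeMapLin_mk {N N' : Contra k H} (g : N ⟶ N') (h : H) (n : N) :
    primeMapLin g (primeMk N (h ⊗ₜ n)) = primeMk N' (h ⊗ₜ Contra.lin g n) := rfl

/-- From here on pure tensors suffice: the explicit formulas are linear in the coaction of t, so
comatrices need not be chosen again. -/
theorem primeL_hom_ext {T : FdComod k H} {N : Contra k H} {X : Type*} [AddCommGroup X] [Module k X]
    {f g : primeSpace (Contra.tensorL T.twist N) →ₗ[k] X}
    (h : ∀ (x : H) (t : T.toComod) (n : N),
      f (primeMkL T N (x ⊗ₜ (t ⊗ₜ n))) = g (primeMkL T N (x ⊗ₜ (t ⊗ₜ n)))) : f = g :=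
  primeTensorL_ext fun m D n v C hD hC hv a b j w => h _ _ _

theorem primeR_hom_ext {T : FdComod k H} {N : Contra k H} {X : Type*} [AddCommGroup X] [Module k X]
    {f g : primeSpace (Contra.tensorR T N) →ₗ[k] X}
    (h : ∀ (x : H) (n : N) (t : T.toComod),
      f (primeMkR T N (x ⊗ₜ (n ⊗ₜ t))) = g (primeMkR T N (x ⊗ₜ (n ⊗ₜ t)))) : f = g :=
  primeTensorR_ext fun m D n v C hD hC hv a b j w => h _ _ _

variable {T T' L : FdComod k H} {N N' : Contra k H}

/-- The formula t₀ ⊗ [S(t₁) h ⊗ n] uses only the coaction of T, with which f commutes; g acts on n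
alone. -/
theorem primeLeft_natural (f : T.toComod ⟶ T'.toComod) (g : N ⟶ N') (h : H) (t : T.toComod)
    (n : N) :
    primeLeft T' N' (primeMkL T' N' (h ⊗ₜ (Comod.lin f t ⊗ₜ Contra.lin g n))) =
      TensorProduct.map (Comod.lin f) (primeMapLin g)
        (primeLeft T N (primeMkL T N (h ⊗ₜ (t ⊗ₜ n)))) := by
  have e := LinearMap.congr_fun (Comod.lin_comm f) t
  simp only [LinearMap.comp_apply] at e
  rw [primeLeft_pure, primeLeft_pure, e]
  generalize T.toComod.coact t = z
  induction z with
  | zero => simp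
  | add x y hx hy => simp only [map_add, hx, hy]
  | tmul a b => simp [primeMapLin_mk]

theorem primeRight_natural (g : N ⟶ N') (f : T.toComod ⟶ T'.toComod) (h : H) (n : N)
    (t : T.toComod) :
    primeRight T' N' (primeMkR T' N' (h ⊗ₜ (Contra.lin g n ⊗ₜ Comod.lin f t))) =
      TensorProduct.map (primeMapLin g) (Comod.lin f)
        (primeRight T N (primeMkR T N (h ⊗ₜ (n ⊗ₜ t)))) := by
  have e := LinearMap.congr_fun (Comod.lin_comm f) t
  simp only [LinearMap.comp_apply] at e
  rw [primeRight_pure, primeRight_pure, e]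
  generalize T.toComod.coact t = z
  induction z with
  | zero => simp
  | add x y hx hy => simp only [map_add, hx, hy]
  | tmul a b => simp [primeMapLin_mk]

/-- Successive application multiplies h by S(t'₁) S(t₁), which is S(t₁ t'₁). -/
theorem primeLeft_assoc (h : H) (t : T.toComod) (t' : T'.toComod) (n : N) :
    (primeLeft T' N).lTensor T.toComod (primeLeft T (Contra.tensorL T'.twist N)
      (primeMkL T (Contra.tensorL T'.twist N)
        (h ⊗ₜ (t ⊗ₜ (show Contra.tensorL T'.twist N from t' ⊗ₜ[k] n))))) =
      TensorProduct.assoc k T.toComod T'.toComod (primeSpace N)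
        (primeLeft (T.tensor T') N (primeMkL (T.tensor T') N
          (h ⊗ₜ ((show (T.tensor T').toComod from t ⊗ₜ[k] t') ⊗ₜ n)))) := by
  rw [primeLeft_pure]
  refine Eq.trans ?_ (congrArg (TensorProduct.assoc k T.toComod T'.toComod (primeSpace N))
    (primeLeft_pure (T := T.tensor T') h (t ⊗ₜ[k] t') n)).symm
  change _ = TensorProduct.assoc k T.toComod T'.toComod (primeSpace N)
    ((primeMk N ∘ₗ (TensorProduct.mk k H N).flip n ∘ₗ LinearMap.mulRight k h ∘ₗ
      HopfAlgebra.antipode k).lTensor (T.toComod ⊗[k] T'.toComod)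
        (tensorCoact T.toComod T'.toComod (t ⊗ₜ[k] t')))
  rw [tensorCoact_tmul]
  generalize T.toComod.coact t = z
  induction z with
  | zero => simp
  | add x y hx hy => simp only [map_add, TensorProduct.add_tmul, hx, hy]
  | tmul a b =>
    change a ⊗ₜ[k] primeLeft T' N (primeMkL T' N
      ((HopfAlgebra.antipode k b * h) ⊗ₜ (t' ⊗ₜ[k] n))) = _
    rw [primeLeft_pure]
    generalize T'.toComod.coact t' = y
    induction y with
    | zero => simp
    | add x y hx hy => simp only [map_add, TensorProduct.tmul_add, hx, hy]
    | tmul c d => simp [HopfAlgebra.antipode_mul_antidistrib, mul_assoc]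

/-- Removing t' before t gives h S(t'₁) S(t₁) = h S(t₁ t'₁). -/
theorem primeRight_assoc (h : H) (n : N) (t : T.toComod) (t' : T'.toComod) :
    (primeRight T N).rTensor T'.toComod (primeRight T' (Contra.tensorR T N)
      (primeMkR T' (Contra.tensorR T N)
        (h ⊗ₜ ((show Contra.tensorR T N from n ⊗ₜ[k] t) ⊗ₜ t')))) =
      (TensorProduct.assoc k (primeSpace N) T.toComod T'.toComod).symm
        (primeRight (T.tensor T') N (primeMkR (T.tensor T') N
          (h ⊗ₜ (n ⊗ₜ (show (T.tensor T').toComod from t ⊗ₜ[k] t'))))) := by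
  rw [primeRight_pure]
  refine Eq.trans ?_ (congrArg (TensorProduct.assoc k (primeSpace N) T.toComod T'.toComod).symm
    (primeRight_pure (T := T.tensor T') h n (t ⊗ₜ[k] t'))).symm
  change _ = (TensorProduct.assoc k (primeSpace N) T.toComod T'.toComod).symm
    (TensorProduct.comm k (T.toComod ⊗[k] T'.toComod) (primeSpace N)
      ((primeMk N ∘ₗ (TensorProduct.mk k H N).flip n ∘ₗ LinearMap.mulLeft k h ∘ₗ
        HopfAlgebra.antipode k).lTensor (T.toComod ⊗[k] T'.toComod)
          (tensorCoact T.toComod T'.toComod (t ⊗ₜ[k] t'))))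
  rw [tensorCoact_tmul]
  generalize T'.toComod.coact t' = z
  induction z with
  | zero => simp
  | add x y hx hy => simp only [map_add, TensorProduct.tmul_add, hx, hy]
  | tmul a b =>
    change primeRight T N (primeMkR T N
      ((h * HopfAlgebra.antipode k b) ⊗ₜ (n ⊗ₜ[k] t))) ⊗ₜ[k] a = _
    rw [primeRight_pure]
    generalize T.toComod.coact t = y
    induction y with
    | zero => simp
    | add x y hx hy => simp only [map_add, TensorProduct.add_tmul, hx, hy]
    | tmul c d => simp [HopfAlgebra.antipode_mul_antidistrib, mul_assoc]

/-- Both orders give S(t₁) h S(l₁), by associativity of H. -/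
theorem primeLeft_primeRight (h : H) (t : T.toComod) (n : N) (l : L.toComod) :
    (primeRight L N).lTensor T.toComod (primeLeft T (Contra.tensorR L N)
      (primeMkL T (Contra.tensorR L N)
        (h ⊗ₜ (t ⊗ₜ (show Contra.tensorR L N from n ⊗ₜ[k] l))))) =
      TensorProduct.assoc k T.toComod (primeSpace N) L.toComod
        ((primeLeft T N).rTensor L.toComod (primeRight L (Contra.tensorL T.twist N)
          (primeMkR L (Contra.tensorL T.twist N)
            (h ⊗ₜ ((show Contra.tensorL T.twist N from t ⊗ₜ[k] n) ⊗ₜ l))))) := by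
  rw [primeLeft_pure, primeRight_pure]
  have h1 : ∀ x y : H, x = y → primeMkR L N (x ⊗ₜ (n ⊗ₜ[k] l)) = primeMkR L N (y ⊗ₜ (n ⊗ₜ l)) :=
    fun x y e => e ▸ rfl
  -- Finite expressions for the two coactions suffice here: the identity is bilinear in them and
  -- uses no coalgebra axiom.
  obtain ⟨R, hR⟩ := TensorProduct.exists_finset (T.toComod.coact t)
  obtain ⟨S, hS⟩ := TensorProduct.exists_finset (L.toComod.coact l)
  have e1 : ∀ x, primeRight L N (primeMkR L N (x ⊗ₜ (n ⊗ₜ l))) = ∑ p ∈ S,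
      primeMk N ((x * HopfAlgebra.antipode k p.2) ⊗ₜ n) ⊗ₜ[k] p.1 := by
    intro x
    rw [primeRight_pure, hS, map_sum, map_sum]
    rfl
  have e2 : ∀ x, primeLeft T N (primeMkL T N (x ⊗ₜ (t ⊗ₜ n))) = ∑ p ∈ R,
      p.1 ⊗ₜ[k] primeMk N ((HopfAlgebra.antipode k p.2 * x) ⊗ₜ n) := by
    intro x
    rw [primeLeft_pure, hR, map_sum]
    rfl
  rw [hR, hS]
  simp only [map_sum]
  trans ∑ p ∈ R, ∑ q ∈ S, p.1 ⊗ₜ[k] (primeMk N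
    ((HopfAlgebra.antipode k p.2 * h * HopfAlgebra.antipode k q.2) ⊗ₜ n) ⊗ₜ[k] q.1)
  · refine Finset.sum_congr rfl fun p _ => ?_
    refine (congrArg (TensorProduct.mk k T.toComod _ p.1) (e1 _)).trans ?_
    rw [map_sum]
    rfl
  · rw [Finset.sum_comm]
    refine Finset.sum_congr rfl fun q _ => ?_
    refine Eq.trans ?_ (congrArg (fun z => TensorProduct.assoc k T.toComod (primeSpace N) L.toComod
      (z ⊗ₜ[k] q.1)) (e2 (h * HopfAlgebra.antipode k q.2))).symm
    simp only [TensorProduct.sum_tmul, map_sum, mul_assoc, TensorProduct.assoc_tmul]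

theorem primeLeft_unit (h : H) (r : k) (n : N) :
    TensorProduct.lid k (primeSpace N) (primeLeft (𝟙_ (FdComod k H)) N
      (primeMkL (𝟙_ (FdComod k H)) N (h ⊗ₜ ((show (𝟙_ (FdComod k H)).toComod from r) ⊗ₜ n)))) =
      primeMk N (h ⊗ₜ (r • n)) := by
  refine (congrArg _ (primeLeft_pure (T := 𝟙_ (FdComod k H)) h r n)).trans ?_
  change TensorProduct.lid k (primeSpace N) ((primeMk N ∘ₗ (TensorProduct.mk k H N).flip n ∘ₗ
    LinearMap.mulRight k h ∘ₗ HopfAlgebra.antipode k).lTensor k (r ⊗ₜ[k] (1 : H))) = _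
  simp

theorem primeRight_unit (h : H) (n : N) (r : k) :
    TensorProduct.rid k (primeSpace N) (primeRight (𝟙_ (FdComod k H)) N
      (primeMkR (𝟙_ (FdComod k H)) N (h ⊗ₜ (n ⊗ₜ (show (𝟙_ (FdComod k H)).toComod from r))))) =
      primeMk N (h ⊗ₜ (r • n)) := by
  refine (congrArg _ (primeRight_pure (T := 𝟙_ (FdComod k H)) h n r)).trans ?_
  change TensorProduct.rid k (primeSpace N) (TensorProduct.comm k k (primeSpace N)
    ((primeMk N ∘ₗ (TensorProduct.mk k H N).flip n ∘ₗ LinearMap.mulLeft k h ∘ₗ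
      HopfAlgebra.antipode k).lTensor k (r ⊗ₜ[k] (1 : H)))) = _
  simp

/-- Reduces further to pure tensors inside T ⊗ T', as needed for the associativity axiom; the two
lemmas after it do the same for the right associativity and middle axioms. -/
theorem primeL_tensor_ext {X : Type*} [AddCommGroup X] [Module k X]
    {f g : primeSpace (Contra.tensorL (T.tensor T').twist N) →ₗ[k] X}
    (h : ∀ (x : H) (t : T.toComod) (t' : T'.toComod) (n : N),
      f (primeMkL (T.tensor T') N (x ⊗ₜ ((show (T.tensor T').toComod from t ⊗ₜ[k] t') ⊗ₜ n))) =
        g (primeMkL (T.tensor T') N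
          (x ⊗ₜ ((show (T.tensor T').toComod from t ⊗ₜ[k] t') ⊗ₜ n)))) : f = g := by
  refine primeL_hom_ext (T := T.tensor T') fun x => ?_
  change ∀ (y : T.toComod ⊗[k] T'.toComod) (n : N), _
  intro y n
  exact LinearMap.congr_fun (f := f ∘ₗ primeMkL (T.tensor T') N ∘ₗ TensorProduct.mk k H _ x ∘ₗ
      (TensorProduct.mk k (T.toComod ⊗[k] T'.toComod) N).flip n)
    (g := g ∘ₗ primeMkL (T.tensor T') N ∘ₗ TensorProduct.mk k H _ x ∘ₗ
      (TensorProduct.mk k (T.toComod ⊗[k] T'.toComod) N).flip n)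
    (TensorProduct.ext' fun t t' => h x t t' n) y

theorem primeR_tensor_ext {X : Type*} [AddCommGroup X] [Module k X]
    {f g : primeSpace (Contra.tensorR (T.tensor T') N) →ₗ[k] X}
    (h : ∀ (x : H) (n : N) (t : T.toComod) (t' : T'.toComod),
      f (primeMkR (T.tensor T') N (x ⊗ₜ (n ⊗ₜ (show (T.tensor T').toComod from t ⊗ₜ[k] t')))) =
        g (primeMkR (T.tensor T') N
          (x ⊗ₜ (n ⊗ₜ (show (T.tensor T').toComod from t ⊗ₜ[k] t'))))) : f = g := by
  refine primeR_hom_ext (T := T.tensor T') fun x n => ?_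
  change ∀ (y : T.toComod ⊗[k] T'.toComod), _
  intro y
  exact LinearMap.congr_fun (f := f ∘ₗ primeMkR (T.tensor T') N ∘ₗ TensorProduct.mk k H _ x ∘ₗ
      TensorProduct.mk k N (T.toComod ⊗[k] T'.toComod) n)
    (g := g ∘ₗ primeMkR (T.tensor T') N ∘ₗ TensorProduct.mk k H _ x ∘ₗ
      TensorProduct.mk k N (T.toComod ⊗[k] T'.toComod) n)
    (TensorProduct.ext' fun t t' => h x n t t') y

theorem primeMid_ext {X : Type*} [AddCommGroup X] [Module k X]
    {f g : primeSpace (Contra.tensorR L (Contra.tensorL T.twist N)) →ₗ[k] X}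
    (h : ∀ (x : H) (t : T.toComod) (n : N) (l : L.toComod),
      f (primeMkR L (Contra.tensorL T.twist N)
        (x ⊗ₜ ((show Contra.tensorL T.twist N from t ⊗ₜ[k] n) ⊗ₜ l))) =
        g (primeMkR L (Contra.tensorL T.twist N)
          (x ⊗ₜ ((show Contra.tensorL T.twist N from t ⊗ₜ[k] n) ⊗ₜ l)))) : f = g := by
  refine primeR_hom_ext (N := Contra.tensorL T.twist N) fun x => ?_
  change ∀ (y : T.toComod ⊗[k] N) (l : L.toComod), _
  intro y l
  exact LinearMap.congr_fun (f := f ∘ₗ primeMkR L (Contra.tensorL T.twist N) ∘ₗ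
      TensorProduct.mk k H _ x ∘ₗ (TensorProduct.mk k (T.toComod ⊗[k] N) L.toComod).flip l)
    (g := g ∘ₗ primeMkR L (Contra.tensorL T.twist N) ∘ₗ
      TensorProduct.mk k H _ x ∘ₗ (TensorProduct.mk k (T.toComod ⊗[k] N) L.toComod).flip l)
    (TensorProduct.ext' fun t n => h x t n l) y

variable (k H) in
/-- The functor `N ↦ N'` is a functor of bimodule categories. -/
def primeBimodule : BimoduleFunctor (FdComod k H) (prime k H) where
  left T N := primeLeftIso T N
  right N T := primeRightIso T N
  left_naturality {T T' N N'} f g := Comod.hom_ext (primeL_hom_ext (T := T) (N := N)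
    fun x t n => primeLeft_natural f g x t n)
  right_naturality {N N' T T'} g f := Comod.hom_ext (primeR_hom_ext (T := T) (N := N)
    fun x n t => primeRight_natural g f x n t)
  left_assoc T T' N := Comod.hom_ext (primeL_tensor_ext (T := T) (T' := T') (N := N)
    fun x t t' n => primeLeft_assoc x t t' n)
  left_unit N := Comod.hom_ext (primeL_hom_ext (T := 𝟙_ (FdComod k H)) (N := N)
    fun x r n => primeLeft_unit (k := k) (H := H) x r n)
  right_assoc N T T' := Comod.hom_ext (primeR_tensor_ext (T := T) (T' := T') (N := N)
    -- The identification of (T ⊗ T')^{S²} with T^{S²} ⊗ T'^{S²} contributes an identity map,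
    -- supplied by `TensorProduct.map_id`.
    fun x n t t' => (primeRight_assoc x n t t').trans
      (congrArg (TensorProduct.assoc k (primeSpace N) T.toComod T'.toComod).symm
        (LinearMap.congr_fun TensorProduct.map_id _).symm))
  right_unit N := Comod.hom_ext (primeR_hom_ext (T := 𝟙_ (FdComod k H)) (N := N)
    fun x n r => (congrArg (TensorProduct.rid k (primeSpace N))
      (LinearMap.congr_fun TensorProduct.map_id _)).trans (primeRight_unit (k := k) (H := H) x n r))
  middle T N L := Comod.hom_ext (primeMid_ext (T := T) (L := L) (N := N)
    fun x t n l => primeLeft_primeRight x t n l)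

end PrimeBimodule

end
end AYD

/-! ### Lifting an adjunction of bimodule functors to the centers. -/

namespace AYD

noncomputable section

section CenterAdjunction

universe v₁ u₁ v₂ u₂ v₃ u₃

open MonoidalLeftAction MonoidalRightAction BimoduleCategory

variable {C : Type u₁} [Category.{v₁} C] [MonoidalCategory C]
  {D : Type u₂} [Category.{v₂} D] [MonoidalLeftAction C D] [MonoidalRightAction C D]
  [BimoduleCategory C D]
  {E : Type u₃} [Category.{v₃} E] [MonoidalLeftAction C E] [MonoidalRightAction C E]
  [BimoduleCategory C E]

/-- An isomorphism of the center from an isomorphism that commutes with the central structures. -/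
def BimoduleCenter.mkIso {M N : BimoduleCenter C D} (e : M.obj ≅ N.obj)
    (h : ∀ X : C, X ⊴ₗ e.hom ≫ (N.β X).hom = (M.β X).hom ≫ e.hom ⊵ᵣ X) : M ≅ N where
  hom := ⟨e.hom, h⟩
  inv := ⟨e.inv, fun X => by
    -- Compatibility of the inverse is the given compatibility after composing with the isomorphism
    -- `e.hom ⊵ᵣ X`.
    rw [← cancel_mono (e.hom ⊵ᵣ X), Category.assoc, Category.assoc, ← h X]
    simp [← MonoidalRightAction.comp_actionHomLeft,
      ← MonoidalLeftAction.actionHomRight_comp_assoc]⟩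
  hom_inv_id := BimoduleCenter.hom_ext e.hom_inv_id
  inv_hom_id := BimoduleCenter.hom_ext e.inv_hom_id

variable {F : D ⥤ E} {G : E ⥤ D} (adj : F ⊣ G) (A : BimoduleFunctor C F)
  (B : BimoduleFunctor C G)

/-- The two compatibilities are mates. Transposed along the adjunction, the right-hand side becomes
an identity by a triangle identity, and the left-hand side collapses by naturality of the unit and
`hl`. Hence only the unit needs checking in concrete cases. -/
theorem counit_left_of_unit_left
    (hl : ∀ (X : C) (M : D), adj.unit.app (X ⊙ₗ M) ≫ G.map (A.left X M).hom =
      X ⊴ₗ adj.unit.app M ≫ (B.left X (F.obj M)).inv) (X : C) (M : E) :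
    F.map (B.left X M).hom ≫ (A.left X (G.obj M)).hom ≫ X ⊴ₗ adj.counit.app M =
      adj.counit.app (X ⊙ₗ M) := by
  apply (adj.homEquiv _ _).injective
  rw [adj.homEquiv_unit, adj.homEquiv_unit, adj.right_triangle_components, G.map_comp,
    adj.unit_naturality_assoc, G.map_comp, reassoc_of% (hl X (G.obj M))]
  have h := B.map_whisker_left X (adj.counit.app M)
  rw [h]
  simp [← MonoidalLeftAction.actionHomRight_comp_assoc]

theorem counit_right_of_unit_right
    (hr : ∀ (M : D) (X : C), adj.unit.app (M ⊙ᵣ X) ≫ G.map (A.right M X).hom =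
      adj.unit.app M ⊵ᵣ X ≫ (B.right (F.obj M) X).inv) (M : E) (X : C) :
    F.map (B.right M X).hom ≫ (A.right (G.obj M) X).hom ≫ adj.counit.app M ⊵ᵣ X =
      adj.counit.app (M ⊙ᵣ X) := by
  apply (adj.homEquiv _ _).injective
  rw [adj.homEquiv_unit, adj.homEquiv_unit, adj.right_triangle_components, G.map_comp,
    adj.unit_naturality_assoc, G.map_comp, reassoc_of% (hr (G.obj M) X)]
  have h := B.map_whisker_right (adj.counit.app M) X
  rw [h]
  simp [← MonoidalRightAction.comp_actionHomLeft_assoc]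

/-- An adjunction whose unit is compatible with bimodule functor structures lifts to the
centers. -/
def BimoduleFunctor.centerAdj
    (hl : ∀ (X : C) (M : D), adj.unit.app (X ⊙ₗ M) ≫ G.map (A.left X M).hom =
      X ⊴ₗ adj.unit.app M ≫ (B.left X (F.obj M)).inv)
    (hr : ∀ (M : D) (X : C), adj.unit.app (M ⊙ᵣ X) ≫ G.map (A.right M X).hom =
      adj.unit.app M ⊵ᵣ X ≫ (B.right (F.obj M) X).inv) :
    A.center ⊣ B.center where
  unit :=
    { app := fun M => ⟨adj.unit.app M.obj, fun X => by
        -- With the central structure of G F M written out, `hl` carries the unit past the left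
        -- isomorphisms, naturality past the central isomorphism of M, and `hr` past the right
        -- isomorphisms.
        change X ⊴ₗ adj.unit.app M.obj ≫ (B.left X (F.obj M.obj)).inv ≫
          G.map ((A.left X M.obj).inv ≫ F.map (M.β X).hom ≫ (A.right M.obj X).hom) ≫
            (B.right (F.obj M.obj) X).hom = (M.β X).hom ≫ adj.unit.app M.obj ⊵ᵣ X
        have h1 := (Iso.eq_comp_inv _).1 (hr M.obj X)
        rw [← reassoc_of% (hl X M.obj), ← G.map_comp_assoc, Iso.hom_inv_id_assoc, G.map_comp,
          Category.assoc, adj.unit_naturality_assoc, ← h1, Category.assoc]⟩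
      naturality := fun M N f => BimoduleCenter.hom_ext (adj.unit.naturality _) }
  counit :=
    { app := fun M => ⟨adj.counit.app M.obj, fun X => by
        change X ⊴ₗ adj.counit.app M.obj ≫ (M.β X).hom = ((A.left X (G.obj M.obj)).inv ≫
          F.map ((B.left X M.obj).inv ≫ G.map (M.β X).hom ≫ (B.right M.obj X).hom) ≫
            (A.right (G.obj M.obj) X).hom) ≫ adj.counit.app M.obj ⊵ᵣ X
        -- The compatibilities of the counit come from those of the unit as mates.
        have h1 := counit_left_of_unit_left adj A B hl X M.obj
        have h2 := counit_right_of_unit_right adj A B hr M.obj X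
        simp only [F.map_comp, Category.assoc]
        have h3 : F.map (G.map (M.β X).hom) ≫ adj.counit.app (M.obj ⊙ᵣ X) =
          adj.counit.app (X ⊙ₗ M.obj) ≫ (M.β X).hom := adj.counit.naturality _
        rw [h2, Iso.eq_inv_comp]
        refine Eq.trans ?_ (congrArg (F.map (B.left X M.obj).inv ≫ ·) h3).symm
        rw [← h1]
        simp [← F.map_comp_assoc]⟩
      naturality := fun M N f => BimoduleCenter.hom_ext (adj.counit.naturality _) }
  -- Morphisms of a center are determined by their underlying morphisms, so the triangle identities
  -- are inherited.
  left_triangle_components M := BimoduleCenter.hom_ext (adj.left_triangle_components M.obj)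
  right_triangle_components M := BimoduleCenter.hom_ext (adj.right_triangle_components M.obj)

end CenterAdjunction

variable {k H : Type u} [Field k] [Ring H] [HopfAlgebra k H]

variable (k H) in
/-- The adjunction between the centers of the bimodule categories of contramodules and of
comodules. -/
def centerAdj : (primeBimodule k H).center ⊣ (hatBimodule k H).center :=
  BimoduleFunctor.centerAdj (primeHatAdj k H) (primeBimodule k H) (hatBimodule k H)
    -- Both sides evaluated at h are t₀ ⊗ [S(t₁) h ⊗ n]: the formula for N', and the inverse formula
    -- for Hom(H, -)^H at the function h ↦ [h ⊗ n]. The right version is the same with h S(t₁).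
    (fun T N => Contra.hom_ext (TensorProduct.ext' fun t n => Subtype.ext (LinearMap.ext fun h =>
      (primeLeft_pure (T := T) (N := N) h t n).trans
        (hatLeft_pure (T := T.toComod) (M := primeObj N) t (unitLin N n) h).symm)))
    (fun N T => Contra.hom_ext (TensorProduct.ext' fun n t => Subtype.ext (LinearMap.ext fun h =>
      (primeRight_pure (T := T) (N := N) h n t).trans
        (hatRight_pure (T := T.toComod) (M := primeObj N) (unitLin N n) t h).symm)))

/-! ### The adjunction for anti-Yetter–Drinfeld objects, and stability. -/

section AYDAdjunction

/-- The action on functions conjugates the argument by S(h³) - h¹, while the action on N' multiplies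
by h³ - S(h¹). Performed in succession they cancel on the factor H and leave h acting on n. -/
theorem unitLin_act (N : AYDContra k H) (h : H) (n : N.toContra) :
    unitLin N.toContra (N.act h n) = hatHAct (primeHObj N) h (unitLin N.toContra n) := by
  refine LinearMap.congr_fun (f := unitLin N.toContra ∘ₗ N.act.toLinearMap.flip n)
    (g := (hatHAct (primeHObj N)).toLinearMap.flip (unitLin N.toContra n))
    (hopf_ext fun m C hC i j => Subtype.ext (LinearMap.ext fun x => ?_)) h
  refine Eq.symm ((conjAct_apply (primeHAct N).toLinearMap hC i j
    (unitLin N.toContra n).1 x).trans ?_)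
  change ∑ p, ∑ q, primeHAct N (C p q) (primeMk N.toContra
    ((HopfAlgebra.antipode k (C q j) * (x * C i p)) ⊗ₜ n)) =
      primeMk N.toContra (x ⊗ₜ N.act (C i j) n)
  simp only [primeHAct_apply N hC]
  -- The sums over the matched indices q and p are moved inside, where `IsComatrix.collapse`
  -- evaluates both products c S(c) at once.
  calc _ = ∑ s, ∑ t, primeMk N.toContra ((∑ q, ∑ p, C t q * (HopfAlgebra.antipode k (C q j) * x *
        C i p * HopfAlgebra.antipode k (C p s))) ⊗ₜ N.act (C s t) n) := by
        simp only [TensorProduct.sum_tmul, map_sum, mul_assoc]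
        rw [Finset.sum_comm]
        refine (Finset.sum_congr rfl fun q _ => Finset.sum_comm).trans ?_
        rw [Finset.sum_comm]
        refine Finset.sum_congr rfl fun s _ => ?_
        refine (Finset.sum_congr rfl fun q _ => Finset.sum_comm).trans ?_
        rw [Finset.sum_comm]
    _ = _ := by
        simp only [hC.collapse]
        simp [TensorProduct.ite_tmul, apply_ite (primeMk N.toContra)]

/-- The same cancellation in the other order: the conjugation on φ surrounds c_qj d_ab S(c_ip) by
S(c_tq) and c_ps, so two products S(c) c collapse and the action of M on φ(d_ab) remains. -/
theorem counitLin_act (M : AYDMod k H) (h : H) (z : primeSpace (hatObj M.toComod)) :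
    counitLin M.toComod (primeHAct (hatHObj M) h z) = M.act h (counitLin M.toComod z) := by
  let L : H →ₗ[k] primeSpace (hatObj M.toComod) →ₗ[k] M.toComod :=
    LinearMap.llcomp k _ _ _ (counitLin M.toComod) ∘ₗ (primeHAct (hatHObj M)).toLinearMap
  let R : H →ₗ[k] primeSpace (hatObj M.toComod) →ₗ[k] M.toComod :=
    LinearMap.lcomp k _ (counitLin M.toComod) ∘ₗ M.act.toLinearMap
  suffices hLR : L = R from LinearMap.congr_fun (LinearMap.congr_fun hLR h) z
  refine hopf_ext fun m C hC i j => prime_ext fun n D hD a b => ?_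
  change ∀ φ : hatSubmodule M.toComod, counitLin M.toComod (primeHAct (hatHObj M) (C i j)
    (primeMk (hatObj M.toComod) (D a b ⊗ₜ φ))) = M.act (C i j) (φ.1 (D a b))
  intro φ
  refine (congrArg (counitLin M.toComod)
    (primeHAct_apply (hatHObj M) hC i j (D a b) φ)).trans ?_
  refine (map_sum (counitLin M.toComod) _ _).trans
    ((Finset.sum_congr rfl fun p _ => map_sum (counitLin M.toComod) _ _).trans ?_)
  have h1 : ∀ p q, counitLin M.toComod (primeMk (hatObj M.toComod)
      ((C q j * (D a b * HopfAlgebra.antipode k (C i p))) ⊗ₜ hatHAct M (C p q) φ)) =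
        ∑ s, ∑ t, M.act (C s t) (φ.1 (HopfAlgebra.antipode k (C t q) *
          ((C q j * (D a b * HopfAlgebra.antipode k (C i p))) * C p s))) := fun p q =>
    conjAct_apply M.act.toLinearMap hC p q φ.1 _
  refine (Finset.sum_congr rfl fun p _ => Finset.sum_congr rfl fun q _ => h1 p q).trans ?_
  calc _ = ∑ s, ∑ t, M.act (C s t) (φ.1 ((∑ q, HopfAlgebra.antipode k (C t q) * C q j) * D a b *
        (∑ p, HopfAlgebra.antipode k (C i p) * C p s))) := by
        simp only [Finset.sum_mul, Finset.mul_sum, map_sum, mul_assoc]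
        rw [Finset.sum_comm]
        refine (Finset.sum_congr rfl fun q _ => Finset.sum_comm).trans ?_
        rw [Finset.sum_comm]
        refine Finset.sum_congr rfl fun s _ => ?_
        refine (Finset.sum_congr rfl fun q _ => Finset.sum_comm).trans ?_
        rw [Finset.sum_comm]
        exact Finset.sum_congr rfl fun t _ => Finset.sum_comm
    _ = _ := by
        simp only [hC.antipode_mul]
        simp [apply_ite φ.1, apply_ite (M.act _)]

variable (k H) in
/-- The adjunction between anti-Yetter-Drinfeld contramodules and modules. -/
def primeHatHAdj : primeH k H ⊣ hatH k H where
  unit :=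
    { app := fun N => ⟨(primeHatAdj k H).unit.app N.toContra, unitLin_act N⟩
      naturality := fun N P f => AYDContra.hom_ext ((primeHatAdj k H).unit.naturality _) }
  counit :=
    { app := fun M => ⟨(primeHatAdj k H).counit.app M.toComod, counitLin_act M⟩
      naturality := fun M P f => AYDMod.hom_ext ((primeHatAdj k H).counit.naturality _) }
  left_triangle_components N :=
    AYDMod.hom_ext ((primeHatAdj k H).left_triangle_components N.toContra)
  right_triangle_components M :=
    AYDContra.hom_ext ((primeHatAdj k H).right_triangle_components M.toComod)

/-- At c_ij the contraaction of l ↦ l · φ contains Σ_l S(c_ql) c_lj = δ_qj and reduces to Σ_p c_pj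
φ(c_ip). By colinearity of φ this is m₁ m₀ for m = φ(c_ij), so stability of M concludes. -/
theorem stableContra_hatH (M : AYDMod k H) (hM : stableMod k H M) :
    stableContra k H ((hatH k H).obj M) := by
  change ∀ φ : hatSubmodule M.toComod, hatAct M.toComod ((hatHAct M).toLinearMap.flip φ) = φ
  intro φ
  refine Subtype.ext (hopf_ext fun n C hC i j => ?_)
  rw [hatAct_apply _ hC]
  change ∑ l, conjAct M.act.toLinearMap (C i l) φ.1 (C l j) = φ.1 (C i j)
  have h := hM (φ.1 (C i j))
  rw [hatSubmodule_apply φ hC, map_sum] at h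
  simp only [TensorProduct.lift.tmul, LinearMap.flip_apply, AlgHom.toLinearMap_apply] at h
  rw [← h]
  simp only [conjAct_apply _ hC]
  calc _ = ∑ p, ∑ q, M.act (C p q) (φ.1 ((∑ l, HopfAlgebra.antipode k (C q l) * C l j) * C i p)) := by
        simp only [Finset.sum_mul, map_sum, mul_assoc]
        rw [Finset.sum_comm]
        exact Finset.sum_congr rfl fun p _ => Finset.sum_comm
    _ = _ := by
        simp only [hC.antipode_mul]
        simp [apply_ite φ.1, apply_ite (M.act _)]

/-- For m = [c_ij ⊗ w] the factor Σ_l c_il S(c_lp) = δ_ip reduces m₁ m₀ to Σ_q [c_qj ⊗ c_iq w]. The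
cokernel relation turns this into [c_ij ⊗ α(r_w)], and α(r_w) = w. -/
theorem stableMod_primeH (N : AYDContra k H) (hN : stableContra k H N) :
    stableMod k H ((primeH k H).obj N) := by
  change ∀ z : primeSpace N.toContra, TensorProduct.lift (primeHAct N).toLinearMap.flip
    (primeCoact N.toContra z) = z
  refine LinearMap.congr_fun (f := TensorProduct.lift (primeHAct N).toLinearMap.flip ∘ₗ
    primeCoact N.toContra) (g := LinearMap.id) (prime_ext fun n C hC i j w => ?_)
  change TensorProduct.lift (primeHAct N).toLinearMap.flip
    (primeCoact N.toContra (primeMk N.toContra (C i j ⊗ₜ w))) = primeMk N.toContra (C i j ⊗ₜ w)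
  rw [primeCoact_apply hC, map_sum]
  -- The target is expanded instead: stability introduces α(r_w), and the relation distributes it
  -- over the comatrix.
  conv_rhs => rw [← hN w, primeMk_rel hC]
  simp only [TensorProduct.lift.tmul, LinearMap.flip_apply, AlgHom.toLinearMap_apply,
    primeHAct_apply N hC]
  calc _ = ∑ p, ∑ q, primeMk N.toContra ((C q j * ∑ l, C i l * HopfAlgebra.antipode k (C l p)) ⊗ₜ
        N.act (C p q) w) := by
        simp only [Finset.mul_sum, TensorProduct.sum_tmul, map_sum]
        rw [Finset.sum_comm]
        exact Finset.sum_congr rfl fun p _ => Finset.sum_comm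
    _ = _ := by
        simp only [hC.mul_antipode]
        simp [TensorProduct.ite_tmul, apply_ite (primeMk N.toContra)]

variable (k H) in
/-- The adjunction between stable anti-Yetter-Drinfeld contramodules and modules. -/
def stableAdj :
    (stableMod k H).lift ((stableContra k H).ι ⋙ primeH k H)
        (fun N => stableMod_primeH N.obj N.property) ⊣
      (stableContra k H).lift ((stableMod k H).ι ⋙ hatH k H)
        (fun M => stableContra_hatH M.obj M.property) :=
  (primeHatHAdj k H).restrictFullyFaithful (stableContra k H).fullyFaithfulι
    (stableMod k H).fullyFaithfulι (Iso.refl _) (Iso.refl _)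

/-- The restriction is made along full inclusions with identity comparison isomorphisms, so the
general formula for the restricted unit loses all its correction terms. -/
theorem stableAdj_unit (N : (stableContra k H).FullSubcategory) :
    ((stableAdj k H).unit.app N).hom = (primeHatHAdj k H).unit.app N.obj := by
  have h := (primeHatHAdj k H).map_restrictFullyFaithful_unit_app
    (stableContra k H).fullyFaithfulι (stableMod k H).fullyFaithfulι
      (L := (stableMod k H).lift ((stableContra k H).ι ⋙ primeH k H)
        (fun N => stableMod_primeH N.obj N.property))
      (R := (stableContra k H).lift ((stableMod k H).ι ⋙ hatH k H)
        (fun M => stableContra_hatH M.obj M.property)) (Iso.refl _) (Iso.refl _) N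
  refine h.trans ?_
  simp

theorem stableAdj_counit (M : (stableMod k H).FullSubcategory) :
    ((stableAdj k H).counit.app M).hom = (primeHatHAdj k H).counit.app M.obj := by
  have h := (primeHatHAdj k H).map_restrictFullyFaithful_counit_app
    (stableContra k H).fullyFaithfulι (stableMod k H).fullyFaithfulι
      (L := (stableMod k H).lift ((stableContra k H).ι ⋙ primeH k H)
        (fun N => stableMod_primeH N.obj N.property))
      (R := (stableContra k H).lift ((stableMod k H).ι ⋙ hatH k H)
        (fun M => stableContra_hatH M.obj M.property)) (Iso.refl _) (Iso.refl _) M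
  refine h.trans ?_
  simp

end AYDAdjunction

end
end AYD

/-! ### Commutativity of the squares. -/

namespace AYD

noncomputable section

variable {k H : Type u} [Field k] [Ring H] [HopfAlgebra k H]

section Squares

/-- The factor c_ip of the conjugated argument meets S(c_li) from the right shift, and Σ_i S(c_li)
c_ip = δ_lp. What survives is Σ c_lq φ(S(c_qj) x) ⊗ v_l, the braiding of M applied to the left
shift. -/
theorem hatRight_braid (M : AYDMod k H) (T : Comod k H) (t : T) (φ : hatSubmodule M.toComod)
    (x : H) :
    (hatRight T M.toComod (braid T.coact (hatHAct M).toLinearMap (t ⊗ₜ φ))).1 x =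
      braid T.coact M.act.toLinearMap ((hatLeft T M.toComod (t ⊗ₜ φ)).1 x) := by
  let ev : hatSubmodule (M.toComod.tensor T.twist) →ₗ[k] M.toComod ⊗[k] T :=
    LinearMap.applyₗ x ∘ₗ (hatSubmodule (M.toComod.tensor T.twist)).subtype
  let ev' : hatSubmodule (T.tensor M.toComod) →ₗ[k] T ⊗[k] M.toComod :=
    LinearMap.applyₗ x ∘ₗ (hatSubmodule (T.tensor M.toComod)).subtype
  refine LinearMap.congr_fun (f := ev ∘ₗ hatRight T M.toComod ∘ₗ
      braid T.coact (hatHAct M).toLinearMap ∘ₗ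
        (TensorProduct.mk k T (hatSubmodule M.toComod)).flip φ)
    (g := braid T.coact M.act.toLinearMap ∘ₗ ev' ∘ₗ hatLeft T M.toComod ∘ₗ
      (TensorProduct.mk k T (hatSubmodule M.toComod)).flip φ)
    (T.lin_ext fun n v C hC hv j => ?_) t
  change ev (hatRight T M.toComod (braid T.coact (hatHAct M).toLinearMap (v j ⊗ₜ φ))) =
    braid T.coact M.act.toLinearMap (ev' (hatLeft T M.toComod (v j ⊗ₜ φ)))
  have e1 : ev' (hatLeft T M.toComod (v j ⊗ₜ φ)) =
      ∑ q, v q ⊗ₜ[k] φ.1 (HopfAlgebra.antipode k (C q j) * x) := hatLeft_tmul hv j φ x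
  have e2 : ∀ i, ev (hatRight T M.toComod (hatHAct M (C i j) φ ⊗ₜ v i)) = ∑ l, ∑ p, ∑ q,
      M.act (C p q) (φ.1 (HopfAlgebra.antipode k (C q j) * (x *
        (HopfAlgebra.antipode k (C l i) * C i p)))) ⊗ₜ[k] v l := by
    intro i
    refine (hatRight_tmul hv _ i x).trans (Finset.sum_congr rfl fun l _ => ?_)
    refine (congrArg (· ⊗ₜ[k] v l) (conjAct_apply M.act.toLinearMap hC i j φ.1 _)).trans ?_
    simp only [TensorProduct.sum_tmul, mul_assoc]
    rfl
  rw [e1, braid_apply _ hv, map_sum, map_sum, map_sum]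
  simp only [AlgHom.toLinearMap_apply, e2, braid_apply _ hv]
  calc _ = ∑ l, ∑ p, ∑ q, M.act (C p q) (φ.1 (HopfAlgebra.antipode k (C q j) * (x *
        (∑ i, HopfAlgebra.antipode k (C l i) * C i p)))) ⊗ₜ[k] v l := by
        simp only [Finset.mul_sum, map_sum, TensorProduct.sum_tmul]
        rw [Finset.sum_comm]
        refine Finset.sum_congr rfl fun l _ => ?_
        rw [Finset.sum_comm]
        exact Finset.sum_congr rfl fun p _ => Finset.sum_comm
    _ = ∑ l, ∑ q, M.act (C l q) (φ.1 (HopfAlgebra.antipode k (C q j) * x)) ⊗ₜ[k] v l := by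
        simp only [hC.antipode_mul]
        simp [apply_ite φ.1, apply_ite (M.act _), TensorProduct.ite_tmul, Finset.sum_ite_irrel]
    _ = _ := Finset.sum_comm

/-- The action of c_li on [S(c_ij) h ⊗ n] multiplies by c_qi on the left, where Σ_i c_qi S(c_ij) =
δ_qj, and leaves S(c_lp) on the right, as in the right comparison map. -/
theorem primeRight_braid (N : AYDContra k H) (T : FdComod k H) (h : H) (t : T.toComod)
    (n : N.toContra) :
    braid T.toComod.coact (primeHAct N).toLinearMap
        (primeLeft T N.toContra (primeMkL T N.toContra (h ⊗ₜ (t ⊗ₜ n)))) =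
      primeRight T N.toContra (primeMkR T N.toContra
        (h ⊗ₜ braid T.toComod.coact N.act.toLinearMap (t ⊗ₜ n))) := by
  refine LinearMap.congr_fun (f := braid T.toComod.coact (primeHAct N).toLinearMap ∘ₗ
      primeLeft T N.toContra ∘ₗ primeMkL T N.toContra ∘ₗ TensorProduct.mk k H _ h ∘ₗ
        (TensorProduct.mk k T.toComod N.toContra).flip n)
    (g := primeRight T N.toContra ∘ₗ primeMkR T N.toContra ∘ₗ TensorProduct.mk k H _ h ∘ₗ
      braid T.toComod.coact N.act.toLinearMap ∘ₗ
        (TensorProduct.mk k T.toComod N.toContra).flip n)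
    (T.toComod.lin_ext fun m v C hC hv j => ?_) t
  change braid T.toComod.coact (primeHAct N).toLinearMap
        (primeLeft T N.toContra (primeMkL T N.toContra (h ⊗ₜ (v j ⊗ₜ n)))) =
      primeRight T N.toContra (primeMkR T N.toContra
        (h ⊗ₜ braid T.toComod.coact N.act.toLinearMap (v j ⊗ₜ n)))
  rw [primeLeft_tmul hv, braid_apply _ hv, TensorProduct.tmul_sum]
  simp only [map_sum, braid_apply _ hv, primeRight_tmul hv, AlgHom.toLinearMap_apply,
    primeHAct_apply N hC, TensorProduct.sum_tmul]
  calc _ = ∑ l, ∑ p, ∑ q, primeMk N.toContra ((((∑ i, C q i * HopfAlgebra.antipode k (C i j)) * h) *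
        HopfAlgebra.antipode k (C l p)) ⊗ₜ[k] N.act (C p q) n) ⊗ₜ[k] v l := by
        simp only [Finset.sum_mul, map_sum, TensorProduct.sum_tmul, mul_assoc]
        rw [Finset.sum_comm]
        refine Finset.sum_congr rfl fun l _ => ?_
        rw [Finset.sum_comm]
        exact Finset.sum_congr rfl fun p _ => Finset.sum_comm
    _ = ∑ l, ∑ p, primeMk N.toContra ((h * HopfAlgebra.antipode k (C l p)) ⊗ₜ[k]
          N.act (C p j) n) ⊗ₜ[k] v l := by
        simp only [hC.mul_antipode]
        simp [TensorProduct.ite_tmul, apply_ite (primeMk N.toContra)]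
    _ = _ := Finset.sum_comm

/-- This is what makes the identity of Hom(H, M)^H a morphism of the center between the two central
structures; `prime_central` does the same for N'. -/
theorem hat_central (M : AYDMod k H) (T : FdComod k H) :
    (((contraToCenter k H).obj (hatHObj M)).β T).hom ≫ (hatRightIso M.toComod T).hom =
      (hatLeftIso M.toComod T).hom ≫ (hat k H).map (((modToCenter k H).obj M).β T).hom :=
  Contra.hom_ext (TensorProduct.ext' fun t φ => Subtype.ext (LinearMap.ext fun x =>
    hatRight_braid M T.toComod t φ x))

theorem prime_central (N : AYDContra k H) (T : FdComod k H) :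
    (primeLeftIso T N.toContra).hom ≫ (((modToCenter k H).obj (primeHObj N)).β T).hom =
      (prime k H).map (((contraToCenter k H).obj N).β T).hom ≫
        (primeRightIso T N.toContra).hom :=
  Comod.hom_ext (primeL_hom_ext (T := T) (N := N.toContra) fun x t n =>
    primeRight_braid N T x t n)

variable (k H) in
/-- The functors from anti-Yetter-Drinfeld modules to the center of the bimodule category of
contramodules agree. -/
def squareHat : hatH k H ⋙ contraToCenter k H ≅ modToCenter k H ⋙ (hatBimodule k H).center :=
  NatIso.ofComponents (fun M => BimoduleCenter.mkIso (M := (contraToCenter k H).obj (hatHObj M))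
      (N := (hatBimodule k H).center.obj ((modToCenter k H).obj M))
      (Iso.refl (hatObj M.toComod)) fun T => by
    -- The structure maps of `hatBimodule` are the inverses of `hatLeftIso` and `hatRightIso`, so
    -- the induced central structure starts with the former and ends with the inverse of the latter.
    change T ⊴ₗ 𝟙 (hatObj M.toComod) ≫ (hatLeftIso M.toComod T).hom ≫
      (hat k H).map (((modToCenter k H).obj M).β T).hom ≫ (hatRightIso M.toComod T).inv =
        (((contraToCenter k H).obj (hatHObj M)).β T).hom ≫ 𝟙 (hatObj M.toComod) ⊵ᵣ T
    rw [MonoidalLeftAction.actionHomRight_id, MonoidalRightAction.id_actionHomLeft]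
    refine (Category.id_comp _).trans (Eq.trans ?_ (Category.comp_id _).symm)
    refine (Category.assoc _ _ _).symm.trans ?_
    exact (Iso.comp_inv_eq _).2 (hat_central M T).symm)
    fun {M M'} f => BimoduleCenter.hom_ext
      ((Category.comp_id _).trans (Category.id_comp _).symm)

variable (k H) in
/-- The functors from anti-Yetter-Drinfeld contramodules to the center of the bimodule category
of comodules agree. -/
def squarePrime :
    primeH k H ⋙ modToCenter k H ≅ contraToCenter k H ⋙ (primeBimodule k H).center :=
  NatIso.ofComponents (fun N => BimoduleCenter.mkIso (M := (modToCenter k H).obj (primeHObj N))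
      (N := (primeBimodule k H).center.obj ((contraToCenter k H).obj N))
      (Iso.refl (primeObj N.toContra)) fun T => by
    change T ⊴ₗ 𝟙 (primeObj N.toContra) ≫ (primeLeftIso T N.toContra).inv ≫
      (prime k H).map (((contraToCenter k H).obj N).β T).hom ≫
        (primeRightIso T N.toContra).hom =
          (((modToCenter k H).obj (primeHObj N)).β T).hom ≫ 𝟙 (primeObj N.toContra) ⊵ᵣ T
    rw [MonoidalLeftAction.actionHomRight_id, MonoidalRightAction.id_actionHomLeft]
    refine (Category.id_comp _).trans (Eq.trans ?_ (Category.comp_id _).symm)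
    exact (Iso.inv_comp_eq _).2 (prime_central N T).symm)
    fun {N N'} f => BimoduleCenter.hom_ext
      ((Category.comp_id _).trans (Category.id_comp _).symm)

end Squares

end
end AYD

namespace AYD

noncomputable section

variable {k H : Type u} [Field k] [Ring H] [HopfAlgebra k H]

/-! ### Subcomodules and matrix comodules -/

section Subcomodule

variable (k H) in
/-- The comodule `H` with coaction `Δ`. -/
def Comod.regular : Comod k H where
  carrier := H
  coact := Coalgebra.comul
  coassoc := Coalgebra.coassoc
  counit := by ext a; simp

/-- A subspace `D` of a comodule with `ρ(D) ⊆ D ⊗ H`. -/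
def Comod.IsSub (M : Comod k H) (D : Submodule k M) : Prop :=
  ∀ x ∈ D, M.coact x ∈ LinearMap.range (D.subtype.rTensor H)

variable {M : Comod k H} {D : Submodule k M}

/-- A retraction onto a subspace. -/
def retract (D : Submodule k M) : M →ₗ[k] D :=
  (LinearMap.exists_leftInverse_of_injective D.subtype D.ker_subtype).choose

theorem retract_coe (D : Submodule k M) (x : D) : retract D x.1 = x :=
  LinearMap.congr_fun
    (LinearMap.exists_leftInverse_of_injective D.subtype D.ker_subtype).choose_spec x

theorem retract_comp_subtype (D : Submodule k M) : retract D ∘ₗ D.subtype = LinearMap.id :=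
  LinearMap.ext (retract_coe D)

/-- The coaction of x already lies in D ⊗ H, where every retraction is the identity. Hence a
coaction on D defined through an arbitrary retraction is the restricted one. -/
theorem Comod.IsSub.retract_coact (hD : M.IsSub D) {x : M} (hx : x ∈ D) :
    D.subtype.rTensor H ((retract D).rTensor H (M.coact x)) = M.coact x := by
  obtain ⟨z, hz⟩ := hD x hx
  rw [← hz, ← LinearMap.comp_apply (LinearMap.rTensor H (retract D)), ← LinearMap.rTensor_comp,
    retract_comp_subtype, LinearMap.rTensor_id, LinearMap.id_apply]

/-- A subcomodule as a comodule. -/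
def Comod.sub (M : Comod k H) (D : Submodule k M) (hD : M.IsSub D) : Comod k H where
  carrier := D
  coact := (retract D).rTensor H ∘ₗ M.coact ∘ₗ D.subtype
  coassoc := LinearMap.ext fun x => by
    have h1 := LinearMap.congr_fun M.coassoc x.1
    simp only [LinearMap.comp_apply, LinearEquiv.coe_coe] at h1
    have h2 : ∀ z : (M ⊗[k] H) ⊗[k] H, TensorProduct.assoc k D H H
        (((retract D).rTensor H).rTensor H z) =
          (retract D).rTensor (H ⊗[k] H) (TensorProduct.assoc k M H H z) := by
      intro z
      refine LinearMap.congr_fun (f := (TensorProduct.assoc k D H H).toLinearMap ∘ₗ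
        ((retract D).rTensor H).rTensor H) (g := (retract D).rTensor (H ⊗[k] H) ∘ₗ
          (TensorProduct.assoc k M H H).toLinearMap) ?_ z
      exact TensorProduct.ext_threefold fun _ _ _ => rfl
    simp only [LinearMap.comp_apply, LinearEquiv.coe_coe, Submodule.subtype_apply,
      LinearMap.rTensor_comp]
    rw [hD.retract_coact x.2, h2, h1]
    generalize M.coact x.1 = z
    induction z with
    | zero => simp
    | add x y hx hy => simp only [map_add, hx, hy]
    | tmul a b => rfl
  counit := LinearMap.ext fun x => by
    have h1 := LinearMap.congr_fun M.counit x.1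
    simp only [LinearMap.comp_apply, LinearEquiv.coe_coe, LinearMap.id_apply] at h1
    have h2 : ∀ z : M ⊗[k] H, TensorProduct.rid k D ((Coalgebra.counit (R := k)).lTensor D
        ((retract D).rTensor H z)) =
          retract D (TensorProduct.rid k M ((Coalgebra.counit (R := k)).lTensor M z)) := by
      intro z
      induction z with
      | zero => simp
      | add x y hx hy => simp only [map_add, hx, hy]
      | tmul a b => simp
    simp only [LinearMap.comp_apply, LinearEquiv.coe_coe, Submodule.subtype_apply,
      LinearMap.id_apply]
    rw [h2, h1, retract_coe]

/-- A morphism into a comodule with values in a subcomodule. -/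
def Comod.subLift (hD : M.IsSub D) {T : Comod k H} (f : T ⟶ M)
    (hf : ∀ t, Comod.lin f t ∈ D) : T ⟶ M.sub D hD where
  lin := LinearMap.codRestrict D (Comod.lin f) hf
  comm := LinearMap.ext fun t => by
    have h1 := LinearMap.congr_fun (Comod.lin_comm f) t
    simp only [LinearMap.comp_apply] at h1
    have h2 : retract D ∘ₗ Comod.lin f = LinearMap.codRestrict D (Comod.lin f) hf :=
      LinearMap.ext fun t => retract_coe D ⟨_, hf t⟩
    change (retract D).rTensor H (M.coact (Comod.lin f t)) = _
    rw [h1, ← LinearMap.comp_apply, ← LinearMap.rTensor_comp, h2]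
    rfl

/-- The inclusion of a subcomodule. -/
def Comod.subι (hD : M.IsSub D) : M.sub D hD ⟶ M where
  lin := D.subtype
  comm := LinearMap.ext fun x => (hD.retract_coact x.2).symm

theorem Comod.isSub_range {T : Comod k H} (f : T ⟶ M) : M.IsSub (LinearMap.range (Comod.lin f)) := by
  rintro _ ⟨t, rfl⟩
  have h1 := LinearMap.congr_fun (Comod.lin_comm f) t
  simp only [LinearMap.comp_apply] at h1
  rw [h1]
  refine ⟨(Comod.lin f).rangeRestrict.rTensor H (T.coact t), ?_⟩
  rw [← LinearMap.comp_apply, ← LinearMap.rTensor_comp]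
  rfl

theorem Comod.IsSub.mono_range {D' : Submodule k M} (h : D ≤ D') :
    LinearMap.range (D.subtype.rTensor H) ≤ LinearMap.range (D'.subtype.rTensor H) := by
  rintro _ ⟨z, rfl⟩
  refine ⟨(Submodule.inclusion h).rTensor H z, ?_⟩
  rw [← LinearMap.comp_apply, ← LinearMap.rTensor_comp]
  rfl

theorem Comod.IsSub.sup {D' : Submodule k M} (hD : M.IsSub D) (hD' : M.IsSub D') :
    M.IsSub (D ⊔ D') := by
  intro x hx
  obtain ⟨y, hy, z, hz, rfl⟩ := Submodule.mem_sup.1 hx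
  rw [map_add]
  exact add_mem (mono_range le_sup_left (hD y hy)) (mono_range le_sup_right (hD' z hz))

/-- The comodule with basis `e_j` and coaction `e_j ↦ ∑ e_i ⊗ c_ij` given by a comatrix. -/
def matComod {n : ℕ} {C : Fin n → Fin n → H} (hC : IsComatrix k C) : FdComod k H where
  toComod :=
    { carrier := Fin n → k
      coact := (Pi.basisFun k (Fin n)).constr k fun j => ∑ i, Pi.basisFun k (Fin n) i ⊗ₜ[k] C i j
      coassoc := (Pi.basisFun k (Fin n)).ext fun j =>
        coassoc_of_comatrix _ hC (v := Pi.basisFun k (Fin n))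
          (fun j => Module.Basis.constr_basis _ _ _ _) j
      counit := (Pi.basisFun k (Fin n)).ext fun j =>
        counit_of_comatrix _ hC (v := Pi.basisFun k (Fin n))
          (fun j => Module.Basis.constr_basis _ _ _ _) j }
  fd := inferInstanceAs (FiniteDimensional k (Fin n → k))

/-- The standard basis of a matrix comodule. -/
def matBasis {n : ℕ} {C : Fin n → Fin n → H} (hC : IsComatrix k C) :
    Module.Basis (Fin n) k (matComod hC).toComod := Pi.basisFun k (Fin n)

theorem matComod_coact {n : ℕ} {C : Fin n → Fin n → H} (hC : IsComatrix k C) (j : Fin n) :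
    (matComod hC).toComod.coact (matBasis hC j) = ∑ i, matBasis hC i ⊗ₜ[k] C i j :=
  (Pi.basisFun k (Fin n)).constr_basis k
    (fun j => ∑ i, Pi.basisFun k (Fin n) i ⊗ₜ[k] C i j) j

/-- Restated so that the supremum is formed among subspaces of H rather than of the carrier of
`Comod.regular`. -/
theorem regular_isSub_sup {D E : Submodule k H} (hD : (Comod.regular k H).IsSub D)
    (hE : (Comod.regular k H).IsSub E) : (Comod.regular k H).IsSub (D ⊔ E : Submodule k H) :=
  hD.sup hE

/-- A comatrix family v whose span contains x defines a comodule map e_j ↦ v_j from a matrix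
comodule to H; D is its image. -/
theorem exists_fd_sub (x : H) : ∃ D : Submodule k H, FiniteDimensional k D ∧
    (Comod.regular k H).IsSub D ∧ x ∈ D := by
  obtain ⟨n, v, C, hC, hv, hx⟩ := exists_comatrix (k := k) (Coalgebra.comul (R := k) (A := H))
    Coalgebra.coassoc (by ext a; simp) x
  let f : (matComod hC).toComod ⟶ Comod.regular k H :=
    { lin := (show (matComod hC).toComod →ₗ[k] H from (matBasis hC).constr k v)
      comm := (matBasis hC).ext fun j => by
        change Coalgebra.comul ((matBasis hC).constr k v (matBasis hC j)) =
          ((matBasis hC).constr k v).rTensor H ((matComod hC).toComod.coact (matBasis hC j))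
        rw [Module.Basis.constr_basis, hv, matComod_coact, map_sum]
        simp }
  refine ⟨LinearMap.range (Comod.lin f), inferInstance, Comod.isSub_range f, ?_⟩
  refine Submodule.span_le.2 ?_ hx
  rintro _ ⟨j, rfl⟩
  exact ⟨matBasis hC j, Module.Basis.constr_basis _ _ _ _⟩

end Subcomodule

/-! ### Central structures come from actions -/

section Reconstruct

variable {W : Type u} [AddCommGroup W] [Module k W]

/-- The map `w ⊗ t ↦ f(t) w`. -/
def coeffR {V : Type u} [AddCommGroup V] [Module k V] (f : V →ₗ[k] k) : W ⊗[k] V →ₗ[k] W :=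
  (TensorProduct.rid k W).toLinearMap ∘ₗ f.lTensor W

theorem coeffR_lTensor {V V' : Type u} [AddCommGroup V] [Module k V] [AddCommGroup V']
    [Module k V'] (f : V' →ₗ[k] k) (g : V →ₗ[k] V') (z : W ⊗[k] V) :
    coeffR f (g.lTensor W z) = coeffR (f ∘ₗ g) z := by
  simp [coeffR, LinearMap.lTensor_comp]

/-- The finite-dimensional comodule given by a subcomodule of `H`. -/
def fdSub (D : Submodule k H) [FiniteDimensional k D] (hD : (Comod.regular k H).IsSub D) :
    FdComod k H where
  toComod := (Comod.regular k H).sub D hD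
  fd := inferInstanceAs (FiniteDimensional k D)

variable (k H W) in
/-- A natural family of maps `T ⊗ W → W ⊗ T` compatible with tensor products and the unit. -/
structure HalfBraiding where
  β (T : FdComod k H) : T.toComod ⊗[k] W →ₗ[k] W ⊗[k] T.toComod
  natural {T T' : FdComod k H} (f : T ⟶ T') (t : T.toComod) (w : W) :
    β T' (FdComod.lin f t ⊗ₜ w) = (FdComod.lin f).lTensor W (β T (t ⊗ₜ w))
  hexagon (T T' : FdComod k H) (t : T.toComod) (t' : T'.toComod) (w : W) :
    β (T.tensor T') ((show (T.tensor T').toComod from t ⊗ₜ[k] t') ⊗ₜ w) =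
      TensorProduct.assoc k W T.toComod T'.toComod ((β T).rTensor T'.toComod
        ((TensorProduct.assoc k T.toComod W T'.toComod).symm (t ⊗ₜ β T' (t' ⊗ₜ w))))
  unit (w : W) : β (𝟙_ (FdComod k H)) ((show (𝟙_ (FdComod k H)).toComod from (1 : k)) ⊗ₜ w) =
    w ⊗ₜ[k] (1 : k)

namespace HalfBraiding

variable (B : HalfBraiding k H W)

/-- The operator by which an element `x` of a finite-dimensional subcomodule of `H` acts. -/
def subOp (D : Submodule k H) [FiniteDimensional k D] (hD : (Comod.regular k H).IsSub D) :
    D →ₗ[k] Module.End k W :=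
  TensorProduct.curry (show D ⊗[k] W →ₗ[k] W from
    coeffR (Coalgebra.counit (R := k) ∘ₗ D.subtype) ∘ₗ B.β (fdSub D hD))

/-- Naturality of β for f regarded as a map T → D, followed by the counit on the second factor. It
is what relates an arbitrary T to the operators of elements of H. -/
theorem coeffR_eq_subOp {T : FdComod k H} (f : T.toComod ⟶ Comod.regular k H)
    (D : Submodule k H) [FiniteDimensional k D] (hD : (Comod.regular k H).IsSub D)
    (hf : ∀ t, Comod.lin f t ∈ D) (t : T.toComod) (w : W) :
    coeffR (Coalgebra.counit (R := k) ∘ₗ (show T.toComod →ₗ[k] H from Comod.lin f))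
      (B.β T (t ⊗ₜ w)) = B.subOp D hD ⟨Comod.lin f t, hf t⟩ w := by
  have h := B.natural (T := T) (T' := fdSub D hD) (Comod.subLift hD f hf) t w
  refine Eq.symm ((congrArg (coeffR (Coalgebra.counit (R := k) ∘ₗ D.subtype)) h).trans ?_)
  exact coeffR_lTensor (W := W) (V := T.toComod) (V' := D)
    (Coalgebra.counit (R := k) ∘ₗ D.subtype) (LinearMap.codRestrict D (Comod.lin f) hf) _

/-- The previous lemma for the inclusion of D in H, whose values lie in D'. -/
theorem subOp_mono {D D' : Submodule k H} [FiniteDimensional k D] [FiniteDimensional k D']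
    (hD : (Comod.regular k H).IsSub D) (hD' : (Comod.regular k H).IsSub D') (h : D ≤ D') {x : H}
    (hx : x ∈ D) : B.subOp D hD ⟨x, hx⟩ = B.subOp D' hD' ⟨x, h hx⟩ :=
  LinearMap.ext fun w => B.coeffR_eq_subOp (T := fdSub D hD) (Comod.subι hD) D' hD'
    (fun t => h t.2) ⟨x, hx⟩ w

/-- The operator of x does not depend on the subcomodule chosen: two choices are compared in their
sum. -/
theorem exists_subOp (x : H) : ∃ u : Module.End k W, ∀ (D : Submodule k H)
    [FiniteDimensional k D] (hD : (Comod.regular k H).IsSub D) (hx : x ∈ D),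
      B.subOp D hD ⟨x, hx⟩ = u := by
  obtain ⟨E, hfd, hE, hxE⟩ := exists_fd_sub (k := k) x
  refine ⟨B.subOp E hE ⟨x, hxE⟩, fun D _ hD hx => ?_⟩
  exact (B.subOp_mono (D' := D ⊔ E) hD (regular_isSub_sup hD hE) le_sup_left hx).trans
    (B.subOp_mono (D' := D ⊔ E) hE (regular_isSub_sup hD hE) le_sup_right hxE).symm

/-- The operator by which an element of `H` acts. -/
def opFun (x : H) : Module.End k W := (B.exists_subOp x).choose

theorem subOp_eq (D : Submodule k H) [FiniteDimensional k D]
    (hD : (Comod.regular k H).IsSub D) (x : D) : B.subOp D hD x = B.opFun x.1 :=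
  (B.exists_subOp x.1).choose_spec D hD x.2

/-- The linear map `H → End W` of a half-braiding. -/
def op : H →ₗ[k] Module.End k W where
  toFun := B.opFun
  -- Additivity holds in any subcomodule containing both elements, such as the sum of one for x and
  -- one for y.
  map_add' x y := by
    obtain ⟨D, _, hD, hx⟩ := exists_fd_sub (k := k) x
    obtain ⟨E, _, hE, hy⟩ := exists_fd_sub (k := k) y
    have h := map_add (B.subOp (D ⊔ E) (regular_isSub_sup hD hE)) ⟨x, Submodule.mem_sup_left hx⟩
      ⟨y, Submodule.mem_sup_right hy⟩
    rw [subOp_eq, subOp_eq, subOp_eq] at h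
    exact h
  map_smul' r x := by
    obtain ⟨D, _, hD, hx⟩ := exists_fd_sub (k := k) x
    have h := map_smul (B.subOp D hD) r ⟨x, hx⟩
    rw [subOp_eq, subOp_eq] at h
    exact h

/-- The subcomodule is taken to be the range of f, which is finite-dimensional since T is. -/
theorem coeffR_eq_op {T : FdComod k H} (f : T.toComod ⟶ Comod.regular k H) (t : T.toComod)
    (w : W) :
    coeffR (Coalgebra.counit (R := k) ∘ₗ (show T.toComod →ₗ[k] H from Comod.lin f))
      (B.β T (t ⊗ₜ w)) = B.op (show H from Comod.lin f t) w := by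
  have : FiniteDimensional k (LinearMap.range (show T.toComod →ₗ[k] H from Comod.lin f)) :=
    inferInstance
  refine (B.coeffR_eq_subOp f (LinearMap.range (show T.toComod →ₗ[k] H from Comod.lin f))
    (Comod.isSub_range f) (fun t => ⟨t, rfl⟩) t w).trans ?_
  exact LinearMap.congr_fun (B.subOp_eq (LinearMap.range (show T.toComod →ₗ[k] H from Comod.lin f))
    (Comod.isSub_range f) ⟨Comod.lin f t, t, rfl⟩) w

/-- The matrix coefficient `T → H` of a comodule with a finite basis. -/
def _root_.AYD.coeffHom {ι : Type} [Fintype ι] [DecidableEq ι] {T : Comod k H}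
    (b : Module.Basis ι k T) {C : ι → ι → H} (hC : IsComatrix k C)
    (hb : ∀ j, T.coact (b j) = ∑ i, b i ⊗ₜ[k] C i j) (i : ι) : T ⟶ Comod.regular k H where
  lin := (show T →ₗ[k] H from b.constr k (C i))
  comm := b.ext fun j => by
    change Coalgebra.comul (b.constr k (C i) (b j)) = (b.constr k (C i)).rTensor H (T.coact (b j))
    rw [Module.Basis.constr_basis, hC.comul, hb, map_sum]
    simp

/-- The matrix coefficient b_j ↦ c_ij is a comodule map T → H, and since ε(c_ij) = δ_ij its
composite with the counit is the i-th coordinate. So `coeffR_eq_op` computes the coefficient of b_i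
in β(b_j ⊗ w). -/
theorem β_basis {ι : Type} [Fintype ι] [DecidableEq ι] {T : FdComod k H}
    (b : Module.Basis ι k T.toComod) {C : ι → ι → H} (hC : IsComatrix k C)
    (hb : ∀ j, T.toComod.coact (b j) = ∑ i, b i ⊗ₜ[k] C i j) (j : ι) (w : W) :
    B.β T (b j ⊗ₜ w) = ∑ i, B.op (C i j) w ⊗ₜ[k] b i := by
  rw [← sum_rightCoeff b (B.β T (b j ⊗ₜ w))]
  refine Finset.sum_congr rfl fun i _ => congrArg (· ⊗ₜ[k] b i) ?_
  have h := B.coeffR_eq_op (coeffHom b hC hb i) (b j) w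
  have h1 : Coalgebra.counit (R := k) ∘ₗ b.constr k (C i) = b.coord i :=
    b.ext fun l => by simp [hC.counit, Finsupp.single_apply, eq_comm]
  have h2 : b.constr k (C i) (b j) = C i j := b.constr_basis k _ _
  change coeffR (Coalgebra.counit (R := k) ∘ₗ b.constr k (C i)) _ =
    B.op (b.constr k (C i) (b j)) w at h
  rw [h1, h2] at h
  exact h

/-- A half-braiding is thus recovered from its operators; the remaining axioms become properties of
`op`. -/
theorem β_eq_braid (T : FdComod k H) : B.β T = braid T.toComod.coact B.op := by
  let b := Module.finBasis k T.toComod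
  obtain ⟨C, hC, hb⟩ := Comod.exists_basis_comatrix T.toComod b
  refine TensorProduct.ext (b.ext fun j => LinearMap.ext fun w => ?_)
  exact (B.β_basis b hC hb j w).trans (braid_apply _ hb j w).symm

/-- The coaction of the unit comodule is r ↦ r ⊗ 1, so the unit axiom is a statement about the
operator of 1. -/
theorem op_one : B.op 1 = 1 := by
  refine LinearMap.ext fun w => ?_
  have h := B.unit w
  rw [B.β_eq_braid] at h
  have h2 : braid (Comod.unit k H).coact B.op ((1 : k) ⊗ₜ w) = B.op 1 w ⊗ₜ[k] (1 : k) := by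
    change TensorProduct.comm k k W ((B.op.flip w).lTensor k ((1 : k) ⊗ₜ[k] (1 : H))) = _
    simp
  simpa using congrArg (TensorProduct.rid k W) (h2.symm.trans h)

/-- The hexagon for the matrix comodules of two comatrices compares the operators of c_ij d_ab, the
coefficients of the tensor product, with the composites of the operators of c_ij and d_ab. -/
theorem op_mul (x y : H) : B.op (x * y) = B.op x * B.op y := by
  refine hopf_mul_ext B.op (fun n m C D hC hD i j a b => LinearMap.ext fun w => ?_) x y
  have h := B.hexagon (matComod hC) (matComod hD) (matBasis hC j) (matBasis hD b) w
  let bb := (matBasis hC).tensorProduct (matBasis hD)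
  have hbb : ∀ q, bb q = matBasis hC q.1 ⊗ₜ matBasis hD q.2 :=
    fun q => Module.Basis.tensorProduct_apply _ _ _ _
  have hcoact : ∀ q, tensorCoact (matComod hC).toComod (matComod hD).toComod (bb q) =
      ∑ p, bb p ⊗ₜ[k] (C p.1 q.1 * D p.2 q.2) := by
    intro q
    simp only [hbb]
    exact tensorCoact_apply (matComod_coact hC) (matComod_coact hD) q
  have h1 : B.β ((matComod hC).tensor (matComod hD)) (bb (j, b) ⊗ₜ w) =
      ∑ p : Fin n × Fin m, B.op (C p.1 j * D p.2 b) w ⊗ₜ[k] bb p :=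
    B.β_basis (T := (matComod hC).tensor (matComod hD)) bb (hC.mul hD) hcoact (j, b) w
  have h2 : TensorProduct.assoc k W (matComod hC).toComod (matComod hD).toComod
      ((B.β (matComod hC)).rTensor (matComod hD).toComod
        ((TensorProduct.assoc k (matComod hC).toComod W (matComod hD).toComod).symm
          (matBasis hC j ⊗ₜ B.β (matComod hD) (matBasis hD b ⊗ₜ w)))) =
      ∑ p : Fin n × Fin m, B.op (C p.1 j) (B.op (D p.2 b) w) ⊗ₜ[k] bb p := by
    rw [B.β_basis (matBasis hD) hD (matComod_coact hD), TensorProduct.tmul_sum]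
    simp only [map_sum, TensorProduct.assoc_symm_tmul, LinearMap.rTensor_tmul,
      B.β_basis (matBasis hC) hC (matComod_coact hC), TensorProduct.sum_tmul,
      TensorProduct.assoc_tmul, Fintype.sum_prod_type, hbb]
    exact Finset.sum_comm
  rw [hbb] at h1
  -- The multiplicativity sought is the coefficient at the basis vector indexed by (i, a).
  exact congrFun (tmul_right_injective bb ((h1.symm.trans h).trans h2)) (i, a)

/-- The action of `H` given by a half-braiding. -/
def act : H →ₐ[k] Module.End k W := AlgHom.ofLinearMap B.op B.op_one B.op_mul

theorem β_eq (T : FdComod k H) : B.β T = braid T.toComod.coact B.act.toLinearMap :=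
  B.β_eq_braid T

end HalfBraiding

end Reconstruct

end
end AYD

namespace AYD

noncomputable section

variable {k H : Type u} [Field k] [Ring H] [HopfAlgebra k H]

/-! ### The centers consist of anti-Yetter-Drinfeld objects -/

/-- Gives fullness: on the matrix comodule of c, commuting with the braidings says, coefficient by
coefficient, that g commutes with the operators of the c_ij, and such entries determine linear maps
on H. -/
theorem comm_of_braid {W W' : Type u} [AddCommGroup W] [Module k W] [AddCommGroup W']
    [Module k W'] (a : H →ₗ[k] Module.End k W) (a' : H →ₗ[k] Module.End k W') (g : W →ₗ[k] W')
    (hg : ∀ (T : FdComod k H) (t : T.toComod) (w : W), braid T.toComod.coact a' (t ⊗ₜ g w) =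
      g.rTensor T.toComod (braid T.toComod.coact a (t ⊗ₜ w))) (h : H) (w : W) :
    g (a h w) = a' h (g w) := by
  refine LinearMap.congr_fun (f := g ∘ₗ a.flip w) (g := a'.flip (g w))
    (hopf_ext fun n C hC i j => ?_) h
  have e := hg (matComod hC) (matBasis hC j) w
  rw [braid_apply _ (matComod_coact hC), braid_apply _ (matComod_coact hC), map_sum] at e
  exact (congrFun (tmul_right_injective (matBasis hC) e) i).symm

/-- Colinearity of the braiding on a matrix comodule determines ρ(c_ij m) up to right multiplication
by S²(c). Multiplying by S(c) isolates ρ(c_qj m) and produces the factor S(h¹) of the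
anti-Yetter–Drinfeld formula. -/
theorem aydAct_of_braid (M : Comod k H) (b : H →ₗ[k] Module.End k M)
    (hb : ∀ (T : FdComod k H) (z : T.toComod ⊗[k] M),
      tensorTwistCoact M T.toComod (braid T.toComod.coact b z) =
        (braid T.toComod.coact b).rTensor H (tensorCoact T.toComod M z)) (h : H) (m : M) :
    M.coact (b h m) = aydAct b h (M.coact m) := by
  refine LinearMap.congr_fun (f := M.coact ∘ₗ b.flip m) (g := (aydAct b).flip (M.coact m))
    (hopf_ext fun n C hC q j => ?_) h
  have hv := matComod_coact hC
  -- This is the coefficient of e_l in colinearity at e_j ⊗ m.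
  have key : ∀ l, ∑ i, (LinearMap.mulRight k (antipodeSq k H (C l i))).lTensor M
        (M.coact (b (C i j) m)) =
      ∑ i, TensorProduct.map (b (C l i)) (LinearMap.mulLeft k (C i j)) (M.coact m) := by
    intro l
    have e := congrArg ((rightCoeff (W := M) (matBasis hC) l).rTensor H)
      (hb (matComod hC) (matBasis hC j ⊗ₜ m))
    rw [braid_apply _ hv, map_sum] at e
    simp only [tensorTwistCoact_right hv, tensorCoact_left hv, map_sum] at e
    have e1 : ∀ i p (z : M ⊗[k] H), (rightCoeff (W := M) (matBasis hC) l).rTensor H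
        (TensorProduct.map ((TensorProduct.mk k M (matComod hC).toComod).flip (matBasis hC p))
          (LinearMap.mulRight k (antipodeSq k H (C p i))) z) =
        if p = l then (LinearMap.mulRight k (antipodeSq k H (C p i))).lTensor M z else 0 := by
      intro i p z
      induction z with
      | zero => simp
      | add x y hx hy =>
        simp only [map_add, hx, hy]
        split_ifs <;> simp
      | tmul x y =>
        simp only [TensorProduct.map_tmul, LinearMap.flip_apply, TensorProduct.mk_apply,
          LinearMap.rTensor_tmul, rightCoeff_tmul, LinearMap.lTensor_tmul,
          TensorProduct.ite_tmul]
    have e2 : ∀ i (z : M ⊗[k] H), (rightCoeff (W := M) (matBasis hC) l).rTensor H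
        ((braid (matComod hC).toComod.coact b).rTensor H
          (TensorProduct.map (TensorProduct.mk k (matComod hC).toComod M (matBasis hC i))
            (LinearMap.mulLeft k (C i j)) z)) =
        TensorProduct.map (b (C l i)) (LinearMap.mulLeft k (C i j)) z := by
      intro i z
      induction z with
      | zero => simp
      | add x y hx hy => simp only [map_add, hx, hy]
      | tmul x y =>
        simp only [TensorProduct.map_tmul, TensorProduct.mk_apply, LinearMap.rTensor_tmul,
          braid_apply _ hv, map_sum, rightCoeff_tmul]
        simp
    simp only [e1, e2, Finset.sum_ite_eq', Finset.mem_univ, if_true] at e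
    exact e
  -- Each equation is multiplied on the right by S(c_ql), in preparation for summing over l.
  have key2 : ∀ l, ∑ i, (LinearMap.mulRight k (antipodeSq k H (C l i) *
        HopfAlgebra.antipode k (C q l))).lTensor M (M.coact (b (C i j) m)) =
      ∑ i, TensorProduct.map (b (C l i)) (LinearMap.mulLeft k (C i j) ∘ₗ
        LinearMap.mulRight k (HopfAlgebra.antipode k (C q l))) (M.coact m) := by
    intro l
    have e := congrArg ((LinearMap.mulRight k (HopfAlgebra.antipode k (C q l))).lTensor M) (key l)
    rw [map_sum, map_sum] at e
    refine Eq.trans (Finset.sum_congr rfl fun i _ => ?_) (e.trans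
      (Finset.sum_congr rfl fun i _ => ?_))
    · generalize M.coact (b (C i j) m) = z
      induction z with
      | zero => simp
      | add x y hx hy => simp only [map_add, hx, hy]
      | tmul x y => simp [mul_assoc]
    · generalize M.coact m = z
      induction z with
      | zero => simp
      | add x y hx hy => simp only [map_add, hx, hy]
      | tmul x y => simp [mul_assoc]
  have e := Finset.sum_congr (rfl : (Finset.univ : Finset (Fin n)) = _) fun l _ => key2 l
  rw [Finset.sum_comm] at e
  -- Σ_l S²(c_li) S(c_ql) = δ_qi leaves the single term ρ(c_qj m) on the left.
  have h1 : ∀ i (z : M ⊗[k] H), ∑ l, (LinearMap.mulRight k (antipodeSq k H (C l i) *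
      HopfAlgebra.antipode k (C q l))).lTensor M z = if q = i then z else 0 := by
    intro i z
    induction z with
    | zero => simp
    | add x y hx hy =>
      simp only [map_add, Finset.sum_add_distrib, hx, hy]
      split_ifs <;> simp
    | tmul x y =>
      simp only [LinearMap.lTensor_tmul, LinearMap.mulRight_apply, ← TensorProduct.tmul_sum,
        ← Finset.mul_sum, hC.antipodeSq_antipode]
      split_ifs <;> simp
  simp only [h1, Finset.sum_ite_eq, Finset.mem_univ, if_true] at e
  refine e.trans ?_
  change _ = aydAct b (C q j) (M.coact m)
  generalize M.coact m = z
  induction z with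
  | zero => simp
  | add x y hx hy => simp only [map_add, Finset.sum_add_distrib, hx, hy]
  | tmul x y =>
    rw [aydAct_apply b hC]
    rfl

/-- The contramodule analogue. Contralinearity contains the shift by S²(c_ij), which is removed by
testing on functions already shifted by S; that shift becomes the S(h³) of the conjugated action. -/
theorem conjAct_of_braid (N : Contra k H) (b : H →ₗ[k] Module.End k N)
    (hb : ∀ (T : FdComod k H) (F : H →ₗ[k] T.toComod ⊗[k] N),
      braid T.toComod.coact b
          (contraActL ((antipodeSq k H).lTensor T.toComod ∘ₗ T.toComod.coact) N.act F) =
        contraActR T.toComod.coact N.act (braid T.toComod.coact b ∘ₗ F))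
    (h : H) (f : H →ₗ[k] N) : b h (N.act f) = N.act (conjAct b h f) := by
  refine LinearMap.congr_fun (f := b.flip (N.act f)) (g := N.act ∘ₗ (conjAct b).flip f)
    (hopf_ext fun n C hC l p => ?_) h
  have hv := matComod_coact hC
  have hT : ∀ j, ((antipodeSq k H).lTensor (matComod hC).toComod ∘ₗ (matComod hC).toComod.coact)
      (matBasis hC j) = ∑ i, matBasis hC i ⊗ₜ[k] antipodeSq k H (C i j) := by
    intro j
    rw [LinearMap.comp_apply, hv, map_sum]
    rfl
  -- This is the coefficient of e_l in contralinearity at the function x ↦ e_j ⊗ φ(x).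
  have key : ∀ j (φ : H →ₗ[k] N),
      ∑ i, b (C l i) (N.act (φ ∘ₗ LinearMap.mulLeft k (antipodeSq k H (C i j)))) =
        ∑ i, N.act (b (C i j) ∘ₗ φ ∘ₗ LinearMap.mulRight k (C l i)) := by
    intro j φ
    have e := hb (matComod hC) (canonL H (matComod hC).toComod N (matBasis hC j ⊗ₜ φ))
    have e1 : braid (matComod hC).toComod.coact b ∘ₗ
        canonL H (matComod hC).toComod N (matBasis hC j ⊗ₜ φ) =
          ∑ i, canonR H N (matComod hC).toComod ((b (C i j) ∘ₗ φ) ⊗ₜ matBasis hC i) := by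
      ext x
      simp [braid_apply _ hv]
    rw [contraActL_tmul hT, e1, map_sum, map_sum] at e
    simp only [braid_apply _ hv, contraActR_tmul hv] at e
    have e2 := congrArg (rightCoeff (W := N) (matBasis hC) l) e
    simp only [map_sum, rightCoeff_tmul, Finset.sum_ite_eq', Finset.mem_univ, if_true] at e2
    exact e2
  -- The test function is f(S(c_jp) -), depending on j; after summation over j the product S(c_jp)
  -- S²(c_ij) collapses to δ_ip.
  have e := Finset.sum_congr (rfl : (Finset.univ : Finset (Fin n)) = _) fun j _ =>
    key j (φ := f ∘ₗ LinearMap.mulLeft k (HopfAlgebra.antipode k (C j p)))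
  rw [Finset.sum_comm] at e
  have h1 : ∀ i, ∑ j, (f ∘ₗ LinearMap.mulLeft k (HopfAlgebra.antipode k (C j p))) ∘ₗ
      LinearMap.mulLeft k (antipodeSq k H (C i j)) = if i = p then f else 0 := by
    intro i
    ext x
    have := congrArg (fun y => f (y * x)) (hC.antipode_antipodeSq p i)
    simp only [Finset.sum_mul, map_sum, mul_assoc] at this
    simp only [LinearMap.sum_apply, LinearMap.comp_apply, LinearMap.mulLeft_apply]
    refine this.trans ?_
    split_ifs <;> simp
  simp only [← map_sum, h1] at e
  -- On the other side the sum is h² f(S(h³) - h¹) for h = c_lp, written in matrix form.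
  have h2 : ∑ j, ∑ i, b (C i j) ∘ₗ (f ∘ₗ LinearMap.mulLeft k (HopfAlgebra.antipode k (C j p))) ∘ₗ
      LinearMap.mulRight k (C l i) = conjAct b (C l p) f := by
    ext x
    rw [conjAct_apply b hC, Finset.sum_comm]
    simp [LinearMap.sum_apply]
  rw [h2] at e
  refine Eq.trans ?_ e
  have h3 : ∀ x, b (C l x) (N.act (if x = p then f else 0)) =
      if x = p then b (C l x) (N.act f) else 0 := by
    intro x
    split_ifs <;> simp
  simp only [h3, Finset.sum_ite_eq', Finset.mem_univ, if_true]
  rfl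

end
end AYD

/-! ### The equivalences between anti-Yetter–Drinfeld objects and the centers. -/

namespace AYD

noncomputable section

variable {k H : Type u} [Field k] [Ring H] [HopfAlgebra k H]

/-- The half-braiding of an object of the center of the bimodule category of comodules. -/
def HalfBraiding.ofComod (X : BimoduleCenter (FdComod k H) (Comod k H)) :
    HalfBraiding k H X.obj where
  β T := (show T.toComod ⊗[k] X.obj →ₗ[k] X.obj ⊗[k] T.toComod from
    Comod.lin (M := T.toComod.tensor X.obj) (N := X.obj.tensor T.toComod.twist) (X.β T).hom)
  natural {T T'} f t w := LinearMap.congr_fun (congrArg (Comod.lin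
    (M := T.toComod.tensor X.obj) (N := X.obj.tensor T'.toComod.twist)) (X.naturality f))
      (t ⊗ₜ[k] w)
  -- For comodules the right associator includes the identification of the twisted tensor product,
  -- an identity on spaces that `TensorProduct.map_id` removes.
  hexagon T T' t t' w := (LinearMap.congr_fun (congrArg (Comod.lin
    (M := (T.toComod.tensor T'.toComod).tensor X.obj)
      (N := X.obj.tensor (T.toComod.tensor T'.toComod).twist)) (X.hexagon T T'))
        ((t ⊗ₜ[k] t') ⊗ₜ[k] w)).trans (LinearMap.congr_fun
          (TensorProduct.map_id (R := k) (M := X.obj) (N := T.toComod ⊗[k] T'.toComod)) _)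
  unit w := (LinearMap.congr_fun (congrArg (Comod.lin
    (M := (Comod.unit k H).tensor X.obj) (N := X.obj.tensor (Comod.unit k H).twist)) X.unit)
      ((1 : k) ⊗ₜ[k] w)).trans
        ((LinearMap.congr_fun (TensorProduct.map_id (R := k) (M := X.obj) (N := k)) _).trans
          (congrArg (· ⊗ₜ[k] (1 : k)) (one_smul k w)))

/-- The half-braiding of an object of the center of the bimodule category of contramodules. -/
def HalfBraiding.ofContra (X : BimoduleCenter (FdComod k H) (Contra k H)) :
    HalfBraiding k H X.obj where
  β T := (show T.toComod ⊗[k] X.obj →ₗ[k] X.obj ⊗[k] T.toComod from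
    Contra.lin (M := Contra.tensorL T.twist X.obj) (N := Contra.tensorR T X.obj) (X.β T).hom)
  natural {T T'} f t w := LinearMap.congr_fun (congrArg (Contra.lin
    (M := Contra.tensorL T.twist X.obj) (N := Contra.tensorR T' X.obj)) (X.naturality f))
      (t ⊗ₜ[k] w)
  hexagon T T' t t' w := LinearMap.congr_fun (congrArg (Contra.lin
    (M := Contra.tensorL (T.tensor T').twist X.obj)
      (N := Contra.tensorR (T.tensor T') X.obj)) (X.hexagon T T')) ((t ⊗ₜ[k] t') ⊗ₜ[k] w)
  unit w := (LinearMap.congr_fun (congrArg (Contra.lin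
    (M := Contra.tensorL (𝟙_ (FdComod k H)).twist X.obj)
      (N := Contra.tensorR (𝟙_ (FdComod k H)) X.obj)) X.unit) ((1 : k) ⊗ₜ[k] w)).trans
        (congrArg (· ⊗ₜ[k] (1 : k)) (one_smul k w))

/-- The anti-Yetter-Drinfeld module given by an object of the center. -/
def AYDMod.ofCenter (X : BimoduleCenter (FdComod k H) (Comod k H)) : AYDMod k H where
  toComod := X.obj
  act := (HalfBraiding.ofComod X).act
  compat := aydAct_of_braid X.obj _ fun T z => by
    -- The braiding by the reconstructed action is the given central isomorphism, which is colinear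
    -- because it is a morphism of comodules.
    rw [← (HalfBraiding.ofComod X).β_eq T]
    exact LinearMap.congr_fun (Comod.lin_comm (M := T.toComod.tensor X.obj)
      (N := X.obj.tensor T.toComod.twist) (X.β T).hom) z

/-- The anti-Yetter-Drinfeld contramodule given by an object of the center. -/
def AYDContra.ofCenter (X : BimoduleCenter (FdComod k H) (Contra k H)) : AYDContra k H where
  toContra := X.obj
  act := (HalfBraiding.ofContra X).act
  compat := conjAct_of_braid X.obj _ fun T F => by
    rw [← (HalfBraiding.ofContra X).β_eq T]
    exact Contra.lin_comm (M := Contra.tensorL T.twist X.obj) (N := Contra.tensorR T X.obj)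
      (X.β T).hom F

/-- An object of the center of the bimodule category of comodules comes from an
anti-Yetter-Drinfeld module. -/
def modToCenterIso (X : BimoduleCenter (FdComod k H) (Comod k H)) :
    (modToCenter k H).obj (AYDMod.ofCenter X) ≅ X :=
  BimoduleCenter.mkIso (M := (modToCenter k H).obj (AYDMod.ofCenter X)) (N := X)
    (Iso.refl X.obj) fun T => by
    change T ⊴ₗ 𝟙 X.obj ≫ (X.β T).hom =
      (((modToCenter k H).obj (AYDMod.ofCenter X)).β T).hom ≫ 𝟙 X.obj ⊵ᵣ T
    rw [MonoidalLeftAction.actionHomRight_id, MonoidalRightAction.id_actionHomLeft]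
    refine (Category.id_comp _).trans (Eq.trans ?_ (Category.comp_id _).symm)
    exact Comod.hom_ext (M := T.toComod.tensor X.obj) (N := X.obj.tensor T.toComod.twist)
      ((HalfBraiding.ofComod X).β_eq T)

/-- An object of the center of the bimodule category of contramodules comes from an
anti-Yetter-Drinfeld contramodule. -/
def contraToCenterIso (X : BimoduleCenter (FdComod k H) (Contra k H)) :
    (contraToCenter k H).obj (AYDContra.ofCenter X) ≅ X :=
  BimoduleCenter.mkIso (M := (contraToCenter k H).obj (AYDContra.ofCenter X)) (N := X)
    (Iso.refl X.obj) fun T => by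
    change T ⊴ₗ 𝟙 X.obj ≫ (X.β T).hom =
      (((contraToCenter k H).obj (AYDContra.ofCenter X)).β T).hom ≫ 𝟙 X.obj ⊵ᵣ T
    rw [MonoidalLeftAction.actionHomRight_id, MonoidalRightAction.id_actionHomLeft]
    refine (Category.id_comp _).trans (Eq.trans ?_ (Category.comp_id _).symm)
    exact Contra.hom_ext (M := Contra.tensorL T.twist X.obj) (N := Contra.tensorR T X.obj)
      ((HalfBraiding.ofContra X).β_eq T)

/-- Morphisms on both sides are comodule maps with an extra condition. This gives faithfulness at
once and fullness through `comm_of_braid`; essential surjectivity is the reconstruction, with the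
identity as isomorphism. -/
theorem modToCenter_isEquivalence : (modToCenter k H).IsEquivalence where
  faithful := ⟨fun h => AYDMod.hom_ext (congrArg BimoduleCenter.hom h)⟩
  full := ⟨fun {M N} f => ⟨⟨BimoduleCenter.hom f, comm_of_braid M.act.toLinearMap
    N.act.toLinearMap (Comod.lin (M := M.toComod) (N := N.toComod) (BimoduleCenter.hom f))
      fun T t w => LinearMap.congr_fun (congrArg (Comod.lin (M := T.toComod.tensor M.toComod)
        (N := N.toComod.tensor T.toComod.twist)) (BimoduleCenter.Hom.comm f T)) (t ⊗ₜ[k] w)⟩,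
    BimoduleCenter.hom_ext rfl⟩⟩
  essSurj := ⟨fun X => ⟨_, ⟨modToCenterIso X⟩⟩⟩

theorem contraToCenter_isEquivalence : (contraToCenter k H).IsEquivalence where
  faithful := ⟨fun h => AYDContra.hom_ext (congrArg BimoduleCenter.hom h)⟩
  full := ⟨fun {M N} f => ⟨⟨BimoduleCenter.hom f, comm_of_braid M.act.toLinearMap
    N.act.toLinearMap (Contra.lin (M := M.toContra) (N := N.toContra) (BimoduleCenter.hom f))
      fun T t w => LinearMap.congr_fun (congrArg (Contra.lin
        (M := Contra.tensorL T.twist M.toContra) (N := Contra.tensorR T N.toContra))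
          (BimoduleCenter.Hom.comm f T)) (t ⊗ₜ[k] w)⟩,
    BimoduleCenter.hom_ext rfl⟩⟩
  essSurj := ⟨fun X => ⟨_, ⟨contraToCenterIso X⟩⟩⟩

end
end AYD

/-! ### Explicit form of the bimodule structure on Hom(H, -)^H, and the theorem. -/

namespace AYD

noncomputable section

variable {k H : Type u} [Field k] [Ring H] [HopfAlgebra k H]

/-- The structure map is the inverse of `hatLeft`. If F is the image of y, injectivity of the
canonical map forces z to be the S-shift of y, and the S²-shift recovers y. The equation lives in T
⊗ Hom(H, M), since the components of z need not be comodule maps. -/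
theorem hatBimodule_left (T : FdComod k H) (M : Comod k H)
    (F : hatSubmodule (T.toComod.tensor M)) (z : T.toComod ⊗[k] (H →ₗ[k] M))
    (hz : canonL H T.toComod M z = F.1) :
    (hatSubmodule M).subtype.lTensor T.toComod
      (Contra.lin (M := hatObj (T.toComod.tensor M)) (N := Contra.tensorL T.twist (hatObj M))
        ((hatBimodule k H).left T M).hom F) =
      shiftL ((antipodeSq k H).lTensor T.toComod ∘ₗ T.toComod.coact) M z := by
  obtain ⟨y, rfl⟩ := hatLeft_surjective M T F
  have e : Contra.lin (M := hatObj (T.toComod.tensor M)) (N := Contra.tensorL T.twist (hatObj M))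
      ((hatBimodule k H).left T M).hom (hatLeft T.toComod M y) = y :=
    LinearEquiv.ofBijective_symm_apply_apply (hatLeft T.toComod M) y
  refine (congrArg _ e).trans ?_
  have h := (canonLEquiv H T.toComod M).injective (a₁ := z) (a₂ := shiftL
    ((HopfAlgebra.antipode k).lTensor T.toComod ∘ₗ T.toComod.coact) M
      ((hatSubmodule M).subtype.lTensor T.toComod y)) hz
  rw [h, shiftL_antipodeSq_antipode]

theorem hatBimodule_right (M : Comod k H) (L : FdComod k H)
    (F : hatSubmodule (M.tensor L.toComod.twist)) (z : (H →ₗ[k] M) ⊗[k] L.toComod)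
    (hz : canonR H M L.toComod z = F.1) :
    (hatSubmodule M).subtype.rTensor L.toComod
      (Contra.lin (M := hatObj (M.tensor L.toComod.twist)) (N := Contra.tensorR L (hatObj M))
        ((hatBimodule k H).right M L).hom F) =
      shiftR L.toComod.coact M z := by
  obtain ⟨y, rfl⟩ := hatRight_surjective M L F
  have e : Contra.lin (M := hatObj (M.tensor L.toComod.twist)) (N := Contra.tensorR L (hatObj M))
      ((hatBimodule k H).right M L).hom (hatRight L.toComod M y) = y :=
    LinearEquiv.ofBijective_symm_apply_apply (hatRight L.toComod M) y
  refine (congrArg _ e).trans ?_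
  have h := (canonREquiv H M L.toComod).injective (a₁ := z) (a₂ := shiftR
    ((HopfAlgebra.antipode k).lTensor L.toComod ∘ₗ L.toComod.coact) M
      ((hatSubmodule M).subtype.rTensor L.toComod y)) hz
  rw [h, shiftR_coact_antipode]

end
end AYD

/-- In the formulas for Hom(H, -)^H, the tensor z represents F as a sum of elements t ⊗ f or f ⊗ l.
It exists and is unique because T and L are finite-dimensional, and the inclusion applied to the
image is injective, so the equations determine the structure maps. -/
theorem mainTheorem6 (k H : Type u) [Field k] [CharZero k] [Ring H] [HopfAlgebra k H]
    (hS : Function.Bijective (HopfAlgebra.antipode k (A := H))) :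
    ∃ (adj : prime k H ⊣ hat k H)
      (Bhat : BimoduleFunctor (FdComod k H) (hat k H))
      (Bprime : BimoduleFunctor (FdComod k H) (prime k H))
      (adjZ : Bprime.center ⊣ Bhat.center)
      (adjH : primeH k H ⊣ hatH k H)
      (stable_hat : ∀ M : AYDMod k H, stableMod k H M → stableContra k H ((hatH k H).obj M))
      (stable_prime : ∀ N : AYDContra k H,
        stableContra k H N → stableMod k H ((primeH k H).obj N))
      (adjS : (stableMod k H).lift ((stableContra k H).ι ⋙ primeH k H)
          (fun N => stable_prime N.obj N.property) ⊣
        (stableContra k H).lift ((stableMod k H).ι ⋙ hatH k H)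
          (fun M => stable_hat M.obj M.property))
      (squareHat : hatH k H ⋙ contraToCenter k H ≅ modToCenter k H ⋙ Bhat.center)
      (squarePrime : primeH k H ⋙ modToCenter k H ≅ contraToCenter k H ⋙ Bprime.center),
      -- the counit `h ⊗ f ↦ f(h)` and the unit `n ↦ (h ↦ h ⊗ n)`
      (∀ (M : Comod k H) (h : H) (f : hatSubmodule M),
        Comod.lin (M := primeObj (hatObj M)) (N := M) (adj.counit.app M)
          (primeMk (hatObj M) (h ⊗ₜ[k] f)) = f.1 h) ∧
      (∀ (N : Contra k H) (n : N) (h : H),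
        (show hatSubmodule (primeObj N) from
          Contra.lin (M := N) (N := hatObj (primeObj N)) (adj.unit.app N) n).1 h =
            primeMk N (h ⊗ₜ[k] n)) ∧
      -- the bimodule structure of `M ↦ Hom(H, M)^H`: `t ⊗ f ↦ t₀ ⊗ f(S²(t₁) -)` and
      -- `f ⊗ l ↦ f(- l₁) ⊗ l₀`
      (∀ (T : FdComod k H) (M : Comod k H) (F : hatSubmodule (T.toComod.tensor M))
        (z : T.toComod ⊗[k] (H →ₗ[k] M)), canonL H T.toComod M z = F.1 →
        (hatSubmodule M).subtype.lTensor T.toComod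
          (Contra.lin (M := hatObj (T.toComod.tensor M))
            (N := Contra.tensorL T.twist (hatObj M)) (Bhat.left T M).hom F) =
          shiftL ((antipodeSq k H).lTensor T.toComod ∘ₗ T.toComod.coact) M z) ∧
      (∀ (M : Comod k H) (L : FdComod k H) (F : hatSubmodule (M.tensor L.toComod.twist))
        (z : (H →ₗ[k] M) ⊗[k] L.toComod), canonR H M L.toComod z = F.1 →
        (hatSubmodule M).subtype.rTensor L.toComod
          (Contra.lin (M := hatObj (M.tensor L.toComod.twist))
            (N := Contra.tensorR L (hatObj M)) (Bhat.right M L).hom F) =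
          shiftR L.toComod.coact M z) ∧
      -- the bimodule structure of `N ↦ N'`: `h ⊗ t ⊗ n ↦ t₀ ⊗ S(t₁) h ⊗ n` and
      -- `h ⊗ n ⊗ l ↦ h S(l₁) ⊗ n ⊗ l₀`
      (∀ (T : FdComod k H) (N : Contra k H) (h : H) (t : T.toComod) (n : N),
        Comod.lin (M := primeObj (Contra.tensorL T.twist N)) (N := T.toComod.tensor (primeObj N))
          (Bprime.left T N).hom (primeMk (Contra.tensorL T.twist N) (h ⊗ₜ[k] (t ⊗ₜ[k] n))) =
          (primeMk N ∘ₗ (TensorProduct.mk k H N).flip n ∘ₗ LinearMap.mulRight k h ∘ₗ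
            HopfAlgebra.antipode k).lTensor T.toComod (T.toComod.coact t)) ∧
      (∀ (N : Contra k H) (L : FdComod k H) (h : H) (n : N) (l : L.toComod),
        Comod.lin (M := primeObj (Contra.tensorR L N))
          (N := (primeObj N).tensor L.toComod.twist)
          (Bprime.right N L).hom (primeMk (Contra.tensorR L N) (h ⊗ₜ[k] (n ⊗ₜ[k] l))) =
          TensorProduct.comm k L.toComod (primeSpace N)
            ((primeMk N ∘ₗ (TensorProduct.mk k H N).flip n ∘ₗ LinearMap.mulLeft k h ∘ₗ
              HopfAlgebra.antipode k).lTensor L.toComod (L.toComod.coact l))) ∧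
      -- the centers are the categories of anti-Yetter-Drinfeld objects
      (modToCenter k H).IsEquivalence ∧ (contraToCenter k H).IsEquivalence ∧
      -- the squares commute, with identity components on the underlying objects
      (∀ M : AYDMod k H, BimoduleCenter.hom (squareHat.hom.app M) = 𝟙 ((hat k H).obj M.toComod)) ∧
      (∀ N : AYDContra k H,
        BimoduleCenter.hom (squarePrime.hom.app N) = 𝟙 ((prime k H).obj N.toContra)) ∧
      -- all the adjunctions are lifts or restrictions of the first one
      (∀ X : BimoduleCenter (FdComod k H) (Contra k H),
        BimoduleCenter.hom (adjZ.unit.app X) = adj.unit.app X.obj) ∧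
      (∀ X : BimoduleCenter (FdComod k H) (Comod k H),
        BimoduleCenter.hom (adjZ.counit.app X) = adj.counit.app X.obj) ∧
      (∀ N : AYDContra k H, AYDContra.hom (adjH.unit.app N) = adj.unit.app N.toContra) ∧
      (∀ M : AYDMod k H, AYDMod.hom (adjH.counit.app M) = adj.counit.app M.toComod) ∧
      (∀ N : (stableContra k H).FullSubcategory,
        (adjS.unit.app N).hom = adjH.unit.app N.obj) ∧
      (∀ M : (stableMod k H).FullSubcategory,
        (adjS.counit.app M).hom = adjH.counit.app M.obj) :=
  -- The lifted adjunctions and the squares were built on the original unit, counit and identity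
  -- maps, so most of the comparisons hold by definition. The formulas for the bimodule structures
  -- and the restricted adjunction are the ones that use lemmas.
  ⟨primeHatAdj k H, hatBimodule k H, primeBimodule k H, centerAdj k H, primeHatHAdj k H,
    stableContra_hatH, stableMod_primeH, stableAdj k H, squareHat k H, squarePrime k H,
    fun _ _ _ => rfl, fun _ _ _ => rfl, hatBimodule_left, hatBimodule_right,
    fun _ _ h t n => primeLeft_pure h t n, fun _ _ h n l => primeRight_pure h n l,
    modToCenter_isEquivalence, contraToCenter_isEquivalence, fun _ => rfl, fun _ => rfl,
    fun _ => rfl, fun _ => rfl, fun _ => rfl, fun _ => rfl, stableAdj_unit, stableAdj_counit⟩
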